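/- **Setting.** All fields are on $\mathbb R^3$. Let $a_0\in C^\infty(\mathbb R^3\setminus\{0\};\mathbb R^3)$ be divergence-free and scale-invariant ($\kappa a_0(\kappa x)=a_0(x)$ for $\kappa>0$), and let $A_0=e^{\Delta}a_0=\int_{\mathbb R^3}(4\pi)^{-3/2}e^{-|\cdot-y|^2/4}a_0(y)\,dy$. Let $\mathcal V=\{v\in L^2\cap L^4:\nabla\cdot v=0\}$ with norm $\|v\|_{L^2}+\|v\|_{L^4}$, and $\mathcal D=\{v\in\mathcal V:\ \partial^\alpha v\in\mathcal V\ (|\alpha|\le 2),\ x\cdot\nabla v\in\mathcal V\}$ with norm $\|v\|_{\mathcal V}+\|\nabla v\|_{\mathcal V}+\|\nabla^2v\|_{\mathcal V}+\|x\cdot\nabla v\|_{\mathcal V}$ (or equivalent norms). For $v\in\mathcal D$, $\sigma\in\mathbb R$ put $$F(v,\sigma)=-\Delta v-\tfrac x2\cdot\nabla v-\tfrac12v+(\sigma A_0+v)\cdot\nabla(\sigma A_0+v)+\nabla P,$$ and for $U=\sigma A_0+v$, $\phi\in\mathcal D$, $$\mathcal L(U)\phi=-\Delta\phi-\tfrac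 x2\cdot\nabla\phi-\tfrac12\phi+U\cdot\nabla\phi+\phi\cdot\nabla U+\nabla p .$$ Here and below $\nabla P$, $\nabla p$, $\nabla q$ are the gradients that make the respective expression divergence-free (Helmholtz–Leray projection). These expressions are well defined: the advection terms $(\sigma A_0+v)\cdot\nabla(\sigma A_0+v)$ and $U\cdot\nabla\phi+\phi\cdot\nabla U$ are in $L^2$, and $F:\mathcal D\times\mathbb R\to\mathcal V$, $\mathcal L(U):\mathcal D\to\mathcal V$. The spectrum of $\mathcal L(U)$ is that of the unbounded operator in the complexification of $\mathcal V$ with domain the complexification of $\mathcal D$. We say that $U$ is a *profile solution* with datum $u_0$ if, in the sense of distributions and for some pressure $P$, $\Delta U+\frac x2\cdot\nabla U+\frac12U-U\cdot\nabla U-\nabla P=0$, $\nabla\cdot U=0$, and $U(x)=u_0(x)+o(|x|^{-1})$ as $|x|\to\infty$. **Theorem.** Let $\sigma_0\in\mathbb R$ and $v_0\in\mathcal D$ with $F(v_0,\sigma_0)=0$, and $U_0=\sigma_0A_0+v_0$. Then $U_0$ is a profile solution with datum $\sigma_0a_0$, and the following hold. (i) *Continuation.* If $0$ is not in the spectrum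 of $\mathcal L(U_0)$, there are $\varepsilon>0$ and a $C^\infty$ curve $v:(\sigma_0-\varepsilon,\sigma_0+\varepsilon)\to\mathcal D$ with $v(\sigma_0)=v_0$ and $F(v(\sigma),\sigma)=0$ for all $\sigma$ in this interval; in particular $\sigma A_0+v(\sigma)$ is a profile solution with datum $\sigma a_0$. The curve is unique: every continuous curve of solutions on this interval that equals $v_0$ at $\sigma_0$ coincides with it, and there is $r>0$ such that $|\sigma-\sigma_0|<\varepsilon$, $\|u-v_0\|_{\mathcal D}<r$ and $F(u,\sigma)=0$ imply $u=v(\sigma)$. (ii) *Bifurcation.* Let $\varepsilon>0$ and let $v_1:(\sigma_0-\varepsilon,\sigma_0+\varepsilon)\to\mathcal D$ be a $C^\infty$ curve with $v_1(\sigma_0)=v_0$ and $F(v_1(\sigma),\sigma)=0$ for all $\sigma$. Suppose that $\{0\}\subset\operatorname{spec}\mathcal L(U_0)\subset\{\operatorname{Re}\lambda>\delta\}\cup\{0\}$ for some $\delta>0$, that the kernel of $\mathcal L(U_0)$ is one-dimensional, spanned by $\phi\ne0$ (as is the case if $0$ is a simple eigenvalue with eigenvector $\phi$), and that $$\psi\cdot\nabla\phi+\phi\cdot\nabla\psi+\nabla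 p\notin\operatorname{Range}\mathcal L(U_0),\qquad\psi=A_0+v_1'(\sigma_0).$$ Then there are $\varepsilon_2>0$ and a second $C^\infty$ solution curve $(v_2,\sigma_2):(-\varepsilon_2,\varepsilon_2)\to\mathcal D\times(\sigma_0-\varepsilon,\sigma_0+\varepsilon)$ with $F(v_2(s),\sigma_2(s))=0$, $(v_2(0),\sigma_2(0))=(v_0,\sigma_0)$, $v_2(s)\neq v_1(\sigma_2(s))$ for $s\ne0$, and $\frac{d}{ds}\big|_{s=0}\bigl(v_2(s)-v_1(\sigma_2(s))\bigr)=\phi$. It is unique in the sense that all solutions of $F(v,\sigma)=0$ in some neighbourhood of $(v_0,\sigma_0)$ in $\mathcal D\times\mathbb R$ lie on one of the two curves. Moreover: * if $\phi\cdot\nabla\phi+\nabla p\notin\operatorname{Range}\mathcal L(U_0)$, the bifurcation is transcritical, that is, $\sigma_2'(0)\ne0$; * if $\phi\cdot\nabla\phi+\nabla p\in\operatorname{Range}\mathcal L(U_0)$ and the following non-degeneracy condition holds: some $\chi\in\mathcal D$ satisfies $\mathcal L(U_0)\chi+\phi\cdot\nabla\phi+\nabla p=0$ and $\phi\cdot\nabla\chi+\chi\cdot\nabla\phi+\nabla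 q\notin\operatorname{Range}\mathcal L(U_0)$, then the bifurcation is of pitchfork type, that is, $\sigma_2'(0)=0$ and $\sigma_2''(0)\ne0$. -/

import Mathlib

open MeasureTheory Filter Topology Set
open scoped ContDiff ENNReal RealInnerProductSpace

noncomputable section

namespace SelfSimilarNS

/-! ### Fields on three-dimensional space, partial derivatives, test functions -/

/-- Euclidean space `ℝ³`. -/
abbrev E3 : Type := EuclideanSpace ℝ (Fin 3)

/-- The `i`-th vector of the standard basis. -/
def e (i : Fin 3) : E3 := EuclideanSpace.single i 1

/-- Classical partial derivative `∂ᵢ f`. -/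
def pd {F : Type*} [NormedAddCommGroup F] [NormedSpace ℝ F] (i : Fin 3) (f : E3 → F) : E3 → F :=
  fun x => fderiv ℝ f x (e i)

/-- Test functions: smooth with compact support. -/
structure IsTest {F : Type*} [NormedAddCommGroup F] [NormedSpace ℝ F] (η : E3 → F) : Prop where
  smooth : ContDiff ℝ ∞ η
  compact : HasCompactSupport η

instance factOneLeFour : Fact ((1 : ℝ≥0∞) ≤ 4) := ⟨by norm_num⟩

/-- `L²(ℝ³; ℝ³)`. -/
abbrev L2 : Type := Lp E3 2 (volume : Measure E3)

/-- `L⁴(ℝ³; ℝ³)`. -/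
abbrev L4 : Type := Lp E3 4 (volume : Measure E3)

/-! ### Divergence-free fields and the Helmholtz–Leray projection -/

/-- Gradients of scalar test functions, as elements of `L²`. -/
def testGradients : Set L2 :=
  {g | ∃ η : E3 → ℝ, IsTest η ∧ (g : E3 → E3) =ᵐ[volume] gradient η}

/-- The fields in `L²` with (distributional) divergence zero: `f` is divergence-free iff
`∫ f · ∇η = 0` for all scalar test functions `η`. -/
def solenoidal : Submodule ℝ L2 := (Submodule.span ℝ testGradients)ᗮ

instance solenoidalHasOrthogonalProjection : solenoidal.HasOrthogonalProjection :=
  haveI : CompleteSpace solenoidal :=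
    inferInstanceAs (CompleteSpace ((Submodule.span ℝ testGradients)ᗮ : Submodule ℝ L2))
  Submodule.HasOrthogonalProjection.ofCompleteSpace solenoidal

open Classical in
/-- The Helmholtz–Leray projection `f ↦ f + ∇p`, where `p` is chosen such that `f + ∇p` is
divergence-free. It is the orthogonal projection of `L²` onto the divergence-free fields; its
argument is a function, and the value is `0` if that function is not in `L²`. -/
def leray (f : E3 → E3) : L2 :=
  if h : MemLp f 2 (volume : Measure E3) then solenoidal.starProjection (h.toLp f) else 0

/-! ### The space `𝒱 = {v ∈ L² ∩ L⁴ : ∇ · v = 0}` -/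

/-- The divergence-free fields in `L² ∩ L⁴`, as pairs of an element of `L²` and an element of
`L⁴` that agree almost everywhere. The norm, the maximum of the `L²` and the `L⁴` norm, is
equivalent to their sum. -/
def spaceV : Submodule ℝ (L2 × L4) where
  carrier := {v | v.1 ∈ solenoidal ∧ (v.1 : E3 → E3) =ᵐ[volume] v.2}
  zero_mem' := by
    refine ⟨solenoidal.zero_mem, ?_⟩
    filter_upwards [Lp.coeFn_zero E3 2 (volume : Measure E3),
      Lp.coeFn_zero E3 4 (volume : Measure E3)] with x h1 h2
    exact h1.trans h2.symm
  add_mem' := by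
    rintro a b ⟨ha, ha'⟩ ⟨hb, hb'⟩
    refine ⟨solenoidal.add_mem ha hb, ?_⟩
    filter_upwards [Lp.coeFn_add a.1 b.1, Lp.coeFn_add a.2 b.2, ha', hb'] with x h1 h2 h3 h4
    simp only [Prod.fst_add, Prod.snd_add, h1, h2, Pi.add_apply, h3, h4]
  smul_mem' := by
    rintro c a ⟨ha, ha'⟩
    refine ⟨solenoidal.smul_mem c ha, ?_⟩
    filter_upwards [Lp.coeFn_smul c a.1, Lp.coeFn_smul c a.2, ha'] with x h1 h2 h3
    simp only [Prod.smul_fst, Prod.smul_snd, h1, h2, Pi.smul_apply, h3]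

/-- The space `𝒱`. -/
def V : Type := spaceV

instance V.normedAddCommGroup : NormedAddCommGroup V :=
  inferInstanceAs (NormedAddCommGroup spaceV)

instance V.normedSpace : NormedSpace ℝ V := inferInstanceAs (NormedSpace ℝ spaceV)

/-- The inclusion of `𝒱` in `L²`. -/
def V.toL2 (v : V) : L2 := v.1.1

/-! ### The space `𝒟` -/

/-- `g` is the weak partial derivative `∂ᵢ f`. -/
def IsWeakPartial (i : Fin 3) (f g : E3 → E3) : Prop :=
  ∀ η : E3 → ℝ, IsTest η → ∫ x, pd i η x • f x = - ∫ x, η x • g x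

theorem IsTest.pd {η : E3 → ℝ} (h : IsTest η) (i : Fin 3) : IsTest (pd i η) where
  smooth := (h.smooth.fderiv_right (m := ∞) (by simp)).clm_apply contDiff_const
  compact := h.compact.fderiv_apply (𝕜 := ℝ) (e i)

theorem IsTest.integrable_smul {η : E3 → ℝ} (h : IsTest η) (f : L2) :
    Integrable (fun x => η x • f x) (volume : Measure E3) :=
  ((Lp.memLp f).locallyIntegrable (by norm_num)).integrable_smul_left_of_hasCompactSupport
    h.smooth.continuous h.compact

theorem IsTest.integral_smul_zero (η : E3 → ℝ) : ∫ x, η x • (0 : L2) x = 0 := by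
  rw [← integral_zero E3 E3 (μ := volume)]
  refine integral_congr_ae ?_
  filter_upwards [Lp.coeFn_zero E3 2 (volume : Measure E3)] with x hx
  rw [hx, Pi.zero_apply, smul_zero]

theorem IsTest.integral_smul_add {η : E3 → ℝ} (h : IsTest η) (f g : L2) :
    ∫ x, η x • (f + g : L2) x = (∫ x, η x • f x) + ∫ x, η x • g x := by
  rw [← integral_add (h.integrable_smul f) (h.integrable_smul g)]
  refine integral_congr_ae ?_
  filter_upwards [Lp.coeFn_add f g] with x hx
  rw [hx, Pi.add_apply, smul_add]

theorem IsTest.integral_smul_smul (η : E3 → ℝ) (c : ℝ) (f : L2) :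
    ∫ x, η x • (c • f : L2) x = c • ∫ x, η x • f x := by
  rw [← integral_smul]
  refine integral_congr_ae ?_
  filter_upwards [Lp.coeFn_smul c f] with x hx
  rw [hx, Pi.smul_apply, smul_comm]

theorem IsWeakPartial.zero (i : Fin 3) : IsWeakPartial i (0 : L2) (0 : L2) := fun η _ => by
  simp only [IsTest.integral_smul_zero, neg_zero]

theorem IsWeakPartial.add {i : Fin 3} {f g f' g' : L2} (h : IsWeakPartial i f g)
    (h' : IsWeakPartial i f' g') : IsWeakPartial i (f + f' : L2) (g + g' : L2) := fun η hη => by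
  rw [(hη.pd i).integral_smul_add, hη.integral_smul_add, h η hη, h' η hη, neg_add]

theorem IsWeakPartial.smul {i : Fin 3} {f g : L2} (c : ℝ) (h : IsWeakPartial i f g) :
    IsWeakPartial i (c • f : L2) (c • g : L2) := fun η hη => by
  rw [IsTest.integral_smul_smul, IsTest.integral_smul_smul, h η hη, smul_neg]

/-- The space `𝒟` of all `v ∈ 𝒱` with `∂ᵢ v ∈ 𝒱`, `∂ᵢ ∂ⱼ v ∈ 𝒱` and `x · ∇ v ∈ 𝒱`. An element is
stored together with these derivatives, as a tuple `(v, (∂ᵢ v)ᵢ, (∂ⱼ ∂ᵢ v)ᵢⱼ, x · ∇ v)`; the last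
three entries are determined by `v`. The norm is the maximum of the norms of the entries in `𝒱`,
which is equivalent to the sum of these norms. -/
def spaceD : Submodule ℝ (V × (Fin 3 → V) × (Fin 3 → Fin 3 → V) × V) where
  carrier := {v | (∀ i, IsWeakPartial i v.1.toL2 (v.2.1 i).toL2) ∧
    (∀ i j, IsWeakPartial j (v.2.1 i).toL2 (v.2.2.1 i j).toL2) ∧
    (v.2.2.2.toL2 : E3 → E3) =ᵐ[volume] fun x => ∑ i, x i • (v.2.1 i).toL2 x}
  zero_mem' := by
    refine ⟨fun i => IsWeakPartial.zero i, fun i j => IsWeakPartial.zero j, ?_⟩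
    filter_upwards [Lp.coeFn_zero E3 2 (volume : Measure E3)] with x h
    change (0 : L2) x = ∑ i, x i • (0 : L2) x
    rw [h]
    simp
  add_mem' := by
    rintro a b ⟨ha1, ha2, ha3⟩ ⟨hb1, hb2, hb3⟩
    refine ⟨fun i => (ha1 i).add (hb1 i), fun i j => (ha2 i j).add (hb2 i j), ?_⟩
    have key : ∀ᵐ x ∂(volume : Measure E3), ∀ i, ((a.2.1 i).toL2 + (b.2.1 i).toL2 : L2) x
        = (a.2.1 i).toL2 x + (b.2.1 i).toL2 x :=
      ae_all_iff.2 fun i => Lp.coeFn_add _ _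
    filter_upwards [Lp.coeFn_add a.2.2.2.toL2 b.2.2.2.toL2, ha3, hb3, key] with x h1 h2 h3 h4
    change (a.2.2.2.toL2 + b.2.2.2.toL2 : L2) x
      = ∑ i, x i • ((a.2.1 i).toL2 + (b.2.1 i).toL2 : L2) x
    rw [h1, Pi.add_apply, h2, h3, ← Finset.sum_add_distrib]
    exact Finset.sum_congr rfl fun i _ => by rw [h4 i, smul_add]
  smul_mem' := by
    rintro c a ⟨ha1, ha2, ha3⟩
    refine ⟨fun i => (ha1 i).smul c, fun i j => (ha2 i j).smul c, ?_⟩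
    have key : ∀ᵐ x ∂(volume : Measure E3), ∀ i, (c • (a.2.1 i).toL2 : L2) x
        = c • (a.2.1 i).toL2 x :=
      ae_all_iff.2 fun i => Lp.coeFn_smul _ _
    filter_upwards [Lp.coeFn_smul c a.2.2.2.toL2, ha3, key] with x h1 h2 h4
    change (c • a.2.2.2.toL2 : L2) x = ∑ i, x i • (c • (a.2.1 i).toL2 : L2) x
    rw [h1, Pi.smul_apply, h2, Finset.smul_sum]
    exact Finset.sum_congr rfl fun i _ => by rw [h4 i, smul_comm]

/-- The space `𝒟`. -/
def D : Type := spaceD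

instance D.normedAddCommGroup : NormedAddCommGroup D :=
  inferInstanceAs (NormedAddCommGroup spaceD)

instance D.normedSpace : NormedSpace ℝ D := inferInstanceAs (NormedSpace ℝ spaceD)

/-- The inclusion of `𝒟` in `𝒱`. -/
def D.toV (v : D) : V := v.1.1

/-- `∂ᵢ v`. -/
def D.partial (v : D) (i : Fin 3) : V := v.1.2.1 i

/-- `∂ⱼ ∂ᵢ v`. -/
def D.partial₂ (v : D) (i j : Fin 3) : V := v.1.2.2.1 i j

/-- `x · ∇ v`. -/
def D.radial (v : D) : V := v.1.2.2.2

/-! ### The initial datum and its heat extension -/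

/-- `a₀` is a scale-invariant (that is, `(-1)`-homogeneous) divergence-free vector field, smooth
away from the origin. -/
structure IsScaleInvariantDatum (a₀ : E3 → E3) : Prop where
  smooth : ContDiffOn ℝ ∞ a₀ {0}ᶜ
  scale : ∀ c : ℝ, 0 < c → ∀ x : E3, x ≠ 0 → c • a₀ (c • x) = a₀ x
  div_free : ∀ x : E3, x ≠ 0 → ∑ i, (pd i a₀ x) i = 0

/-- `A₀ = e^Δ a₀`, the solution at time `1` of the heat equation with initial datum `a₀`. -/
def heatExt (a₀ : E3 → E3) : E3 → E3 := fun x =>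
  ∫ y, ((4 * Real.pi) ^ (-(3 : ℝ) / 2) * Real.exp (-‖x - y‖ ^ 2 / 4)) • a₀ y

/-! ### The nonlinear map `F` and the linearization `ℒ(U)` -/

/-- A vector field together with its first partial derivatives. -/
structure GradField where
  val : E3 → E3
  grad : Fin 3 → E3 → E3

/-- `v ∈ 𝒟` as a vector field with its first (weak) partial derivatives. -/
def D.field (v : D) : GradField where
  val := v.toV.toL2
  grad := fun i => (v.partial i).toL2

/-- The field `U = σ A₀ + v`, for `σ ∈ ℝ` and `v ∈ 𝒟`, with its first partial derivatives. -/
def profile (a₀ : E3 → E3) (σ : ℝ) (v : D) : GradField where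
  val := fun x => σ • heatExt a₀ x + v.field.val x
  grad := fun i x => σ • pd i (heatExt a₀) x + v.field.grad i x

/-- The advection term `u · ∇ w`. -/
def adv (u w : GradField) : E3 → E3 := fun x => ∑ i, u.val x i • w.grad i x

/-- `u · ∇ w + w · ∇ u`. -/
def advSym (u w : GradField) : E3 → E3 := fun x => adv u w x + adv w u x

/-- The linear part `-Δ v - (x / 2) · ∇ v - v / 2`. -/
def linPart (v : D) : L2 :=
  -(∑ i, (v.partial₂ i i).toL2) - (1 / 2 : ℝ) • v.radial.toL2 - (1 / 2 : ℝ) • v.toV.toL2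

/-- `F(v, σ) = -Δ v - (x / 2) · ∇ v - v / 2 + (σ A₀ + v) · ∇ (σ A₀ + v) + ∇ P`, with `P` such that
the result is divergence-free. (The first three terms are divergence-free.) -/
def F (a₀ : E3 → E3) (v : D) (σ : ℝ) : L2 :=
  linPart v + leray (adv (profile a₀ σ v) (profile a₀ σ v))

/-- The linearization
`ℒ(U) φ = -Δ φ - (x / 2) · ∇ φ - φ / 2 + U · ∇ φ + φ · ∇ U + ∇ p`, with `p` such that the result is
divergence-free. -/
def lin (U : GradField) (φ : D) : L2 := linPart φ + leray (advSym U φ.field)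

/-- The range of `ℒ(U)`. -/
def linRange (U : GradField) : Set L2 := Set.range (lin U)

/-- `lam` is in the resolvent set of `ℒ(U)`, regarded as an unbounded operator in (the
complexification of) `𝒱` with domain `𝒟`: the operator `ℒ(U) - lam` is a bijection from the
complexification of `𝒟` to that of `𝒱`, with bounded inverse in `𝒱`. Complex fields are written as
pairs of their real and imaginary parts. -/
def InResolventSet (U : GradField) (lam : ℂ) : Prop :=
  (∀ w₁ w₂ : V, ∃! φ : D × D,
    lin U φ.1 - lam.re • φ.1.toV.toL2 + lam.im • φ.2.toV.toL2 = w₁.toL2 ∧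
    lin U φ.2 - lam.re • φ.2.toV.toL2 - lam.im • φ.1.toV.toL2 = w₂.toL2) ∧
  ∃ C : ℝ, ∀ (w₁ w₂ : V) (φ₁ φ₂ : D),
    lin U φ₁ - lam.re • φ₁.toV.toL2 + lam.im • φ₂.toV.toL2 = w₁.toL2 →
    lin U φ₂ - lam.re • φ₂.toV.toL2 - lam.im • φ₁.toV.toL2 = w₂.toL2 →
    ‖φ₁.toV‖ + ‖φ₂.toV‖ ≤ C * (‖w₁‖ + ‖w₂‖)

/-- The spectrum of `ℒ(U)`. -/
def linSpectrum (U : GradField) : Set ℂ := {lam | ¬ InResolventSet U lam}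

/-! ### Solutions of the profile equations -/

/-- `U` solves, for some pressure `P`, the profile equations
`Δ U + (x / 2) · ∇ U + U / 2 - U · ∇ U - ∇ P = 0`, `∇ · U = 0` on `ℝ³` in the sense of
distributions, and `U(x) = u₀(x) + o(1 / |x|)` as `|x| → ∞`. -/
structure IsProfileSolution (u₀ U : E3 → E3) : Prop where
  locallyIntegrable : LocallyIntegrable U
  locallyIntegrable_sq : LocallyIntegrable fun x => ‖U x‖ ^ 2
  div_free : ∀ η : E3 → ℝ, IsTest η → ∫ x, ⟪U x, gradient η x⟫ = 0
  equation : ∃ P : E3 → ℝ, LocallyIntegrable P ∧ ∀ ξ : E3 → E3, IsTest ξ →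
    (∫ x, ⟪U x, (∑ i, pd i (pd i ξ) x) - (1 / 2 : ℝ) • fderiv ℝ ξ x x - ξ x⟫)
      + (∫ x, ⟪U x, fderiv ℝ ξ x (U x)⟫)
      + (∫ x, P x * ∑ i, (pd i ξ x) i) = 0
  asymptotics : ∀ ε : ℝ, 0 < ε → ∃ R : ℝ, ∀ᵐ x : E3, R ≤ ‖x‖ → ‖U x - u₀ x‖ ≤ ε / ‖x‖

/-! ### Types of bifurcation -/

/-- The branch with parameter component `σ₂` crosses the parameter value `σ₂ 0` transversally. -/
def IsTranscritical (σ₂ : ℝ → ℝ) : Prop := deriv σ₂ 0 ≠ 0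

/-- The branch with parameter component `σ₂` has a quadratic turning point at `σ₂ 0`, so that near
`s = 0` it lies on one side of the parameter value `σ₂ 0`. -/
def IsPitchfork (σ₂ : ℝ → ℝ) : Prop := deriv σ₂ 0 = 0 ∧ iteratedDeriv 2 σ₂ 0 ≠ 0

/-- The non-degeneracy condition for a pitchfork bifurcation along the eigenvector `φ`: for some
solution `χ` of `ℒ(U) χ + (φ · ∇ φ + ∇ p) = 0`, the field `φ · ∇ χ + χ · ∇ φ + ∇ q` is not in the
range of `ℒ(U)`. -/
def PitchforkNondegenerate (U : GradField) (φ : D) : Prop :=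
  ∃ χ : D, lin U χ + leray (adv φ.field φ.field) = 0 ∧
    leray (advSym φ.field χ.field) ∉ linRange U

end SelfSimilarNS

end

open SelfSimilarNS

noncomputable section

open SchwartzMap FourierTransform
open scoped ComplexConjugate

namespace SelfSimilarNS

/-! ### Partial derivatives and cut-off functions -/

/-! The theorem is bifurcation theory for a quadratic equation between the Banach spaces 𝒟 and 𝒱,
made available by three facts about the profile equation.

The equation is quadratic. Bounded functions multiply 𝒱 into L², and so do functions in L⁴, by
Hölder. Hence U·∇φ and φ·∇U, with U = σA₀ + v, are in H¹. The Leray projection is a Fourier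
multiplier, so it commutes with derivatives and keeps H¹, and H¹ ⊂ L² ∩ L⁴ by Sobolev; the projected
terms are therefore in 𝒱. The term A₀·∇A₀ is in H¹ as well, because A₀ is O(1/|x|) while its first
and second derivatives are O(1/|x|²). Thus `IsScaleInvariantDatum.exists_maps` writes F(v, σ) as Lv
+ σ²a + σTv + B(v, v) with bounded L, T, B.

The linearization is a Fredholm operator of index zero. It is L + K, where ⟨Lv, v⟩ = ‖∇v‖² + ‖v‖²/4
(`D.inner_linPart`) makes L coercive. The advection part K is compact by Rellich's theorem, since U
and ∇U vanish at infinity as multipliers (`IsScaleInvariantDatum.exists_compact_advSym`). That L is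
onto is not shown by solving an equation: the spectral hypothesis says that L + K + t is bijective
for t > 0. Subtracting the compact K from it leaves L + t, which is injective by coercivity and so
bijective by the Riesz–Schauder theory; the bounds are uniform in t, so L is bijective too.
Consequently, if the kernel of A = L + K is spanned by φ, if l φ = 1 and z is not in the range, then
A + l ⊗ z is injective, hence bijective (`bijective_add_smulRight`).

Solutions are profile solutions. The heat equation for A₀ turns F = 0 into the equation for U, and
the pressure has the Fourier symbols ξᵢξⱼ/|ξ|². The delicate point is the decay v = o(1/|x|).
Testing the equation with m v and m Δv, where m is a truncation of |x|², bounds |x|v, |x|∇v and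
|x|Δv in L². So xⱼv and its Laplacian are in L²; its Fourier transform is then integrable, and xⱼv
vanishes at infinity by the Riemann–Lebesgue lemma. The rest is A₀ - a₀ = O(1/|x|²).

Now continuation is the implicit function theorem. For bifurcation, v = v₁(σ) + w turns the equation
into N(σ)w + B(w, w) = 0 with N(σ) the linearization along v₁. Write w = s(φ + χ) with l χ = 0,
divide by s, and take y = (σ - σ₀)φ + χ as unknown. At s = 0, y = 0 the derivative in y is N(σ₀) + l
⊗ N'(σ₀)φ. The transversality condition says that N'(σ₀)φ is not in the range, so this is bijective
and the implicit function theorem gives the second curve (`exists_bifurcating_curve`). All other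
small solutions are captured because the same bijectivity forces them to be nearly multiples of φ
(`eventually_decomposition`). The type of the bifurcation is read off from the first two derivatives
of the divided equation at s = 0 (`bifurcation_type`). -/

theorem pd_mul {f g : E3 → ℝ} {x : E3} (i : Fin 3) (hf : DifferentiableAt ℝ f x)
    (hg : DifferentiableAt ℝ g x) :
    pd i (fun y => f y * g y) x = pd i f x * g x + f x * pd i g x := by
  simp only [pd]
  rw [fderiv_fun_mul hf hg]
  simp only [_root_.add_apply, _root_.smul_apply, smul_eq_mul]
  ring

theorem IsTest.mul_left {η m : E3 → ℝ} (hη : IsTest η) (hm : ContDiff ℝ ∞ m) :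
    IsTest (fun x => m x * η x) :=
  ⟨hm.mul hη.smooth, hη.compact.mul_left⟩

theorem IsTest.memLp {η : E3 → ℝ} (hη : IsTest η) (p : ℝ≥0∞) : MemLp η p (volume : Measure E3) :=
  hη.smooth.continuous.memLp_of_hasCompactSupport hη.compact

theorem IsTest.differentiable {F : Type*} [NormedAddCommGroup F] [NormedSpace ℝ F] {η : E3 → F}
    (hη : IsTest η) : Differentiable ℝ η :=
  hη.smooth.differentiable (by simp)

theorem norm_e (i : Fin 3) : ‖e i‖ = 1 := by simp [e]

theorem abs_pd_le {F : Type*} [NormedAddCommGroup F] [NormedSpace ℝ F] (i : Fin 3) (f : E3 → F)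
    (x : E3) : ‖pd i f x‖ ≤ ‖fderiv ℝ f x‖ := by
  have := (fderiv ℝ f x).le_opNorm (e i)
  rwa [norm_e, mul_one] at this

theorem norm_fderiv_le_sum_pd {F : Type*} [NormedAddCommGroup F] [NormedSpace ℝ F] (f : E3 → F)
    (x : E3) : ‖fderiv ℝ f x‖ ≤ ∑ i, ‖pd i f x‖ := by
  refine ContinuousLinearMap.opNorm_le_bound _ (by positivity) fun y => ?_
  have hy : y = ∑ i, y i • e i := by
    ext j
    fin_cases j <;> simp [e, Fin.sum_univ_three]
  calc ‖fderiv ℝ f x y‖ = ‖∑ i, y i • pd i f x‖ := by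
        conv_lhs => rw [hy, map_sum]
        simp [pd]
    _ ≤ ∑ i, ‖y i • pd i f x‖ := norm_sum_le _ _
    _ ≤ ∑ i, ‖pd i f x‖ * ‖y‖ := Finset.sum_le_sum fun i _ => by
        rw [norm_smul, mul_comm]
        exact mul_le_mul_of_nonneg_left (PiLp.norm_apply_le y i) (norm_nonneg _)
    _ = _ := by rw [Finset.sum_mul]

/-- Smooth cut-off functions that increase to `1`, with uniformly bounded derivatives. -/
theorem exists_cutoff : ∃ (χ : ℕ → E3 → ℝ) (C : ℝ), 0 ≤ C ∧ (∀ n, IsTest (χ n)) ∧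
    (∀ n x, |χ n x| ≤ 1) ∧ (∀ n i x, |pd i (χ n) x| ≤ C) ∧
    (∀ x, ∀ᶠ n in atTop, χ n x = 1) ∧ ∀ x i, ∀ᶠ n in atTop, pd i (χ n) x = 0 := by
  let b : ContDiffBump (0 : E3) := ⟨1, 2, one_pos, one_lt_two⟩
  have hb : IsTest (b : E3 → ℝ) := ⟨b.contDiff, b.hasCompactSupport⟩
  obtain ⟨C, hC⟩ := (hb.compact.fderiv (𝕜 := ℝ)).exists_bound_of_continuous
    (hb.smooth.continuous_fderiv (by simp))
  let χ : ℕ → E3 → ℝ := fun n x => b (((n : ℝ) + 1)⁻¹ • x)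
  have hpos : ∀ n : ℕ, (0 : ℝ) < (n + 1 : ℝ)⁻¹ := fun n => by positivity
  have hpd : ∀ n i x, pd i (χ n) x = ((n : ℝ) + 1)⁻¹ * pd i b (((n : ℝ) + 1)⁻¹ • x) := by
    intro n i x
    have h1 : HasFDerivAt (fun y : E3 => ((n : ℝ) + 1)⁻¹ • y)
        (((n : ℝ) + 1)⁻¹ • ContinuousLinearMap.id ℝ E3) x :=
      (hasFDerivAt_id (𝕜 := ℝ) x).const_smul (((n : ℝ) + 1)⁻¹)
    have h2 := ((hb.differentiable (((n : ℝ) + 1)⁻¹ • x)).hasFDerivAt.comp x h1).fderiv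
    simp only [pd]
    rw [show fderiv ℝ (χ n) x = _ from h2]
    simp
  have hone : ∀ x : E3, ∀ᶠ n : ℕ in atTop, ‖x‖ < (n : ℝ) + 1 := fun x => by
    filter_upwards [eventually_ge_atTop ⌈‖x‖⌉₊] with n hn
    exact lt_of_le_of_lt (Nat.ceil_le.1 hn) (by linarith)
  have hmem : ∀ (x : E3) (n : ℕ), ‖x‖ < (n : ℝ) + 1 → ‖((n : ℝ) + 1)⁻¹ • x‖ < 1 := by
    intro x n hn
    rw [norm_smul, Real.norm_of_nonneg (hpos n).le, inv_mul_lt_iff₀ (by positivity)]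
    linarith
  refine ⟨χ, C, (norm_nonneg _).trans (hC 0), fun n => ⟨?_, ?_⟩, ?_, ?_, ?_, ?_⟩
  · exact hb.smooth.comp (contDiff_const_smul _)
  · exact hb.compact.comp_smul (hpos n).ne'
  · intro n x
    rw [abs_of_nonneg b.nonneg]
    exact b.le_one
  · intro n i x
    rw [hpd, abs_mul, abs_of_pos (hpos n)]
    have h1 := (abs_pd_le i b (((n : ℝ) + 1)⁻¹ • x)).trans (hC _)
    rw [Real.norm_eq_abs] at h1
    have h2 : ((n : ℝ) + 1)⁻¹ ≤ 1 := inv_le_one_of_one_le₀ (by linarith [n.cast_nonneg (α := ℝ)])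
    nlinarith [abs_nonneg (pd i b (((n : ℝ) + 1)⁻¹ • x)), hpos n]
  · intro x
    filter_upwards [hone x] with n hn
    exact b.one_of_mem_closedBall (by simpa using (hmem x n hn).le)
  · intro x i
    filter_upwards [hone x] with n hn
    have h1 : (b : E3 → ℝ) =ᶠ[𝓝 (((n : ℝ) + 1)⁻¹ • x)] fun _ => 1 :=
      b.eventuallyEq_one_of_mem_ball (by simpa using hmem x n hn)
    rw [hpd, pd, h1.fderiv_eq]
    simp

/-! ### Weak divergences and the Fourier transform -/

/-- `q` is the weak divergence of `(G₀, G₁, G₂)`. -/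
def IsWeakDiv (G : Fin 3 → E3 → ℝ) (q : E3 → ℝ) : Prop :=
  ∀ η : E3 → ℝ, IsTest η → ∑ k, ∫ x, pd k η x * G k x = - ∫ x, η x * q x

/-- Test with the product of η and a cut-off and remove the cut-off by dominated convergence. The
cut-off derivatives are uniformly bounded and tend to zero pointwise, and all products of two L²
functions are integrable. -/
theorem IsWeakDiv.of_smooth {G : Fin 3 → E3 → ℝ} {q : E3 → ℝ} (h : IsWeakDiv G q)
    (hG : ∀ k, MemLp (G k) 2 volume) (hq : MemLp q 2 volume) {η : E3 → ℝ} (hη : ContDiff ℝ ∞ η)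
    (hη2 : MemLp η 2 volume) (hdη : ∀ k, MemLp (pd k η) 2 volume) :
    ∑ k, ∫ x, pd k η x * G k x = - ∫ x, η x * q x := by
  obtain ⟨χ, C, hC, hχ, hχ1, hχd, hχt, hχt'⟩ := exists_cutoff
  have hd : ∀ n k x, pd k (fun y => χ n y * η y) x
      = pd k (χ n) x * η x + χ n x * pd k η x := fun n k x =>
    pd_mul k ((hχ n).differentiable x) (hη.differentiable (by simp) x)
  have hpdm : ∀ n k, Continuous (pd k (χ n)) := fun n k => ((hχ n).pd k).smooth.continuous
  have h1 : Tendsto (fun n => ∑ k, ∫ x, pd k (fun y => χ n y * η y) x * G k x) atTop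
      (𝓝 (∑ k, ∫ x, pd k η x * G k x)) := by
    refine tendsto_finsetSum _ fun k _ => ?_
    refine tendsto_integral_of_dominated_convergence
      (fun x => C * ‖η x * G k x‖ + ‖pd k η x * G k x‖) (fun n => ?_) ?_ (fun n => ?_) ?_
    · simp only [hd]
      exact ((((hpdm n k).aestronglyMeasurable.mul hη2.1).add
        ((hχ n).smooth.continuous.aestronglyMeasurable.mul (hdη k).1))).mul (hG k).1
    · exact ((hη2.integrable_mul (hG k)).norm.const_mul C).add ((hdη k).integrable_mul (hG k)).norm
    · refine Eventually.of_forall fun x => ?_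
      rw [hd, add_mul]
      refine (norm_add_le _ _).trans (add_le_add ?_ ?_)
      · rw [mul_assoc, norm_mul]
        exact mul_le_mul_of_nonneg_right (hχd n k x) (norm_nonneg _)
      · rw [mul_assoc, norm_mul]
        exact mul_le_of_le_one_left (norm_nonneg _) (hχ1 n x)
    · refine Eventually.of_forall fun x => ?_
      refine tendsto_const_nhds.congr' ?_
      filter_upwards [hχt x, hχt' x k] with n h1 h2
      rw [hd, h1, h2]
      ring
  have h2 : Tendsto (fun n => - ∫ x, (χ n x * η x) * q x) atTop (𝓝 (- ∫ x, η x * q x)) := by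
    refine Tendsto.neg ?_
    refine tendsto_integral_of_dominated_convergence (fun x => ‖η x * q x‖) (fun n => ?_)
      (hη2.integrable_mul hq).norm (fun n => ?_) ?_
    · exact ((hχ n).smooth.continuous.aestronglyMeasurable.mul hη2.1).mul hq.1
    · refine Eventually.of_forall fun x => ?_
      rw [mul_assoc, norm_mul]
      exact mul_le_of_le_one_left (norm_nonneg _) (hχ1 n x)
    · refine Eventually.of_forall fun x => ?_
      refine tendsto_const_nhds.congr' ?_
      filter_upwards [hχt x] with n h1
      rw [h1, one_mul]
  refine tendsto_nhds_unique h1 (h2.congr fun n => ?_)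
  have hT : IsTest (fun y => χ n y * η y) := ⟨(hχ n).smooth.mul hη, (hχ n).compact.mul_right⟩
  exact (h _ hT).symm

theorem memLp_ofReal {f : E3 → ℝ} {p : ℝ≥0∞} (h : MemLp f p volume) :
    MemLp (fun x => (f x : ℂ)) p volume := h.ofReal

open Classical in
/-- The Fourier transform of a real function in `L²`. -/
def hat (f : E3 → ℝ) : Lp ℂ 2 (volume : Measure E3) :=
  if h : MemLp f 2 (volume : Measure E3) then 𝓕 (((memLp_ofReal h)).toLp _) else 0

theorem hat_of_memLp {f : E3 → ℝ} (h : MemLp f 2 volume) :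
    hat f = 𝓕 (((memLp_ofReal h)).toLp (fun x => (f x : ℂ))) := dif_pos h

theorem hat_congr {f g : E3 → ℝ} (h : f =ᵐ[volume] g) : hat f = hat g := by
  by_cases hf : MemLp f 2 volume
  · have hg := hf.ae_eq h
    rw [hat_of_memLp hf, hat_of_memLp hg]
    congr 1
    rw [MemLp.toLp_eq_toLp_iff]
    filter_upwards [h] with x hx
    rw [hx]
  · have hg : ¬ MemLp g 2 volume := fun hg => hf (hg.ae_eq h.symm)
    rw [hat, hat, dif_neg hf, dif_neg hg]

theorem hat_add {f g : E3 → ℝ} (hf : MemLp f 2 volume) (hg : MemLp g 2 volume) :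
    hat (fun x => f x + g x) = hat f + hat g := by
  have h : MemLp (fun x => f x + g x) 2 volume := hf.add hg
  rw [hat_of_memLp h, hat_of_memLp hf, hat_of_memLp hg, ← FourierTransform.fourier_add]
  congr 1
  rw [← MemLp.toLp_add, MemLp.toLp_eq_toLp_iff]
  refine Eventually.of_forall fun x => ?_
  simp

theorem hat_const_mul {f : E3 → ℝ} (c : ℝ) (hf : MemLp f 2 volume) :
    hat (fun x => c * f x) = (c : ℂ) • hat f := by
  have h : MemLp (fun x => c * f x) 2 volume := hf.const_mul c
  rw [hat_of_memLp h, hat_of_memLp hf, ← FourierTransform.fourier_smul]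
  congr 1
  rw [← MemLp.toLp_const_smul, MemLp.toLp_eq_toLp_iff]
  refine Eventually.of_forall fun x => ?_
  simp

theorem hat_sub {f g : E3 → ℝ} (hf : MemLp f 2 volume) (hg : MemLp g 2 volume) :
    hat (fun x => f x - g x) = hat f - hat g := by
  have h := hat_add hf (hg.const_mul (-1))
  rw [hat_const_mul _ hg] at h
  simpa [sub_eq_add_neg] using h

theorem norm_hat {f : E3 → ℝ} (hf : MemLp f 2 volume) : ‖hat f‖ = (eLpNorm f 2 volume).toReal := by
  rw [hat_of_memLp hf, Lp.norm_fourier_eq, Lp.norm_toLp]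
  congr 1
  exact eLpNorm_congr_norm_ae (Eventually.of_forall fun x => by simp)

/-- Plancherel's theorem against Schwartz functions. -/
theorem integral_conj_mul_eq (ζ : 𝓢(E3, ℂ)) {f : E3 → ℝ} (hf : MemLp f 2 volume) :
    ∫ x, conj (ζ x) * (f x : ℂ) = ∫ ξ, conj ((𝓕 ζ : 𝓢(E3, ℂ)) ξ) * hat f ξ := by
  have h := Lp.inner_fourier_eq (ζ.toLp 2) (((memLp_ofReal hf)).toLp (fun x => (f x : ℂ)))
  rw [← hat_of_memLp hf, SchwartzMap.toLp_fourier_eq, L2.inner_def, L2.inner_def] at h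
  rw [integral_congr_ae (g := fun x => inner ℂ ((ζ.toLp 2) x)
    ((((memLp_ofReal hf)).toLp (fun x => (f x : ℂ))) x)), ← h]
  · refine integral_congr_ae ?_
    filter_upwards [SchwartzMap.coeFn_toLp (𝓕 ζ) 2 volume] with x hx
    rw [hx, RCLike.inner_apply, mul_comm]
  · filter_upwards [SchwartzMap.coeFn_toLp ζ 2 volume, MemLp.coeFn_toLp ((memLp_ofReal hf))]
      with x hx hx'
    rw [hx, hx', RCLike.inner_apply, mul_comm]

/-- Plancherel's theorem for real functions. -/
theorem integral_mul_eq_hat {f g : E3 → ℝ} (hf : MemLp f 2 volume) (hg : MemLp g 2 volume) :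
    ((∫ x, f x * g x : ℝ) : ℂ) = ∫ ξ, conj (hat f ξ) * hat g ξ := by
  have h := Lp.inner_fourier_eq (((memLp_ofReal hf)).toLp (fun x => (f x : ℂ)))
    (((memLp_ofReal hg)).toLp (fun x => (g x : ℂ)))
  rw [← hat_of_memLp hf, ← hat_of_memLp hg, L2.inner_def, L2.inner_def] at h
  rw [integral_congr_ae (g := fun x => inner ℂ (hat f x) (hat g x)), h, ← integral_complex_ofReal]
  · refine integral_congr_ae ?_
    filter_upwards [MemLp.coeFn_toLp ((memLp_ofReal hf)), MemLp.coeFn_toLp ((memLp_ofReal hg))]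
      with x hx hx'
    rw [hx, hx', RCLike.inner_apply]
    simp [mul_comm]
  · exact Eventually.of_forall fun x => by simp [mul_comm]

theorem fourier_pd_apply (ζ : 𝓢(E3, ℂ)) (k : Fin 3) (ξ : E3) :
    (𝓕 (LineDeriv.lineDerivOp (e k) ζ) : 𝓢(E3, ℂ)) ξ
      = 2 * Real.pi * Complex.I * (ξ k : ℂ) * (𝓕 ζ : 𝓢(E3, ℂ)) ξ := by
  rw [SchwartzMap.fourier_lineDerivOp_eq, _root_.smul_apply,
    SchwartzMap.smulLeftCLM_apply_apply (by fun_prop)]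
  have : inner ℝ ξ (e k) = ξ k := by rw [e, EuclideanSpace.inner_single_right]; simp
  rw [this]
  simp [mul_assoc]

/-- A complex Schwartz function splits into real smooth square integrable functions. -/
theorem IsWeakDiv.of_schwartz {G : Fin 3 → E3 → ℝ} {q : E3 → ℝ} (h : IsWeakDiv G q)
    (hG : ∀ k, MemLp (G k) 2 volume) (hq : MemLp q 2 volume) (ζ : 𝓢(E3, ℂ)) :
    ∑ k, ∫ x, conj ((LineDeriv.lineDerivOp (e k) ζ : 𝓢(E3, ℂ)) x) * (G k x : ℂ)
      = - ∫ x, conj (ζ x) * (q x : ℂ) := by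
  -- Weak divergences are defined with real test functions. A real-linear functional of ζ is one,
  -- and the real and imaginary parts together recover the complex identity.
  have key : ∀ L : ℂ →L[ℝ] ℝ, ∑ k, ∫ x, L ((LineDeriv.lineDerivOp (e k) ζ : 𝓢(E3, ℂ)) x) * G k x
      = - ∫ x, L (ζ x) * q x := by
    intro L
    have hd : ∀ k, pd k (fun x => L (ζ x))
        = fun x => L ((LineDeriv.lineDerivOp (e k) ζ : 𝓢(E3, ℂ)) x) := by
      intro k
      funext x
      rw [SchwartzMap.lineDerivOp_apply_eq_fderiv, pd]
      have := (L.hasFDerivAt.comp x ζ.differentiableAt.hasFDerivAt).fderiv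
      rw [show fderiv ℝ (fun x => L (ζ x)) x = _ from this]
      rfl
    have := h.of_smooth hG hq (η := fun x => L (ζ x)) (L.contDiff.comp (ζ.smooth ⊤))
      (L.comp_memLp' (ζ.memLp 2 volume)) (fun k => by
        rw [hd]; exact L.comp_memLp' ((LineDeriv.lineDerivOp (e k) ζ : 𝓢(E3, ℂ)).memLp 2 volume))
    simpa only [hd] using this
  have hint : ∀ (ψ : 𝓢(E3, ℂ)) {f : E3 → ℝ}, MemLp f 2 volume → 
      ∫ x, conj (ψ x) * (f x : ℂ) = ((∫ x, Complex.reCLM (ψ x) * f x : ℝ) : ℂ)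
        - ((∫ x, Complex.imCLM (ψ x) * f x : ℝ) : ℂ) * Complex.I := by
    intro ψ f hf
    have h1 : Integrable (fun x => Complex.reCLM (ψ x) * f x) volume :=
      (Complex.reCLM.comp_memLp' (ψ.memLp 2 volume)).integrable_mul hf
    have h2 : Integrable (fun x => Complex.imCLM (ψ x) * f x) volume :=
      (Complex.imCLM.comp_memLp' (ψ.memLp 2 volume)).integrable_mul hf
    rw [← integral_complex_ofReal, ← integral_complex_ofReal, ← integral_mul_const, ← integral_sub]
    · refine integral_congr_ae (Eventually.of_forall fun x => ?_)
      simp only [Complex.reCLM_apply, Complex.imCLM_apply]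
      apply Complex.ext <;> simp
    · exact h1.ofReal
    · exact h2.ofReal.mul_const _
  rw [hint ζ hq]
  simp only [hint _ (hG _)]
  rw [Finset.sum_sub_distrib, ← Finset.sum_mul, ← Complex.ofReal_sum, ← Complex.ofReal_sum,
    key Complex.reCLM, key Complex.imCLM]
  push_cast
  ring

theorem integrable_conj_mul {f g : E3 → ℂ} (hf : MemLp f 2 volume) (hg : MemLp g 2 volume) :
    Integrable (fun x => conj (f x) * g x) volume := by
  have : MemLp (fun x => conj (f x)) 2 volume := hf.star
  exact this.integrable_mul hg

theorem memLp_coord_mul_schwartz (k : Fin 3) (ζ : 𝓢(E3, ℂ)) :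
    MemLp (fun ξ : E3 => (ξ k : ℂ) * (𝓕 ζ : 𝓢(E3, ℂ)) ξ) 2 volume := by
  have h := ((𝓕 (LineDeriv.lineDerivOp (e k) ζ) : 𝓢(E3, ℂ)).memLp 2 volume).const_mul
    ((2 * Real.pi * Complex.I)⁻¹ : ℂ)
  refine h.ae_eq (Eventually.of_forall fun ξ => ?_)
  simp only [fourier_pd_apply]
  field_simp [Complex.I_ne_zero, Real.pi_ne_zero]

theorem locallyIntegrable_coord_mul (k : Fin 3) {w : E3 → ℂ} (hw : MemLp w 2 volume) :
    LocallyIntegrable (fun ξ : E3 => (ξ k : ℂ) * w ξ) volume := by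
  have h := hw.locallyIntegrable (by norm_num)
  rw [← locallyIntegrableOn_univ] at h ⊢
  exact h.continuousOn_mul (by fun_prop) isOpen_univ.isLocallyClosed

/-- The Fourier transform of the weak divergence. -/
theorem IsWeakDiv.hat_eq {G : Fin 3 → E3 → ℝ} {q : E3 → ℝ} (h : IsWeakDiv G q)
    (hG : ∀ k, MemLp (G k) 2 volume) (hq : MemLp q 2 volume) :
    ∀ᵐ ξ : E3, hat q ξ = ∑ k, 2 * Real.pi * Complex.I * (ξ k : ℂ) * hat (G k) ξ := by
  have hloc : LocallyIntegrable (fun ξ : E3 => hat q ξ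
      - ∑ k, 2 * Real.pi * Complex.I * (ξ k : ℂ) * hat (G k) ξ) volume := by
    refine ((Lp.memLp _).locallyIntegrable (by norm_num)).sub ?_
    refine locallyIntegrable_finsetSum _ fun k _ => ?_
    have := (locallyIntegrable_coord_mul k (Lp.memLp (hat (G k)))).smul
      (2 * Real.pi * Complex.I : ℂ)
    refine this.congr (Eventually.of_forall fun ξ => ?_)
    simp [mul_assoc]
  -- The difference of the two sides is tested against a compactly supported smooth g on the
  -- frequency side. Such a g is the Fourier transform of a Schwartz function ζ, and the divergence
  -- identity for ζ is what Plancherel turns into the claim.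
  have hz := ae_eq_zero_of_integral_contDiff_smul_eq_zero hloc fun g hg hgc => ?_
  · filter_upwards [hz] with ξ hξ
    exact sub_eq_zero.1 hξ
  let ψ : 𝓢(E3, ℂ) := HasCompactSupport.toSchwartzMap (f := fun x => (g x : ℂ))
    (hgc.comp_left (g := fun r : ℝ => (r : ℂ)) (by simp)) (Complex.ofRealCLM.contDiff.comp hg)
  have hψ : ∀ x, ψ x = (g x : ℂ) := fun x => rfl
  let ζ : 𝓢(E3, ℂ) := 𝓕⁻ ψ
  have hζ : (𝓕 ζ : 𝓢(E3, ℂ)) = ψ := FourierTransform.fourier_fourierInv_eq ψ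
  have h1 := h.of_schwartz hG hq ζ
  simp only [integral_conj_mul_eq _ (hG _), integral_conj_mul_eq _ hq, fourier_pd_apply, hζ, hψ]
    at h1
  have hI : ∀ k, Integrable (fun ξ : E3 => (g ξ : ℂ) *
      (2 * Real.pi * Complex.I * (ξ k : ℂ) * hat (G k) ξ)) volume := by
    intro k
    have := ((integrable_conj_mul (memLp_coord_mul_schwartz k ζ) (Lp.memLp (hat (G k)))).const_mul
      (2 * Real.pi * Complex.I : ℂ))
    refine this.congr (Eventually.of_forall fun ξ => ?_)
    simp only [hζ, hψ, map_mul, Complex.conj_ofReal]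
    ring
  have hI' : Integrable (fun ξ : E3 => (g ξ : ℂ) * hat q ξ) volume := by
    refine (integrable_conj_mul (ψ.memLp 2 volume) (Lp.memLp (hat q))).congr
      (Eventually.of_forall fun ξ => ?_)
    simp [hψ]
  have h2 : (fun ξ : E3 => g ξ • (hat q ξ
      - ∑ k, 2 * Real.pi * Complex.I * (ξ k : ℂ) * hat (G k) ξ)) = fun ξ => (g ξ : ℂ) * hat q ξ
      - ∑ k, (g ξ : ℂ) * (2 * Real.pi * Complex.I * (ξ k : ℂ) * hat (G k) ξ) := by
    funext ξ
    rw [Complex.real_smul, mul_sub, Finset.mul_sum]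
  rw [h2, integral_sub hI' (integrable_finsetSum _ fun k _ => hI k),
    integral_finsetSum _ fun k _ => hI k]
  have h3 : ∀ k, ∫ ξ : E3, conj (2 * Real.pi * Complex.I * (ξ k : ℂ) * (g ξ : ℂ)) * hat (G k) ξ
      = - ∫ ξ : E3, (g ξ : ℂ) * (2 * Real.pi * Complex.I * (ξ k : ℂ) * hat (G k) ξ) := by
    intro k
    rw [← integral_neg]
    refine integral_congr_ae (Eventually.of_forall fun ξ => ?_)
    simp only [map_mul, Complex.conj_ofReal, Complex.conj_I, map_ofNat]
    ring
  simp only [h3, Finset.sum_neg_distrib, neg_inj, Complex.conj_ofReal] at h1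
  rw [h1, sub_self]

/-! ### Weak partial derivatives in `L²` -/

theorem integrable_mul_of_memLp {f g : E3 → ℝ} (hf : MemLp f 2 volume) (hg : MemLp g 2 volume) :
    Integrable (fun x => f x * g x) volume := hf.integrable_mul hg

/-- `f, g ∈ L²(ℝ³)` and `g` is the weak partial derivative `∂ₖ f`. -/
structure HasWeakPD (k : Fin 3) (f g : E3 → ℝ) : Prop where
  left : MemLp f 2 volume
  right : MemLp g 2 volume
  weak : ∀ η : E3 → ℝ, IsTest η → ∫ x, pd k η x * f x = - ∫ x, η x * g x

/-- One partial derivative is the divergence of a field with a single nonzero component, so the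
Fourier rule for divergences covers derivatives too. -/
theorem HasWeakPD.isWeakDiv {k : Fin 3} {f g : E3 → ℝ} (h : HasWeakPD k f g) :
    IsWeakDiv (fun j => if j = k then f else 0) g := by
  intro η hη
  rw [Finset.sum_eq_single k]
  · simpa using h.weak η hη
  · intro j _ hj
    simp [hj]
  · simp

theorem HasWeakPD.hat_eq {k : Fin 3} {f g : E3 → ℝ} (h : HasWeakPD k f g) :
    ∀ᵐ ξ : E3, hat g ξ = 2 * Real.pi * Complex.I * (ξ k : ℂ) * hat f ξ := by
  have h1 := h.isWeakDiv.hat_eq (fun j => by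
    by_cases hj : j = k
    · simpa [hj] using h.left
    · simp [hj]) h.right
  have h0 : ∀ᵐ ξ : E3, hat (0 : E3 → ℝ) ξ = 0 := by
    have : hat (0 : E3 → ℝ) = 0 := by
      have := hat_const_mul (f := (0 : E3 → ℝ)) 0 MemLp.zero
      simpa [Pi.zero_def] using this
    rw [this]
    exact Lp.coeFn_zero _ _ _
  filter_upwards [h1, h0] with ξ h1 h0
  rw [h1, Finset.sum_eq_single k]
  · simp
  · intro j _ hj
    simp [hj, h0]
  · simp

theorem HasWeakPD.congr {k : Fin 3} {f g f' g' : E3 → ℝ} (h : HasWeakPD k f g)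
    (hf : f =ᵐ[volume] f') (hg : g =ᵐ[volume] g') : HasWeakPD k f' g' where
  left := h.left.ae_eq hf
  right := h.right.ae_eq hg
  weak η hη := by
    rw [← integral_congr_ae (f := fun x => pd k η x * f x), h.weak η hη]
    · congr 1
      refine integral_congr_ae ?_
      filter_upwards [hg] with x hx
      rw [hx]
    · filter_upwards [hf] with x hx
      rw [hx]

theorem HasWeakPD.add {k : Fin 3} {f g f' g' : E3 → ℝ} (h : HasWeakPD k f g)
    (h' : HasWeakPD k f' g') : HasWeakPD k (fun x => f x + f' x) (fun x => g x + g' x) where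
  left := h.left.add h'.left
  right := h.right.add h'.right
  weak η hη := by
    have e1 : MemLp (pd k η) 2 volume := (hη.pd k).memLp 2
    have e2 : MemLp η 2 volume := hη.memLp 2
    simp only [mul_add]
    rw [integral_add (integrable_mul_of_memLp e1 h.left) (integrable_mul_of_memLp e1 h'.left),
      integral_add (integrable_mul_of_memLp e2 h.right) (integrable_mul_of_memLp e2 h'.right),
          h.weak η hη,
      h'.weak η hη, neg_add]

theorem HasWeakPD.const_mul {k : Fin 3} {f g : E3 → ℝ} (c : ℝ) (h : HasWeakPD k f g) :
    HasWeakPD k (fun x => c * f x) (fun x => c * g x) where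
  left := h.left.const_mul c
  right := h.right.const_mul c
  weak η hη := by
    simp only [mul_left_comm _ c]
    rw [integral_const_mul, integral_const_mul, h.weak η hη, mul_neg]

theorem HasWeakPD.zero (k : Fin 3) : HasWeakPD k (fun _ => 0) (fun _ => 0) where
  left := MemLp.zero
  right := MemLp.zero
  weak η hη := by simp

theorem HasWeakPD.sum {ι : Type*} (s : Finset ι) {k : Fin 3} {f g : ι → E3 → ℝ}
    (h : ∀ i ∈ s, HasWeakPD k (f i) (g i)) :
    HasWeakPD k (fun x => ∑ i ∈ s, f i x) (fun x => ∑ i ∈ s, g i x) := by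
  classical
  induction s using Finset.induction_on with
  | empty => simpa using HasWeakPD.zero k
  | insert a s ha ih =>
    simp only [Finset.sum_insert ha]
    exact (h a (Finset.mem_insert_self _ _)).add
      (ih fun i hi => h i (Finset.mem_insert_of_mem hi))

/-- A differentiable function has its classical partial derivative as weak one. -/
theorem HasWeakPD.of_differentiable {k : Fin 3} {f : E3 → ℝ} (hd : Differentiable ℝ f)
    (hf : MemLp f 2 volume) (hg : MemLp (pd k f) 2 volume) : HasWeakPD k f (pd k f) where
  left := hf
  right := hg
  weak η hη := by
    have e1 : MemLp (pd k η) 2 volume := (hη.pd k).memLp 2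
    have e2 : MemLp η 2 volume := hη.memLp 2
    have := integral_mul_fderiv_eq_neg_fderiv_mul_of_integrable (f := η) (g := f) (v := e k)
      (μ := volume) (e1.integrable_mul hf) (e2.integrable_mul hg) (e2.integrable_mul hf)
      (fun x _ => hη.differentiable x) (fun x _ => hd x)
    rw [← neg_eq_iff_eq_neg] at this
    exact this.symm

theorem IsTest.hasWeakPD {η : E3 → ℝ} (hη : IsTest η) (k : Fin 3) :
    HasWeakPD k η (SelfSimilarNS.pd k η) :=
  .of_differentiable hη.differentiable (hη.memLp 2) ((hη.pd k).memLp 2)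

/-- Integration by parts in `H¹`. -/
theorem HasWeakPD.integral_mul {k : Fin 3} {f f' g g' : E3 → ℝ} (hf : HasWeakPD k f f')
    (hg : HasWeakPD k g g') : ∫ x, f' x * g x = - ∫ x, f x * g' x := by
  have h : ((∫ x, f' x * g x : ℝ) : ℂ) = ((- ∫ x, f x * g' x : ℝ) : ℂ) := by
    rw [Complex.ofReal_neg, integral_mul_eq_hat hf.right hg.left,
        integral_mul_eq_hat hf.left hg.right,
      ← integral_neg]
    refine integral_congr_ae ?_
    filter_upwards [hf.hat_eq, hg.hat_eq] with ξ h1 h2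
    rw [h1, h2]
    simp only [map_mul, Complex.conj_ofReal, Complex.conj_I, map_ofNat]
    ring
  exact_mod_cast h

/-- Plancherel against the test function, whose own transform obeys the derivative rule; conjugating
the factor 2πi ξₖ gives the sign of the integration by parts. With `HasWeakPD.hat_eq` this makes
weak derivatives a condition on Fourier transforms. -/
theorem HasWeakPD.of_hat {k : Fin 3} {f g : E3 → ℝ} (hf : MemLp f 2 volume)
    (hg : MemLp g 2 volume)
    (h : ∀ᵐ ξ : E3, hat g ξ = 2 * Real.pi * Complex.I * (ξ k : ℂ) * hat f ξ) :
    HasWeakPD k f g where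
  left := hf
  right := hg
  weak η hη := by
    have h' : ((∫ x, pd k η x * f x : ℝ) : ℂ) = ((- ∫ x, η x * g x : ℝ) : ℂ) := by
      rw [Complex.ofReal_neg, integral_mul_eq_hat ((hη.pd k).memLp 2) hf,
        integral_mul_eq_hat (hη.memLp 2) hg, ← integral_neg]
      refine integral_congr_ae ?_
      filter_upwards [(hη.hasWeakPD k).hat_eq, h] with ξ h1 h2
      rw [h1, h2]
      simp only [map_mul, Complex.conj_ofReal, Complex.conj_I, map_ofNat]
      ring
    exact_mod_cast h'

/-- `f'` is the partial derivative `∂ₖ f`, after localization by test functions. -/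
def HasLocWeakPD (k : Fin 3) (f f' : E3 → ℝ) : Prop :=
  ∀ η : E3 → ℝ, IsTest η → HasWeakPD k (fun x => η x * f x) (fun x => pd k η x * f x + η x * f' x)

theorem IsTest.mul_memLp {η f : E3 → ℝ} (hη : IsTest η) {p : ℝ≥0∞} (hf : MemLp f p volume) :
    MemLp (fun x => η x * f x) p volume :=
  hf.mul (hη.memLp ∞)

theorem HasWeakPD.loc {k : Fin 3} {f f' : E3 → ℝ} (h : HasWeakPD k f f') : HasLocWeakPD k f f' := by
  intro η hη
  refine ⟨hη.mul_memLp h.left, ((hη.pd k).mul_memLp h.left).add (hη.mul_memLp h.right), ?_⟩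
  intro ζ hζ
  have e1 := h.weak _ (hη.mul_left hζ.smooth)
  simp only [pd_mul k (hζ.differentiable _) (hη.differentiable _)] at e1
  have i1 : Integrable (fun x => pd k ζ x * (η x * f x)) volume :=
    ((hζ.pd k).memLp 2).integrable_mul (hη.mul_memLp h.left)
  have i2 : Integrable (fun x => ζ x * (pd k η x * f x)) volume :=
    (hζ.memLp 2).integrable_mul ((hη.pd k).mul_memLp h.left)
  have i3 : Integrable (fun x => ζ x * (η x * f' x)) volume :=
    (hζ.memLp 2).integrable_mul (hη.mul_memLp h.right)
  have e2 : ∫ x, (pd k ζ x * η x + ζ x * pd k η x) * f x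
      = (∫ x, pd k ζ x * (η x * f x)) + ∫ x, ζ x * (pd k η x * f x) := by
    rw [← integral_add i1 i2]
    exact integral_congr_ae (Eventually.of_forall fun x => by ring)
  rw [e2] at e1
  simp only [mul_add]
  rw [integral_add i2 i3]
  simp only [mul_assoc] at e1 ⊢
  linarith

theorem HasLocWeakPD.of_differentiable {k : Fin 3} {f : E3 → ℝ} (hd : Differentiable ℝ f)
    (hb : ∀ R : ℝ, ∃ C, ∀ x, ‖x‖ ≤ R → |pd k f x| ≤ C) : HasLocWeakPD k f (pd k f) := by
  intro η hη
  have hmeas : Measurable (pd k f) := measurable_fderiv_apply_const ℝ f (e k)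
  have hm1 : MemLp (fun x => η x * f x) 2 volume :=
    (hη.smooth.continuous.mul hd.continuous).memLp_of_hasCompactSupport hη.compact.mul_right
  have hm2 : MemLp (fun x => pd k η x * f x) 2 volume :=
    ((hη.pd k).smooth.continuous.mul hd.continuous).memLp_of_hasCompactSupport
      (hη.pd k).compact.mul_right
  have hm3 : MemLp (fun x => η x * pd k f x) 2 volume := by
    obtain ⟨R, hR⟩ := hη.compact.isCompact.isBounded.exists_norm_le
    obtain ⟨C, hC⟩ := hb R
    refine MemLp.of_le ((hη.memLp 2).const_mul C)
      (hη.smooth.continuous.aestronglyMeasurable.mul hmeas.aestronglyMeasurable)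
      (Eventually.of_forall fun x => ?_)
    by_cases hx : x ∈ tsupport η
    · rw [norm_mul, norm_mul, mul_comm]
      exact mul_le_mul_of_nonneg_right ((hC x (hR x hx)).trans (le_abs_self C)) (norm_nonneg _)
    · simp [image_eq_zero_of_notMem_tsupport hx]
  have hpd : pd k (fun x => η x * f x) = fun x => pd k η x * f x + η x * pd k f x :=
    funext fun x => pd_mul k (hη.differentiable x) (hd x)
  rw [← hpd]
  refine HasWeakPD.of_differentiable (hη.differentiable.mul hd) hm1 ?_
  rw [hpd]
  exact hm2.add hm3

theorem HasLocWeakPD.of_smooth {f : E3 → ℝ} (hf : ContDiff ℝ ∞ f) (k : Fin 3) :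
    HasLocWeakPD k f (pd k f) := by
  refine .of_differentiable (hf.differentiable (by simp)) fun R => ?_
  have hc : Continuous (pd k f) := (hf.continuous_fderiv (by simp)).clm_apply continuous_const
  obtain ⟨C, hC⟩ := (isCompact_closedBall (0 : E3) R).exists_bound_of_continuousOn hc.continuousOn
  exact ⟨C, fun x hx => hC x (by simpa using hx)⟩

/-- The product rule. -/
theorem HasLocWeakPD.mul {k : Fin 3} {f f' g g' : E3 → ℝ} (hf : HasLocWeakPD k f f')
    (hg : HasWeakPD k g g') (h1 : MemLp (fun x => f x * g x) 2 volume)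
    (h2 : MemLp (fun x => f' x * g x + f x * g' x) 2 volume) :
    HasWeakPD k (fun x => f x * g x) (fun x => f' x * g x + f x * g' x) where
  left := h1
  right := h2
  weak η hη := by
    -- The test function is attached to f: then both ηf and g are in L² with their derivatives, and
    -- the integration by parts in H¹ applies although f itself need not be in L².
    have e1 := (hf η hη).integral_mul hg
    have i1 : Integrable (fun x => η x * (f' x * g x + f x * g' x)) volume :=
      (hη.memLp 2).integrable_mul h2
    have i2 : Integrable (fun x => pd k η x * (f x * g x)) volume :=
      ((hη.pd k).memLp 2).integrable_mul h1
    have i3 : Integrable (fun x => η x * f x * g' x) volume :=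
      (hf η hη).left.integrable_mul hg.right
    have e2 : ∫ x, (pd k η x * f x + η x * f' x) * g x = (∫ x, pd k η x * (f x * g x))
        + ((∫ x, η x * (f' x * g x + f x * g' x)) - ∫ x, η x * f x * g' x) := by
      rw [← integral_sub i1 i3, ← integral_add i2]
      · exact integral_congr_ae (Eventually.of_forall fun x => by simp only []; ring)
      · exact i1.sub i3
    rw [e2] at e1
    linarith

/-! ### The Sobolev inequality -/

theorem eLpNorm_ofReal (f : E3 → ℝ) (p : ℝ≥0∞) :
    eLpNorm (fun x => (f x : ℂ)) p volume = eLpNorm f p volume :=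
  eLpNorm_congr_norm_ae (Eventually.of_forall fun x => by simp)

/-- The Gagliardo–Nirenberg–Sobolev inequality for compact support, with 1/6 = 1/2 - 1/3, is applied
to χₙζ. The bound is uniform in n, and Fatou's lemma in L⁶ removes the cut-off. -/
theorem exists_sobolev_schwartz : ∃ K : NNReal, ∀ ζ : 𝓢(E3, ℂ),
    eLpNorm ζ 6 volume ≤ K * (eLpNorm ζ 2 volume
      + ∑ k, eLpNorm (LineDeriv.lineDerivOp (e k) ζ : 𝓢(E3, ℂ)) 2 volume) := by
  obtain ⟨χ, C, hC, hχ, hχ1, hχd, hχt, hχt'⟩ := exists_cutoff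
  let K₀ := eLpNormLESNormFDerivOfEqInnerConst (volume : Measure E3) ((2 : NNReal) : ℝ)
  refine ⟨K₀ * (3 * C.toNNReal + 1), fun ζ => ?_⟩
  have hle : ∀ n, eLpNorm (fun x => χ n x • ζ x) 6 volume ≤ K₀ * (3 * C.toNNReal + 1)
      * (eLpNorm ζ 2 volume
      + ∑ k, eLpNorm (LineDeriv.lineDerivOp (e k) ζ : 𝓢(E3, ℂ)) 2 volume) := by
    intro n
    have h1 := eLpNorm_le_eLpNorm_fderiv_of_eq_inner (μ := (volume : Measure E3))
      (u := fun x => χ n x • ζ x) (p := 2) (p' := 6)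
      (((hχ n).smooth.smul (ζ.smooth ⊤)).of_le (by simp)) (hχ n).compact.smul_right
      (by norm_num) (by simp) (by simp; norm_num)
    refine h1.trans ?_
    rw [mul_assoc]
    refine mul_le_mul_right ?_ _
    have h2 : ∀ x, ‖fderiv ℝ (fun x => χ n x • ζ x) x‖
        ≤ ‖3 * C * ‖ζ x‖ + ∑ k, ‖(LineDeriv.lineDerivOp (e k) ζ : 𝓢(E3, ℂ)) x‖‖ := by
      intro x
      rw [Real.norm_of_nonneg (by positivity)]
      refine (norm_fderiv_le_sum_pd _ x).trans ?_
      have h3 : ∀ k, ‖pd k (fun x => χ n x • ζ x) x‖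
          ≤ C * ‖ζ x‖ + ‖(LineDeriv.lineDerivOp (e k) ζ : 𝓢(E3, ℂ)) x‖ := by
        intro k
        simp only [pd]
        rw [fderiv_fun_smul ((hχ n).differentiable x) ζ.differentiableAt,
          SchwartzMap.lineDerivOp_apply_eq_fderiv]
        simp only [_root_.add_apply, _root_.smul_apply, ContinuousLinearMap.smulRight_apply]
        rw [add_comm]
        refine (norm_add_le _ _).trans (add_le_add ?_ ?_)
        · rw [norm_smul]
          exact mul_le_mul_of_nonneg_right (hχd n k x) (norm_nonneg _)
        · rw [norm_smul]
          exact mul_le_of_le_one_left (norm_nonneg _) (hχ1 n x)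
      refine (Finset.sum_le_sum fun k _ => h3 k).trans ?_
      rw [Finset.sum_add_distrib]
      simp
      linarith
    refine (eLpNorm_mono h2).trans ?_
    have h4 : (fun x => 3 * C * ‖ζ x‖ + ∑ k, ‖(LineDeriv.lineDerivOp (e k) ζ : 𝓢(E3, ℂ)) x‖)
        = (3 * C) • (fun x => ‖ζ x‖)
          + ∑ k, fun x => ‖(LineDeriv.lineDerivOp (e k) ζ : 𝓢(E3, ℂ)) x‖ := by
      funext x
      simp [Finset.sum_apply]
    rw [h4]
    refine (eLpNorm_add_le ((ζ.continuous.norm.aestronglyMeasurable).const_smul _)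
      (Finset.aestronglyMeasurable_sum _ fun k _ =>
        (SchwartzMap.continuous _).norm.aestronglyMeasurable) (by norm_num)).trans ?_
    have h5 := eLpNorm_sum_le (f := fun k => fun x =>
      ‖(LineDeriv.lineDerivOp (e k) ζ : 𝓢(E3, ℂ)) x‖) (s := Finset.univ) (p := 2)
      (μ := (volume : Measure E3)) (fun k _ =>
        (SchwartzMap.continuous _).norm.aestronglyMeasurable) (by norm_num)
    simp only [eLpNorm_norm] at h5
    rw [eLpNorm_const_smul, eLpNorm_norm]
    have h6 : ‖3 * C‖ₑ = 3 * (C.toNNReal : ℝ≥0∞) := by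
      rw [Real.enorm_of_nonneg (by positivity), ENNReal.ofReal_mul (by norm_num)]
      simp [ENNReal.ofReal]
    rw [h6, mul_add]
    refine add_le_add (mul_le_mul_left (by simp) _) (h5.trans ?_)
    exact le_mul_of_one_le_left (by simp) (by simp)
  have hlim := Lp.eLpNorm_lim_le_liminf_eLpNorm (p := 6) (μ := (volume : Measure E3))
    (f := fun n x => χ n x • ζ x)
    (fun n => ((hχ n).smooth.continuous.smul ζ.continuous).aestronglyMeasurable) ζ
    (Eventually.of_forall fun x => by
      refine tendsto_const_nhds.congr' ?_
      filter_upwards [hχt x] with n hn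
      rw [hn, one_smul])
  refine hlim.trans ?_
  refine (liminf_le_of_frequently_le' (Eventually.of_forall hle).frequently).trans ?_
  push_cast
  exact le_rfl

/-- The symbol of (1 - Δ)^(1/2), up to constants, is dominated by those of the identity and the
first derivatives. It puts the weighted transform of an H¹ function in L². -/
theorem norm_sqrt_mul_le (ξ : E3) (z : ℂ) : ‖(((1 + ‖ξ‖ ^ 2) ^ (1 / 2 : ℝ) : ℝ) : ℂ) * z‖
    ≤ ‖z‖ + ∑ k, ‖2 * Real.pi * Complex.I * (ξ k : ℂ) * z‖ := by
  have h1 : (1 + ‖ξ‖ ^ 2) ^ (1 / 2 : ℝ) ≤ 1 + ∑ k, |ξ k| := by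
    rw [← Real.sqrt_eq_rpow, EuclideanSpace.real_norm_sq_eq]
    apply Real.sqrt_le_iff.2
    refine ⟨by positivity, ?_⟩
    simp only [Fin.sum_univ_three]
    have := abs_nonneg (ξ 0)
    have := abs_nonneg (ξ 1)
    have := abs_nonneg (ξ 2)
    rw [← sq_abs (ξ 0), ← sq_abs (ξ 1), ← sq_abs (ξ 2)]
    nlinarith [mul_nonneg (abs_nonneg (ξ 0)) (abs_nonneg (ξ 1)),
      mul_nonneg (abs_nonneg (ξ 0)) (abs_nonneg (ξ 2)),
      mul_nonneg (abs_nonneg (ξ 1)) (abs_nonneg (ξ 2))]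
  rw [norm_mul, Complex.norm_real, Real.norm_of_nonneg (by positivity)]
  refine (mul_le_mul_of_nonneg_right h1 (norm_nonneg z)).trans ?_
  rw [add_mul, one_mul, Finset.sum_mul]
  refine add_le_add le_rfl (Finset.sum_le_sum fun k _ => ?_)
  simp only [norm_mul, Complex.norm_I, Complex.norm_real, Complex.norm_ofNat, mul_one,
    Real.norm_eq_abs, abs_of_pos Real.pi_pos]
  rw [mul_assoc]
  refine le_mul_of_one_le_left (by positivity) ?_
  linarith [Real.pi_gt_three]

/-- Density is arranged on the Fourier side. If J = (1 + |ξ|²)^(1/2), then J f̂ is in L² and is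
approximated there by Schwartz functions ψₙ. The inverse transforms ζₙ of ψₙ/J are Schwartz
functions that tend to f in L², and the H¹ norm of ζₙ is controlled by the L² norm of ψₙ. The
inequality for ζₙ passes to f by Fatou's lemma along an almost everywhere convergent subsequence. -/
theorem exists_sobolev_six : ∃ K : NNReal, ∀ (f : E3 → ℝ) (g : Fin 3 → E3 → ℝ),
    (∀ k, HasWeakPD k f (g k)) →
    eLpNorm f 6 volume ≤ K * (eLpNorm f 2 volume + ∑ k, eLpNorm (g k) 2 volume) := by
  obtain ⟨K, hK⟩ := exists_sobolev_schwartz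
  refine ⟨K * (1 + 3 * (2 * Real.pi).toNNReal), fun f g hfg => ?_⟩
  have hf := (hfg 0).left
  let J : E3 → ℝ := fun ξ => (1 + ‖ξ‖ ^ 2) ^ (1 / 2 : ℝ)
  let Ji : E3 → ℂ := fun ξ => (((1 + ‖ξ‖ ^ 2) ^ (-(1 / 2) : ℝ) : ℝ) : ℂ)
  have hJi : Ji.HasTemperateGrowth := by fun_prop
  have hJJ : ∀ ξ z, Ji ξ * ((J ξ : ℂ) * z) = z := fun ξ z => by
    simp only [Ji, J]
    rw [← mul_assoc, ← Complex.ofReal_mul, ← Real.rpow_add (by positivity)]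
    simp
  have hJi1 : ∀ ξ, ‖Ji ξ‖ ≤ 1 := fun ξ => by
    simp only [Ji]
    rw [Complex.norm_real, Real.norm_of_nonneg (by positivity)]
    exact Real.rpow_le_one_of_one_le_of_nonpos (by simp) (by norm_num)
  have hJk : ∀ (ξ : E3) (k : Fin 3), ‖(ξ k : ℂ) * Ji ξ‖ ≤ 1 := fun ξ k => by
    simp only [Ji]
    rw [← Complex.ofReal_mul, Complex.norm_real, norm_mul,
      Real.norm_of_nonneg (r := (1 + ‖ξ‖ ^ 2) ^ (-(1 / 2) : ℝ)) (by positivity),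
      Real.rpow_neg (by positivity), ← Real.sqrt_eq_rpow]
    rw [← div_eq_mul_inv, div_le_one (by positivity)]
    refine (PiLp.norm_apply_le ξ k).trans (Real.le_sqrt_of_sq_le (by linarith))
  have hae : ∀ᵐ ξ : E3, ∀ k, hat (g k) ξ = 2 * Real.pi * Complex.I * (ξ k : ℂ) * hat f ξ :=
    ae_all_iff.2 fun k => (hfg k).hat_eq
  have hψm : MemLp (fun ξ => (J ξ : ℂ) * hat f ξ) 2 volume := by
    have : MemLp (fun ξ => ‖hat f ξ‖ + ∑ k, ‖hat (g k) ξ‖) 2 volume :=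
      (Lp.memLp (hat f)).norm.add (memLp_finsetSum _ fun k _ => (Lp.memLp (hat (g k))).norm)
    refine this.of_le ?_ ?_
    · exact (Continuous.aestronglyMeasurable (by
        refine Complex.continuous_ofReal.comp (Continuous.rpow_const (by fun_prop) ?_)
        intro x; left; positivity)).mul (Lp.aestronglyMeasurable _)
    · filter_upwards [hae] with ξ hξ
      rw [Real.norm_of_nonneg (by positivity)]
      simp only [hξ]
      exact norm_sqrt_mul_le ξ _
  have hψn : eLpNorm (fun ξ => (J ξ : ℂ) * hat f ξ) 2 volume
      ≤ eLpNorm f 2 volume + ∑ k, eLpNorm (g k) 2 volume := by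
    have h1 : eLpNorm (fun ξ => (J ξ : ℂ) * hat f ξ) 2 volume
        ≤ eLpNorm ((fun ξ => ‖hat f ξ‖) + ∑ k, fun ξ => ‖hat (g k) ξ‖) 2 volume := by
      refine eLpNorm_mono_ae ?_
      filter_upwards [hae] with ξ hξ
      simp only [Pi.add_apply, Finset.sum_apply]
      rw [Real.norm_of_nonneg (by positivity)]
      simp only [hξ]
      exact norm_sqrt_mul_le ξ _
    have hm : ∀ k ∈ Finset.univ, AEStronglyMeasurable (fun ξ => ‖hat (g k) ξ‖) volume :=
      fun k _ => (Lp.aestronglyMeasurable (hat (g k))).norm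
    refine h1.trans ((eLpNorm_add_le (Lp.aestronglyMeasurable _).norm
      (Finset.aestronglyMeasurable_sum _ hm) (by norm_num)).trans ?_)
    have hn : ∀ u : E3 → ℝ, MemLp u 2 volume → eLpNorm (fun ξ => ‖hat u ξ‖) 2 volume
        = eLpNorm u 2 volume := by
      intro u hu
      rw [eLpNorm_norm, ← ENNReal.toReal_eq_toReal_iff' (Lp.memLp (hat u)).2.ne hu.2.ne,
        ← norm_hat hu, Lp.norm_def]
    refine add_le_add (hn f hf).le ((eLpNorm_sum_le hm (by norm_num)).trans ?_)
    exact Finset.sum_le_sum fun k _ => (hn (g k) (hfg k).right).le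
  obtain ⟨u, hu⟩ := mem_closure_iff_seq_limit.1
    ((SchwartzMap.denseRange_toLpCLM (E := E3) (F := ℂ) (p := 2) (μ := volume)
      ENNReal.ofNat_ne_top).closure_eq ▸ mem_univ hψm.toLp)
  obtain ⟨hu, hulim⟩ := hu
  choose ψ hψ using hu
  have hψlim : Tendsto (fun n => (ψ n).toLp 2 volume) atTop (𝓝 hψm.toLp) := by
    refine hulim.congr fun n => ?_
    rw [← hψ n]
    rfl
  let θ : ℕ → 𝓢(E3, ℂ) := fun n => SchwartzMap.smulLeftCLM ℂ Ji (ψ n)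
  have hθ : ∀ n ξ, θ n ξ = Ji ξ * ψ n ξ := fun n ξ => by
    simp only [θ]
    rw [SchwartzMap.smulLeftCLM_apply_apply hJi, smul_eq_mul]
  let ζ : ℕ → 𝓢(E3, ℂ) := fun n => 𝓕⁻ (θ n)
  have hζ : ∀ n, 𝓕 (ζ n) = θ n := fun n => FourierTransform.fourier_fourierInv_eq _
  have hθlim : Tendsto (fun n => (θ n).toLp 2 volume) atTop (𝓝 (hat f)) := by
    rw [tendsto_iff_norm_sub_tendsto_zero] at hψlim ⊢
    refine squeeze_zero (fun n => norm_nonneg _) (fun n => ?_) hψlim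
    refine Lp.norm_le_norm_of_ae_le ?_
    filter_upwards [Lp.coeFn_sub ((θ n).toLp 2 volume) (hat f),
      Lp.coeFn_sub ((ψ n).toLp 2 volume) hψm.toLp, SchwartzMap.coeFn_toLp (θ n) 2 volume,
      SchwartzMap.coeFn_toLp (ψ n) 2 volume, hψm.coeFn_toLp] with ξ h1 h2 h3 h4 h5
    rw [h1, h2, Pi.sub_apply, Pi.sub_apply, h3, h4, h5, hθ]
    calc ‖Ji ξ * ψ n ξ - hat f ξ‖ = ‖Ji ξ * (ψ n ξ - J ξ * hat f ξ)‖ := by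
          rw [mul_sub, hJJ]
      _ ≤ _ := by
          rw [norm_mul]
          exact mul_le_of_le_one_left (norm_nonneg _) (hJi1 ξ)
  have hζlim : Tendsto (fun n => (ζ n).toLp 2 volume) atTop
      (𝓝 ((memLp_ofReal hf).toLp (fun x => (f x : ℂ)))) := by
    have h1 := (ContinuousFourierInv.continuous_fourierInv.tendsto (hat f)).comp hθlim
    rw [hat_of_memLp hf, FourierTransform.fourierInv_fourier_eq] at h1
    refine h1.congr fun n => ?_
    simp only [Function.comp_apply, ζ]
    rw [SchwartzMap.toLp_fourierInv_eq]
  obtain ⟨ns, hns, hnsae⟩ := (tendstoInMeasure_of_tendsto_Lp hζlim).exists_seq_tendsto_ae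
  have hbound : ∀ n, eLpNorm (ζ n) 6 volume
      ≤ K * ((1 + 3 * (2 * Real.pi).toNNReal) * eLpNorm (ψ n) 2 volume) := by
    intro n
    refine (hK (ζ n)).trans (mul_le_mul_right ?_ _)
    have hpl : ∀ v : 𝓢(E3, ℂ), eLpNorm v 2 volume = eLpNorm (𝓕 v : 𝓢(E3, ℂ)) 2 volume := by
      intro v
      have := SchwartzMap.norm_fourier_toL2_eq v
      rw [SchwartzMap.norm_toLp, SchwartzMap.norm_toLp,
        ENNReal.toReal_eq_toReal_iff' (SchwartzMap.memLp _ _ _).2.ne (SchwartzMap.memLp _ _ _).2.ne]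
        at this
      exact this.symm
    rw [add_mul, one_mul]
    refine add_le_add ?_ ?_
    · rw [hpl, hζ]
      refine eLpNorm_mono fun ξ => ?_
      rw [hθ, norm_mul]
      exact mul_le_of_le_one_left (norm_nonneg _) (hJi1 ξ)
    · have h3 : ∀ k, eLpNorm (LineDeriv.lineDerivOp (e k) (ζ n) : 𝓢(E3, ℂ)) 2 volume
          ≤ (2 * Real.pi).toNNReal * eLpNorm (ψ n) 2 volume := by
        intro k
        rw [hpl]
        have h4 : eLpNorm ((2 * Real.pi) • (ψ n : E3 → ℂ)) 2 volume
            = (2 * Real.pi).toNNReal * eLpNorm (ψ n) 2 volume := by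
          rw [eLpNorm_const_smul, Real.enorm_of_nonneg (by positivity)]
          rfl
        rw [← h4]
        refine eLpNorm_mono fun ξ => ?_
        rw [fourier_pd_apply, hζ, hθ, Pi.smul_apply, norm_smul, ← mul_assoc,
          mul_assoc (2 * Real.pi * Complex.I : ℂ), norm_mul, norm_mul]
        have h5 : ‖(2 * Real.pi * Complex.I : ℂ)‖ = ‖2 * Real.pi‖ := by simp
        rw [h5]
        refine mul_le_mul_of_nonneg_right ?_ (norm_nonneg _)
        exact mul_le_of_le_one_right (norm_nonneg _) (hJk ξ k)
      refine (Finset.sum_le_sum fun k _ => h3 k).trans ?_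
      simp [mul_assoc]
  have hlim := Lp.eLpNorm_lim_le_liminf_eLpNorm (p := 6) (μ := (volume : Measure E3))
    (f := fun n => (ζ (ns n)).toLp 2 volume) (fun n => Lp.aestronglyMeasurable _) _ hnsae
  have h7 : eLpNorm ((memLp_ofReal hf).toLp (fun x => (f x : ℂ))) 6 volume
      = eLpNorm f 6 volume := by
    rw [eLpNorm_congr_ae (memLp_ofReal hf).coeFn_toLp, eLpNorm_ofReal]
  rw [h7] at hlim
  refine hlim.trans ?_
  have hψe : Tendsto (fun n => eLpNorm (ψ (ns n)) 2 volume) atTop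
      (𝓝 (eLpNorm (fun ξ => (J ξ : ℂ) * hat f ξ) 2 volume)) := by
    have h8 := (continuous_enorm.tendsto _).comp (hψlim.comp hns.tendsto_atTop)
    rw [Lp.enorm_toLp] at h8
    refine h8.congr fun n => ?_
    simp only [Function.comp_apply]
    rw [SchwartzMap.toLp, Lp.enorm_toLp]
  have hlim2 : Tendsto (fun n => (K : ℝ≥0∞) * ((1 + 3 * (2 * Real.pi).toNNReal)
      * eLpNorm (ψ (ns n)) 2 volume)) atTop (𝓝 (K * ((1 + 3 * (2 * Real.pi).toNNReal)
      * eLpNorm (fun ξ => (J ξ : ℂ) * hat f ξ) 2 volume))) := by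
    refine ENNReal.Tendsto.const_mul (ENNReal.Tendsto.const_mul hψe (Or.inr ?_))
      (Or.inr ENNReal.coe_ne_top)
    exact ENNReal.add_ne_top.2 ⟨ENNReal.one_ne_top,
      ENNReal.mul_ne_top (by simp) ENNReal.coe_ne_top⟩
  have h9 : liminf (fun n => eLpNorm ((ζ (ns n)).toLp 2 volume) 6 volume) atTop
      ≤ K * ((1 + 3 * (2 * Real.pi).toNNReal)
      * eLpNorm (fun ξ => (J ξ : ℂ) * hat f ξ) 2 volume) := by
    rw [← hlim2.liminf_eq]
    refine liminf_le_liminf (Eventually.of_forall fun n => ?_)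
    rw [eLpNorm_congr_ae (SchwartzMap.coeFn_toLp (ζ (ns n)) 2 volume)]
    exact hbound _
  refine h9.trans ?_
  push_cast
  rw [mul_assoc]
  gcongr

/-- `‖f‖₄ ≤ ‖f‖₂^{1/4} ‖f‖₆^{3/4}`. -/
theorem eLpNorm_four_le {F : Type*} [NormedAddCommGroup F] {f : E3 → F}
    (hf : AEStronglyMeasurable f volume) :
    eLpNorm f 4 volume ≤ eLpNorm f 2 volume ^ (1 / 4 : ℝ) * eLpNorm f 6 volume ^ (3 / 4 : ℝ) := by
  -- Hölder with 1/8 + 1/8 = 1/4 for |f|^(1/4) and |f|^(3/4): the L⁸ norm of the first sees f in L²,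
  -- that of the second sees f in L⁶.
  have h1 := eLpNorm_smul_le_mul_eLpNorm (p := 8) (q := 8) (r := 4) (μ := (volume : Measure E3))
    (f := fun x => ‖f x‖ ^ (3 / 4 : ℝ)) (φ := fun x => ‖f x‖ ^ (1 / 4 : ℝ))
    (hf.norm.aemeasurable.pow_const _).aestronglyMeasurable
    (hf.norm.aemeasurable.pow_const _).aestronglyMeasurable (hpqr := ⟨by
      rw [← two_mul, ← div_eq_mul_inv]
      rw [ENNReal.div_eq_inv_mul, show (8 : ℝ≥0∞) = 4 * 2 by norm_num,
        ENNReal.mul_inv (by simp) (by simp), mul_assoc, ENNReal.inv_mul_cancel (by simp) (by simp),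
        mul_one]⟩)
  rw [eLpNorm_norm_rpow f (by norm_num), eLpNorm_norm_rpow f (by norm_num)] at h1
  have h2 : ((fun x => ‖f x‖ ^ (1 / 4 : ℝ)) • fun x => ‖f x‖ ^ (3 / 4 : ℝ)) = fun x => ‖f x‖ := by
    funext x
    simp only [Pi.smul_apply', smul_eq_mul]
    rw [← Real.rpow_add' (norm_nonneg _) (by norm_num)]
    norm_num
  rw [h2, eLpNorm_norm] at h1
  have h3 : (8 : ℝ≥0∞) * ENNReal.ofReal (1 / 4) = 2 := by
    rw [show (8 : ℝ≥0∞) = ENNReal.ofReal 8 by simp, ← ENNReal.ofReal_mul (by norm_num)]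
    norm_num
  have h4 : (8 : ℝ≥0∞) * ENNReal.ofReal (3 / 4) = 6 := by
    rw [show (8 : ℝ≥0∞) = ENNReal.ofReal 8 by simp, ← ENNReal.ofReal_mul (by norm_num)]
    norm_num
  rwa [h3, h4] at h1

/-! ### Fourier inversion for integrable transforms -/

theorem conj_fourier_ofReal (ψ : 𝓢(E3, ℂ)) (hψ : ∀ x, conj (ψ x) = ψ x) (ξ : E3) :
    conj ((𝓕 ψ : 𝓢(E3, ℂ)) ξ) = 𝓕⁻ (ψ : E3 → ℂ) ξ := by
  rw [SchwartzMap.fourier_coe, Real.fourier_eq, Real.fourierInv_eq, ← integral_conj]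
  refine integral_congr_ae (Eventually.of_forall fun x => ?_)
  simp only [Circle.smul_def, smul_eq_mul, map_mul, hψ]
  congr 1
  rw [← Circle.coe_inv_eq_conj, ← AddChar.map_neg_eq_inv, neg_neg]

theorem integral_fourierInv_mul {f g : E3 → ℂ} (hf : Integrable f volume)
    (hg : Integrable g volume) : ∫ ξ, 𝓕⁻ f ξ * g ξ = ∫ x, f x * 𝓕⁻ g x := by
  have h := VectorFourier.integral_fourierIntegral_smul_eq_flip (e := Real.fourierChar)
    (μ := (volume : Measure E3)) (ν := (volume : Measure E3)) (L := -innerₗ E3) (f := f) (g := g)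
    Real.continuous_fourierChar (by simp; fun_prop) hf hg
  have h1 : ∀ (u : E3 → ℂ) (ξ : E3),
      VectorFourier.fourierIntegral Real.fourierChar volume (-innerₗ E3) u ξ = 𝓕⁻ u ξ := by
    intro u ξ
    rw [Real.fourierInv_eq, VectorFourier.fourierIntegral]
    simp
  have h2 : (-innerₗ E3).flip = -innerₗ E3 := by
    ext x y
    simp [real_inner_comm]
  simp only [h2, h1, smul_eq_mul] at h
  exact h

/-- The inverse transform on L² is defined by extension, so it is compared with the integral by
duality: against a real test function, Plancherel for the one and the multiplication formula for the
other give the same value. -/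
theorem fourierInv_toLp_ae_eq (w : Lp ℂ 2 (volume : Measure E3)) (hw : Integrable w volume) :
    (𝓕⁻ w : Lp ℂ 2 (volume : Measure E3)) =ᵐ[volume] 𝓕⁻ (w : E3 → ℂ) := by
  have hcont : Continuous (𝓕⁻ (w : E3 → ℂ)) := by
    have := VectorFourier.fourierIntegral_continuous (e := Real.fourierChar)
      (μ := (volume : Measure E3)) (L := -innerₗ E3) Real.continuous_fourierChar
      (by simp; fun_prop) hw
    convert this using 1
    funext ξ
    rw [Real.fourierInv_eq, VectorFourier.fourierIntegral]
    simp
  refine ae_eq_of_integral_contDiff_smul_eq ((Lp.memLp _).locallyIntegrable (by norm_num))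
    hcont.locallyIntegrable fun g hg hgc => ?_
  let ψ : 𝓢(E3, ℂ) := HasCompactSupport.toSchwartzMap (f := fun x => (g x : ℂ))
    (hgc.comp_left (g := fun r : ℝ => (r : ℂ)) (by simp)) (Complex.ofRealCLM.contDiff.comp hg)
  have hψ : ∀ x, ψ x = (g x : ℂ) := fun x => rfl
  have h1 := Lp.inner_fourier_eq (ψ.toLp 2) (𝓕⁻ w)
  rw [FourierTransform.fourier_fourierInv_eq, SchwartzMap.toLp_fourier_eq, L2.inner_def,
    L2.inner_def] at h1
  have h2 : ∫ x, g x • (𝓕⁻ w : Lp ℂ 2 (volume : Measure E3)) x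
      = ∫ x, inner ℂ (ψ.toLp 2 volume x) ((𝓕⁻ w : Lp ℂ 2 (volume : Measure E3)) x) := by
    refine integral_congr_ae ?_
    filter_upwards [SchwartzMap.coeFn_toLp ψ 2 volume] with x hx
    rw [hx, RCLike.inner_apply, hψ]
    simp [mul_comm]
  rw [h2, ← h1]
  have h3 : ∫ ξ, inner ℂ ((𝓕 ψ : 𝓢(E3, ℂ)).toLp 2 volume ξ) (w ξ)
      = ∫ ξ, 𝓕⁻ (ψ : E3 → ℂ) ξ * w ξ := by
    refine integral_congr_ae ?_
    filter_upwards [SchwartzMap.coeFn_toLp (𝓕 ψ : 𝓢(E3, ℂ)) 2 volume] with x hx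
    rw [hx, RCLike.inner_apply, conj_fourier_ofReal ψ (fun x => by simp [hψ]), mul_comm]
  rw [h3, integral_fourierInv_mul ψ.integrable hw]
  refine integral_congr_ae (Eventually.of_forall fun x => ?_)
  simp [hψ]

theorem fourierInv_hat {f : E3 → ℝ} (hf : MemLp f 2 volume) :
    (𝓕⁻ (hat f) : Lp ℂ 2 (volume : Measure E3)) =ᵐ[volume] fun x => (f x : ℂ) := by
  rw [hat_of_memLp hf, FourierTransform.fourierInv_fourier_eq]
  exact (memLp_ofReal hf).coeFn_toLp

/-- Functions in `H²(ℝ³)` are bounded and vanish at infinity. -/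
theorem bounded_and_vanishing_of_hat {f : E3 → ℝ} (hf : MemLp f 2 volume)
    (h2 : MemLp (fun ξ => ((‖ξ‖ ^ 2 : ℝ) : ℂ) * hat f ξ) 2 volume) :
    (∃ C : ℝ, ∀ᵐ x : E3, |f x| ≤ C) ∧
    ∀ ε : ℝ, 0 < ε → ∃ R : ℝ, ∀ᵐ x : E3, R ≤ ‖x‖ → |f x| ≤ ε := by
  have h3 : MemLp (fun ξ => ((1 + ‖ξ‖ ^ 2 : ℝ) : ℂ) * hat f ξ) 2 volume := by
    refine ((Lp.memLp (hat f)).add h2).ae_eq (Eventually.of_forall fun ξ => ?_)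
    simp only [Pi.add_apply]
    push_cast
    ring
  -- In three dimensions (1 + |ξ|²)⁻¹ is square integrable, since 4 > 3. By Cauchy–Schwarz the
  -- transform of f is then integrable.
  have h4 : MemLp (fun ξ : E3 => (((1 + ‖ξ‖ ^ 2)⁻¹ : ℝ) : ℂ)) 2 volume := by
    refine memLp_ofReal ?_
    rw [memLp_two_iff_integrable_sq]
    · have := integrable_rpow_neg_one_add_norm_sq (E := E3) (μ := volume) (r := 4)
        (by simp; norm_num)
      refine this.congr (Eventually.of_forall fun x => ?_)
      simp only
      rw [show (-4 / 2 : ℝ) = -2 by norm_num, Real.rpow_neg (by positivity), inv_pow]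
      norm_cast
    · exact (Continuous.inv₀ (by fun_prop) (fun x => by positivity)).aestronglyMeasurable
  have hint : Integrable (hat f) volume := by
    refine (h4.integrable_mul h3).congr (Eventually.of_forall fun ξ => ?_)
    simp only [Pi.mul_apply]
    rw [← mul_assoc, ← Complex.ofReal_mul, inv_mul_cancel₀ (by positivity)]
    simp
  have hae : ∀ᵐ x : E3, (f x : ℂ) = 𝓕⁻ (hat f : E3 → ℂ) x := by
    filter_upwards [fourierInv_hat hf, fourierInv_toLp_ae_eq (hat f) hint] with x h1 h2
    rw [← h1, h2]
  have hn : ∀ x : E3, (f x : ℂ) = 𝓕⁻ (hat f : E3 → ℂ) x → |f x| = ‖𝓕⁻ (hat f : E3 → ℂ) x‖ :=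
    fun x hx => by rw [← hx, Complex.norm_real, Real.norm_eq_abs]
  constructor
  · refine ⟨∫ ξ, ‖hat f ξ‖, ?_⟩
    filter_upwards [hae] with x hx
    rw [hn x hx, Real.fourierInv_eq]
    refine (norm_integral_le_integral_norm _).trans (le_of_eq ?_)
    exact integral_congr_ae (Eventually.of_forall fun ξ => by simp)
  · intro ε hε
    -- The Riemann–Lebesgue lemma; it is stated with the opposite sign in the exponent, hence the
    -- evaluation at -x below.
    have h5 := (tendsto_integral_exp_inner_smul_cocompact (V := E3) (hat f : E3 → ℂ)).norm
    rw [norm_zero] at h5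
    have h6 := (h5.eventually_lt_const hε)
    rw [← Metric.cobounded_eq_cocompact, ← comap_norm_atTop, eventually_comap] at h6
    obtain ⟨R, hR⟩ := eventually_atTop.1 h6
    refine ⟨R, ?_⟩
    filter_upwards [hae] with x hx hxR
    rw [hn x hx]
    have h7 := hR ‖-x‖ (by rwa [norm_neg]) (-x) rfl
    rw [Real.fourierInv_eq]
    simpa using h7.le

/-! ### Components of vector fields -/

theorem inner_eq_sum (x y : E3) : ⟪x, y⟫ = ∑ a, x a * y a := by
  simp [PiLp.inner_apply, mul_comm]

theorem smul_e_apply (c : ℝ) (a b : Fin 3) : (c • e a : E3) b = if b = a then c else 0 := by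
  simp [e]

theorem sum_smul_e (x : E3) : ∑ a, x a • e a = x := by
  ext j
  fin_cases j <;> simp [e, Fin.sum_univ_three]

theorem norm_le_sum_abs (x : E3) : ‖x‖ ≤ ∑ a, |x a| := by
  conv_lhs => rw [← sum_smul_e x]
  refine (norm_sum_le _ _).trans (Finset.sum_le_sum fun a _ => ?_)
  rw [norm_smul, norm_e, mul_one, Real.norm_eq_abs]

theorem abs_apply_le (x : E3) (a : Fin 3) : |x a| ≤ ‖x‖ := PiLp.norm_apply_le x a

theorem memLp_apply {f : E3 → E3} {p : ℝ≥0∞} (hf : MemLp f p volume) (a : Fin 3) :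
    MemLp (fun x => f x a) p volume :=
  (EuclideanSpace.proj (𝕜 := ℝ) a : E3 →L[ℝ] ℝ).comp_memLp' hf

theorem memLp_smul_e {f : E3 → ℝ} {p : ℝ≥0∞} (hf : MemLp f p volume) (a : Fin 3) :
    MemLp (fun x => f x • e a) p volume :=
  (ContinuousLinearMap.toSpanSingleton ℝ (e a)).comp_memLp' hf

theorem memLp_of_apply {f : E3 → E3} {p : ℝ≥0∞} (hf : ∀ a, MemLp (fun x => f x a) p volume) :
    MemLp f p volume := by
  have h : MemLp (fun x => ∑ a, f x a • e a) p volume :=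
    memLp_finsetSum _ fun a _ => memLp_smul_e (hf a) a
  simpa only [sum_smul_e] using h

theorem eLpNorm_apply_le (f : E3 → E3) (p : ℝ≥0∞) (a : Fin 3) :
    eLpNorm (fun x => f x a) p volume ≤ eLpNorm f p volume :=
  eLpNorm_mono fun x => abs_apply_le (f x) a

theorem eLpNorm_le_sum_apply {f : E3 → E3} (hf : AEStronglyMeasurable f volume) {p : ℝ≥0∞}
    (hp : 1 ≤ p) : eLpNorm f p volume ≤ ∑ a, eLpNorm (fun x => f x a) p volume := by
  have hm : ∀ a, AEStronglyMeasurable (fun x => f x a) volume := fun a =>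
    (EuclideanSpace.proj (𝕜 := ℝ) a : E3 →L[ℝ] ℝ).continuous.comp_aestronglyMeasurable hf
  have h1 : eLpNorm f p volume ≤ eLpNorm (∑ a, fun x => |f x a|) p volume := by
    refine eLpNorm_mono fun x => ?_
    simp only [Finset.sum_apply]
    rw [Real.norm_of_nonneg (by positivity)]
    exact norm_le_sum_abs _
  refine h1.trans ((eLpNorm_sum_le (fun a _ => (hm a).norm) hp).trans
    (Finset.sum_le_sum fun a _ => ?_))
  exact (eLpNorm_norm (f := fun x => f x a)).le

theorem integral_apply {f : E3 → E3} (hf : Integrable f volume) (a : Fin 3) :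
    (∫ x, f x) a = ∫ x, f x a :=
  ((EuclideanSpace.proj (𝕜 := ℝ) a : E3 →L[ℝ] ℝ).integral_comp_comm hf).symm

theorem gradient_apply (η : E3 → ℝ) (x : E3) (a : Fin 3) :
    (gradient η x) a = pd a η x := by
  have h1 : ⟪gradient η x, e a⟫ = fderiv ℝ η x (e a) :=
    InnerProductSpace.toDual_symm_apply
  rw [pd, ← h1, e, EuclideanSpace.inner_single_right]
  simp

/-- The vector field `η eₐ`, for a test function `η`. -/
def testVec {η : E3 → ℝ} (hη : IsTest η) (a : Fin 3) : L2 :=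
  (memLp_smul_e (hη.memLp 2) a).toLp (fun x => η x • e a)

theorem inner_testVec {η : E3 → ℝ} (hη : IsTest η) (a : Fin 3) (f : L2) :
    ⟪testVec hη a, f⟫ = ∫ x, η x * f x a := by
  rw [L2.inner_def]
  refine integral_congr_ae ?_
  filter_upwards [(memLp_smul_e (hη.memLp 2) a).coeFn_toLp] with x hx
  rw [testVec, hx, inner_eq_sum, Finset.sum_eq_single a]
  · rw [smul_e_apply, if_pos rfl]
  · intro b _ hb
    rw [smul_e_apply, if_neg hb, zero_mul]
  · simp

theorem isWeakPartial_iff {i : Fin 3} {f g : L2} : IsWeakPartial i f g ↔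
    ∀ a, HasWeakPD i (fun x => f x a) (fun x => g x a) := by
  have hc : ∀ (η : E3 → ℝ) (_ : IsTest η) (u : L2) (a : Fin 3),
      (∫ x, η x • u x) a = ∫ x, η x * u x a := fun η hη u a =>
    integral_apply (hη.integrable_smul u) a
  constructor
  · intro h a
    refine ⟨memLp_apply (Lp.memLp f) a, memLp_apply (Lp.memLp g) a, fun η hη => ?_⟩
    rw [← hc _ (hη.pd i), ← hc _ hη, h η hη]
    rfl
  · intro h η hη
    ext a
    rw [hc _ (hη.pd i), (h a).weak η hη, ← hc _ hη]
    rfl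

theorem pd_comm {F : Type*} [NormedAddCommGroup F] [NormedSpace ℝ F] {η : E3 → F}
    (hη : ContDiff ℝ ∞ η) (i j : Fin 3) : pd i (pd j η) = pd j (pd i η) := by
  funext x
  have hd : DifferentiableAt ℝ (fderiv ℝ η) x :=
    (hη.fderiv_right (m := ∞) (by simp)).differentiable (by simp) x
  have hs := (hη.contDiffAt (x := x)).isSymmSndFDerivAt (by
    rw [minSmoothness_of_isRCLikeNormedField]
    exact WithTop.coe_le_coe.2 le_top)
  have hh : ∀ k l, pd k (pd l η) x = fderiv ℝ (fderiv ℝ η) x (e k) (e l) := by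
    intro k l
    change fderiv ℝ (fun y => fderiv ℝ η y (e l)) x (e k) = _
    rw [fderiv_clm_apply hd (by fun_prop)]
    simp
  rw [hh, hh]
  exact hs.eq _ _

/-! ### The Helmholtz–Leray projection on the Fourier side -/

theorem mem_solenoidal_iff {f : L2} :
    f ∈ solenoidal ↔ IsWeakDiv (fun a x => f x a) (fun _ => 0) := by
  have key : ∀ (η : E3 → ℝ) (hη : IsTest η) (u : L2), (u : E3 → E3) =ᵐ[volume] gradient η →
      ⟪u, f⟫ = ∑ a, ∫ x, pd a η x * f x a := by
    intro η hη u hu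
    rw [L2.inner_def, ← integral_finsetSum _ fun a _ =>
      integrable_mul_of_memLp ((hη.pd a).memLp 2) (memLp_apply (Lp.memLp f) a)]
    refine integral_congr_ae ?_
    filter_upwards [hu] with x hx
    rw [hx, inner_eq_sum]
    simp only [gradient_apply η]
  constructor
  · intro h η hη
    have hm : MemLp (gradient η) 2 volume := memLp_of_apply fun a => by
      simp only [gradient_apply η]
      exact (hη.pd a).memLp 2
    have h1 := key η hη hm.toLp hm.coeFn_toLp
    rw [← h1]
    simp only [mul_zero, integral_zero, neg_zero]
    exact (Submodule.mem_orthogonal _ _).1 h _ (Submodule.subset_span ⟨η, hη, hm.coeFn_toLp⟩)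
  · intro h
    refine (Submodule.mem_orthogonal _ _).2 fun u hu => ?_
    induction hu using Submodule.span_induction with
    | mem u hu =>
      obtain ⟨η, hη, hu⟩ := hu
      rw [key η hη u hu, h η hη]
      simp
    | zero => exact inner_zero_left _
    | add u w _ _ h1 h2 => rw [inner_add_left, h1, h2, add_zero]
    | smul c u _ h1 => rw [inner_smul_left, h1, mul_zero]

theorem hat_zero_fun : hat (fun _ => 0) = 0 := by
  simpa using hat_const_mul (f := fun _ => 0) 0 MemLp.zero

theorem hat_solenoidal {s : L2} (hs : s ∈ solenoidal) :
    ∀ᵐ ξ : E3, ∑ a, (ξ a : ℂ) * hat (fun x => s x a) ξ = 0 := by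
  filter_upwards [(mem_solenoidal_iff.1 hs).hat_eq (fun a => memLp_apply (Lp.memLp s) a)
    MemLp.zero, Lp.coeFn_zero ℂ 2 (volume : Measure E3)] with ξ h h0
  rw [hat_zero_fun, h0] at h
  simp only [mul_assoc, ← Finset.mul_sum] at h
  have h2 : (2 * (Real.pi * (Complex.I * ∑ a, (ξ a : ℂ) * hat (fun x => s x a) ξ))) = 0 := h.symm
  simpa [Real.pi_ne_zero, Complex.I_ne_zero] using h2

/-- The fields ∂ⱼη eᵢ - ∂ᵢη eⱼ are divergence-free because second derivatives commute. A field
orthogonal to all of them has vanishing weak curl. The curl is encoded as the divergence of a field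
with entries gᵢ and -gⱼ, so that the Fourier rule for divergences applies. -/
theorem hat_gradient {g : L2} (hg : g ∈ solenoidalᗮ) (i j : Fin 3) :
    ∀ᵐ ξ : E3, (ξ i : ℂ) * hat (fun x => g x j) ξ = (ξ j : ℂ) * hat (fun x => g x i) ξ := by
  by_cases hij : i = j
  · subst hij
    exact Eventually.of_forall fun ξ => rfl
  have hcurl : IsWeakDiv (fun k x => if k = j then g x i else if k = i then -1 * g x j else 0)
      (fun _ => 0) := by
    intro η hη
    let w : L2 := testVec (hη.pd j) i - testVec (hη.pd i) j
    have hw : w ∈ solenoidal := by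
      rw [mem_solenoidal_iff]
      intro ζ hζ
      have h1 : ∀ u : E3 → ℝ, ∀ hu : IsTest u, ∀ k, ∑ a, ∫ x, pd a ζ x * (testVec hu k : L2) x a
          = ∫ x, pd k ζ x * u x := by
        intro u hu k
        have h2 : ∀ a, ∫ x, pd a ζ x * (testVec hu k : L2) x a
            = ∫ x, if a = k then pd k ζ x * u x else 0 := by
          intro a
          refine integral_congr_ae ?_
          filter_upwards [(memLp_smul_e (hu.memLp 2) k).coeFn_toLp] with x hx
          rw [testVec, hx, smul_e_apply]
          by_cases hak : a = k <;> simp [hak]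
        simp only [h2]
        rw [Finset.sum_eq_single k]
        · simp
        · intro b _ hb
          simp [hb]
        · simp
      have h3 : ∀ a, ∫ x, pd a ζ x * w x a = (∫ x, pd a ζ x * (testVec (hη.pd j) i : L2) x a)
          - ∫ x, pd a ζ x * (testVec (hη.pd i) j : L2) x a := by
        intro a
        rw [← integral_sub (integrable_mul_of_memLp ((hζ.pd a).memLp 2)
          (memLp_apply (Lp.memLp _) a)) (integrable_mul_of_memLp ((hζ.pd a).memLp 2)
          (memLp_apply (Lp.memLp _) a))]
        refine integral_congr_ae ?_
        filter_upwards [Lp.coeFn_sub (testVec (hη.pd j) i) (testVec (hη.pd i) j)] with x hx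
        rw [hx]
        simp [mul_sub]
      simp only [h3]
      rw [Finset.sum_sub_distrib, h1, h1]
      have e6 := (hζ.hasWeakPD i).integral_mul ((hη.pd j).hasWeakPD i)
      have e7 := (hζ.hasWeakPD j).integral_mul ((hη.pd i).hasWeakPD j)
      rw [e6, e7, pd_comm hη.smooth i j]
      simp
    have h0 := (Submodule.mem_orthogonal _ _).1 hg w hw
    rw [inner_sub_left, inner_testVec, inner_testVec] at h0
    rw [Finset.sum_eq_add (f := fun k => ∫ x, pd k η x *
      (if k = j then g x i else if k = i then -1 * g x j else 0)) i j hij]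
    · simp only [if_neg hij, if_true, mul_zero, integral_zero, neg_zero, neg_mul, one_mul, mul_neg,
        integral_neg]
      linarith
    · intro c _ hc
      simp [hc.1, hc.2]
    · simp
    · simp
  have hm : ∀ k, MemLp (fun x => if k = j then g x i else if k = i then -1 * g x j else 0) 2
      volume := by
    intro k
    split_ifs
    · exact memLp_apply (Lp.memLp g) i
    · exact (memLp_apply (Lp.memLp g) j).const_mul _
    · exact MemLp.zero
  have hneg : hat (fun x => -1 * g x j) = (-1 : ℂ) • hat (fun x => g x j) := by
    have := hat_const_mul (-1) (memLp_apply (Lp.memLp g) j)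
    simpa using this
  filter_upwards [hcurl.hat_eq hm MemLp.zero, Lp.coeFn_zero ℂ 2 (volume : Measure E3),
    Lp.coeFn_smul (-1 : ℂ) (hat (fun x => g x j))] with ξ h h0 h1
  rw [hat_zero_fun, h0, Finset.sum_eq_add (f := fun k : Fin 3 => 2 * Real.pi * Complex.I * (ξ k : ℂ)
      * hat (fun x => if k = j then g x i else if k = i then -1 * g x j else 0) ξ) i j hij] at h
  · simp only [if_neg hij, if_true] at h
    rw [hneg, h1] at h
    have h2 : (2 * (Real.pi * (Complex.I * ((ξ j : ℂ) * hat (fun x => g x i) ξ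
        - (ξ i : ℂ) * hat (fun x => g x j) ξ)))) = (0 : ℂ) := by
      simp only [Pi.smul_apply, Pi.zero_apply, smul_eq_mul] at h
      linear_combination -h
    simp only [mul_eq_zero, OfNat.ofNat_ne_zero, Complex.ofReal_eq_zero, Real.pi_ne_zero,
      Complex.I_ne_zero, false_or] at h2
    exact (sub_eq_zero.1 h2).symm
  · intro c _ hc
    simp [hc.1, hc.2, hat_zero_fun]
  · simp
  · simp

theorem norm_sq_eq_sum_complex (ξ : E3) : ((‖ξ‖ ^ 2 : ℝ) : ℂ) = ∑ j, (ξ j : ℂ) * (ξ j : ℂ) := by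
  rw [EuclideanSpace.real_norm_sq_eq]
  push_cast
  exact Finset.sum_congr rfl fun j _ => by ring

theorem hat_coeFn_sub_apply (f g : L2) (a : Fin 3) :
    hat (fun x => (f - g : L2) x a) = hat (fun x => f x a) - hat (fun x => g x a) := by
  rw [← hat_sub (memLp_apply (Lp.memLp f) a) (memLp_apply (Lp.memLp g) a)]
  refine hat_congr ?_
  filter_upwards [Lp.coeFn_sub f g] with x hx
  rw [hx]
  rfl

theorem sub_starProjection_mem (f : L2) : f - solenoidal.starProjection f ∈ solenoidalᗮ :=
  Submodule.sub_starProjection_mem_orthogonal f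

/-- The Fourier symbol of the gradient part of the Helmholtz decomposition. -/
theorem hat_gradientPart (f : L2) (i : Fin 3) : ∀ᵐ ξ : E3, ((‖ξ‖ ^ 2 : ℝ) : ℂ)
    * hat (fun x => (f - solenoidal.starProjection f : L2) x i) ξ
      = (ξ i : ℂ) * ∑ j, (ξ j : ℂ) * hat (fun x => f x j) ξ := by
  have hg := sub_starProjection_mem f
  set g := f - solenoidal.starProjection f with hgdef
  have h1 : ∀ᵐ ξ : E3, ∀ j, (ξ i : ℂ) * hat (fun x => g x j) ξ
      = (ξ j : ℂ) * hat (fun x => g x i) ξ := ae_all_iff.2 fun j => hat_gradient hg i j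
  have h2 := hat_solenoidal (solenoidal.starProjection_apply_mem f)
  have h3 : ∀ᵐ ξ : E3, ∀ j, hat (fun x => g x j) ξ
      = hat (fun x => f x j) ξ - hat (fun x => (solenoidal.starProjection f) x j) ξ := by
    refine ae_all_iff.2 fun j => ?_
    rw [hgdef, hat_coeFn_sub_apply]
    exact Lp.coeFn_sub _ _
  filter_upwards [h1, h2, h3] with ξ h1 h2 h3
  -- The divergence-free part drops out after contraction with ξ. Then the curl relation moves the
  -- factor ξᵢ from ĝⱼ to ĝᵢ and produces |ξ|².
  have h4 : ∑ j, (ξ j : ℂ) * hat (fun x => f x j) ξ = ∑ j, (ξ j : ℂ) * hat (fun x => g x j) ξ := by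
    simp only [h3, mul_sub, Finset.sum_sub_distrib, h2, sub_zero]
  rw [h4, norm_sq_eq_sum_complex, Finset.sum_mul, Finset.mul_sum]
  refine Finset.sum_congr rfl fun j _ => ?_
  rw [mul_assoc, ← h1 j]
  ring

theorem ae_ne_zero : ∀ᵐ ξ : E3, ξ ≠ 0 := by
  simp [ae_iff, measure_singleton]

/-- The Helmholtz–Leray projection commutes with weak derivatives. -/
theorem IsWeakPartial.starProjection {k : Fin 3} {f f' : L2} (h : IsWeakPartial k f f') :
    IsWeakPartial k (solenoidal.starProjection f : L2) (solenoidal.starProjection f' : L2) := by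
  rw [isWeakPartial_iff] at h ⊢
  intro i
  refine .of_hat (memLp_apply (Lp.memLp _) i) (memLp_apply (Lp.memLp _) i) ?_
  have hall : ∀ᵐ ξ : E3, ∀ j, hat (fun x => f' x j) ξ
      = 2 * Real.pi * Complex.I * (ξ k : ℂ) * hat (fun x => f x j) ξ :=
    ae_all_iff.2 fun j => (h j).hat_eq
  have e1 := hat_coeFn_sub_apply f (solenoidal.starProjection f) i
  have e2 := hat_coeFn_sub_apply f' (solenoidal.starProjection f') i
  filter_upwards [hall, hat_gradientPart f i, hat_gradientPart f' i, ae_ne_zero,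
    Lp.coeFn_sub (hat (fun x => f x i)) (hat (fun x => (solenoidal.starProjection f) x i)),
    Lp.coeFn_sub (hat (fun x => f' x i)) (hat (fun x => (solenoidal.starProjection f') x i))]
    with ξ h1 h2 h3 h0 h4 h5
  rw [e1, h4, Pi.sub_apply] at h2
  rw [e2, h5, Pi.sub_apply] at h3
  have hn : ((‖ξ‖ ^ 2 : ℝ) : ℂ) ≠ 0 := by
    rw [Complex.ofReal_ne_zero]
    positivity
  apply mul_left_cancel₀ hn
  have h6 : ∑ j, (ξ j : ℂ) * hat (fun x => f' x j) ξ
      = 2 * Real.pi * Complex.I * (ξ k : ℂ) * ∑ j, (ξ j : ℂ) * hat (fun x => f x j) ξ := by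
    rw [Finset.mul_sum]
    exact Finset.sum_congr rfl fun j _ => by rw [h1 j]; ring
  rw [h6, h1 i] at h3
  linear_combination (2 * Real.pi * Complex.I * (ξ k : ℂ)) * h2 - h3

theorem leray_of_memLp {f : E3 → E3} (h : MemLp f 2 volume) :
    leray f = solenoidal.starProjection (h.toLp f) := dif_pos h

/-! ### The pressure -/

/-- The pressure is constructed as an inverse Fourier transform. Tested against real functions, only
its real part is seen, so it need not be shown to be real-valued. -/
theorem integral_mul_re_fourierInv {u : E3 → ℝ} (hu : MemLp u 2 volume)
    (w : Lp ℂ 2 (volume : Measure E3)) :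
    ∫ x, u x * ((𝓕⁻ w : Lp ℂ 2 (volume : Measure E3)) x).re = (∫ ξ, conj (hat u ξ) * w ξ).re := by
  have h1 := Lp.inner_fourier_eq ((memLp_ofReal hu).toLp (fun x => (u x : ℂ))) (𝓕⁻ w)
  rw [FourierTransform.fourier_fourierInv_eq, ← hat_of_memLp hu, L2.inner_def, L2.inner_def] at h1
  have h2 : ∫ ξ, conj (hat u ξ) * w ξ = ∫ ξ, inner ℂ (hat u ξ) (w ξ) :=
    integral_congr_ae (Eventually.of_forall fun ξ => by simp [mul_comm])
  rw [h2, h1]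
  have hi : Integrable (fun x => inner ℂ ((memLp_ofReal hu).toLp (fun x => (u x : ℂ)) x)
      ((𝓕⁻ w : Lp ℂ 2 (volume : Measure E3)) x)) volume := L2.integrable_inner _ _
  have h3 := (Complex.reCLM.integral_comp_comm hi)
  rw [Complex.reCLM_apply] at h3
  rw [← h3]
  refine integral_congr_ae ?_
  filter_upwards [(memLp_ofReal hu).coeFn_toLp] with x hx
  rw [hx, RCLike.inner_apply]
  simp [mul_comm]

/-- If `f ∈ L²` is the divergence of a tensor field in `L²`, then the gradient part of its Helmholtz
decomposition is the gradient of a function in `L²`. -/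
theorem exists_pressure (f : L2) (T : Fin 3 → Fin 3 → E3 → ℝ) (hT : ∀ i j, MemLp (T i j) 2 volume)
    (hf : ∀ i, IsWeakDiv (T i) (fun x => f x i)) : ∃ P : E3 → ℝ,
    ∀ i, HasWeakPD i P (fun x => (f - solenoidal.starProjection f : L2) x i) := by
  -- The symbols ξᵢξⱼ/|ξ|² are bounded by 1, so P̂ = ∑ (ξᵢξⱼ/|ξ|²) T̂ᵢⱼ is in L². Here f̂ᵢ = 2πi ∑
  -- ξⱼ T̂ᵢⱼ, so no inverse power of |ξ| is left over.
  have hq : MemLp (fun ξ : E3 => ∑ i, ∑ j, (((ξ i * ξ j / ‖ξ‖ ^ 2 : ℝ)) : ℂ) * hat (T i j) ξ) 2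
      volume := by
    refine memLp_finsetSum _ fun i _ => memLp_finsetSum _ fun j _ => ?_
    refine (Lp.memLp (hat (T i j))).of_le ?_ (Eventually.of_forall fun ξ => ?_)
    · refine AEStronglyMeasurable.mul ?_ (Lp.aestronglyMeasurable _)
      refine (Measurable.aestronglyMeasurable ?_)
      exact Complex.measurable_ofReal.comp (by fun_prop)
    · rw [norm_mul]
      refine mul_le_of_le_one_left (norm_nonneg _) ?_
      rw [Complex.norm_real, norm_div, norm_mul, norm_pow, norm_norm]
      refine div_le_one_of_le₀ ?_ (by positivity)
      rw [sq]
      exact mul_le_mul (PiLp.norm_apply_le ξ i) (PiLp.norm_apply_le ξ j) (norm_nonneg _)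
        (norm_nonneg _)
  refine ⟨fun x => ((𝓕⁻ hq.toLp : Lp ℂ 2 (volume : Measure E3)) x).re, fun i =>
    ⟨(Lp.memLp (𝓕⁻ hq.toLp : Lp ℂ 2 (volume : Measure E3))).re, memLp_apply (Lp.memLp _) i, ?_⟩⟩
  intro η hη
  rw [integral_mul_re_fourierInv ((hη.pd i).memLp 2)]
  have h1 := integral_mul_eq_hat (hη.memLp 2)
    (memLp_apply (Lp.memLp (f - solenoidal.starProjection f)) i)
  have hall : ∀ᵐ ξ : E3, ∀ j, hat (fun x => f x j) ξ
      = ∑ k, 2 * Real.pi * Complex.I * (ξ k : ℂ) * hat (T j k) ξ :=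
    ae_all_iff.2 fun j => (hf j).hat_eq (hT j) (memLp_apply (Lp.memLp f) j)
  have h2 : ∫ ξ, conj (hat (pd i η) ξ) * hq.toLp (fun ξ : E3 => ∑ i, ∑ j,
        (((ξ i * ξ j / ‖ξ‖ ^ 2 : ℝ)) : ℂ) * hat (T i j) ξ) ξ
      = - ∫ ξ, conj (hat η ξ) * hat (fun x => (f - solenoidal.starProjection f : L2) x i) ξ := by
    rw [← integral_neg]
    refine integral_congr_ae ?_
    filter_upwards [hall, hat_gradientPart f i, (hη.hasWeakPD i).hat_eq, hq.coeFn_toLp, ae_ne_zero]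
      with ξ h3 h4 h5 h6 h0
    have hn : ((‖ξ‖ ^ 2 : ℝ) : ℂ) ≠ 0 := by
      rw [Complex.ofReal_ne_zero]
      positivity
    have h7 : hat (fun x => (f - solenoidal.starProjection f : L2) x i) ξ = 2 * Real.pi * Complex.I
        * (ξ i : ℂ) * ∑ i, ∑ j, (((ξ i * ξ j / ‖ξ‖ ^ 2 : ℝ)) : ℂ) * hat (T i j) ξ := by
      apply mul_left_cancel₀ hn
      rw [h4]
      simp only [h3, Finset.mul_sum]
      refine Finset.sum_congr rfl fun j _ => Finset.sum_congr rfl fun k _ => ?_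
      rw [Complex.ofReal_div, Complex.ofReal_mul]
      field_simp
    rw [h5, h6, h7]
    simp only [map_mul, Complex.conj_ofReal, Complex.conj_I, map_ofNat]
    ring
  rw [h2, ← h1, Complex.neg_re, Complex.ofReal_re]

/-! ### The spaces `𝒱` and `𝒟` -/

theorem V.toL2_add (v w : V) : (v + w).toL2 = v.toL2 + w.toL2 := rfl
theorem V.toL2_sub (v w : V) : (v - w).toL2 = v.toL2 - w.toL2 := rfl
theorem V.toL2_neg (v : V) : (-v).toL2 = -v.toL2 := rfl
theorem V.toL2_smul (c : ℝ) (v : V) : (c • v).toL2 = c • v.toL2 := rfl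

theorem V.norm_eq (v : V) : ‖v‖ = max ‖v.1.1‖ ‖v.1.2‖ := rfl

theorem V.norm_toL2_le (v : V) : ‖v.toL2‖ ≤ ‖v‖ := le_max_left _ _

theorem V.toL2_injective : Function.Injective V.toL2 := by
  intro v w h
  refine Subtype.ext (Prod.ext h ?_)
  refine Lp.ext ?_
  have h' : v.1.1 = w.1.1 := h
  exact v.2.2.symm.trans ((by rw [h'] : (v.1.1 : E3 → E3) =ᵐ[volume] w.1.1).trans w.2.2)

/-- The inclusion of `𝒱` in `L²` as a continuous linear map. -/
def V.toL2L : V →L[ℝ] L2 :=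
  LinearMap.mkContinuous ⟨⟨V.toL2, V.toL2_add⟩, V.toL2_smul⟩ 1 fun v => by
    simpa using v.norm_toL2_le

/-- The component `vₐ` of `v ∈ 𝒱`. -/
def V.comp (v : V) (a : Fin 3) : E3 → ℝ := fun x => v.toL2 x a

theorem V.memLp_two (v : V) (a : Fin 3) : MemLp (v.comp a) 2 volume := memLp_apply (Lp.memLp _) a

theorem V.memLp_four (v : V) (a : Fin 3) : MemLp (v.comp a) 4 volume :=
  memLp_apply ((Lp.memLp v.1.2).ae_eq v.2.2.symm) a

theorem V.eLpNorm_two_le (v : V) (a : Fin 3) :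
    eLpNorm (v.comp a) 2 volume ≤ ENNReal.ofReal ‖v‖ := by
  refine (eLpNorm_apply_le _ _ _).trans ?_
  rw [← Lp.enorm_def, ← ofReal_norm]
  exact ENNReal.ofReal_le_ofReal v.norm_toL2_le

theorem V.eLpNorm_four_le (v : V) (a : Fin 3) :
    eLpNorm (v.comp a) 4 volume ≤ ENNReal.ofReal ‖v‖ := by
  refine (eLpNorm_apply_le _ _ _).trans ?_
  rw [V.toL2, eLpNorm_congr_ae v.2.2, ← Lp.enorm_def, ← ofReal_norm]
  exact ENNReal.ofReal_le_ofReal (le_max_right _ _)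

theorem exists_sobolev_vector : ∃ K : NNReal, ∀ (s : L2) (g : Fin 3 → L2),
    (∀ k, IsWeakPartial k s (g k)) →
    eLpNorm s 6 volume ≤ K * ENNReal.ofReal (‖s‖ + ∑ k, ‖g k‖) := by
  obtain ⟨K, hK⟩ := exists_sobolev_six
  refine ⟨3 * K, fun s g h => ?_⟩
  have h1 : ∀ a, eLpNorm (fun x => s x a) 6 volume ≤ K * ENNReal.ofReal (‖s‖ + ∑ k, ‖g k‖) := by
    intro a
    refine (hK _ (fun k x => g k x a) fun k => isWeakPartial_iff.1 (h k) a).trans ?_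
    refine mul_le_mul_right ?_ _
    rw [ENNReal.ofReal_add (norm_nonneg _) (by positivity),
      ENNReal.ofReal_sum_of_nonneg fun _ _ => norm_nonneg _]
    have h2 : ∀ u : L2, eLpNorm (fun x => u x a) 2 volume ≤ ENNReal.ofReal ‖u‖ := fun u => by
      rw [ofReal_norm, Lp.enorm_def]
      exact eLpNorm_apply_le _ _ _
    exact add_le_add (h2 s) (Finset.sum_le_sum fun k _ => h2 (g k))
  refine (eLpNorm_le_sum_apply (Lp.aestronglyMeasurable s) (by norm_num)).trans ?_
  refine (Finset.sum_le_sum fun a _ => h1 a).trans ?_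
  simp [mul_assoc]

/-- Divergence-free fields in `H¹` belong to `𝒱`. -/
theorem exists_V_of_isWeakPartial {s : L2} {g : Fin 3 → L2} (hs : s ∈ solenoidal)
    (h : ∀ k, IsWeakPartial k s (g k)) : ∃ w : V, w.toL2 = s := by
  obtain ⟨K, hK⟩ := exists_sobolev_vector
  have h6 := hK s g h
  have h4 : MemLp s 4 volume := by
    refine ⟨Lp.aestronglyMeasurable s, (eLpNorm_four_le (Lp.aestronglyMeasurable s)).trans_lt ?_⟩
    refine ENNReal.mul_lt_top ?_ ?_
    · exact ENNReal.rpow_lt_top_of_nonneg (by norm_num) (Lp.memLp s).2.ne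
    · refine ENNReal.rpow_lt_top_of_nonneg (by norm_num) (h6.trans_lt ?_).ne
      exact ENNReal.mul_lt_top ENNReal.coe_lt_top ENNReal.ofReal_lt_top
  exact ⟨⟨(s, h4.toLp s), hs, h4.coeFn_toLp.symm⟩, rfl⟩

/-- The norm of `𝒱` is controlled by an interpolation between `L²` and `H¹`. -/
theorem exists_norm_V_le : ∃ K : ℝ, 0 ≤ K ∧ ∀ (w : V) (g : Fin 3 → L2),
    (∀ k, IsWeakPartial k w.toL2 (g k)) →
    ‖w‖ ≤ ‖w.toL2‖ + K * ‖w.toL2‖ ^ (1 / 4 : ℝ) * (‖w.toL2‖ + ∑ k, ‖g k‖) ^ (3 / 4 : ℝ) := by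
  obtain ⟨K, hK⟩ := exists_sobolev_vector
  refine ⟨(K : ℝ) ^ (3 / 4 : ℝ), by positivity, fun w g h => ?_⟩
  have h6 := hK w.toL2 g h
  have h4 := eLpNorm_four_le (Lp.aestronglyMeasurable w.toL2)
  have hA : 0 ≤ ‖w.toL2‖ + ∑ k, ‖g k‖ := by positivity
  have h5 : eLpNorm w.toL2 4 volume ≤ ENNReal.ofReal (‖w.toL2‖ ^ (1 / 4 : ℝ)
      * (K * (‖w.toL2‖ + ∑ k, ‖g k‖)) ^ (3 / 4 : ℝ)) := by
    refine h4.trans ?_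
    rw [ENNReal.ofReal_mul (by positivity),
      ← ENNReal.ofReal_rpow_of_nonneg (norm_nonneg _) (by norm_num),
      ← ENNReal.ofReal_rpow_of_nonneg (by positivity) (by norm_num), ofReal_norm, Lp.enorm_def]
    refine mul_le_mul_right (ENNReal.rpow_le_rpow (h6.trans ?_) (by norm_num)) _
    rw [ENNReal.ofReal_mul (by positivity)]
    simp
  have h7 : ‖w.1.2‖ ≤ ‖w.toL2‖ ^ (1 / 4 : ℝ) * (K * (‖w.toL2‖ + ∑ k, ‖g k‖)) ^ (3 / 4 : ℝ) := by
    rw [Lp.norm_def]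
    refine ENNReal.toReal_le_of_le_ofReal (by positivity) ?_
    rwa [V.toL2, eLpNorm_congr_ae w.2.2] at h5
  rw [Real.mul_rpow (by positivity) hA] at h7
  rw [V.norm_eq]
  refine max_le ?_ (h7.trans ?_)
  · exact le_add_of_nonneg_right (by positivity)
  · have : (0 : ℝ) ≤ ‖w.toL2‖ := norm_nonneg _
    nlinarith

theorem exists_norm_V_le_H1 : ∃ K : ℝ, 0 ≤ K ∧ ∀ (w : V) (g : Fin 3 → L2),
    (∀ k, IsWeakPartial k w.toL2 (g k)) → ‖w‖ ≤ K * (‖w.toL2‖ + ∑ k, ‖g k‖) := by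
  obtain ⟨K, hK0, hK⟩ := exists_norm_V_le
  refine ⟨1 + K, by positivity, fun w g h => (hK w g h).trans ?_⟩
  have hA : 0 ≤ ‖w.toL2‖ + ∑ k, ‖g k‖ := by positivity
  have hle : ‖w.toL2‖ ≤ ‖w.toL2‖ + ∑ k, ‖g k‖ := le_add_of_nonneg_right (by positivity)
  rw [add_mul, one_mul]
  refine add_le_add hle ?_
  rw [mul_assoc]
  refine mul_le_mul_of_nonneg_left ?_ hK0
  calc _ ≤ (‖w.toL2‖ + ∑ k, ‖g k‖) ^ (1 / 4 : ℝ) * (‖w.toL2‖ + ∑ k, ‖g k‖) ^ (3 / 4 : ℝ) := by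
        gcongr
    _ = _ := by
        rw [← Real.rpow_add' hA (by norm_num)]
        norm_num

/-- The projection of a field in `H¹`, as an element of `𝒱`. -/
theorem exists_leray_V : ∃ K : ℝ, 0 ≤ K ∧ ∀ (f : L2) (g : Fin 3 → L2),
    (∀ k, IsWeakPartial k f (g k)) → ∃ w : V, w.toL2 = solenoidal.starProjection f ∧
      ‖w‖ ≤ K * (‖f‖ + ∑ k, ‖g k‖) := by
  obtain ⟨K, hK0, hK⟩ := exists_norm_V_le_H1
  refine ⟨K, hK0, fun f g h => ?_⟩
  have h' := fun k => (h k).starProjection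
  obtain ⟨w, hw⟩ := exists_V_of_isWeakPartial (Submodule.starProjection_apply_mem _ f) h'
  refine ⟨w, hw, ?_⟩
  have hle : ∀ u : L2, ‖solenoidal.starProjection u‖ ≤ ‖u‖ := fun u =>
    Submodule.norm_starProjection_apply_le _ u
  have := hK w _ (by rwa [hw])
  rw [hw] at this
  refine this.trans (mul_le_mul_of_nonneg_left ?_ hK0)
  exact add_le_add (hle f) (Finset.sum_le_sum fun k _ => hle _)

instance V.completeSpace : CompleteSpace V := by
  have hcl : IsClosed (spaceV : Set (L2 × L4)) := by
    refine IsSeqClosed.isClosed fun u v hu huv => ?_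
    have h1 : Tendsto (fun n => (u n).1) atTop (𝓝 v.1) := (continuous_fst.tendsto v).comp huv
    have h2 : Tendsto (fun n => (u n).2) atTop (𝓝 v.2) := (continuous_snd.tendsto v).comp huv
    refine ⟨?_, ?_⟩
    · have hc : IsClosed (solenoidal : Set L2) := Submodule.isClosed_orthogonal _
      exact hc.mem_of_tendsto h1 (Eventually.of_forall fun n => (hu n).1)
    -- The limits in L² and in L⁴ could differ a priori. Both are limits in measure of the same
    -- sequence and therefore agree almost everywhere.
    · have m1 := tendstoInMeasure_of_tendsto_Lp h1
      have m2 := tendstoInMeasure_of_tendsto_Lp h2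
      exact tendstoInMeasure_ae_unique (m1.congr (fun n => (hu n).2) EventuallyEq.rfl) m2
  exact hcl.completeSpace_coe

theorem D.norm_toV_le (v : D) : ‖v.toV‖ ≤ ‖v‖ := norm_fst_le v.1
theorem D.norm_partial_le (v : D) (i : Fin 3) : ‖v.partial i‖ ≤ ‖v‖ :=
  (norm_le_pi_norm v.1.2.1 i).trans ((norm_fst_le v.1.2).trans (norm_snd_le v.1))
theorem D.norm_partial₂_le (v : D) (i j : Fin 3) : ‖v.partial₂ i j‖ ≤ ‖v‖ :=
  (norm_le_pi_norm (v.1.2.2.1 i) j).trans ((norm_le_pi_norm v.1.2.2.1 i).trans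
    ((norm_fst_le v.1.2.2).trans ((norm_snd_le v.1.2).trans (norm_snd_le v.1))))
theorem D.norm_radial_le (v : D) : ‖v.radial‖ ≤ ‖v‖ :=
  (norm_snd_le v.1.2.2).trans ((norm_snd_le v.1.2).trans (norm_snd_le v.1))

theorem D.hasWeakPD (v : D) (i a : Fin 3) : HasWeakPD i (v.toV.comp a) ((v.partial i).comp a) :=
  isWeakPartial_iff.1 (v.2.1 i) a

theorem D.hasWeakPD₂ (v : D) (i j a : Fin 3) :
    HasWeakPD j ((v.partial i).comp a) ((v.partial₂ i j).comp a) :=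
  isWeakPartial_iff.1 (v.2.2.1 i j) a

theorem D.radial_ae (v : D) (a : Fin 3) :
    v.radial.comp a =ᵐ[volume] fun x => ∑ i, x i * (v.partial i).comp a x := by
  filter_upwards [v.2.2.2] with x hx
  change (v.1.2.2.2.toL2 x) a = _
  rw [hx]
  simp only [WithLp.ofLp_sum, Finset.sum_apply, PiLp.smul_apply, smul_eq_mul]
  rfl

/-- A weak derivative is a family of equations between L² inner products with fixed test fields, and
each of them is a closed condition. -/
theorem isClosed_isWeakPartial (i : Fin 3) : IsClosed {p : L2 × L2 | IsWeakPartial i p.1 p.2} := by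
  have h : {p : L2 × L2 | IsWeakPartial i p.1 p.2} = ⋂ (a : Fin 3) (η : E3 → ℝ) (hη : IsTest η),
      {p : L2 × L2 | ⟪testVec (hη.pd i) a, p.1⟫ = - ⟪testVec hη a, p.2⟫} := by
    ext p
    simp only [mem_ofPred_eq, mem_iInter, inner_testVec]
    rw [isWeakPartial_iff]
    exact ⟨fun h a η hη => (h a).weak η hη, fun h a =>
      ⟨memLp_apply (Lp.memLp _) a, memLp_apply (Lp.memLp _) a, fun η hη => h a η hη⟩⟩
  rw [h]
  refine isClosed_iInter fun a => isClosed_iInter fun η => isClosed_iInter fun hη => ?_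
  exact isClosed_eq (by fun_prop) (by fun_prop)

theorem isTest_coord_mul {η : E3 → ℝ} (hη : IsTest η) (i : Fin 3) : IsTest (fun x => x i * η x) :=
  hη.mul_left (by fun_prop)

/-- Multiplication by x is unbounded on L², but the factor xᵢ can be moved to the test function,
where it does no harm. The relation thus becomes a family of closed conditions. -/
theorem isClosed_radial : IsClosed {p : L2 × (Fin 3 → L2) |
    (p.1 : E3 → E3) =ᵐ[volume] fun x => ∑ i, x i • p.2 i x} := by
  have h : {p : L2 × (Fin 3 → L2) | (p.1 : E3 → E3) =ᵐ[volume] fun x => ∑ i, x i • p.2 i x}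
      = ⋂ (a : Fin 3) (η : E3 → ℝ) (hη : IsTest η), {p : L2 × (Fin 3 → L2) |
        ⟪testVec hη a, p.1⟫ = ∑ i, ⟪testVec (isTest_coord_mul hη i) a, p.2 i⟫} := by
    ext p
    simp only [mem_ofPred_eq, mem_iInter, inner_testVec]
    have hsum : ∀ x (a : Fin 3), (∑ i, x i • p.2 i x) a = ∑ i, x i * p.2 i x a := fun x a => by
      simp [WithLp.ofLp_sum, Finset.sum_apply]
    have hint : ∀ (η : E3 → ℝ), IsTest η → ∀ a,
        ∑ i, ∫ x, x i * η x * p.2 i x a = ∫ x, η x * (∑ i, x i • p.2 i x) a := by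
      intro η hη a
      rw [← integral_finsetSum _ fun i _ => integrable_mul_of_memLp
        ((isTest_coord_mul hη i).memLp 2) (memLp_apply (Lp.memLp (p.2 i)) a)]
      refine integral_congr_ae (Eventually.of_forall fun x => ?_)
      simp only [hsum, Finset.mul_sum]
      exact Finset.sum_congr rfl fun i _ => by ring
    constructor
    · intro h a η hη
      rw [hint η hη a]
      refine integral_congr_ae ?_
      filter_upwards [h] with x hx
      rw [hx]
    · intro h
      have h1 : ∀ a, ∀ᵐ x, p.1 x a = (∑ i, x i • p.2 i x) a := by
        intro a
        refine ae_eq_of_integral_contDiff_smul_eq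
          ((memLp_apply (Lp.memLp p.1) a).locallyIntegrable (by norm_num)) ?_ fun η h1 h2 => ?_
        · simp only [hsum]
          refine locallyIntegrable_finsetSum _ fun i _ => ?_
          have := (memLp_apply (Lp.memLp (p.2 i)) a).locallyIntegrable (by norm_num)
          rw [← locallyIntegrableOn_univ] at this ⊢
          exact this.continuousOn_mul (by fun_prop) isOpen_univ.isLocallyClosed
        · simp only [smul_eq_mul]
          rw [h a η ⟨h1, h2⟩, hint η ⟨h1, h2⟩ a]
      filter_upwards [ae_all_iff.2 h1] with x hx
      ext a
      exact hx a
  rw [h]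
  refine isClosed_iInter fun a => isClosed_iInter fun η => isClosed_iInter fun hη => ?_
  exact isClosed_eq (by fun_prop) (by fun_prop)

instance D.completeSpace : CompleteSpace D := by
  have hcl : IsClosed (spaceD : Set (V × (Fin 3 → V) × (Fin 3 → Fin 3 → V) × V)) := by
    have h : (spaceD : Set (V × (Fin 3 → V) × (Fin 3 → Fin 3 → V) × V)) =
        (⋂ i, {v | IsWeakPartial i (V.toL2L v.1) (V.toL2L (v.2.1 i))}) ∩
        ((⋂ i, ⋂ j, {v | IsWeakPartial j (V.toL2L (v.2.1 i)) (V.toL2L (v.2.2.1 i j))}) ∩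
        {v | (V.toL2L v.2.2.2 : E3 → E3) =ᵐ[volume] fun x => ∑ i, x i • V.toL2L (v.2.1 i) x}) := by
      ext v
      simp only [mem_inter_iff, mem_iInter, mem_ofPred_eq]
      exact Iff.rfl
    rw [h]
    refine (isClosed_iInter fun i => ?_).inter ((isClosed_iInter fun i => isClosed_iInter fun j =>
      ?_).inter ?_)
    · exact (isClosed_isWeakPartial i).preimage (f := fun v : V × (Fin 3 → V) ×
        (Fin 3 → Fin 3 → V) × V => (V.toL2L v.1, V.toL2L (v.2.1 i))) (by fun_prop)
    · exact (isClosed_isWeakPartial j).preimage (f := fun v : V × (Fin 3 → V) ×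
        (Fin 3 → Fin 3 → V) × V => (V.toL2L (v.2.1 i), V.toL2L (v.2.2.1 i j))) (by fun_prop)
    · exact isClosed_radial.preimage (f := fun v : V × (Fin 3 → V) ×
        (Fin 3 → Fin 3 → V) × V => (V.toL2L v.2.2.2, fun i => V.toL2L (v.2.1 i))) (by fun_prop)
  exact hcl.completeSpace_coe

/-! ### Convolution with kernels of Gaussian decay -/

/-- The Gaussian majorant `exp (-|z|² / 16)`. -/
def gmaj (z : E3) : ℝ := Real.exp (-‖z‖ ^ 2 / 16)

theorem gmaj_pos (z : E3) : 0 < gmaj z := Real.exp_pos _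

theorem gmaj_le_one (z : E3) : gmaj z ≤ 1 :=
    Real.exp_le_one_iff.2 (by have := sq_nonneg ‖z‖; linarith)

theorem integrable_gmaj : Integrable gmaj := by
  have h := GaussianFourier.integrable_cexp_neg_mul_sq_norm_add (V := E3) (b := 1 / 16)
    (by norm_num) 0 0
  refine h.norm.congr (ae_of_all _ fun z => ?_)
  simp only [gmaj, Complex.norm_exp]
  congr 1
  simp [← Complex.ofReal_pow]
  norm_num [← Complex.ofReal_pow]
  simp [pow_two]
  ring

theorem continuous_gmaj : Continuous gmaj := by unfold gmaj; fun_prop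

/-- Half of the Gaussian exponent pays for the polynomial factor: (1 + r)⁴ ≤ 8(1 + r⁴), and r⁴ ≤ 128
exp(r²/8) from the quadratic term of the exponential series, whence 8 + 8 · 128 = 1032. The fourth
power covers two derivatives of the heat kernel and a weight of order two. -/
theorem one_add_pow_four_mul_exp_le (r : ℝ) :
    (1 + r) ^ 4 * Real.exp (-r ^ 2 / 4) ≤ 1032 * Real.exp (-r ^ 2 / 8) := by
  have h1 := Real.pow_div_factorial_le_exp (r ^ 2 / 8) (by positivity) 2
  have h2 : (1 + r) ^ 4 ≤ 8 * (1 + r ^ 4) := by 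
    nlinarith [sq_nonneg (r - 1), sq_nonneg (r ^ 2 - 1), sq_nonneg (r ^ 2 - r)]
  have h3 : 1 ≤ Real.exp (r ^ 2 / 8) := Real.one_le_exp (by positivity)
  have h4 : (1 + r) ^ 4 ≤ 1032 * Real.exp (r ^ 2 / 8) := by
    norm_num [Nat.factorial] at h1
    nlinarith
  calc (1 + r) ^ 4 * Real.exp (-r ^ 2 / 4)
      ≤ 1032 * Real.exp (r ^ 2 / 8) * Real.exp (-r ^ 2 / 4) := by gcongr
    _ = 1032 * Real.exp (-r ^ 2 / 8) := by rw [mul_assoc, ← Real.exp_add]; congr 2; ring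

/-- From |x₀ - y|² ≤ 2|x - y|² + 2. Losing half of the exponent gives a bound that does not depend
on x in the unit ball about x₀, as is needed to differentiate under the integral. -/
theorem exp_le_gmaj_of_close {x x₀ y : E3} (h : ‖x - x₀‖ ≤ 1) :
    Real.exp (-‖x - y‖ ^ 2 / 8) ≤ 2 * gmaj (x₀ - y) := by
  have h1 : ‖x₀ - y‖ ≤ ‖x - y‖ + 1 := by
    calc ‖x₀ - y‖ = ‖(x - y) - (x - x₀)‖ := by congr 1; abel
      _ ≤ _ := (norm_sub_le _ _).trans (by gcongr)
  have h2 : ‖x₀ - y‖ ^ 2 ≤ 2 * ‖x - y‖ ^ 2 + 2 := by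
    nlinarith [sq_nonneg (‖x - y‖ - 1), norm_nonneg (x₀ - y), norm_nonneg (x - y)]
  have h3 : Real.exp (1 / 8) ≤ 2 := by
    have := Real.exp_one_lt_d9
    have h : Real.exp (1 / 8) ^ 8 = Real.exp 1 := by rw [← Real.exp_nat_mul]; norm_num
    by_contra! hc
    have : (2 : ℝ) ^ 8 < Real.exp (1 / 8) ^ 8 := pow_lt_pow_left₀ hc (by norm_num) (by norm_num)
    norm_num at this
    linarith
  calc Real.exp (-‖x - y‖ ^ 2 / 8) ≤ Real.exp (1 / 8 + -‖x₀ - y‖ ^ 2 / 16) := by gcongr; linarith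
    _ ≤ 2 * gmaj (x₀ - y) := by rw [Real.exp_add, gmaj]; gcongr

/-- The convolution of a scalar kernel with a field. -/
def kconv {F : Type*} [NormedAddCommGroup F] [NormedSpace ℝ F] (K : E3 → ℝ) (b : E3 → F) (x : E3) :
    F := ∫ y, K (x - y) • b y

/-- A field that is measurable and bounded by a constant plus an integrable function. -/
structure HasMajorant {F : Type*} [NormedAddCommGroup F] (b : E3 → F) (g : E3 → ℝ) : Prop where
  meas : AEStronglyMeasurable b volume
  int : Integrable g volume
  nonneg : ∀ y, 0 ≤ g y
  le : ∀ᵐ y : E3, ‖b y‖ ≤ 1 + g y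

/-- A continuous kernel with Gaussian decay. -/
structure HasGaussBound {G : Type*} [NormedAddCommGroup G] (K : E3 → G) (C : ℝ) : Prop where
  cont : Continuous K
  nonneg : 0 ≤ C
  le : ∀ z, ‖K z‖ ≤ C * Real.exp (-‖z‖ ^ 2 / 8)

theorem exp_le_gmaj (z : E3) : Real.exp (-‖z‖ ^ 2 / 8) ≤ gmaj z := by
  have := sq_nonneg ‖z‖
  exact Real.exp_le_exp.2 (by linarith)

theorem integrable_gmaj_mul {g : E3 → ℝ} (hg : Integrable g volume) (x : E3) :
    Integrable (fun y => gmaj (x - y) * (1 + g y)) volume := by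
  have h1 : Integrable (fun y => gmaj (x - y)) volume := integrable_gmaj.comp_sub_left x
  have h2 : Integrable (fun y => gmaj (x - y) * g y) volume :=
    hg.bdd_mul (c := 1) (continuous_gmaj.comp (by fun_prop)).aestronglyMeasurable
      (ae_of_all _ fun y => by
        rw [Real.norm_of_nonneg (gmaj_pos _).le]; exact gmaj_le_one _)
  refine (h1.add h2).congr (ae_of_all _ fun y => ?_)
  simp only [Pi.add_apply]
  ring

theorem integral_gmaj_mul_le {g : E3 → ℝ} (hg : Integrable g volume) (hg0 : ∀ y, 0 ≤ g y) (x : E3) :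
    ∫ y, gmaj (x - y) * (1 + g y) ≤ (∫ z, gmaj z) + ∫ y, g y := by
  have h1 : Integrable (fun y => gmaj (x - y)) volume := integrable_gmaj.comp_sub_left x
  rw [← integral_sub_left_eq_self gmaj volume x, ← integral_add h1 hg]
  refine integral_mono (integrable_gmaj_mul hg x) (h1.add hg) fun y => ?_
  have := mul_le_mul_of_nonneg_right (gmaj_le_one (x - y)) (hg0 y)
  change _ ≤ gmaj (x - y) + g y
  linarith

section Conv
variable {F : Type*} [NormedAddCommGroup F] [NormedSpace ℝ F]

theorem kconv_integrable {K : E3 → ℝ} {C : ℝ} (hK : HasGaussBound K C) {b : E3 → F}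
    {g : E3 → ℝ} (hb : HasMajorant b g) (x : E3) :
    Integrable (fun y => K (x - y) • b y) volume := by
  refine ((integrable_gmaj_mul hb.int x).const_mul C).mono'
    ((hK.cont.comp (by fun_prop)).aestronglyMeasurable.smul hb.meas) ?_
  filter_upwards [hb.le] with y hy
  rw [norm_smul, ← mul_assoc]
  have := hb.nonneg y
  exact mul_le_mul ((hK.le _).trans (mul_le_mul_of_nonneg_left (exp_le_gmaj _) hK.nonneg)) hy
    (norm_nonneg _) (mul_nonneg hK.nonneg (gmaj_pos _).le)

theorem norm_kconv_le {K : E3 → ℝ} {C : ℝ} (hK : HasGaussBound K C) {b : E3 → F}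
    {g : E3 → ℝ} (hb : HasMajorant b g) (x : E3) :
    ‖kconv K b x‖ ≤ C * ((∫ z, gmaj z) + ∫ y, g y) := by
  refine (norm_integral_le_of_norm_le ((integrable_gmaj_mul hb.int x).const_mul C) ?_).trans ?_
  · filter_upwards [hb.le] with y hy
    rw [norm_smul, ← mul_assoc]
    have := hb.nonneg y
    exact mul_le_mul ((hK.le _).trans (mul_le_mul_of_nonneg_left (exp_le_gmaj _) hK.nonneg)) hy
      (norm_nonneg _) (mul_nonneg hK.nonneg (gmaj_pos _).le)
  · rw [integral_const_mul]
    exact mul_le_mul_of_nonneg_left (integral_gmaj_mul_le hb.int hb.nonneg x) hK.nonneg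

theorem hasFDerivAt_kconv [CompleteSpace F] {K : E3 → ℝ} {K' : E3 → E3 →L[ℝ] ℝ} {C C' : ℝ}
    (hK : HasGaussBound K C) (hK' : HasGaussBound K' C') (hd : ∀ z, HasFDerivAt K (K' z) z)
    {b : E3 → F} {g : E3 → ℝ} (hb : HasMajorant b g) (x : E3) :
    HasFDerivAt (kconv K b) (∫ y, (K' (x - y)).smulRight (b y)) x := by
  refine hasFDerivAt_integral_of_dominated_of_fderiv_le (𝕜 := ℝ)
    (F := fun x y => K (x - y) • b y) (F' := fun x y => (K' (x - y)).smulRight (b y))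
    (s := Metric.ball x 1)
    (bound := fun y => C' * 2 * (gmaj (x - y) * (1 + g y))) (Metric.ball_mem_nhds x one_pos)
    (Eventually.of_forall fun z => (kconv_integrable hK hb z).aestronglyMeasurable)
    (kconv_integrable hK hb x) ?_ ?_ ((integrable_gmaj_mul hb.int x).const_mul _) ?_
  · exact (ContinuousLinearMap.smulRightL ℝ E3 F).isBoundedBilinearMap.continuous.comp_aestronglyMeasurable₂
      (hK'.cont.comp (by fun_prop)).aestronglyMeasurable hb.meas
  · filter_upwards [hb.le] with y hy z hz
    rw [ContinuousLinearMap.norm_smulRight_apply, ← mul_assoc]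
    have h1 : ‖z - x‖ ≤ 1 := (mem_ball_iff_norm.1 hz).le
    refine mul_le_mul ?_ hy (norm_nonneg _)
      (mul_nonneg (mul_nonneg hK'.nonneg zero_le_two) (gmaj_pos _).le)
    calc _ ≤ C' * Real.exp (-‖z - y‖ ^ 2 / 8) := hK'.le _
      _ ≤ C' * (2 * gmaj (x - y)) := mul_le_mul_of_nonneg_left (exp_le_gmaj_of_close h1) hK'.nonneg
      _ = _ := by ring
  · refine ae_of_all _ fun y z _ => ?_
    exact ((hd (z - y)).comp z ((hasFDerivAt_id z).sub_const y)).smul_const (b y)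

theorem pd_kconv [CompleteSpace F] {K : E3 → ℝ} {K' : E3 → E3 →L[ℝ] ℝ} {C C' : ℝ}
    (hK : HasGaussBound K C) (hK' : HasGaussBound K' C') (hd : ∀ z, HasFDerivAt K (K' z) z)
    {b : E3 → F} {g : E3 → ℝ} (hb : HasMajorant b g) (i : Fin 3) :
    pd i (kconv K b) = kconv (fun z => K' z (e i)) b := by
  ext1 x
  have h := hasFDerivAt_kconv hK hK' hd hb x
  rw [pd, h.fderiv, ContinuousLinearMap.integral_apply]
  · rfl
  · refine ((integrable_gmaj_mul hb.int x).const_mul C').mono' ?_ ?_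
    · exact (ContinuousLinearMap.smulRightL ℝ E3 F).isBoundedBilinearMap.continuous.comp_aestronglyMeasurable₂
        (hK'.cont.comp (by fun_prop)).aestronglyMeasurable hb.meas
    · filter_upwards [hb.le] with y hy
      rw [ContinuousLinearMap.norm_smulRight_apply, ← mul_assoc]
      have := hb.nonneg y
      exact mul_le_mul ((hK'.le _).trans (mul_le_mul_of_nonneg_left (exp_le_gmaj _) hK'.nonneg)) hy
        (norm_nonneg _) (mul_nonneg hK'.nonneg (gmaj_pos _).le)

/-- Decay survives the convolution because |x|^k ≤ 4((1 + |x - y|)² + |y|^k): the first summand is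
absorbed by the kernel, the second by the decay of b. -/
theorem pow_norm_mul_norm_kconv_le {k : ℕ} (hk : k ≤ 2) {K : E3 → ℝ} {C M : ℝ} (hM : 0 ≤ M)
    (hK : HasGaussBound K C) (hK2 : ∀ z, (1 + ‖z‖) ^ 2 * |K z| ≤ C * Real.exp (-‖z‖ ^ 2 / 8))
    {b : E3 → F} {g : E3 → ℝ} (hb : HasMajorant b g) (hbM : ∀ᵐ y : E3, ‖y‖ ^ k * ‖b y‖ ≤ M)
    (x : E3) : ‖x‖ ^ k * ‖kconv K b x‖
      ≤ 4 * (C * (1 + M) * ((∫ z, gmaj z) + ∫ y, g y)) := by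
  rw [← norm_norm x, ← norm_pow, ← norm_smul, kconv, ← integral_smul]
  refine (norm_integral_le_of_norm_le
    ((integrable_gmaj_mul hb.int x).const_mul (4 * (C * (1 + M)))) ?_).trans ?_
  · filter_upwards [hb.le, hbM] with y hy hyM
    have h0 := hb.nonneg y
    have hx : ‖x‖ ^ k ≤ 4 * ((1 + ‖x - y‖) ^ 2 + ‖y‖ ^ k) := by
      have h1 : ‖x‖ ≤ ‖x - y‖ + ‖y‖ := by simpa using norm_add_le (x - y) y
      have h2 : ‖x‖ ^ k ≤ (‖x - y‖ + ‖y‖) ^ k := by gcongr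
      have h3 := norm_nonneg (x - y)
      have h4 := norm_nonneg y
      interval_cases k
      · nlinarith
      · nlinarith
      · nlinarith [sq_nonneg (‖x - y‖ - ‖y‖)]
    have h5 : C * Real.exp (-‖x - y‖ ^ 2 / 8) ≤ C * gmaj (x - y) :=
      mul_le_mul_of_nonneg_left (exp_le_gmaj _) hK.nonneg
    have h6 := (hK2 (x - y)).trans h5
    have h7 := (hK.le (x - y)).trans h5
    have hC : 0 ≤ C * gmaj (x - y) := (norm_nonneg _).trans h7
    rw [norm_smul, norm_smul, norm_pow, norm_norm]
    rw [Real.norm_eq_abs] at h7 ⊢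
    calc ‖x‖ ^ k * (|K (x - y)| * ‖b y‖)
        ≤ 4 * ((1 + ‖x - y‖) ^ 2 + ‖y‖ ^ k) * (|K (x - y)| * ‖b y‖) := by gcongr
      _ = 4 * (((1 + ‖x - y‖) ^ 2 * |K (x - y)|) * ‖b y‖ + |K (x - y)| * (‖y‖ ^ k * ‖b y‖)) := by
          ring
      _ ≤ 4 * ((C * gmaj (x - y)) * (1 + g y) + (C * gmaj (x - y)) * M) := by gcongr
      _ ≤ 4 * (C * (1 + M)) * (gmaj (x - y) * (1 + g y)) := by
          have : 0 ≤ (C * gmaj (x - y)) * (M * g y) := by positivity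
          nlinarith
  · rw [integral_const_mul, mul_assoc]
    have := integral_gmaj_mul_le hb.int hb.nonneg x
    have : 0 ≤ C := hK.nonneg
    gcongr

end Conv

/-! ### The heat kernel at time one -/

/-- The heat kernel at time `1`. -/
def heatKer (z : E3) : ℝ := (4 * Real.pi) ^ (-(3 : ℝ) / 2) * Real.exp (-‖z‖ ^ 2 / 4)

/-- The derivative of the heat kernel. -/
def heatKer' (z : E3) : E3 →L[ℝ] ℝ := (-(1 / 2 : ℝ) * heatKer z) • innerSL ℝ z

/-- The derivative of `∂ᵢ` of the heat kernel. -/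
def heatKer₂ (i : Fin 3) (z : E3) : E3 →L[ℝ] ℝ :=
  (-(1 / 2 : ℝ) * heatKer z) • (EuclideanSpace.proj i : E3 →L[ℝ] ℝ) + (-(1 / 2 : ℝ) * z i) •
      heatKer' z

theorem kconv_heatKer (a : E3 → E3) : kconv heatKer a = heatExt a := rfl

theorem heatKer_nonneg (z : E3) : 0 ≤ heatKer z := by unfold heatKer; positivity

theorem heatKer_le_one_mul : ∀ z, heatKer z ≤ Real.exp (-‖z‖ ^ 2 / 4) := fun z => by
  unfold heatKer
  refine mul_le_of_le_one_left (Real.exp_pos _).le ?_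
  refine Real.rpow_le_one_of_one_le_of_nonpos ?_ (by norm_num)
  have := Real.pi_gt_three
  linarith

theorem hasFDerivAt_heatKer (z : E3) : HasFDerivAt heatKer (heatKer' z) z := by
  have h : HasFDerivAt (fun z : E3 => ‖z‖ ^ 2) (2 • innerSL ℝ z) z :=
      (hasStrictFDerivAt_norm_sq z).hasFDerivAt
  have h2 := ((h.const_mul (-(1 / 4 : ℝ))).exp.const_mul ((4 * Real.pi) ^ (-(3 : ℝ) / 2)))
  have e1 : heatKer = fun z => (4 * Real.pi) ^ (-(3 : ℝ) / 2) * Real.exp (-(1 / 4) * ‖z‖ ^ 2) := by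
    ext z; simp only [heatKer]; congr 2; ring
  have e2 : heatKer' z = (4 * Real.pi) ^ (-(3 : ℝ) / 2) •
      Real.exp (-(1 / 4) * ‖z‖ ^ 2) • (-(1 / 4 : ℝ)) • 2 • innerSL ℝ z := by
    rw [heatKer', e1]
    simp only [smul_smul, ← Nat.cast_smul_eq_nsmul ℝ]
    congr 1
    push_cast
    ring
  rw [e2, e1]
  exact h2

theorem heatKer'_apply (z : E3) (i : Fin 3) : heatKer' z (e i) = -(1 / 2 : ℝ) * z i * heatKer z := by
  simp only [heatKer', _root_.smul_apply, smul_eq_mul, innerSL_apply_apply]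
  rw [e, EuclideanSpace.inner_single_right]
  simp
  ring

theorem hasFDerivAt_heatKer' (i : Fin 3) (z : E3) :
    HasFDerivAt (fun z => heatKer' z (e i)) (heatKer₂ i z) z := by
  simp only [heatKer'_apply]
  have h1 : HasFDerivAt (fun z : E3 => z i) (EuclideanSpace.proj i : E3 →L[ℝ] ℝ) z :=
    (EuclideanSpace.proj i : E3 →L[ℝ] ℝ).hasFDerivAt
  have h2 := (h1.const_mul (-(1 / 2 : ℝ))).mul (hasFDerivAt_heatKer z)
  have e1 : heatKer₂ i z = (-(1 / 2 : ℝ) * z i) • heatKer' z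
      + heatKer z • ((-(1 / 2 : ℝ)) • (EuclideanSpace.proj i : E3 →L[ℝ] ℝ)) := by
    rw [heatKer₂, smul_smul, add_comm, mul_comm (heatKer z)]
  rw [e1]
  exact h2

theorem norm_heatKer'_le (z : E3) : ‖heatKer' z‖ ≤ ‖z‖ * heatKer z := by
  rw [heatKer', norm_smul, innerSL_apply_norm, norm_mul, Real.norm_of_nonneg (heatKer_nonneg z)]
  norm_num
  nlinarith [norm_nonneg z, heatKer_nonneg z, mul_nonneg (norm_nonneg z) (heatKer_nonneg z)]

theorem norm_heatKer₂_le (i : Fin 3) (z : E3) : ‖heatKer₂ i z‖ ≤ (1 + ‖z‖) ^ 2 * heatKer z := by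
  have h1 := norm_heatKer'_le z
  have h2 : ‖(EuclideanSpace.proj i : E3 →L[ℝ] ℝ)‖ ≤ 1 :=
    ContinuousLinearMap.opNorm_le_bound _ zero_le_one fun x => by
      simpa using PiLp.norm_apply_le x i
  have h0 := heatKer_nonneg z
  have hz := norm_nonneg z
  refine (norm_add_le _ _).trans ?_
  rw [norm_smul, norm_smul, norm_mul, norm_mul, Real.norm_of_nonneg h0]
  have h3 : ‖z i‖ ≤ ‖z‖ := PiLp.norm_apply_le z i
  have h4 : ‖-(1 / 2 : ℝ)‖ ≤ 1 := by norm_num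
  calc _ ≤ 1 * heatKer z * 1 + 1 * ‖z‖ * (‖z‖ * heatKer z) := by gcongr
    _ ≤ _ := by nlinarith [mul_nonneg hz h0]

theorem pow_mul_heatKer_le {k : ℕ} (hk : k ≤ 4) (z : E3) :
    (1 + ‖z‖) ^ k * heatKer z ≤ 1032 * Real.exp (-‖z‖ ^ 2 / 8) :=
  calc (1 + ‖z‖) ^ k * heatKer z ≤ (1 + ‖z‖) ^ 4 * Real.exp (-‖z‖ ^ 2 / 4) := by
        have := heatKer_nonneg z
        gcongr
        · linarith [norm_nonneg z]
        · exact heatKer_le_one_mul z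
    _ ≤ _ := one_add_pow_four_mul_exp_le _

theorem continuous_heatKer : Continuous heatKer := by unfold heatKer; fun_prop

theorem continuous_heatKer' : Continuous heatKer' := by
  unfold heatKer'
  exact (continuous_const.mul continuous_heatKer).smul (innerSL ℝ).continuous

theorem hasGaussBound_heatKer : HasGaussBound heatKer 1032 :=
  ⟨continuous_heatKer, by norm_num, fun z => by
    rw [Real.norm_of_nonneg (heatKer_nonneg z)]
    simpa using pow_mul_heatKer_le (k := 0) (by norm_num) z⟩

theorem hasGaussBound_heatKer' : HasGaussBound heatKer' 1032 :=
  ⟨continuous_heatKer', by norm_num, fun z => by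
    refine le_trans ?_ (pow_mul_heatKer_le (k := 1) (by norm_num) z)
    have := heatKer_nonneg z
    exact (norm_heatKer'_le z).trans (by gcongr; linarith)⟩

theorem abs_heatKer'_apply_le (i : Fin 3) (z : E3) : |heatKer' z (e i)| ≤ ‖z‖ * heatKer z :=
  ((heatKer' z).le_opNorm (e i)).trans (by rw [norm_e, mul_one]; exact norm_heatKer'_le z)

theorem hasGaussBound_heatKer'_apply (i : Fin 3) : HasGaussBound (fun z => heatKer' z (e i)) 1032 :=
  ⟨continuous_heatKer'.clm_apply continuous_const, by norm_num, fun z => by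
    refine le_trans ?_ (pow_mul_heatKer_le (k := 1) (by norm_num) z)
    have := heatKer_nonneg z
    exact (abs_heatKer'_apply_le i z).trans (by gcongr; linarith)⟩

theorem hasGaussBound_heatKer₂ (i : Fin 3) : HasGaussBound (heatKer₂ i) 1032 := by
  refine ⟨?_, by norm_num, fun z => (norm_heatKer₂_le i z).trans
      (pow_mul_heatKer_le (by norm_num) z)⟩
  unfold heatKer₂
  have := continuous_heatKer
  have := continuous_heatKer'
  fun_prop

theorem sq_mul_heatKer_le (z : E3) :
    (1 + ‖z‖) ^ 2 * |heatKer z| ≤ 1032 * Real.exp (-‖z‖ ^ 2 / 8) := by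
  rw [abs_of_nonneg (heatKer_nonneg z)]
  exact pow_mul_heatKer_le (by norm_num) z

theorem sq_mul_heatKer'_le (i : Fin 3) (z : E3) :
    (1 + ‖z‖) ^ 2 * |heatKer' z (e i)| ≤ 1032 * Real.exp (-‖z‖ ^ 2 / 8) := by
  refine le_trans ?_ (pow_mul_heatKer_le (k := 3) (by norm_num) z)
  have := heatKer_nonneg z
  calc _ ≤ (1 + ‖z‖) ^ 2 * (‖z‖ * heatKer z) := by gcongr; exact abs_heatKer'_apply_le i z
    _ ≤ (1 + ‖z‖) ^ 2 * ((1 + ‖z‖) * heatKer z) := by gcongr; linarith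
    _ = _ := by ring

theorem integral_heatKer : ∫ z, heatKer z = 1 := by
  unfold heatKer
  rw [integral_const_mul]
  have h := GaussianFourier.integral_rexp_neg_mul_sq_norm (V := E3) (b := 1 / 4) (by norm_num)
  have h2 : (fun z : E3 => Real.exp (-‖z‖ ^ 2 / 4)) = fun z => Real.exp (-(1 / 4) * ‖z‖ ^ 2) := by
    ext z; congr 1; ring
  rw [h2, h, finrank_euclideanSpace, Fintype.card_fin]
  rw [show Real.pi / (1 / 4) = 4 * Real.pi by ring, ← Real.rpow_add (by positivity)]
  norm_num

/-! ### Homogeneous fields -/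

/-- By scaling, it is enough to bound the field on the unit sphere, which is compact. -/
theorem exists_bound_of_homogeneous {F : Type*} [NormedAddCommGroup F] [NormedSpace ℝ F]
    {b : E3 → F} (hb : ContinuousOn b {0}ᶜ) (k : ℕ)
    (hs : ∀ c : ℝ, 0 < c → ∀ x : E3, x ≠ 0 → c ^ k • b (c • x) = b x) :
    ∃ M : ℝ, 0 ≤ M ∧ ∀ y ≠ 0, ‖y‖ ^ k * ‖b y‖ ≤ M := by
  have hsub : Metric.sphere (0 : E3) 1 ⊆ {0}ᶜ := fun y hy => by
    rw [mem_sphere_zero_iff_norm] at hy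
    rw [mem_compl_singleton_iff, ← norm_pos_iff, hy]
    exact one_pos
  obtain ⟨M, hM⟩ := (isCompact_sphere (0 : E3) 1).exists_bound_of_continuousOn (hb.mono hsub)
  refine ⟨max M 0, le_max_right _ _, fun y hy => ?_⟩
  have h0 : 0 < ‖y‖ := norm_pos_iff.2 hy
  rw [← hs ‖y‖⁻¹ (inv_pos.2 h0) y hy, norm_smul, norm_pow, norm_inv, norm_norm, ← mul_assoc,
    ← mul_pow, mul_inv_cancel₀ h0.ne', one_pow, one_mul]
  exact (hM _ (by rw [mem_sphere_zero_iff_norm, norm_smul, norm_inv, norm_norm,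
    inv_mul_cancel₀ h0.ne'])).trans (le_max_left _ _)

theorem aestronglyMeasurable_of_continuousOn_compl {F : Type*} [NormedAddCommGroup F]
    {b : E3 → F} (hb : ContinuousOn b {0}ᶜ) : AEStronglyMeasurable b volume := by
  rw [← restrict_compl_singleton (μ := (volume : Measure E3)) 0]
  exact hb.aestronglyMeasurable (measurableSet_singleton 0).compl

/-- A singularity |y|^(-k) with k ≤ 2 is integrable at the origin of ℝ³, and outside the ball of
radius M + 1 the field is bounded by 1. The majorant is the norm of b cut off to that ball. -/
theorem exists_hasMajorant {F : Type*} [NormedAddCommGroup F] {b : E3 → F}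
    (hb : AEStronglyMeasurable b volume) {k : ℕ} (hk1 : 1 ≤ k) (hk2 : k ≤ 2) {M : ℝ} (hM : 0 ≤ M)
    (h : ∀ y ≠ 0, ‖y‖ ^ k * ‖b y‖ ≤ M) : ∃ g, HasMajorant b g := by
  refine ⟨(Metric.ball 0 (M + 1)).indicator fun y => ‖b y‖, hb, ?_, ?_, ?_⟩
  · rw [integrable_indicator_iff Metric.isOpen_ball.measurableSet]
    refine integrableOn_ball_of_norm_le_rpow (C := M) (α := k) (by simp) ?_ ?_ hb.norm
    · simp only [finrank_euclideanSpace, Fintype.card_fin]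
      exact_mod_cast Nat.lt_succ_of_le hk2
    · refine ae_restrict_of_ae ?_
      filter_upwards [ae_ne_zero] with y hy
      have h0 : 0 < ‖y‖ := norm_pos_iff.2 hy
      rw [norm_norm, Real.rpow_neg h0.le, Real.rpow_natCast, ← div_eq_mul_inv,
        le_div_iff₀ (pow_pos h0 k), mul_comm]
      exact h y hy
  · exact fun y => indicator_nonneg (fun _ _ => norm_nonneg _) y
  · filter_upwards [ae_ne_zero] with y hy
    by_cases hR : y ∈ Metric.ball (0 : E3) (M + 1)
    · rw [indicator_of_mem hR]; linarith
    · rw [indicator_of_notMem hR, add_zero]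
      rw [mem_ball_zero_iff, not_lt] at hR
      have h1 := h y hy
      have h2 : M + 1 ≤ ‖y‖ ^ k := hR.trans (le_self_pow₀ (by linarith) (by omega))
      by_contra! hc
      nlinarith [norm_nonneg (b y)]

theorem HasMajorant.smul {F : Type*} [NormedAddCommGroup F] [NormedSpace ℝ F] {b : E3 → F}
    {g θ : E3 → ℝ} (hb : HasMajorant b g) (hθ : Continuous θ) (hθ1 : ∀ y, |θ y| ≤ 1) :
    HasMajorant (fun y => θ y • b y) g where
  meas := hθ.aestronglyMeasurable.smul hb.meas
  int := hb.int
  nonneg := hb.nonneg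
  le := by
    filter_upwards [hb.le] with y hy
    rw [norm_smul]
    exact (mul_le_of_le_one_left (norm_nonneg _) (hθ1 y)).trans hy

/-- Smooth functions `θ n` that vanish near `0` and tend to `1` elsewhere, with
`|y| |∇ θ n (y)|` bounded. -/
theorem exists_cutoff_zero : ∃ (θ : ℕ → E3 → ℝ) (C : ℝ), 0 ≤ C ∧ (∀ n, ContDiff ℝ ∞ (θ n)) ∧
    (∀ n x, |θ n x| ≤ 1) ∧ (∀ n i x, ‖x‖ * |pd i (θ n) x| ≤ C) ∧
    (∀ n, ∀ᶠ x in 𝓝 0, θ n x = 0) ∧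
    (∀ x ≠ 0, ∀ᶠ n in atTop, θ n x = 1) ∧ ∀ x ≠ 0, ∀ i, ∀ᶠ n in atTop, pd i (θ n) x = 0 := by
  let η : ContDiffBump (0 : E3) := ⟨1, 2, one_pos, one_lt_two⟩
  have hη : IsTest (η : E3 → ℝ) := ⟨η.contDiff, η.hasCompactSupport⟩
  have hpd : ∀ (n : ℕ) (i : Fin 3) (x : E3),
      pd i (fun y => 1 - η (((n : ℝ) + 1) • y)) x = -(((n : ℝ) + 1) * pd i η (((n : ℝ) + 1) • x)) := by
    intro n i x
    have h1 : HasFDerivAt (fun y : E3 => ((n : ℝ) + 1) • y)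
        (((n : ℝ) + 1) • ContinuousLinearMap.id ℝ E3) x :=
      (hasFDerivAt_id x).const_smul ((n : ℝ) + 1)
    have h2 := ((hη.differentiable (((n : ℝ) + 1) • x)).hasFDerivAt.comp x h1).const_sub 1
    rw [pd]
    erw [h2.fderiv]
    simp [pd]
  have htend : ∀ x : E3, x ≠ 0 → ∀ᶠ n : ℕ in atTop, 2 < ‖((n : ℝ) + 1) • x‖ := by
    intro x hx
    have h0 : 0 < ‖x‖ := norm_pos_iff.2 hx
    have : Tendsto (fun n : ℕ => ((n : ℝ) + 1) * ‖x‖) atTop atTop :=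
      (tendsto_atTop_add_const_right _ 1 tendsto_natCast_atTop_atTop).atTop_mul_const h0
    filter_upwards [this.eventually_gt_atTop 2] with n hn
    rwa [norm_smul, Real.norm_of_nonneg (by positivity)]
  have hz : ∀ z : E3, 2 < ‖z‖ → z ∉ tsupport η := fun z hz hmem => by
    rw [η.tsupport_eq, mem_closedBall_zero_iff] at hmem
    exact absurd hmem (not_le.2 hz)
  choose C hC using fun i => (hη.pd i).compact.exists_bound_of_continuous
      (hη.pd i).smooth.continuous
  have hCi : ∀ i z, ‖z‖ * |pd i η z| ≤ 2 * ∑ i, |C i| := by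
    intro i z
    have hS : C i ≤ ∑ i, |C i| := (le_abs_self _).trans
      (Finset.single_le_sum (f := fun i => |C i|) (fun i _ => abs_nonneg _) (Finset.mem_univ i))
    have hS0 : 0 ≤ ∑ i, |C i| := Finset.sum_nonneg fun i _ => abs_nonneg _
    by_cases h2 : 2 < ‖z‖
    · have : pd i η z = 0 := by
        rw [pd, fderiv_of_notMem_tsupport ℝ (hz z h2), _root_.zero_apply]
      rw [this]; simpa using hS0
    · have h3 := hC i z
      rw [Real.norm_eq_abs] at h3
      exact mul_le_mul (not_lt.1 h2) (h3.trans hS) (abs_nonneg _) (by norm_num)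
  -- The quantity |y||∇θ(y)| is invariant under dilations, so its bound for one bump holds for all
  -- n.
  refine ⟨fun n y => 1 - η (((n : ℝ) + 1) • y), 2 * ∑ i, |C i|, by positivity, fun n => ?_,
    fun n x => ?_, fun n i x => ?_, fun n => ?_, fun x hx => ?_, fun x hx i => ?_⟩
  · exact contDiff_const.sub (hη.smooth.comp (contDiff_const_smul _))
  · have h1 := η.nonneg (x := ((n : ℝ) + 1) • x)
    have h2 := η.le_one (x := ((n : ℝ) + 1) • x)
    rw [abs_le]; constructor <;> linarith
  · rw [hpd, abs_neg, abs_mul, abs_of_nonneg (by positivity : (0 : ℝ) ≤ n + 1)]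
    have := hCi i (((n : ℝ) + 1) • x)
    rw [norm_smul, Real.norm_of_nonneg (by positivity : (0 : ℝ) ≤ n + 1)] at this
    linarith
  · have h1 : Tendsto (fun y : E3 => ((n : ℝ) + 1) • y) (𝓝 0) (𝓝 0) := by
      have : Continuous fun y : E3 => ((n : ℝ) + 1) • y := by fun_prop
      simpa using this.tendsto 0
    filter_upwards [h1.eventually η.eventuallyEq_one] with y hy
    rw [hy]; simp
  · filter_upwards [htend x hx] with n hn
    rw [image_eq_zero_of_notMem_tsupport (hz _ hn), sub_zero]
  · filter_upwards [htend x hx] with n hn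
    rw [hpd, pd, fderiv_of_notMem_tsupport ℝ (hz _ hn), _root_.zero_apply, mul_zero, neg_zero]

theorem IsScaleInvariantDatum.differentiableAt {a : E3 → E3} (ha : IsScaleInvariantDatum a)
    {y : E3} (hy : y ≠ 0) : DifferentiableAt ℝ a y :=
  (ha.smooth.contDiffAt (isOpen_compl_singleton.mem_nhds hy)).differentiableAt (by simp)

theorem IsScaleInvariantDatum.continuousOn_pd {a : E3 → E3} (ha : IsScaleInvariantDatum a)
    (i : Fin 3) : ContinuousOn (pd i a) {0}ᶜ :=
  (ha.smooth.continuousOn_fderiv_of_isOpen isOpen_compl_singleton (by simp)).clm_apply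
    continuousOn_const

theorem IsScaleInvariantDatum.fderiv_scale {a : E3 → E3} (ha : IsScaleInvariantDatum a)
    {c : ℝ} (hc : 0 < c) {x : E3} (hx : x ≠ 0) :
    c ^ 2 • fderiv ℝ a (c • x) = fderiv ℝ a x := by
  have h1 : HasFDerivAt (fun y : E3 => c • y) (c • ContinuousLinearMap.id ℝ E3) x :=
    (hasFDerivAt_id x).const_smul c
  have h2 := ((ha.differentiableAt (smul_ne_zero hc.ne' hx)).hasFDerivAt.comp x h1).const_smul c
  have h3 : HasFDerivAt a _ x := h2.congr_of_eventuallyEq (by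
    filter_upwards [isOpen_compl_singleton.mem_nhds hx] with y hy
    exact (ha.scale c hc y hy).symm)
  rw [h3.fderiv]
  ext1 v
  simp [pow_two, smul_smul]

/-- Euler's identity for degree -1: differentiate c a(cx) = a(x) at c = 1. -/
theorem IsScaleInvariantDatum.euler {a : E3 → E3} (ha : IsScaleInvariantDatum a)
    {x : E3} (hx : x ≠ 0) : ∑ i, x i • pd i a x = -a x := by
  have h1 : HasDerivAt (fun c : ℝ => c • x) x 1 := by
    simpa using (hasDerivAt_id (1 : ℝ)).smul_const x
  have h2 : HasFDerivAt a (fderiv ℝ a x) ((1 : ℝ) • x) := by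
    rw [one_smul]; exact (ha.differentiableAt hx).hasFDerivAt
  have h3 := (hasDerivAt_id (1 : ℝ)).smul (h2.comp_hasDerivAt 1 h1)
  have h4 : HasDerivAt (fun _ : ℝ => a x) (0 : E3) 1 := hasDerivAt_const _ _
  have h5 := h4.congr_of_eventuallyEq (f₁ := id • a ∘ fun c : ℝ => c • x) (by
    filter_upwards [lt_mem_nhds (zero_lt_one : (0 : ℝ) < 1)] with c hc
    rw [Pi.smul_apply']
    exact ha.scale c hc x hx)
  have h6 := h3.unique h5
  simp only [id, one_smul, Function.comp] at h6
  have h7 : fderiv ℝ a x x = ∑ i, x i • pd i a x := by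
    have h8 := congrArg (fderiv ℝ a x) (sum_smul_e x)
    rw [map_sum] at h8
    simpa [pd] using h8.symm
  rw [← h7]
  exact eq_neg_of_add_eq_zero_left h6

theorem IsScaleInvariantDatum.exists_bound {a : E3 → E3} (ha : IsScaleInvariantDatum a)
    : ∃ M : ℝ, 0 ≤ M ∧
    (∀ y ≠ 0, ‖y‖ * ‖a y‖ ≤ M) ∧ (∀ y ≠ 0, ‖y‖ ^ 2 * ‖fderiv ℝ a y‖ ≤ M) := by
  obtain ⟨M₁, h1, h1'⟩ := exists_bound_of_homogeneous ha.smooth.continuousOn 1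
    (by simpa only [pow_one] using ha.scale)
  obtain ⟨M₂, h2, h2'⟩ := exists_bound_of_homogeneous
    (ha.smooth.continuousOn_fderiv_of_isOpen isOpen_compl_singleton (by simp)) 2
    (fun c hc x hx => ha.fderiv_scale hc hx)
  refine ⟨max M₁ M₂, h1.trans (le_max_left _ _), fun y hy => ?_,
    fun y hy => (h2' y hy).trans (le_max_right _ _)⟩
  exact (by simpa using h1' y hy : ‖y‖ * ‖a y‖ ≤ M₁).trans (le_max_left _ _)

theorem pow_mul_norm_pd_le {a : E3 → E3} {M : ℝ} (hM : ∀ y ≠ 0, ‖y‖ ^ 2 * ‖fderiv ℝ a y‖ ≤ M)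
    (i : Fin 3) {y : E3} (hy : y ≠ 0) : ‖y‖ ^ 2 * ‖pd i a y‖ ≤ M :=
  (mul_le_mul_of_nonneg_left (abs_pd_le i a y) (by positivity)).trans (hM y hy)

theorem IsScaleInvariantDatum.exists_majorant {a : E3 → E3} (ha : IsScaleInvariantDatum a)
    : ∃ g, HasMajorant a g := by
  obtain ⟨M, hM0, hM, -⟩ := ha.exists_bound
  exact exists_hasMajorant (aestronglyMeasurable_of_continuousOn_compl ha.smooth.continuousOn)
    le_rfl one_le_two hM0 (by simpa using hM)

theorem IsScaleInvariantDatum.exists_majorant_pd {a : E3 → E3} (ha : IsScaleInvariantDatum a)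
    (i : Fin 3) : ∃ g, HasMajorant (pd i a) g := by
  obtain ⟨M, hM0, -, hM⟩ := ha.exists_bound
  exact exists_hasMajorant (aestronglyMeasurable_of_continuousOn_compl (ha.continuousOn_pd i))
    one_le_two le_rfl hM0 fun y hy => pow_mul_norm_pd_le hM i hy

/-- Derivatives of the heat extension fall on the datum. -/
theorem IsScaleInvariantDatum.kconv_pd {a : E3 → E3} (ha : IsScaleInvariantDatum a)
    (j : Fin 3) :
    kconv (fun z => heatKer' z (e j)) a = kconv heatKer (pd j a) := by
  ext1 x
  obtain ⟨M, hM0, hMa, hMb⟩ := ha.exists_bound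
  obtain ⟨g, hg⟩ := ha.exists_majorant
  obtain ⟨θ, C, hC0, hθs, hθ1, hθC, hθ0, hθt, hθt'⟩ := exists_cutoff_zero
  have hpdθ : ∀ n y, y ≠ 0 → pd j (fun y => θ n y • a y) y
      = pd j (θ n) y • a y + θ n y • pd j a y := fun n y hy => by
    have h1 := (((hθs n).differentiable (by simp)) y).hasFDerivAt.smul
      (ha.differentiableAt hy).hasFDerivAt
    rw [pd]
    erw [h1.fderiv]
    simp [pd, add_comm]
  have hdiff : ∀ n, Differentiable ℝ (fun y => θ n y • a y) := fun n y => by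
    by_cases hy : y = 0
    · have : (fun y => θ n y • a y) =ᶠ[𝓝 y] fun _ => 0 := by
        rw [hy]
        filter_upwards [hθ0 n] with z hz
        rw [hz, zero_smul]
      exact (differentiableAt_const (0 : E3)).congr_of_eventuallyEq this
    · exact (((hθs n).differentiable (by simp)) y).smul (ha.differentiableAt hy)
  -- Uniform in n: where the cut-off is differentiated one gains 1/|y| from it and 1/|y| from the
  -- datum. So both terms are dominated by 1/|y|², which is integrable near the origin.
  have hbd : ∀ n y, y ≠ 0 → ‖y‖ ^ 2 * ‖pd j (fun y => θ n y • a y) y‖ ≤ C * M + M := by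
    intro n y hy
    rw [hpdθ n y hy]
    calc ‖y‖ ^ 2 * ‖pd j (θ n) y • a y + θ n y • pd j a y‖
        ≤ ‖y‖ ^ 2 * (|pd j (θ n) y| * ‖a y‖ + |θ n y| * ‖pd j a y‖) := by
          gcongr
          refine (norm_add_le _ _).trans ?_
          rw [norm_smul, norm_smul, Real.norm_eq_abs, Real.norm_eq_abs]
      _ = (‖y‖ * |pd j (θ n) y|) * (‖y‖ * ‖a y‖) + |θ n y| * (‖y‖ ^ 2 * ‖pd j a y‖) := by ring
      _ ≤ C * M + 1 * M := by
          gcongr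
          · exact hθC n j y
          · exact hMa y hy
          · exact hθ1 n y
          · exact pow_mul_norm_pd_le hMb j hy
      _ = _ := by ring
  have hmeas : ∀ n, AEStronglyMeasurable (pd j (fun y => θ n y • a y)) volume := fun n => by
    refine AEStronglyMeasurable.congr (f := fun y => pd j (θ n) y • a y + θ n y • pd j a y) ?_ ?_
    · have h1 : Continuous (pd j (θ n)) :=
        ((hθs n).continuous_fderiv (by simp)).clm_apply continuous_const
      exact (h1.aestronglyMeasurable.smul hg.meas).add ((hθs n).continuous.aestronglyMeasurable.smul
        (aestronglyMeasurable_of_continuousOn_compl (ha.continuousOn_pd j)))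
    · filter_upwards [ae_ne_zero] with y hy
      exact (hpdθ n y hy).symm
  have hfd : ∀ y, HasFDerivAt (fun y => heatKer (x - y)) (-heatKer' (x - y)) y := fun y => by
    have h := (hasFDerivAt_heatKer (x - y)).comp y ((hasFDerivAt_id y).const_sub x)
    have e1 : (-heatKer' (x - y) : E3 →L[ℝ] ℝ)
        = heatKer' (x - y) ∘SL (-ContinuousLinearMap.id ℝ E3) := by
      ext v
      simp
    rw [e1]
    exact h
  -- The cut-off field vanishes near the origin and is differentiable everywhere, so ordinary
  -- integration by parts is allowed; the singularity of the datum reappears only in the limit.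
  have key : ∀ n, ∫ y, heatKer (x - y) • pd j (fun y => θ n y • a y) y
      = ∫ y, heatKer' (x - y) (e j) • (θ n y • a y) := by
    intro n
    have hK : ∀ y, fderiv ℝ (fun y => heatKer (x - y)) y (e j) = -heatKer' (x - y) (e j) :=
      fun y => by rw [(hfd y).fderiv]; rfl
    obtain ⟨g', hg'⟩ := exists_hasMajorant (hmeas n) one_le_two le_rfl (by positivity) (hbd n)
    have hθa := hg.smul (hθs n).continuous (hθ1 n)
    have h := integral_smul_fderiv_eq_neg_fderiv_smul_of_integrable (𝕜 := ℝ)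
      (μ := (volume : Measure E3)) (f := fun y => heatKer (x - y)) (g := fun y => θ n y • a y)
      (v := e j) ?_ ?_ ?_ (fun y _ => (hfd y).differentiableAt) (fun y _ => hdiff n y)
    · rw [show (fun y => heatKer (x - y) • pd j (fun y => θ n y • a y) y)
        = fun y => heatKer (x - y) • fderiv ℝ (fun y => θ n y • a y) y (e j) from rfl, h,
        ← integral_neg]
      refine integral_congr_ae (ae_of_all _ fun y => ?_)
      simp only [hK, neg_smul, neg_neg]
    · simp only [hK, neg_smul]
      exact (kconv_integrable (hasGaussBound_heatKer'_apply j) hθa x).neg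
    · exact kconv_integrable hasGaussBound_heatKer hg' x
    · exact kconv_integrable hasGaussBound_heatKer hθa x
  have hL : Tendsto (fun n => ∫ y, heatKer (x - y) • pd j (fun y => θ n y • a y) y) atTop
      (𝓝 (kconv heatKer (pd j a) x)) := by
    obtain ⟨g', hg'⟩ := exists_hasMajorant (b := fun y : E3 => (C * M + M) * (‖y‖ ^ 2)⁻¹)
      (by fun_prop) one_le_two le_rfl (M := C * M + M) (by positivity) fun y hy => by
        have h0 : 0 < ‖y‖ := norm_pos_iff.2 hy
        rw [Real.norm_of_nonneg (by positivity)]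
        field_simp
        exact le_rfl
    refine tendsto_integral_of_dominated_convergence
      (fun y => heatKer (x - y) • ((C * M + M) * (‖y‖ ^ 2)⁻¹)) (fun n => ?_)
      (kconv_integrable hasGaussBound_heatKer hg' x) (fun n => ?_) ?_
    · exact (continuous_heatKer.comp (by fun_prop)).aestronglyMeasurable.smul (hmeas n)
    · filter_upwards [ae_ne_zero] with y hy
      have h0 : 0 < ‖y‖ := norm_pos_iff.2 hy
      rw [norm_smul, Real.norm_of_nonneg (heatKer_nonneg _), smul_eq_mul]
      have := heatKer_nonneg (x - y)
      gcongr
      rw [← div_eq_mul_inv, le_div_iff₀ (by positivity), mul_comm]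
      exact hbd n y hy
    · filter_upwards [ae_ne_zero] with y hy
      refine tendsto_const_nhds.congr' ?_
      filter_upwards [hθt y hy, hθt' y hy j] with n h1 h2
      rw [hpdθ n y hy, h1, h2, zero_smul, zero_add, one_smul]
  have hR : Tendsto (fun n => ∫ y, heatKer' (x - y) (e j) • (θ n y • a y)) atTop
      (𝓝 (kconv (fun z => heatKer' z (e j)) a x)) := by
    refine tendsto_integral_of_dominated_convergence
      (fun y => ‖heatKer' (x - y) (e j) • a y‖) (fun n => ?_)
      (kconv_integrable (hasGaussBound_heatKer'_apply j) hg x).norm (fun n => ?_) ?_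
    · exact (kconv_integrable (hasGaussBound_heatKer'_apply j)
        (hg.smul (hθs n).continuous (hθ1 n)) x).aestronglyMeasurable
    · refine ae_of_all _ fun y => ?_
      rw [norm_smul, norm_smul, norm_smul]
      gcongr
      exact mul_le_of_le_one_left (norm_nonneg _) (hθ1 n y)
    · filter_upwards [ae_ne_zero] with y hy
      refine tendsto_const_nhds.congr' ?_
      filter_upwards [hθt y hy] with n h1
      rw [h1, one_smul]
  simp only [key] at hL
  exact tendsto_nhds_unique hR hL

theorem IsScaleInvariantDatum.pd_heatExt {a : E3 → E3} (ha : IsScaleInvariantDatum a)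
    (j : Fin 3) :
    pd j (heatExt a) = kconv heatKer (pd j a) := by
  obtain ⟨g, hg⟩ := ha.exists_majorant
  rw [← kconv_heatKer, pd_kconv hasGaussBound_heatKer hasGaussBound_heatKer' hasFDerivAt_heatKer hg,
    ha.kconv_pd]

theorem IsScaleInvariantDatum.pd_pd_heatExt {a : E3 → E3} (ha : IsScaleInvariantDatum a)
    (i j : Fin 3) :
    pd i (pd j (heatExt a)) = kconv (fun z => heatKer' z (e i)) (pd j a) := by
  obtain ⟨g, hg⟩ := ha.exists_majorant_pd j
  rw [ha.pd_heatExt, pd_kconv hasGaussBound_heatKer hasGaussBound_heatKer' hasFDerivAt_heatKer hg]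

theorem IsScaleInvariantDatum.differentiable_heatExt {a : E3 → E3} (ha : IsScaleInvariantDatum a)
    : Differentiable ℝ (heatExt a) := fun x => by
  obtain ⟨g, hg⟩ := ha.exists_majorant
  exact (hasFDerivAt_kconv hasGaussBound_heatKer hasGaussBound_heatKer' hasFDerivAt_heatKer hg
    x).differentiableAt

theorem IsScaleInvariantDatum.differentiable_pd_heatExt {a : E3 → E3} (ha : IsScaleInvariantDatum a)
    (j : Fin 3) :
    Differentiable ℝ (pd j (heatExt a)) := fun x => by
  obtain ⟨g, hg⟩ := ha.exists_majorant_pd j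
  rw [ha.pd_heatExt]
  exact (hasFDerivAt_kconv hasGaussBound_heatKer hasGaussBound_heatKer' hasFDerivAt_heatKer hg
    x).differentiableAt

theorem IsScaleInvariantDatum.continuous_pd_pd_heatExt {a : E3 → E3} (ha : IsScaleInvariantDatum a)
    (i j : Fin 3) :
    Continuous (pd i (pd j (heatExt a))) := by
  obtain ⟨g, hg⟩ := ha.exists_majorant_pd j
  rw [ha.pd_pd_heatExt]
  refine Differentiable.continuous (𝕜 := ℝ) fun x => ?_
  exact (hasFDerivAt_kconv (hasGaussBound_heatKer'_apply i) (hasGaussBound_heatKer₂ i)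
    (hasFDerivAt_heatKer' i) hg x).differentiableAt

/-- A derivative of the heat extension can be put on the datum, where it improves the homogeneity to
degree -2. For second derivatives only one is put there and the other stays on the kernel: quadratic
decay is enough, and the datum then needs no second derivatives that are integrable at the origin.
-/
theorem IsScaleInvariantDatum.exists_bound_heatExt {a : E3 → E3} (ha : IsScaleInvariantDatum a)
    : ∃ C : ℝ, 0 ≤ C ∧ ∀ x,
    ((1 + ‖x‖) * ‖heatExt a x‖ ≤ C) ∧ (∀ i, (1 + ‖x‖) ^ 2 * ‖pd i (heatExt a) x‖ ≤ C) ∧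
      ∀ i j, (1 + ‖x‖) ^ 2 * ‖pd i (pd j (heatExt a)) x‖ ≤ C := by
  obtain ⟨M, hM0, hMa, hMb⟩ := ha.exists_bound
  obtain ⟨g, hg⟩ := ha.exists_majorant
  choose g' hg' using ha.exists_majorant_pd
  have hI : 0 ≤ ∫ z, gmaj z := integral_nonneg fun z => (gmaj_pos z).le
  have hJ : 0 ≤ ∫ z, g z := integral_nonneg hg.nonneg
  have hJ' : ∀ i, 0 ≤ ∫ z, g' i z := fun i => integral_nonneg (hg' i).nonneg
  set S := (∫ z, gmaj z) + (∫ z, g z) + ∑ i, ∫ z, g' i z with hS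
  have hS0 : 0 ≤ S := by
    have := Finset.sum_nonneg fun i (_ : i ∈ Finset.univ) => hJ' i
    linarith
  have hS1 : (∫ z, gmaj z) + ∫ z, g z ≤ S := by
    have := Finset.sum_nonneg fun i (_ : i ∈ Finset.univ) => hJ' i
    linarith
  have hS2 : ∀ i, (∫ z, gmaj z) + ∫ z, g' i z ≤ S := fun i => by
    have := Finset.single_le_sum (f := fun i => ∫ z, g' i z) (fun i _ => hJ' i) (Finset.mem_univ i)
    linarith
  have hMa' : ∀ᵐ y : E3, ‖y‖ ^ 1 * ‖a y‖ ≤ M := by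
    filter_upwards [ae_ne_zero] with y hy
    simpa using hMa y hy
  have hMb' : ∀ i, ∀ᵐ y : E3, ‖y‖ ^ 2 * ‖pd i a y‖ ≤ M := fun i => by
    filter_upwards [ae_ne_zero] with y hy
    exact pow_mul_norm_pd_le hMb i hy
  have hT0 : 0 ≤ 1032 * (1 + M) * S := by positivity
  have hT1 : 1032 * S ≤ 1032 * (1 + M) * S := by nlinarith [mul_nonneg hM0 hS0]
  refine ⟨16 * (1032 * (1 + M) * S), by positivity, fun x => ⟨?_, fun i => ?_, fun i j => ?_⟩⟩
  · have h1 := norm_kconv_le hasGaussBound_heatKer hg x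
    have h2 := pow_norm_mul_norm_kconv_le one_le_two hM0 hasGaussBound_heatKer sq_mul_heatKer_le
      hg hMa' x
    rw [kconv_heatKer] at h1 h2
    have h3 : 1032 * (1 + M) * ((∫ z, gmaj z) + ∫ z, g z) ≤ 1032 * (1 + M) * S := by gcongr
    linarith
  · have h1 := norm_kconv_le hasGaussBound_heatKer (hg' i) x
    have h2 := pow_norm_mul_norm_kconv_le le_rfl hM0 hasGaussBound_heatKer sq_mul_heatKer_le
      (hg' i) (hMb' i) x
    rw [← ha.pd_heatExt] at h1 h2
    have h3 : 1032 * (1 + M) * ((∫ z, gmaj z) + ∫ z, g' i z) ≤ 1032 * (1 + M) * S := by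
      gcongr; exact hS2 i
    have h4 := hS2 i
    have h5 : (1 + ‖x‖) ^ 2 ≤ 2 + 2 * ‖x‖ ^ 2 := by nlinarith [sq_nonneg (‖x‖ - 1)]
    nlinarith [mul_le_mul_of_nonneg_right h5 (norm_nonneg (pd i (heatExt a) x))]
  · have h1 := norm_kconv_le (hasGaussBound_heatKer'_apply i) (hg' j) x
    have h2 := pow_norm_mul_norm_kconv_le le_rfl hM0 (hasGaussBound_heatKer'_apply i)
      (sq_mul_heatKer'_le i) (hg' j) (hMb' j) x
    rw [← ha.pd_pd_heatExt] at h1 h2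
    have h3 : 1032 * (1 + M) * ((∫ z, gmaj z) + ∫ z, g' j z) ≤ 1032 * (1 + M) * S := by
      gcongr; exact hS2 j
    have h4 := hS2 j
    have h5 : (1 + ‖x‖) ^ 2 ≤ 2 + 2 * ‖x‖ ^ 2 := by nlinarith [sq_nonneg (‖x‖ - 1)]
    nlinarith [mul_le_mul_of_nonneg_right h5 (norm_nonneg (pd i (pd j (heatExt a)) x))]

theorem IsScaleInvariantDatum.div_heatExt {a : E3 → E3} (ha : IsScaleInvariantDatum a)
    (x : E3) : ∑ i, (pd i (heatExt a) x) i = 0 := by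
  choose g' hg' using ha.exists_majorant_pd
  have h : ∀ i, (pd i (heatExt a) x) i = ∫ y, heatKer (x - y) * (pd i a y) i := fun i => by
    rw [ha.pd_heatExt, kconv, integral_apply (kconv_integrable hasGaussBound_heatKer (hg' i) x)]
    rfl
  simp only [h]
  rw [← integral_finsetSum]
  · rw [← integral_zero E3 ℝ (μ := volume)]
    refine integral_congr_ae ?_
    filter_upwards [ae_ne_zero] with y hy
    rw [← Finset.mul_sum, ha.div_free y hy, mul_zero]
  · exact fun i _ => (EuclideanSpace.proj i : E3 →L[ℝ] ℝ).integrable_comp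
      (kconv_integrable hasGaussBound_heatKer (hg' i) x)

/-- The profile equation of the heat flow. -/
theorem IsScaleInvariantDatum.heat_equation {a : E3 → E3} (ha : IsScaleInvariantDatum a)
    (x : E3) :
    (∑ i, pd i (pd i (heatExt a)) x) + (1 / 2 : ℝ) • (∑ i, x i • pd i (heatExt a) x)
      + (1 / 2 : ℝ) • heatExt a x = 0 := by
  choose g' hg' using ha.exists_majorant_pd
  obtain ⟨g, hg⟩ := ha.exists_majorant
  have h1 := fun i => kconv_integrable hasGaussBound_heatKer (hg' i) x
  have h2 := fun i => kconv_integrable (hasGaussBound_heatKer'_apply i) (hg' i) x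
  have h3 := kconv_integrable hasGaussBound_heatKer hg x
  have h4 : ∀ i, Integrable (fun y => x i • heatKer (x - y) • pd i a y) volume :=
    fun i => (h1 i).smul (x i)
  have h5 : Integrable (fun y => ∑ i, x i • heatKer (x - y) • pd i a y) volume :=
    integrable_finsetSum _ fun i _ => h4 i
  have h6 : Integrable (fun y => ∑ i, heatKer' (x - y) (e i) • pd i a y) volume :=
    integrable_finsetSum _ fun i _ => h2 i
  simp only [ha.pd_pd_heatExt]
  simp only [ha.pd_heatExt]
  rw [← kconv_heatKer]
  simp only [kconv, ← integral_smul]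
  rw [← integral_finsetSum _ fun i _ => h2 i,
    ← integral_finsetSum _ fun i _ => h4 i, ← integral_smul, ← integral_add, ← integral_add,
    ← integral_zero E3 E3 (μ := volume)]
  · refine integral_congr_ae ?_
    filter_upwards [ae_ne_zero] with y hy
    -- The identity holds under the integral sign: ∂ᵢ of the kernel contributes -(xᵢ - yᵢ)/2, the
    -- drift contributes xᵢ/2, and Euler's identity a = -∑ yᵢ∂ᵢa contributes -yᵢ/2. The coefficients
    -- of ∂ᵢa add up to zero.
    have hE := ha.euler hy
    rw [← neg_eq_iff_eq_neg] at hE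
    simp only [heatKer'_apply, ← hE, PiLp.sub_apply]
    rw [Finset.smul_sum, ← Finset.sum_add_distrib, ← Finset.sum_neg_distrib, Finset.smul_sum,
      Finset.smul_sum, ← Finset.sum_add_distrib]
    refine Finset.sum_eq_zero fun i _ => ?_
    module
  · exact h6.add (h5.smul (1 / 2 : ℝ))
  · exact h3.smul (1 / 2 : ℝ)
  · exact h6
  · exact h5.smul (1 / 2 : ℝ)

/-- The heat extension is asymptotic to the datum. -/
theorem IsScaleInvariantDatum.exists_norm_heatExt_sub_le {a : E3 → E3}
    (ha : IsScaleInvariantDatum a)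
    : ∃ C : ℝ, 0 ≤ C ∧ ∀ x, 1 ≤ ‖x‖ →
    ‖heatExt a x - a x‖ ≤ C / ‖x‖ ^ 2 := by
  obtain ⟨M, hM0, hMa, hMb⟩ := ha.exists_bound
  obtain ⟨g, hg⟩ := ha.exists_majorant
  refine ⟨8 * (1 + M) * 1032 * ((∫ z, gmaj z) + ∫ z, g z), ?_, fun x hx => ?_⟩
  · have h1 : 0 ≤ ∫ z, gmaj z := integral_nonneg fun z => (gmaj_pos z).le
    have h2 : 0 ≤ ∫ z, g z := integral_nonneg hg.nonneg
    positivity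
  have hx0 : 0 < ‖x‖ := by linarith
  have hxne : x ≠ 0 := norm_pos_iff.1 hx0
  have hax : ‖a x‖ ≤ M := by nlinarith [hMa x hxne, norm_nonneg (a x)]
  have hint : Integrable (fun y => heatKer (x - y)) volume := by
    refine Integrable.comp_sub_left ?_ x
    by_contra hc
    exact zero_ne_one ((integral_undef hc).symm.trans integral_heatKer)
  have h1 : heatExt a x - a x = ∫ y, heatKer (x - y) • (a y - a x) := by
    simp only [smul_sub]
    rw [integral_sub (kconv_integrable hasGaussBound_heatKer hg x) (hint.smul_const _),
      integral_smul_const, integral_sub_left_eq_self heatKer volume x, integral_heatKer, one_smul]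
    rfl
  rw [h1]
  have hbnd : ∀ᵐ y : E3, ‖heatKer (x - y) • (a y - a x)‖
      ≤ (8 * (1 + M) * 1032 / ‖x‖ ^ 2) * (gmaj (x - y) * (1 + g y)) := by
    filter_upwards [hg.le] with y hy
    have hK := (pow_mul_heatKer_le (k := 2) (by norm_num) (x - y)).trans
      (mul_le_mul_of_nonneg_left (exp_le_gmaj (x - y)) (by norm_num))
    have hK0 := heatKer_nonneg (x - y)
    have hg0 := hg.nonneg y
    have hz := norm_nonneg (x - y)
    -- For |x - y| ≤ |x|/2 the segment stays away from the origin, |∇a| ≤ 4M/|x|² there, and the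
    -- mean value inequality applies. Otherwise |x|² ≤ 4(1 + |x - y|)², which the Gaussian absorbs.
    have hm : ‖a y - a x‖ * ‖x‖ ^ 2 ≤ 8 * (1 + M) * ((1 + ‖x - y‖) ^ 2 * (1 + g y)) := by
      by_cases hc : ‖x - y‖ ≤ ‖x‖ / 2
      · have hball : ∀ z ∈ Metric.closedBall x (‖x‖ / 2), ‖x‖ / 2 ≤ ‖z‖ := fun z hz => by
          rw [mem_closedBall_iff_norm'] at hz
          have : ‖x‖ ≤ ‖x - z‖ + ‖z‖ := by simpa using norm_add_le (x - z) z
          linarith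
        have hne : ∀ z ∈ Metric.closedBall x (‖x‖ / 2), z ≠ 0 := fun z hz =>
          norm_pos_iff.1 (by linarith [hball z hz])
        have := (convex_closedBall x (‖x‖ / 2)).norm_image_sub_le_of_norm_fderiv_le (𝕜 := ℝ)
          (f := a) (C := 4 * M / ‖x‖ ^ 2) (fun z hz => ha.differentiableAt (hne z hz))
          (fun z hz => by
            rw [le_div_iff₀ (by positivity)]
            have h5 := hMb z (hne z hz)
            have h6 : ‖x‖ ^ 2 ≤ 4 * ‖z‖ ^ 2 := by nlinarith [hball z hz]
            nlinarith [norm_nonneg (fderiv ℝ a z)])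
          (Metric.mem_closedBall_self (by linarith))
          (by rw [mem_closedBall_iff_norm']; exact hc : y ∈ Metric.closedBall x (‖x‖ / 2))
        rw [norm_sub_rev y x] at this
        have h7 : ‖a y - a x‖ * ‖x‖ ^ 2 ≤ 4 * M * ‖x - y‖ := by
          calc _ ≤ 4 * M / ‖x‖ ^ 2 * ‖x - y‖ * ‖x‖ ^ 2 := by gcongr
            _ = _ := by field_simp
        have h8 : ‖x - y‖ ≤ (1 + ‖x - y‖) ^ 2 * (1 + g y) := by
          have : ‖x - y‖ ≤ (1 + ‖x - y‖) ^ 2 := by nlinarith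
          nlinarith
        nlinarith
      · have h5 : ‖x‖ ^ 2 ≤ 4 * (1 + ‖x - y‖) ^ 2 := by nlinarith
        have h6 : ‖a y - a x‖ ≤ 2 * (1 + M) * (1 + g y) := by
          have := norm_sub_le (a y) (a x)
          nlinarith
        calc _ ≤ (2 * (1 + M) * (1 + g y)) * (4 * (1 + ‖x - y‖) ^ 2) := by gcongr
          _ = _ := by ring
    rw [norm_smul, Real.norm_of_nonneg hK0, div_mul_eq_mul_div, le_div_iff₀ (by positivity)]
    calc heatKer (x - y) * ‖a y - a x‖ * ‖x‖ ^ 2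
        = heatKer (x - y) * (‖a y - a x‖ * ‖x‖ ^ 2) := by ring
      _ ≤ heatKer (x - y) * (8 * (1 + M) * ((1 + ‖x - y‖) ^ 2 * (1 + g y))) := by gcongr
      _ = 8 * (1 + M) * (((1 + ‖x - y‖) ^ 2 * heatKer (x - y)) * (1 + g y)) := by ring
      _ ≤ 8 * (1 + M) * ((1032 * gmaj (x - y)) * (1 + g y)) := by gcongr
      _ = _ := by ring
  refine (norm_integral_le_of_norm_le ((integrable_gmaj_mul hg.int x).const_mul _) hbnd).trans ?_
  rw [integral_const_mul]
  calc _ ≤ (8 * (1 + M) * 1032 / ‖x‖ ^ 2) * ((∫ z, gmaj z) + ∫ z, g z) := by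
        gcongr
        exact integral_gmaj_mul_le hg.int hg.nonneg x
    _ = _ := by ring

/-! ### Multipliers and advection terms -/

/-- Multiplication by `f` maps `𝒱` to `L²`, with norm at most `N`. -/
structure IsMult (f : E3 → ℝ) (N : ℝ) : Prop where
  meas : AEStronglyMeasurable f volume
  le : ∀ (w : V) (a : Fin 3), eLpNorm (fun x => f x * w.comp a x) 2 volume ≤
      ENNReal.ofReal (N * ‖w‖)

theorem IsMult.memLp {f : E3 → ℝ} {N : ℝ} (h : IsMult f N) (w : V) (a : Fin 3) :
    MemLp (fun x => f x * w.comp a x) 2 volume :=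
  ⟨h.meas.mul (w.memLp_two a).aestronglyMeasurable, (h.le w a).trans_lt ENNReal.ofReal_lt_top⟩

theorem IsMult.of_bounded {f : E3 → ℝ} {C : ℝ} (hC : 0 ≤ C)
    (hf : AEStronglyMeasurable f volume) (h : ∀ᵐ x : E3, |f x| ≤ C) : IsMult f C := by
  refine ⟨hf, fun w a => ?_⟩
  rw [ENNReal.ofReal_mul hC]
  refine (eLpNorm_le_mul_eLpNorm_of_ae_le_mul (g := w.comp a) (c := C) ?_ 2).trans ?_
  · filter_upwards [h] with x hx
    rw [norm_mul]
    exact mul_le_mul_of_nonneg_right hx (norm_nonneg _)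
  · gcongr
    exact w.eLpNorm_two_le a

/-- Hölder with 1/4 + 1/4 = 1/2. This is what the L⁴ norm in 𝒱 is for: it makes products of two
elements square integrable. -/
theorem IsMult.of_memLp_four {f : E3 → ℝ} (hf : MemLp f 4 volume) :
    IsMult f (eLpNorm f 4 volume).toReal := by
  refine ⟨hf.1, fun w a => ?_⟩
  have : ENNReal.HolderTriple 4 4 2 := ⟨by
    rw [← two_mul, show (4 : ℝ≥0∞) = 2 * 2 by norm_num,
      ENNReal.mul_inv (Or.inl two_ne_zero) (Or.inl ENNReal.ofNat_ne_top), ← mul_assoc,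
      ENNReal.mul_inv_cancel two_ne_zero ENNReal.ofNat_ne_top, one_mul]⟩
  rw [ENNReal.ofReal_mul ENNReal.toReal_nonneg, ENNReal.ofReal_toReal hf.2.ne]
  refine (eLpNorm_le_eLpNorm_mul_eLpNorm_of_nnnorm (p := 4) (q := 4) (r := 2) hf.1
    (w.memLp_four a).1 (fun a b => a * b) 1 (ae_of_all _ fun x => ?_)).trans ?_
  · rw [nnnorm_mul, one_mul]
  · rw [ENNReal.coe_one, one_mul]
    gcongr
    exact w.eLpNorm_four_le a

theorem IsMult.comp_V (v : V) (a : Fin 3) : IsMult (v.comp a) ‖v‖ := by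
  refine ⟨(v.memLp_four a).1, fun w b => ((IsMult.of_memLp_four (v.memLp_four a)).le w b).trans ?_⟩
  gcongr
  exact ENNReal.toReal_le_of_le_ofReal (norm_nonneg _) (v.eLpNorm_four_le a)

theorem IsMult.mono {f : E3 → ℝ} {N N' : ℝ} (h : IsMult f N) (hN : N ≤ N') : IsMult f N' :=
  ⟨h.meas, fun w a => (h.le w a).trans (by gcongr)⟩

theorem IsMult.add {f g : E3 → ℝ} {N N' : ℝ} (hf : IsMult f N) (hg : IsMult g N') (h0 : 0 ≤ N)
    (h0' : 0 ≤ N') : IsMult (fun x => f x + g x) (N + N') := by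
  refine ⟨hf.meas.add hg.meas, fun w a => ?_⟩
  simp only [add_mul]
  rw [ENNReal.ofReal_add (by positivity) (by positivity)]
  exact (eLpNorm_add_le (hf.memLp w a).1 (hg.memLp w a).1 (by norm_num)).trans
    (add_le_add (hf.le w a) (hg.le w a))

theorem IsMult.const_mul {f : E3 → ℝ} {N : ℝ} (c : ℝ) (hf : IsMult f N) :
    IsMult (fun x => c * f x) (|c| * N) := by
  refine ⟨hf.meas.const_mul c, fun w a => ?_⟩
  have h : (fun x => c * f x * w.comp a x) = c • fun x => f x * w.comp a x := by
    ext x; simp [mul_assoc]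
  rw [h, eLpNorm_const_smul, mul_assoc, ENNReal.ofReal_mul (abs_nonneg c), ← Real.norm_eq_abs,
    ofReal_norm]
  gcongr
  exact hf.le w a

/-- A field whose derivatives up to second order are multipliers; `H i j = ∂ⱼ ∂ᵢ U`. -/
structure MultField (U : GradField) (H : Fin 3 → Fin 3 → E3 → E3) (N : ℝ) : Prop where
  nonneg : 0 ≤ N
  val_loc : ∀ a k, HasLocWeakPD k (fun x => U.val x a) (fun x => U.grad k x a)
  grad_loc : ∀ i j a, HasLocWeakPD j (fun x => U.grad i x a) (fun x => H i j x a)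
  val_mult : ∀ a, IsMult (fun x => U.val x a) N
  grad_mult : ∀ i a, IsMult (fun x => U.grad i x a) N
  hess_mult : ∀ i j a, IsMult (fun x => H i j x a) N

theorem D.multField (v : D) : MultField v.field (fun i j => (v.partial₂ i j).toL2) ‖v‖ where
  nonneg := norm_nonneg v
  val_loc a k := (v.hasWeakPD k a).loc
  grad_loc i j a := (v.hasWeakPD₂ i j a).loc
  val_mult a := (IsMult.comp_V v.toV a).mono v.norm_toV_le
  grad_mult i a := (IsMult.comp_V (v.partial i) a).mono (v.norm_partial_le i)
  hess_mult i j a := (IsMult.comp_V (v.partial₂ i j) a).mono (v.norm_partial₂_le i j)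

/-- The heat extension as a field with its first partial derivatives. -/
def heatField (a₀ : E3 → E3) : GradField where
  val := heatExt a₀
  grad := fun i => pd i (heatExt a₀)

theorem pd_apply {f : E3 → E3} {x : E3} (hf : DifferentiableAt ℝ f x) (k a : Fin 3) :
    pd k (fun y => f y a) x = (pd k f x) a := by
  have h := (EuclideanSpace.proj a : E3 →L[ℝ] ℝ).hasFDerivAt.comp x hf.hasFDerivAt
  exact congrArg (fun L : E3 →L[ℝ] ℝ => L (e k)) h.fderiv

theorem hasLocWeakPD_apply {f : E3 → E3} (hf : Differentiable ℝ f) {C : ℝ} (k a : Fin 3)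
    (hC : ∀ x, ‖pd k f x‖ ≤ C) : HasLocWeakPD k (fun x => f x a) (fun x => (pd k f x) a) := by
  have h1 : pd k (fun y => f y a) = fun x => (pd k f x) a := funext fun x => pd_apply (hf x) k a
  have hd : Differentiable ℝ fun x => f x a := fun x =>
    ((EuclideanSpace.proj a : E3 →L[ℝ] ℝ).hasFDerivAt.comp x (hf x).hasFDerivAt).differentiableAt
  rw [← h1]
  refine HasLocWeakPD.of_differentiable hd fun R => ⟨C, fun x _ => ?_⟩
  rw [h1]
  exact (abs_apply_le _ a).trans (hC x)

theorem norm_le_of_pow_mul_le {x y : E3} {C : ℝ} (k : ℕ) (h : (1 + ‖x‖) ^ k * ‖y‖ ≤ C) :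
    ‖y‖ ≤ C := by
  have : 1 ≤ (1 + ‖x‖) ^ k := one_le_pow₀ (by linarith [norm_nonneg x])
  nlinarith [norm_nonneg y]

theorem IsScaleInvariantDatum.exists_multField {a₀ : E3 → E3} (ha : IsScaleInvariantDatum a₀) :
    ∃ N, MultField (heatField a₀) (fun i j => pd j (pd i (heatExt a₀))) N := by
  obtain ⟨C, hC0, hC⟩ := ha.exists_bound_heatExt
  have b0 : ∀ x, ‖heatExt a₀ x‖ ≤ C := fun x => norm_le_of_pow_mul_le 1 (by simpa using (hC x).1)
  have b1 : ∀ i x, ‖pd i (heatExt a₀) x‖ ≤ C := fun i x => norm_le_of_pow_mul_le 2 ((hC x).2.1 i)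
  have b2 : ∀ i j x, ‖pd i (pd j (heatExt a₀)) x‖ ≤ C := fun i j x =>
    norm_le_of_pow_mul_le 2 ((hC x).2.2 i j)
  have hm : ∀ f : E3 → E3, Continuous f → (∀ x, ‖f x‖ ≤ C) → ∀ a, IsMult (fun x => f x a) C :=
    fun f hf hb a => IsMult.of_bounded hC0
      ((EuclideanSpace.proj a : E3 →L[ℝ] ℝ).continuous.comp hf).aestronglyMeasurable
      (ae_of_all _ fun x => (abs_apply_le _ a).trans (hb x))
  exact ⟨C, hC0, fun a k => hasLocWeakPD_apply ha.differentiable_heatExt k a (b1 k),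
    fun i j a => hasLocWeakPD_apply (ha.differentiable_pd_heatExt i) j a (b2 j i),
    hm _ ha.differentiable_heatExt.continuous b0,
    fun i => hm _ (ha.differentiable_pd_heatExt i).continuous (b1 i),
    fun i j => hm _ (ha.continuous_pd_pd_heatExt j i) (b2 j i)⟩

/-- The Leray projection of an `H¹` field, with bounds. -/
theorem exists_leray_of_comp : ∃ K : ℝ, 0 ≤ K ∧ ∀ (f : E3 → E3) (g : Fin 3 → Fin 3 → E3 → ℝ)
    (R : ℝ), 0 ≤ R → (∀ k b, HasWeakPD k (fun x => f x b) (g k b)) →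
    (∀ b, eLpNorm (fun x => f x b) 2 volume ≤ ENNReal.ofReal R) →
    (∀ k b, eLpNorm (g k b) 2 volume ≤ ENNReal.ofReal R) →
    MemLp f 2 volume ∧ ∃ w : V, w.toL2 = leray f ∧ ‖w‖ ≤ K * R ∧
      ∃ G : Fin 3 → L2, (∀ k, IsWeakPartial k w.toL2 (G k)) ∧ ∀ k, ‖G k‖ ≤ K * R := by
  obtain ⟨K, hK0, hK⟩ := exists_leray_V
  have hsum : ∀ (h : E3 → E3) (R : ℝ), 0 ≤ R → MemLp h 2 volume →
      (∀ b, eLpNorm (fun x => h x b) 2 volume ≤ ENNReal.ofReal R) →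
      (eLpNorm h 2 volume).toReal ≤ 3 * R := fun h R hR hh hb => by
    refine ENNReal.toReal_le_of_le_ofReal (by positivity)
      ((eLpNorm_le_sum_apply hh.1 (by norm_num)).trans
          ((Finset.sum_le_sum fun b _ => hb b).trans ?_))
    rw [Finset.sum_const, Finset.card_univ, Fintype.card_fin, nsmul_eq_mul,
      ENNReal.ofReal_mul (by norm_num)]
    simp
  refine ⟨12 * K + 3, by positivity, fun f g R hR h hf hg => ?_⟩
  have hfm : MemLp f 2 volume := memLp_of_apply fun b => (h 0 b).left
  let G : Fin 3 → E3 → E3 := fun k x => ∑ b, g k b x • e b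
  have hGa : ∀ k b x, (G k x) b = g k b x := fun k b x => by
    simp only [G, WithLp.ofLp_sum, Finset.sum_apply, smul_e_apply]
    simp
  have hGm : ∀ k, MemLp (G k) 2 volume := fun k => memLp_of_apply fun b => by
    simp only [hGa]; exact (h k b).right
  have hw : ∀ k, IsWeakPartial k (hfm.toLp f : L2) ((hGm k).toLp (G k) : L2) := fun k => by
    rw [isWeakPartial_iff]
    intro b
    refine (h k b).congr ?_ ?_
    · filter_upwards [hfm.coeFn_toLp] with x hx
      rw [hx]
    · filter_upwards [(hGm k).coeFn_toLp] with x hx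
      rw [hx, hGa]
  obtain ⟨w, hw1, hw2⟩ := hK _ _ hw
  have hfR : ‖hfm.toLp f‖ ≤ 3 * R := by
    rw [Lp.norm_toLp]; exact hsum f R hR hfm hf
  have hGR : ∀ k, ‖(hGm k).toLp (G k)‖ ≤ 3 * R := fun k => by
    rw [Lp.norm_toLp]
    exact hsum _ R hR (hGm k) fun b => by simp only [hGa]; exact hg k b
  have hKR : 0 ≤ K * R := by positivity
  refine ⟨hfm, w, hw1.trans (leray_of_memLp hfm).symm, ?_,
    fun k => solenoidal.starProjection ((hGm k).toLp (G k)), fun k => ?_, fun k => ?_⟩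
  · calc ‖w‖ ≤ K * (3 * R + ∑ _k : Fin 3, 3 * R) := by
          refine hw2.trans ?_
          gcongr with k
          exact hGR k
      _ ≤ _ := by simp; nlinarith
  · rw [hw1]; exact (hw k).starProjection
  · refine (solenoidal.norm_starProjection_apply_le _).trans ((hGR k).trans ?_)
    nlinarith

theorem adv_apply (u w : GradField) (x : E3) (b : Fin 3) :
    (adv u w x) b = ∑ i, u.val x i * w.grad i x b := by
  simp [adv]

theorem eLpNorm_sum_le_of_le {ι : Type*} [Fintype ι] {f : ι → E3 → ℝ} {R : ℝ}
    (hf : ∀ i, MemLp (f i) 2 volume) (h : ∀ i, eLpNorm (f i) 2 volume ≤ ENNReal.ofReal R) :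
    eLpNorm (fun x => ∑ i, f i x) 2 volume ≤ ENNReal.ofReal (Fintype.card ι * R) := by
  have h1 : (fun x => ∑ i, f i x) = ∑ i, f i := by ext x; simp
  rw [h1]
  refine (eLpNorm_sum_le (fun i _ => (hf i).1) (by norm_num)).trans
    ((Finset.sum_le_sum fun i _ => h i).trans ?_)
  rw [Finset.sum_const, Finset.card_univ, nsmul_eq_mul, ENNReal.ofReal_mul (by positivity)]
  simp

/-- Bounds for `U · ∇ φ` and `φ · ∇ U`. -/
theorem exists_leray_adv : ∃ K : ℝ, 0 ≤ K ∧ ∀ (U : GradField) (H : Fin 3 → Fin 3 → E3 → E3) (N : ℝ),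
    MultField U H N → ∀ φ : D, ∀ f, (f = adv U φ.field ∨ f = adv φ.field U) →
    MemLp f 2 volume ∧ ∃ w : V, w.toL2 = leray f ∧ ‖w‖ ≤ K * (N * ‖φ‖) ∧
      ∃ G : Fin 3 → L2, (∀ k, IsWeakPartial k w.toL2 (G k)) ∧ ∀ k, ‖G k‖ ≤ K * (N * ‖φ‖) := by
  obtain ⟨K, hK0, hK⟩ := exists_leray_of_comp
  refine ⟨K * 6, by positivity, fun U H N hU φ f hf => ?_⟩
  have hN := hU.nonneg
  have hR : 0 ≤ N * ‖φ‖ := by positivity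
  have hmono : ∀ {w : V}, ‖w‖ ≤ ‖φ‖ → ENNReal.ofReal (N * ‖w‖) ≤ ENNReal.ofReal (N * ‖φ‖) :=
    fun h => by gcongr
  have n0 := φ.norm_toV_le
  have n1 := φ.norm_partial_le
  have n2 := φ.norm_partial₂_le
  -- Both advection terms are sums of products p q in which p is a component of U or ∇U and q one of
  -- φ or ∇φ. The product rule then involves only multipliers applied to entries of φ; the factor 6
  -- counts three summands with two terms each.
  have key : ∀ (p q : Fin 3 → Fin 3 → E3 → ℝ) (p' q' : Fin 3 → Fin 3 → Fin 3 → E3 → ℝ),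
      (∀ x b, (f x) b = ∑ i, p i b x * q i b x) →
      (∀ i b k, HasLocWeakPD k (p i b) (p' i b k)) → (∀ i b k, HasWeakPD k (q i b) (q' i b k)) →
      (∀ i b, MemLp (fun x => p i b x * q i b x) 2 volume ∧
        eLpNorm (fun x => p i b x * q i b x) 2 volume ≤ ENNReal.ofReal (N * ‖φ‖)) →
      (∀ i b k, MemLp (fun x => p' i b k x * q i b x) 2 volume ∧
        eLpNorm (fun x => p' i b k x * q i b x) 2 volume ≤ ENNReal.ofReal (N * ‖φ‖)) →
      (∀ i b k, MemLp (fun x => p i b x * q' i b k x) 2 volume ∧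
        eLpNorm (fun x => p i b x * q' i b k x) 2 volume ≤ ENNReal.ofReal (N * ‖φ‖)) →
      MemLp f 2 volume ∧ ∃ w : V, w.toL2 = leray f ∧ ‖w‖ ≤ K * (6 * (N * ‖φ‖)) ∧
      ∃ G : Fin 3 → L2, (∀ k, IsWeakPartial k w.toL2 (G k)) ∧
        ∀ k, ‖G k‖ ≤ K * (6 * (N * ‖φ‖)) := by
    intro p q p' q' hfe hp hq h0 h1 h2
    have h3 : ∀ i b k, MemLp (fun x => p' i b k x * q i b x + p i b x * q' i b k x) 2 volume :=
      fun i b k => (h1 i b k).1.add (h2 i b k).1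
    refine hK f (fun k b x => ∑ i, (p' i b k x * q i b x + p i b x * q' i b k x)) _ (by positivity)
      (fun k b => ?_) (fun b => ?_) (fun k b => ?_)
    · simp only [hfe]
      exact HasWeakPD.sum _ fun i _ => (hp i b k).mul (hq i b k) (h0 i b).1 (h3 i b k)
    · simp only [hfe]
      refine (eLpNorm_sum_le_of_le (fun i => (h0 i b).1) fun i => (h0 i b).2).trans ?_
      rw [Fintype.card_fin]
      gcongr
      norm_num
    · refine (eLpNorm_sum_le_of_le (R := 2 * (N * ‖φ‖)) (fun i => h3 i b k) fun i => ?_).trans ?_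
      · refine (eLpNorm_add_le (h1 i b k).1.1 (h2 i b k).1.1 (by norm_num)).trans ?_
        rw [two_mul, ENNReal.ofReal_add hR hR]
        exact add_le_add (h1 i b k).2 (h2 i b k).2
      · rw [Fintype.card_fin]
        refine ENNReal.ofReal_le_ofReal (by push_cast; linarith)
  rw [mul_assoc]
  rcases hf with rfl | rfl
  · exact key (fun i _ x => U.val x i) (fun i b => (φ.partial i).comp b)
      (fun i _ k x => U.grad k x i) (fun i b k => (φ.partial₂ i k).comp b)
      (fun x b => adv_apply _ _ x b) (fun i b k => hU.val_loc i k) (fun i b k => φ.hasWeakPD₂ i k b)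
      (fun i b => ⟨(hU.val_mult i).memLp _ b, ((hU.val_mult i).le _ b).trans (hmono (n1 i))⟩)
      (fun i b k => ⟨(hU.grad_mult k i).memLp _ b, ((hU.grad_mult k i).le _ b).trans
          (hmono (n1 i))⟩)
      (fun i b k => ⟨(hU.val_mult i).memLp _ b, ((hU.val_mult i).le _ b).trans (hmono (n2 i k))⟩)
  · exact key (fun i b x => U.grad i x b) (fun i _ => φ.toV.comp i)
      (fun i b k x => H i k x b) (fun i _ k => (φ.partial k).comp i)
      (fun x b => by rw [adv_apply]; exact Finset.sum_congr rfl fun i _ => mul_comm _ _)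
      (fun i b k => hU.grad_loc i k b) (fun i b k => φ.hasWeakPD k i)
      (fun i b => ⟨(hU.grad_mult i b).memLp _ i, ((hU.grad_mult i b).le _ i).trans (hmono n0)⟩)
      (fun i b k => ⟨(hU.hess_mult i k b).memLp _ i, ((hU.hess_mult i k b).le _ i).trans
          (hmono n0)⟩)
      (fun i b k => ⟨(hU.grad_mult i b).memLp _ i, ((hU.grad_mult i b).le _ i).trans
          (hmono (n1 k))⟩)

theorem leray_congr {f g : E3 → E3} (h : f =ᵐ[volume] g) : leray f = leray g := by
  by_cases hf : MemLp f 2 volume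
  · rw [leray_of_memLp hf, leray_of_memLp (hf.ae_eq h), MemLp.toLp_congr hf (hf.ae_eq h) h]
  · rw [leray, dif_neg hf, leray, dif_neg fun hg => hf (hg.ae_eq h.symm)]

theorem leray_add {f g : E3 → E3} (hf : MemLp f 2 volume) (hg : MemLp g 2 volume) :
    leray (fun x => f x + g x) = leray f + leray g := by
  rw [leray_of_memLp hf, leray_of_memLp hg, ← map_add, ← MemLp.toLp_add hf hg]
  exact leray_of_memLp (hf.add hg)

theorem leray_smul {f : E3 → E3} (c : ℝ) (hf : MemLp f 2 volume) :
    leray (fun x => c • f x) = c • leray f := by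
  rw [leray_of_memLp hf, ← map_smul, ← MemLp.toLp_const_smul c hf]
  exact leray_of_memLp (hf.const_smul c)

theorem norm_leray_le (f : E3 → E3) (hf : MemLp f 2 volume) :
    ‖leray f‖ ≤ (eLpNorm f 2 volume).toReal := by
  rw [leray_of_memLp hf, ← Lp.norm_toLp f hf]
  exact solenoidal.norm_starProjection_apply_le _

/-! ### `F` and `ℒ(U)` as bounded polynomial maps -/

theorem D.val_add (v w : D) : (v + w).field.val =ᵐ[volume] fun x => v.field.val x + w.field.val x :=
  Lp.coeFn_add _ _

theorem D.grad_add (v w : D) (i : Fin 3) :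
    (v + w).field.grad i =ᵐ[volume] fun x => v.field.grad i x + w.field.grad i x :=
  Lp.coeFn_add _ _

theorem D.val_smul (c : ℝ) (v : D) : (c • v).field.val =ᵐ[volume] fun x => c • v.field.val x :=
  Lp.coeFn_smul _ _

theorem D.grad_smul (c : ℝ) (v : D) (i : Fin 3) :
    (c • v).field.grad i =ᵐ[volume] fun x => c • v.field.grad i x :=
  Lp.coeFn_smul _ _

theorem adv_add_left (v w : D) (U : GradField) : adv (v + w).field U
    =ᵐ[volume] fun x => adv v.field U x + adv w.field U x := by
  filter_upwards [v.val_add w] with x hx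
  simp only [adv, hx, PiLp.add_apply, add_smul, Finset.sum_add_distrib]

theorem adv_add_right (v w : D) (U : GradField) : adv U (v + w).field
    =ᵐ[volume] fun x => adv U v.field x + adv U w.field x := by
  filter_upwards [ae_all_iff.2 (v.grad_add w)] with x hx
  simp only [adv, hx, smul_add, Finset.sum_add_distrib]

theorem adv_smul_left (c : ℝ) (v : D) (U : GradField) : adv (c • v).field U
    =ᵐ[volume] fun x => c • adv v.field U x := by
  filter_upwards [v.val_smul c] with x hx
  simp only [adv, hx, PiLp.smul_apply, smul_eq_mul, Finset.smul_sum, smul_smul]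

theorem adv_smul_right (c : ℝ) (v : D) (U : GradField) : adv U (c • v).field
    =ᵐ[volume] fun x => c • adv U v.field x := by
  filter_upwards [ae_all_iff.2 (v.grad_smul c)] with x hx
  simp only [adv, hx, Finset.smul_sum]
  exact Finset.sum_congr rfl fun i _ => smul_comm _ _ _

theorem MultField.memLp_left {U : GradField} {H : Fin 3 → Fin 3 → E3 → E3} {N : ℝ}
    (hU : MultField U H N) (φ : D) : MemLp (adv U φ.field) 2 volume := by
  obtain ⟨K, -, hK⟩ := exists_leray_adv
  exact (hK U H N hU φ _ (Or.inl rfl)).1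

theorem MultField.memLp_right {U : GradField} {H : Fin 3 → Fin 3 → E3 → E3} {N : ℝ}
    (hU : MultField U H N) (φ : D) : MemLp (adv φ.field U) 2 volume := by
  obtain ⟨K, -, hK⟩ := exists_leray_adv
  exact (hK U H N hU φ _ (Or.inr rfl)).1

/-- The bilinear map `(v, w) ↦ v · ∇ w + ∇ p`. -/
theorem exists_advB : ∃ B : D →L[ℝ] D →L[ℝ] V,
    ∀ v w, (B v w).toL2 = leray (adv v.field w.field) := by
  obtain ⟨K, hK0, hK⟩ := exists_leray_adv
  choose b hb hbn _ _ using fun v w : D => (hK _ _ _ v.multField w _ (Or.inl rfl)).2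
  have hm : ∀ v w : D, MemLp (adv v.field w.field) 2 volume := fun v w => v.multField.memLp_left w
  refine ⟨LinearMap.mkContinuous₂ (LinearMap.mk₂ ℝ b ?_ ?_ ?_ ?_) K fun v w => ?_, hb⟩
  · intro v v' w
    apply V.toL2_injective
    rw [V.toL2_add, hb, hb, hb, leray_congr (adv_add_left v v' _), leray_add (hm _ _) (hm _ _)]
  · intro c v w
    apply V.toL2_injective
    rw [V.toL2_smul, hb, hb, leray_congr (adv_smul_left c v _), leray_smul _ (hm _ _)]
  · intro v w w'
    apply V.toL2_injective
    rw [V.toL2_add, hb, hb, hb, leray_congr (adv_add_right w w' _), leray_add (hm _ _) (hm _ _)]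
  · intro c v w
    apply V.toL2_injective
    rw [V.toL2_smul, hb, hb, leray_congr (adv_smul_right c w _), leray_smul _ (hm _ _)]
  · exact (hbn v w).trans (le_of_eq (mul_assoc _ _ _).symm)

/-- The linear map `φ ↦ U · ∇ φ + φ · ∇ U + ∇ p`. -/
theorem MultField.exists_advSymL {U : GradField} {H : Fin 3 → Fin 3 → E3 → E3} {N : ℝ}
    (hU : MultField U H N) : ∃ T : D →L[ℝ] V, (∀ φ, (T φ).toL2 = leray (advSym U φ.field)) ∧
      ∃ C, ∀ φ, ∃ G : Fin 3 → L2, (∀ k, IsWeakPartial k (T φ).toL2 (G k)) ∧ ∀ k, ‖G k‖ ≤ C * ‖φ‖ := by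
  obtain ⟨K, hK0, hK⟩ := exists_leray_adv
  choose b hb hbn G hG hGn using fun φ : D => (hK _ _ _ hU φ _ (Or.inl rfl)).2
  choose b' hb' hbn' G' hG' hGn' using fun φ : D => (hK _ _ _ hU φ _ (Or.inr rfl)).2
  have hm := hU.memLp_left
  have hm' := hU.memLp_right
  have hsum : ∀ φ, (b φ + b' φ).toL2 = leray (advSym U φ.field) := fun φ => by
    rw [V.toL2_add, hb, hb', ← leray_add (hm φ) (hm' φ)]
    rfl
  let T : D →ₗ[ℝ] V :=
    { toFun := fun φ => b φ + b' φ
      map_add' := fun φ χ => by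
        apply V.toL2_injective
        simp only [V.toL2_add, hb, hb']
        rw [leray_congr (adv_add_left φ χ _), leray_add (hm' _) (hm' _),
          leray_congr (adv_add_right φ χ _), leray_add (hm _) (hm _)]
        abel
      map_smul' := fun c φ => by
        apply V.toL2_injective
        simp only [V.toL2_add, V.toL2_smul, hb, hb', RingHom.id_apply]
        rw [leray_congr (adv_smul_left c φ _), leray_smul _ (hm' _),
          leray_congr (adv_smul_right c φ _), leray_smul _ (hm _), smul_add] }
  refine ⟨T.mkContinuous (2 * K * N) fun φ => (norm_add_le _ _).trans ?_, hsum, 2 * K * N, fun φ =>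
    ⟨fun k => G φ k + G' φ k, fun k => (hG φ k).add (hG' φ k), fun k => (norm_add_le _ _).trans ?_⟩⟩
  · have h1 := hbn φ
    have h2 := hbn' φ
    linarith
  · have h1 := hGn φ k
    have h2 := hGn' φ k
    linarith

theorem exists_linPart : ∃ L : D →L[ℝ] V, ∀ v, (L v).toL2 = linPart v := by
  let f : D → V := fun v => -(∑ i, v.partial₂ i i) - (1 / 2 : ℝ) • v.radial - (1 / 2 : ℝ) • v.toV
  let T : D →ₗ[ℝ] V :=
    { toFun := f
      map_add' := fun v w => by
        change -(∑ i, (v.partial₂ i i + w.partial₂ i i)) - (1 / 2 : ℝ) • (v.radial + w.radial)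
          - (1 / 2 : ℝ) • (v.toV + w.toV) = _
        simp only [f, Finset.sum_add_distrib, smul_add]
        abel
      map_smul' := fun c v => by
        change -(∑ i, c • v.partial₂ i i) - (1 / 2 : ℝ) • (c • v.radial)
          - (1 / 2 : ℝ) • (c • v.toV) = c • f v
        simp only [f, ← Finset.smul_sum]
        module }
  refine ⟨T.mkContinuous 4 fun v => ?_, fun v => ?_⟩
  · have h1 : ‖∑ i, v.partial₂ i i‖ ≤ 3 * ‖v‖ := by
      refine (norm_sum_le _ _).trans
          ((Finset.sum_le_sum fun i _ => v.norm_partial₂_le i i).trans ?_)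
      simp
    have h2 := v.norm_radial_le
    have h3 := v.norm_toV_le
    refine (norm_sub_le _ _).trans ((add_le_add_left (norm_sub_le _ _) _).trans ?_)
    rw [norm_neg, norm_smul, norm_smul]
    norm_num
    linarith
  · have : (∑ i, v.partial₂ i i).toL2 = ∑ i, (v.partial₂ i i).toL2 := 
      map_sum V.toL2L (fun i => v.partial₂ i i) Finset.univ
    change V.toL2 (f v) = _
    simp only [f, linPart, V.toL2_sub, V.toL2_neg, V.toL2_smul, this]

theorem integrable_pow_neg_four : Integrable (fun x : E3 => (1 + ‖x‖) ^ (-4 : ℝ)) volume :=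
  integrable_one_add_norm (by rw [finrank_euclideanSpace, Fintype.card_fin]; norm_num)

/-- Quadratic decay is square integrable in three dimensions since 4 > 3. -/
theorem memLp_of_sq_decay {F : Type*} [NormedAddCommGroup F] {f : E3 → F}
    (hf : AEStronglyMeasurable f volume) {C : ℝ} (h : ∀ x, (1 + ‖x‖) ^ 2 * ‖f x‖ ≤ C) :
    MemLp f 2 volume := by
  rw [memLp_two_iff_integrable_sq_norm hf]
  refine (integrable_pow_neg_four.const_mul (C ^ 2)).mono' (hf.norm.pow 2) (ae_of_all _ fun x => ?_)
  have h0 : 0 < 1 + ‖x‖ := by linarith [norm_nonneg x]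
  rw [Real.rpow_neg h0.le, ← div_eq_mul_inv, le_div_iff₀ (Real.rpow_pos_of_pos h0 _),
    Real.norm_of_nonneg (by positivity), show ((4 : ℝ) = (4 : ℕ)) by norm_num, Real.rpow_natCast]
  calc ‖f x‖ ^ 2 * (1 + ‖x‖) ^ 4 = ((1 + ‖x‖) ^ 2 * ‖f x‖) ^ 2 := by ring
    _ ≤ C ^ 2 := by
        have := h x
        gcongr

/-- This term is not covered by the bounds for a multiplier field and an element of 𝒟, because decay
1/|x| does not put A₀ in L². But A₀ is bounded, and its first and second derivatives decay
quadratically, so the product is still in H¹. -/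
theorem IsScaleInvariantDatum.exists_leray_adv_heat {a₀ : E3 → E3} (ha : IsScaleInvariantDatum a₀) :
    MemLp (adv (heatField a₀) (heatField a₀)) 2 volume ∧
      ∃ w : V, w.toL2 = leray (adv (heatField a₀) (heatField a₀)) := by
  obtain ⟨C, hC0, hC⟩ := ha.exists_bound_heatExt
  obtain ⟨K, hK0, hK⟩ := exists_leray_of_comp
  obtain ⟨N, hN⟩ := ha.exists_multField
  have b0 : ∀ x, ‖heatExt a₀ x‖ ≤ C := fun x => norm_le_of_pow_mul_le 1 (by simpa using (hC x).1)
  have b1 : ∀ i x, ‖pd i (heatExt a₀) x‖ ≤ C := fun i x => norm_le_of_pow_mul_le 2 ((hC x).2.1 i)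
  have m1 : ∀ i a, MemLp (fun x => (pd i (heatExt a₀) x) a) 2 volume := fun i a =>
    memLp_apply (memLp_of_sq_decay (ha.differentiable_pd_heatExt i).continuous.aestronglyMeasurable
      fun x => (hC x).2.1 i) a
  have m2 : ∀ i j a, MemLp (fun x => (pd j (pd i (heatExt a₀)) x) a) 2 volume := fun i j a =>
    memLp_apply (memLp_of_sq_decay (ha.continuous_pd_pd_heatExt j i).aestronglyMeasurable
      fun x => (hC x).2.2 j i) a
  have hw : ∀ i k b, HasWeakPD k (fun x => (pd i (heatExt a₀) x) b)
      (fun x => (pd k (pd i (heatExt a₀)) x) b) := fun i k b => by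
    have hd : Differentiable ℝ fun x => (pd i (heatExt a₀) x) b := fun x =>
      ((EuclideanSpace.proj b : E3 →L[ℝ] ℝ).hasFDerivAt.comp x
        (ha.differentiable_pd_heatExt i x).hasFDerivAt).differentiableAt
    have he : pd k (fun x => (pd i (heatExt a₀) x) b) = fun x => (pd k (pd i (heatExt a₀)) x) b :=
      funext fun x => pd_apply (ha.differentiable_pd_heatExt i x) k b
    rw [← he]
    exact HasWeakPD.of_differentiable hd (m1 i b) (by rw [he]; exact m2 i k b)
  have hbdd : ∀ {p q : E3 → ℝ}, Continuous p → (∀ x, |p x| ≤ C) → MemLp q 2 volume →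
      MemLp (fun x => p x * q x) 2 volume := fun {p q} hp hpC hq =>
    MemLp.of_le_mul (c := C) hq (hp.aestronglyMeasurable.mul hq.1) (ae_of_all _ fun x => by
      rw [norm_mul]
      exact mul_le_mul_of_nonneg_right (hpC x) (norm_nonneg _))
  have c0 : ∀ a, Continuous fun x => heatExt a₀ x a := fun a =>
    (EuclideanSpace.proj a : E3 →L[ℝ] ℝ).continuous.comp ha.differentiable_heatExt.continuous
  have c1 : ∀ i a, Continuous fun x => pd i (heatExt a₀) x a := fun i a =>
    (EuclideanSpace.proj a : E3 →L[ℝ] ℝ).continuous.comp (ha.differentiable_pd_heatExt i).continuous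
  have p0 : ∀ i b, MemLp (fun x => heatExt a₀ x i * (pd i (heatExt a₀) x) b) 2 volume := fun i b =>
    hbdd (c0 i) (fun x => (abs_apply_le _ i).trans (b0 x)) (m1 i b)
  have p1 : ∀ i k b, MemLp (fun x => (pd k (heatExt a₀) x) i * (pd i (heatExt a₀) x) b
      + heatExt a₀ x i * (pd k (pd i (heatExt a₀)) x) b) 2 volume := fun i k b =>
    (hbdd (c1 k i) (fun x => (abs_apply_le _ i).trans (b1 k x)) (m1 i b)).add
      (hbdd (c0 i) (fun x => (abs_apply_le _ i).trans (b0 x)) (m2 i k b))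
  have hwp : ∀ k b, HasWeakPD k (fun x => (adv (heatField a₀) (heatField a₀) x) b)
      (fun x => ∑ i, ((pd k (heatExt a₀) x) i * (pd i (heatExt a₀) x) b
        + heatExt a₀ x i * (pd k (pd i (heatExt a₀)) x) b)) := fun k b => by
    simp only [adv_apply]
    exact HasWeakPD.sum _ fun i _ => (hN.val_loc i k).mul (hw i k b) (p0 i b) (p1 i k b)
  have hfin : ∀ {f : E3 → ℝ}, MemLp f 2 volume →
      eLpNorm f 2 volume = ENNReal.ofReal (eLpNorm f 2 volume).toReal := fun h =>
    (ENNReal.ofReal_toReal h.2.ne).symm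
  set R := (∑ b, (eLpNorm (fun x => (adv (heatField a₀) (heatField a₀) x) b) 2 volume).toReal)
    + ∑ k, ∑ b, (eLpNorm (fun x => ∑ i, ((pd k (heatExt a₀) x) i * (pd i (heatExt a₀) x) b
        + heatExt a₀ x i * (pd k (pd i (heatExt a₀)) x) b)) 2 volume).toReal with hRdef
  obtain ⟨h1, w, h2, -⟩ := hK _ _ R (by positivity) hwp (fun b => by
      rw [hfin (hwp 0 b).left]
      refine ENNReal.ofReal_le_ofReal (le_trans ?_ (le_add_of_nonneg_right (by positivity)))
      exact Finset.single_le_sum (f := fun b => (eLpNorm (fun x =>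
        (adv (heatField a₀) (heatField a₀) x) b) 2 volume).toReal)
        (fun _ _ => ENNReal.toReal_nonneg) (Finset.mem_univ b)) (fun k b => by
      rw [hfin (hwp k b).right]
      refine ENNReal.ofReal_le_ofReal (le_trans ?_ (le_add_of_nonneg_left (by positivity)))
      refine le_trans ?_ (Finset.single_le_sum (fun k _ => by positivity) (Finset.mem_univ k))
      exact Finset.single_le_sum (f := fun b => (eLpNorm (fun x => ∑ i, ((pd k (heatExt a₀) x) i
        * (pd i (heatExt a₀) x) b + heatExt a₀ x i * (pd k (pd i (heatExt a₀)) x) b)) 2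
          volume).toReal) (fun _ _ => ENNReal.toReal_nonneg) (Finset.mem_univ b))
  exact ⟨h1, w, h2⟩

theorem HasLocWeakPD.add {k : Fin 3} {f f' g g' : E3 → ℝ} (hf : HasLocWeakPD k f f')
    (hg : HasLocWeakPD k g g') : HasLocWeakPD k (fun x => f x + g x) (fun x => f' x + g' x) :=
  fun η hη => ((hf η hη).add (hg η hη)).congr (ae_of_all _ fun x => by simp only []; ring)
    (ae_of_all _ fun x => by simp only []; ring)

theorem HasLocWeakPD.const_mul {k : Fin 3} {f f' : E3 → ℝ} (c : ℝ) (hf : HasLocWeakPD k f f') :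
    HasLocWeakPD k (fun x => c * f x) (fun x => c * f' x) :=
  fun η hη => ((hf η hη).const_mul c).congr (ae_of_all _ fun x => by simp only []; ring)
    (ae_of_all _ fun x => by simp only []; ring)

theorem IsScaleInvariantDatum.exists_multField_profile {a₀ : E3 → E3}
    (ha : IsScaleInvariantDatum a₀) (σ : ℝ) (v : D) : ∃ N, MultField (profile a₀ σ v)
      (fun i j x => σ • pd j (pd i (heatExt a₀)) x + (v.partial₂ i j).toL2 x) N := by
  obtain ⟨N, hN⟩ := ha.exists_multField
  have hv := v.multField
  have h0 : 0 ≤ |σ| * N := mul_nonneg (abs_nonneg _) hN.nonneg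
  exact ⟨|σ| * N + ‖v‖, add_nonneg h0 hv.nonneg,
    fun a k => ((hN.val_loc a k).const_mul σ).add (hv.val_loc a k),
    fun i j a => ((hN.grad_loc i j a).const_mul σ).add (hv.grad_loc i j a),
    fun a => ((hN.val_mult a).const_mul σ).add (hv.val_mult a) h0 hv.nonneg,
    fun i a => ((hN.grad_mult i a).const_mul σ).add (hv.grad_mult i a) h0 hv.nonneg,
    fun i j a => ((hN.hess_mult i j a).const_mul σ).add (hv.hess_mult i j a) h0 hv.nonneg⟩

theorem adv_profile (a₀ : E3 → E3) (σ : ℝ) (v : D) :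
    adv (profile a₀ σ v) (profile a₀ σ v) = fun x =>
      (σ ^ 2 • adv (heatField a₀) (heatField a₀) x + σ • advSym (heatField a₀) v.field x)
        + adv v.field v.field x := by
  ext1 x
  simp only [adv, advSym, profile, heatField, PiLp.add_apply, PiLp.smul_apply, smul_eq_mul,
    Finset.smul_sum, smul_add, ← Finset.sum_add_distrib]
  refine Finset.sum_congr rfl fun i _ => ?_
  module

theorem advSym_profile (a₀ : E3 → E3) (σ : ℝ) (v φ : D) :
    advSym (profile a₀ σ v) φ.field = fun x => σ • advSym (heatField a₀) φ.field x
      + (adv v.field φ.field x + adv φ.field v.field x) := by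
  ext1 x
  simp only [adv, advSym, profile, heatField, PiLp.add_apply, PiLp.smul_apply, smul_eq_mul,
    Finset.smul_sum, smul_add, ← Finset.sum_add_distrib]
  refine Finset.sum_congr rfl fun i _ => ?_
  module

theorem MultField.memLp_advSym {U : GradField} {H : Fin 3 → Fin 3 → E3 → E3} {N : ℝ}
    (hU : MultField U H N) (φ : D) : MemLp (advSym U φ.field) 2 volume :=
  (hU.memLp_left φ).add (hU.memLp_right φ)

theorem IsScaleInvariantDatum.memLp_adv_profile {a₀ : E3 → E3} (ha : IsScaleInvariantDatum a₀)
    (σ : ℝ) (v : D) : MemLp (adv (profile a₀ σ v) (profile a₀ σ v)) 2 volume := by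
  obtain ⟨N, hN⟩ := ha.exists_multField
  have h1 : MemLp (fun x => σ ^ 2 • adv (heatField a₀) (heatField a₀) x) 2 volume :=
    ha.exists_leray_adv_heat.1.const_smul (σ ^ 2)
  have h2 : MemLp (fun x => σ • advSym (heatField a₀) v.field x) 2 volume :=
    (hN.memLp_advSym v).const_smul σ
  rw [adv_profile]
  exact (h1.add h2).add (v.multField.memLp_left v)

/-- `F` and `ℒ(σ A₀ + v)` as maps into `𝒱`. -/
theorem IsScaleInvariantDatum.exists_maps {a₀ : E3 → E3} (ha : IsScaleInvariantDatum a₀) :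
    ∃ (L T : D →L[ℝ] V) (B : D →L[ℝ] D →L[ℝ] V) (a : V), (∀ v, (L v).toL2 = linPart v) ∧
      (∀ v w, (B v w).toL2 = leray (adv v.field w.field)) ∧
      (∀ v σ, (L v + σ ^ 2 • a + σ • T v + B v v).toL2 = F a₀ v σ) ∧
      ∀ v σ φ, (L φ + σ • T φ + B v φ + B φ v).toL2 = lin (profile a₀ σ v) φ := by
  obtain ⟨L, hL⟩ := exists_linPart
  obtain ⟨B, hB⟩ := exists_advB
  obtain ⟨N, hN⟩ := ha.exists_multField
  obtain ⟨T, hT, -⟩ := hN.exists_advSymL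
  obtain ⟨hm, a, hA⟩ := ha.exists_leray_adv_heat
  refine ⟨L, T, B, a, hL, hB, fun v σ => ?_, fun v σ φ => ?_⟩
  · have h1 : MemLp (fun x => σ ^ 2 • adv (heatField a₀) (heatField a₀) x) 2 volume :=
      hm.const_smul (σ ^ 2)
    have h2 : MemLp (fun x => σ • advSym (heatField a₀) v.field x) 2 volume :=
      (hN.memLp_advSym v).const_smul σ
    have h3 : MemLp (fun x => σ ^ 2 • adv (heatField a₀) (heatField a₀) x
      + σ • advSym (heatField a₀) v.field x) 2 volume := h1.add h2
    simp only [V.toL2_add, V.toL2_smul, hL, hB, hT, hA, F]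
    rw [adv_profile, leray_add h3 (v.multField.memLp_left v), leray_add h1 h2,
      leray_smul _ hm, leray_smul _ (hN.memLp_advSym v)]
    abel
  · have h1 : MemLp (fun x => σ • advSym (heatField a₀) φ.field x) 2 volume :=
      (hN.memLp_advSym φ).const_smul σ
    have h2 : MemLp (fun x => adv v.field φ.field x + adv φ.field v.field x) 2 volume :=
      (v.multField.memLp_left φ).add (v.multField.memLp_right φ)
    simp only [V.toL2_add, V.toL2_smul, hL, hB, hT, lin]
    rw [advSym_profile, leray_add h1 h2, leray_smul _ (hN.memLp_advSym φ),
      leray_add (v.multField.memLp_left φ) (v.multField.memLp_right φ)]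
    abel

/-! ### Integration by parts for locally weakly differentiable functions -/

/-- A cut-off equal to 1 around the support of η, inserted next to η at no cost: it turns a second,
only locally integrable, factor into an L² function. -/
theorem IsTest.exists_eq_one {η : E3 → ℝ} (hη : IsTest η) : ∃ χ : E3 → ℝ, IsTest χ ∧
    (∀ x, χ x * η x = η x) ∧ (∀ k x, SelfSimilarNS.pd k χ x * η x = 0) ∧
    ∀ k x, χ x * SelfSimilarNS.pd k η x = SelfSimilarNS.pd k η x := by
  obtain ⟨R, hR0, hR⟩ := hη.compact.isCompact.isBounded.exists_pos_norm_lt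
  let χ : ContDiffBump (0 : E3) := ⟨R, R + 1, hR0, by linarith⟩
  have hball : ∀ x, x ∉ Metric.ball (0 : E3) R → x ∉ tsupport η := fun x hx hmem =>
    hx (mem_ball_zero_iff.2 (hR x hmem))
  have hχ1 : ∀ x ∈ Metric.ball (0 : E3) R, (χ : E3 → ℝ) =ᶠ[𝓝 x] fun _ => 1 := fun x hx => by
    filter_upwards [Metric.isOpen_ball.mem_nhds hx] with y hy
    exact χ.one_of_mem_closedBall (Metric.ball_subset_closedBall hy)
  refine ⟨χ, ⟨χ.contDiff, χ.hasCompactSupport⟩, fun x => ?_, fun k x => ?_, fun k x => ?_⟩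
  · by_cases hx : x ∈ Metric.ball (0 : E3) R
    · rw [(hχ1 x hx).self_of_nhds, one_mul]
    · rw [image_eq_zero_of_notMem_tsupport (hball x hx), mul_zero]
  · by_cases hx : x ∈ Metric.ball (0 : E3) R
    · rw [SelfSimilarNS.pd, (hχ1 x hx).fderiv_eq, fderiv_fun_const]
      simp
    · rw [image_eq_zero_of_notMem_tsupport (hball x hx), mul_zero]
  · by_cases hx : x ∈ Metric.ball (0 : E3) R
    · rw [(hχ1 x hx).self_of_nhds, one_mul]
    · rw [SelfSimilarNS.pd, fderiv_of_notMem_tsupport ℝ (hball x hx), _root_.zero_apply, mul_zero]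

/-- Integration by parts in H¹ for ηf and χg, where χ = 1 near the support of η; the terms with
derivatives of χ vanish. -/
theorem HasLocWeakPD.integral_mul {k : Fin 3} {f f' g g' η : E3 → ℝ} (hf : HasLocWeakPD k f f')
    (hg : HasLocWeakPD k g g') (hη : IsTest η) :
    ∫ x, (pd k η x * f x + η x * f' x) * g x = - ∫ x, η x * f x * g' x := by
  obtain ⟨χ, hχ, h1, h2, h3⟩ := hη.exists_eq_one
  have h := (hf η hη).integral_mul (hg χ hχ)
  calc _ = ∫ x, (pd k η x * f x + η x * f' x) * (χ x * g x) := by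
        refine integral_congr_ae (ae_of_all _ fun x => ?_)
        simp only []
        rw [← h1 x, ← h3 k x]
        have e1 := h1 x
        have e2 := h3 k x
        rw [← sub_eq_zero] at e1 e2
        linear_combination (-(1 + χ x) * f' x * g x + f' x * g x) * e1
          + (-(1 + χ x) * f x * g x + f x * g x) * e2
    _ = _ := by
        rw [h]
        congr 1
        refine integral_congr_ae (ae_of_all _ fun x => ?_)
        linear_combination (f x * g x) * h2 k x + (f x * g' x) * h1 x

theorem HasLocWeakPD.integrable {k : Fin 3} {f f' η : E3 → ℝ} (hf : HasLocWeakPD k f f')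
    (hη : IsTest η) : Integrable (fun x => η x * f x) volume := by
  obtain ⟨χ, hχ, h1, -, -⟩ := hη.exists_eq_one
  refine (integrable_mul_of_memLp (hχ.memLp 2) (hf η hη).left).congr (ae_of_all _ fun x => ?_)
  linear_combination f x * h1 x

theorem HasLocWeakPD.integrable' {k : Fin 3} {f f' η : E3 → ℝ} (hf : HasLocWeakPD k f f')
    (hη : IsTest η) : Integrable (fun x => η x * f' x) volume := by
  obtain ⟨χ, hχ, h1, -, h3⟩ := hη.exists_eq_one
  refine ((integrable_mul_of_memLp (hχ.memLp 2) (hf η hη).right).sub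
    (hf.integrable (hη.pd k))).congr (ae_of_all _ fun x => ?_)
  simp only [Pi.sub_apply]
  linear_combination f' x * h1 x + f x * h3 k x

theorem HasLocWeakPD.integral_pd_mul {k : Fin 3} {f f' η : E3 → ℝ} (hf : HasLocWeakPD k f f')
    (hη : IsTest η) : ∫ x, pd k η x * f x = - ∫ x, η x * f' x := by
  have h := hf.integral_mul (HasLocWeakPD.of_smooth (f := fun _ => (1 : ℝ)) contDiff_const k) hη
  have h0 : pd k (fun _ : E3 => (1 : ℝ)) = fun _ => 0 := by ext x; simp [pd]
  rw [h0] at h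
  simp only [mul_one, mul_zero, integral_zero, neg_zero] at h
  rw [integral_add (hf.integrable (hη.pd k)) (hf.integrable' hη)] at h
  linarith

theorem pd_coord_mul {η : E3 → ℝ} (hη : IsTest η) (k i : Fin 3) (x : E3) :
    pd k (fun y => y i * η y) x = (if i = k then η x else 0) + x i * pd k η x := by
  have h1 : HasFDerivAt (fun y : E3 => y i) (EuclideanSpace.proj i : E3 →L[ℝ] ℝ) x :=
    (EuclideanSpace.proj i : E3 →L[ℝ] ℝ).hasFDerivAt
  rw [pd_mul k h1.differentiableAt (hη.differentiable x), pd, h1.fderiv]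
  simp [e, eq_comm]

/-- `f` is integrable with integral `c`. -/
structure HasInt (f : E3 → ℝ) (c : ℝ) : Prop where
  int : Integrable f volume
  eq : ∫ x, f x = c

theorem HasInt.of_integrable {f : E3 → ℝ} (h : Integrable f volume) : HasInt f (∫ x, f x) :=
    ⟨h, rfl⟩

theorem HasInt.of_memLp {f g : E3 → ℝ} (hf : MemLp f 2 volume) (hg : MemLp g 2 volume) :
    HasInt (fun x => f x * g x) (∫ x, f x * g x) := ⟨integrable_mul_of_memLp hf hg, rfl⟩

theorem HasInt.add {f g : E3 → ℝ} {c d : ℝ} (hf : HasInt f c) (hg : HasInt g d) :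
    HasInt (fun x => f x + g x) (c + d) :=
  ⟨hf.int.add hg.int, by rw [integral_add hf.int hg.int, hf.eq, hg.eq]⟩

theorem HasInt.sub {f g : E3 → ℝ} {c d : ℝ} (hf : HasInt f c) (hg : HasInt g d) :
    HasInt (fun x => f x - g x) (c - d) :=
  ⟨hf.int.sub hg.int, by rw [integral_sub hf.int hg.int, hf.eq, hg.eq]⟩

theorem HasInt.const_mul {f : E3 → ℝ} {c : ℝ} (r : ℝ) (hf : HasInt f c) :
    HasInt (fun x => r * f x) (r * c) :=
  ⟨hf.int.const_mul r, by rw [integral_const_mul, hf.eq]⟩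

theorem HasInt.sum {ι : Type*} [Fintype ι] {f : ι → E3 → ℝ} {c : ι → ℝ}
    (h : ∀ i, HasInt (f i) (c i)) : HasInt (fun x => ∑ i, f i x) (∑ i, c i) :=
  ⟨integrable_finsetSum _ fun i _ => (h i).int, by
    rw [integral_finsetSum _ fun i _ => (h i).int]
    exact Finset.sum_congr rfl fun i _ => (h i).eq⟩

theorem HasInt.congr {f g : E3 → ℝ} {c d : ℝ} (h : HasInt f c) (hfg : f =ᵐ[volume] g)
    (hcd : c = d) : HasInt g d :=
  ⟨h.int.congr hfg, by rw [← integral_congr_ae hfg, h.eq, hcd]⟩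

/-- The formal adjoint of Δ + (x/2)·∇ + 1/2 is Δ - (x/2)·∇ - 1: the divergence of x/2 is 3/2, and
-3/2 + 1/2 = -1. -/
theorem MultField.integral_adjoint {U : GradField} {H : Fin 3 → Fin 3 → E3 → E3} {N : ℝ}
    (hU : MultField U H N) {η : E3 → ℝ} (hη : IsTest η) (a : Fin 3) :
    ∫ x, U.val x a * (∑ i, pd i (pd i η) x - 1 / 2 * ∑ i, x i * pd i η x - η x)
      = ∫ x, η x * (∑ i, H i i x a + 1 / 2 * ∑ i, x i * U.grad i x a + 1 / 2 * U.val x a) := by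
  have hv := hU.val_loc a
  have hg := hU.grad_loc
  have h0 : HasInt (fun x => η x * U.val x a) _ := .of_integrable ((hv 0).integrable hη)
  have h1 : ∀ i, HasInt (fun x => η x * H i i x a) _ := fun i =>
    .of_integrable ((hg i i a).integrable' hη)
  have h2 : ∀ i, HasInt (fun x => (x i * η x) * U.grad i x a) _ := fun i =>
    .of_integrable ((hv i).integrable' (isTest_coord_mul hη i))
  have h3 : ∀ i, HasInt (fun x => pd i (pd i η) x * U.val x a) (∫ x, η x * H i i x a) := fun i =>
    ⟨(hv i).integrable ((hη.pd i).pd i), by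
      rw [(hv i).integral_pd_mul (hη.pd i), (hg i i a).integral_pd_mul hη, neg_neg]⟩
  have h4 : ∀ i, HasInt (fun x => pd i (fun y => y i * η y) x * U.val x a)
      (- ∫ x, (x i * η x) * U.grad i x a) := fun i =>
    ⟨(hv i).integrable ((isTest_coord_mul hη i).pd i),
      (hv i).integral_pd_mul (isTest_coord_mul hη i)⟩
  have lhs := ((HasInt.sum h3).sub ((HasInt.sum h4).const_mul (1 / 2))).add (h0.const_mul (1 / 2))
  have rhs := ((HasInt.sum h1).add ((HasInt.sum h2).const_mul (1 / 2))).add (h0.const_mul (1 / 2))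
  refine (lhs.congr (ae_of_all _ fun x => ?_) ?_).eq.trans
    (rhs.congr (ae_of_all _ fun x => ?_) rfl).eq.symm
  · simp only [pd_coord_mul hη, if_true, Fin.sum_univ_three]
    ring
  · rw [Finset.sum_neg_distrib]
    ring
  · simp only [Fin.sum_univ_three]
    ring

/-! ### The pressure -/

theorem D.div_eq_zero (v : D) : ∀ᵐ x : E3, ∑ a, (v.partial a).comp a x = 0 := by
  refine ae_eq_zero_of_integral_contDiff_smul_eq_zero ?_ fun η h1 h2 => ?_
  · refine MemLp.locallyIntegrable (p := 2) ?_ (by norm_num)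
    exact memLp_finsetSum _ fun a _ => (v.partial a).memLp_two a
  · have hη : IsTest η := ⟨h1, h2⟩
    have h3 := mem_solenoidal_iff.1 v.toV.2.1 η hη
    simp only [smul_eq_mul, Finset.mul_sum]
    rw [integral_finsetSum _ fun a _ => integrable_mul_of_memLp (hη.memLp 2)
        ((v.partial a).memLp_two a)]
    have h4 : ∀ a, ∫ x, η x * (v.partial a).comp a x = - ∫ x, pd a η x * v.toV.comp a x :=
        fun a => by
      rw [(v.hasWeakPD a a).weak η hη, neg_neg]
    simp only [h4, Finset.sum_neg_distrib]
    simp only [mul_zero, integral_zero, neg_zero] at h3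
    exact neg_eq_zero.2 h3

theorem IsScaleInvariantDatum.div_profile {a₀ : E3 → E3} (ha : IsScaleInvariantDatum a₀) (σ : ℝ)
    (v : D) : ∀ᵐ x : E3, ∑ a, (profile a₀ σ v).grad a x a = 0 := by
  filter_upwards [v.div_eq_zero] with x hx
  have h := ha.div_heatExt x
  calc _ = σ * ∑ a, (pd a (heatExt a₀) x) a + ∑ a, (v.partial a).comp a x := by
        rw [Finset.mul_sum, ← Finset.sum_add_distrib]; rfl
    _ = 0 := by rw [h, hx]; ring

/-- The tensor U ⊗ U is in L² although U need not be: A₀ ⊗ A₀ decays quadratically, and every other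
product has a factor v and a multiplier. This is what gives a pressure in L². -/
theorem IsScaleInvariantDatum.memLp_profile_mul {a₀ : E3 → E3} (ha : IsScaleInvariantDatum a₀)
    (σ : ℝ) (v : D) (i j : Fin 3) :
    MemLp (fun x => (profile a₀ σ v).val x j * (profile a₀ σ v).val x i) 2 volume := by
  obtain ⟨N, hN⟩ := ha.exists_multField
  obtain ⟨N', hN'⟩ := ha.exists_multField_profile σ v
  obtain ⟨C, hC0, hC⟩ := ha.exists_bound_heatExt
  have c0 : ∀ a, Continuous fun x => heatExt a₀ x a := fun a =>
    (EuclideanSpace.proj a : E3 →L[ℝ] ℝ).continuous.comp ha.differentiable_heatExt.continuous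
  have h1 : MemLp (fun x => heatExt a₀ x j * heatExt a₀ x i) 2 volume := by
    refine memLp_of_sq_decay (C := C ^ 2) ((c0 j).mul (c0 i)).aestronglyMeasurable fun x => ?_
    have h := (hC x).1
    have h0 : 0 ≤ 1 + ‖x‖ := by positivity
    rw [norm_mul]
    calc (1 + ‖x‖) ^ 2 * (‖heatExt a₀ x j‖ * ‖heatExt a₀ x i‖)
        ≤ (1 + ‖x‖) ^ 2 * (‖heatExt a₀ x‖ * ‖heatExt a₀ x‖) := by
          gcongr
          · exact abs_apply_le _ j
          · exact abs_apply_le _ i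
      _ = ((1 + ‖x‖) * ‖heatExt a₀ x‖) ^ 2 := by ring
      _ ≤ C ^ 2 := by gcongr
  have h2 := (hN'.val_mult j).memLp v.toV i
  have h3 := ((hN.val_mult i).memLp v.toV j).const_mul σ
  refine ((h2.add h3).add (h1.const_mul (σ ^ 2))).ae_eq (ae_of_all _ fun x => ?_)
  simp only [Pi.add_apply, profile, heatField, PiLp.add_apply, PiLp.smul_apply, smul_eq_mul,
    D.field, V.comp]
  ring

/-- `∑ₖ ∂ₖ (Uₖ Uᵢ) = U · ∇ Uᵢ` for divergence-free `U`. -/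
theorem IsScaleInvariantDatum.isWeakDiv_profile {a₀ : E3 → E3} (ha : IsScaleInvariantDatum a₀)
    (σ : ℝ) (v : D) (i : Fin 3) :
    IsWeakDiv (fun k x => (profile a₀ σ v).val x k * (profile a₀ σ v).val x i)
      (fun x => adv (profile a₀ σ v) (profile a₀ σ v) x i) := by
  intro η hη
  obtain ⟨N, hN⟩ := ha.exists_multField_profile σ v
  set U := profile a₀ σ v
  have h1 : ∀ k, ∫ x, (pd k η x * U.val x i + η x * U.grad k x i) * U.val x k
      = - ∫ x, η x * U.val x i * U.grad k x k := fun k =>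
    (hN.val_loc i k).integral_mul (hN.val_loc k k) hη
  obtain ⟨χ, hχ, e1, -, e3⟩ := hη.exists_eq_one
  have hL2 : ∀ {ζ : E3 → ℝ}, IsTest ζ → ∀ a, MemLp (fun x => ζ x * U.val x a) 2 volume :=
    fun hζ a => (hN.val_loc a 0 _ hζ).left
  have hL2' : ∀ {ζ : E3 → ℝ}, IsTest ζ → ∀ a k, MemLp (fun x => ζ x * U.grad k x a) 2 volume :=
    fun hζ a k => (hN.grad_loc k 0 a _ hζ).left
  have i1 : ∀ k, Integrable (fun x => pd k η x * (U.val x k * U.val x i)) volume := fun k =>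
    (integrable_mul_of_memLp (hL2 (hη.pd k) k) (hL2 hχ i)).congr (ae_of_all _ fun x => by
      linear_combination (U.val x k * U.val x i) * e3 k x)
  have i2 : ∀ k, Integrable (fun x => η x * (U.val x k * U.grad k x i)) volume := fun k =>
    (integrable_mul_of_memLp (hL2 hη k) (hL2' hχ i k)).congr (ae_of_all _ fun x => by
      linear_combination (U.val x k * U.grad k x i) * e1 x)
  have i3 : ∀ k, Integrable (fun x => η x * U.val x i * U.grad k x k) volume := fun k =>
    (integrable_mul_of_memLp (hL2 hη i) (hL2' hχ k k)).congr (ae_of_all _ fun x => by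
      linear_combination (U.val x i * U.grad k x k) * e1 x)
  have h2 : ∑ k, ∫ x, η x * U.val x i * U.grad k x k = 0 := by
    rw [← integral_finsetSum _ fun k _ => i3 k, ← integral_zero E3 ℝ (μ := volume)]
    refine integral_congr_ae ?_
    filter_upwards [ha.div_profile σ v] with x hx
    rw [← Finset.mul_sum, hx, mul_zero]
  have h3 : ∀ k, (∫ x, pd k η x * (U.val x k * U.val x i))
      + ∫ x, η x * (U.val x k * U.grad k x i) = - ∫ x, η x * U.val x i * U.grad k x k := fun k => by
    rw [← h1, ← integral_add (i1 k) (i2 k)]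
    refine integral_congr_ae (ae_of_all _ fun x => ?_)
    simp only []
    ring
  have h4 : ∫ x, η x * adv U U x i = ∑ k, ∫ x, η x * (U.val x k * U.grad k x i) := by
    rw [← integral_finsetSum _ fun k _ => i2 k]
    simp only [adv_apply, Finset.mul_sum]
  rw [h4, ← sub_eq_zero, sub_neg_eq_add, ← Finset.sum_add_distrib,
      Finset.sum_congr rfl fun k _ => h3 k,
    Finset.sum_neg_distrib, h2, neg_zero]

/-- The Laplacian of an element of `𝒟`. -/
def D.lap (v : D) : V := ∑ i, v.partial₂ i i

theorem D.lap_comp (v : D) (a : Fin 3) :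
    v.lap.comp a =ᵐ[volume] fun x => ∑ i, (v.partial₂ i i).comp a x := by
  have h : v.lap.toL2 = ∑ i, (v.partial₂ i i).toL2 :=
    map_sum V.toL2L (fun i => v.partial₂ i i) Finset.univ
  have h1 : (v.lap.toL2 : E3 → E3) =ᵐ[volume] fun x => ∑ i, (v.partial₂ i i).toL2 x := by
    rw [h, Fin.sum_univ_three]
    filter_upwards [Lp.coeFn_add ((v.partial₂ 0 0).toL2 + (v.partial₂ 1 1).toL2)
        (v.partial₂ 2 2).toL2,
      Lp.coeFn_add (v.partial₂ 0 0).toL2 (v.partial₂ 1 1).toL2] with x h1 h2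
    rw [h1, Pi.add_apply, h2, Pi.add_apply, Fin.sum_univ_three]
  filter_upwards [h1] with x hx
  simp [V.comp, hx]

theorem D.linPart_apply (v : D) (a : Fin 3) : (fun x => linPart v x a) =ᵐ[volume] fun x =>
    -v.lap.comp a x - 1 / 2 * ∑ i, x i * (v.partial i).comp a x - 1 / 2 * v.toV.comp a x := by
  have h : linPart v = -v.lap.toL2 - (1 / 2 : ℝ) • v.radial.toL2 - (1 / 2 : ℝ) • v.toV.toL2 := by
    have h : v.lap.toL2 = ∑ i, (v.partial₂ i i).toL2 :=
      map_sum V.toL2L (fun i => v.partial₂ i i) Finset.univ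
    rw [linPart, h]
  rw [h]
  filter_upwards [Lp.coeFn_sub (-v.lap.toL2 - (1 / 2 : ℝ) • v.radial.toL2)
      ((1 / 2 : ℝ) • v.toV.toL2),
    Lp.coeFn_sub (-v.lap.toL2) ((1 / 2 : ℝ) • v.radial.toL2), Lp.coeFn_neg v.lap.toL2,
    Lp.coeFn_smul (1 / 2 : ℝ) v.radial.toL2, Lp.coeFn_smul (1 / 2 : ℝ) v.toV.toL2,
    v.radial_ae a] with x h1 h2 h3 h4 h5 h6
  rw [h1, Pi.sub_apply, h2, Pi.sub_apply, h3, Pi.neg_apply, h4, h5, ← h6]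
  rfl

/-- Solutions of `F(v, σ) = 0` satisfy the profile equation with a pressure in `L²`. -/
theorem IsScaleInvariantDatum.exists_pressure_profile {a₀ : E3 → E3} (ha : IsScaleInvariantDatum a₀)
    {σ : ℝ} {v : D} (h : F a₀ v σ = 0) : ∃ P : E3 → ℝ, ∀ a, HasWeakPD a P
      (fun x => adv (profile a₀ σ v) (profile a₀ σ v) x a - v.lap.comp a x
        - 1 / 2 * ∑ i, x i * (v.partial i).comp a x - 1 / 2 * v.toV.comp a x) := by
  have hm := ha.memLp_adv_profile σ v
  obtain ⟨P, hP⟩ := exists_pressure (hm.toLp _)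
    (fun i k x => (profile a₀ σ v).val x k * (profile a₀ σ v).val x i)
    (fun i k => ha.memLp_profile_mul σ v i k) (fun i η hη => by
      rw [ha.isWeakDiv_profile σ v i η hη]
      congr 1
      refine integral_congr_ae ?_
      filter_upwards [hm.coeFn_toLp] with x hx
      rw [hx])
  refine ⟨P, fun a => (hP a).congr ae_eq_rfl ?_⟩
  -- F = 0 says that the projection of the advection term is minus the linear part, so its gradient
  -- part is the sum of advection and linear terms.
  have h1 : solenoidal.starProjection (hm.toLp _) = -linPart v := by
    rw [← leray_of_memLp hm]
    exact (neg_eq_of_add_eq_zero_right h).symm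
  rw [h1, sub_neg_eq_add]
  filter_upwards [Lp.coeFn_add (hm.toLp _) (linPart v), hm.coeFn_toLp, v.linPart_apply a]
    with x h1 h2 h3
  rw [h1, Pi.add_apply, h2, PiLp.add_apply, h3]
  ring

/-! ### Weights -/

/-- `(1 + ε |x|²)^(-1/2)`. -/
def wq (ε : ℝ) (x : E3) : ℝ := (√(1 + ε * ‖x‖ ^ 2))⁻¹

/-- `|x|² (1 + ε |x|²)^(-3/2)`. -/
def wm (ε : ℝ) (x : E3) : ℝ := ‖x‖ ^ 2 * wq ε x ^ 3

section Weights
variable {ε : ℝ}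

theorem wq_arg_pos (hε : 0 < ε) (x : E3) : 0 < 1 + ε * ‖x‖ ^ 2 := by positivity

theorem wq_pos (hε : 0 < ε) (x : E3) : 0 < wq ε x :=
  inv_pos.2 (Real.sqrt_pos.2 (wq_arg_pos hε x))

theorem wq_sq (hε : 0 < ε) (x : E3) : wq ε x ^ 2 * (1 + ε * ‖x‖ ^ 2) = 1 := by
  rw [wq, inv_pow, Real.sq_sqrt (wq_arg_pos hε x).le, inv_mul_cancel₀ (wq_arg_pos hε x).ne']

theorem wq_le_one (hε : 0 < ε) (x : E3) : wq ε x ≤ 1 := by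
  refine inv_le_one_of_one_le₀ (Real.one_le_sqrt.2 ?_)
  have : 0 ≤ ε * ‖x‖ ^ 2 := by positivity
  linarith

theorem contDiff_wq (hε : 0 < ε) : ContDiff ℝ ∞ (wq ε) := by
  refine ContDiff.inv (ContDiff.sqrt ?_ fun x => (wq_arg_pos hε x).ne')
    fun x => (Real.sqrt_pos.2 (wq_arg_pos hε x)).ne'
  exact contDiff_const.add (contDiff_const.mul (contDiff_norm_sq ℝ))

theorem contDiff_wm (hε : 0 < ε) : ContDiff ℝ ∞ (wm ε) :=
  (contDiff_norm_sq ℝ).mul ((contDiff_wq hε).pow 3)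

theorem contDiff_coord (i : Fin 3) : ContDiff ℝ ∞ (fun x : E3 => x i) :=
  (EuclideanSpace.proj i : E3 →L[ℝ] ℝ).contDiff

theorem pd_coord (i k : Fin 3) (x : E3) : pd k (fun x : E3 => x i) x = if i = k then 1 else 0 := by
  have h1 : HasFDerivAt (fun y : E3 => y i) (EuclideanSpace.proj i : E3 →L[ℝ] ℝ) x :=
    (EuclideanSpace.proj i : E3 →L[ℝ] ℝ).hasFDerivAt
  rw [pd, h1.fderiv]
  simp [e]

theorem pd_norm_sq (k : Fin 3) (x : E3) : pd k (fun x : E3 => ‖x‖ ^ 2) x = 2 * x k := by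
  have h : HasFDerivAt (fun z : E3 => ‖z‖ ^ 2) (2 • innerSL ℝ x) x :=
    (hasStrictFDerivAt_norm_sq x).hasFDerivAt
  rw [pd, h.fderiv]
  simp [e, EuclideanSpace.inner_single_right]

theorem pd_wq (hε : 0 < ε) (k : Fin 3) (x : E3) : pd k (wq ε) x = -(ε * x k * wq ε x ^ 3) := by
  have h : HasFDerivAt (fun z : E3 => ‖z‖ ^ 2) (2 • innerSL ℝ x) x :=
    (hasStrictFDerivAt_norm_sq x).hasFDerivAt
  have h0 := wq_arg_pos hε x
  have h1 := (((hasDerivAt_inv (Real.sqrt_pos.2 h0).ne').comp_hasFDerivAt x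
    (((h.const_mul ε).const_add 1).sqrt h0.ne')))
  have h2 : fderiv ℝ (wq ε) x = _ := h1.fderiv
  rw [pd, h2]
  have h3 : ⟪x, e k⟫ = x k := by simp [e, EuclideanSpace.inner_single_right]
  have hs := Real.sqrt_pos.2 h0
  simp only [_root_.smul_apply, innerSL_apply_apply, h3, smul_eq_mul, wq, nsmul_eq_mul]
  field_simp
  norm_num

/-- The product rule, simplified by ε|x|²q² = 1 - q² with q the weight `wq`. -/
theorem pd_wm (hε : 0 < ε) (k : Fin 3) (x : E3) :
    pd k (wm ε) x = x k * wq ε x ^ 3 * (3 * wq ε x ^ 2 - 1) := by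
  have hq := ((contDiff_wq hε).differentiable (by simp)) x
  have h0 : pd k (fun y => wq ε y ^ 3) x = 3 * wq ε x ^ 2 * pd k (wq ε) x := by
    rw [pd, (hq.hasFDerivAt.pow 3).fderiv]
    simp [pd]
  have h1 : pd k (wm ε) x = 2 * x k * wq ε x ^ 3 + ‖x‖ ^ 2 * (3 * wq ε x ^ 2 * pd k (wq ε) x) := by
    rw [← h0, ← pd_norm_sq, ← pd_mul k ((contDiff_norm_sq ℝ (n := ∞)).differentiable (by simp) x)
      (show DifferentiableAt ℝ (fun y => wq ε y ^ 3) x from hq.pow 3)]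
    rfl
  rw [h1, pd_wq hε]
  have h2 := wq_sq hε x
  linear_combination (-3 * x k * wq ε x ^ 3) * h2

theorem wm_nonneg (hε : 0 < ε) (x : E3) : 0 ≤ wm ε x := by
  have := wq_pos hε x
  unfold wm; positivity

theorem wm_le (hε : 0 < ε) (x : E3) : wm ε x ≤ ‖x‖ ^ 2 :=
  mul_le_of_le_one_right (by positivity) (pow_le_one₀ (wq_pos hε x).le (wq_le_one hε x))

theorem abs_pd_wm_le (hε : 0 < ε) (k : Fin 3) (x : E3) :
    |pd k (wm ε) x| ≤ 2 * (‖x‖ * wq ε x ^ 3) := by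
  have hq := wq_pos hε x
  have hq1 := wq_le_one hε x
  rw [pd_wm hε, abs_mul, abs_mul, abs_of_nonneg (by positivity : 0 ≤ wq ε x ^ 3)]
  have h1 : |3 * wq ε x ^ 2 - 1| ≤ 2 := by
    rw [abs_le]; constructor <;> nlinarith
  calc _ ≤ ‖x‖ * wq ε x ^ 3 * 2 := by
        gcongr
        exact abs_apply_le x k
    _ = _ := by ring

theorem norm_mul_wq_le (hε : 0 < ε) (x : E3) : ‖x‖ * wq ε x ≤ (√ε)⁻¹ := by
  have h := wq_sq hε x
  have hs := Real.sqrt_pos.2 hε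
  rw [← one_div, le_div_iff₀ hs]
  have h2 : (‖x‖ * wq ε x * √ε) ^ 2 ≤ 1 := by
    rw [mul_pow, Real.sq_sqrt hε.le]
    nlinarith [sq_nonneg (wq ε x)]
  exact (abs_le_one_iff_mul_self_le_one.2 (by rw [← pow_two]; exact h2)).trans' (le_abs_self _)

/-- For fixed ε the weight m and the fields xᵢm are bounded with bounded derivatives, so multiplying
by them keeps weak differentiability in L². Boundedness of x m forces m to decay at least like
1/|x|; the bound c = ε^(-1/2) for |x|q is where the dependence on ε enters. -/
theorem exists_wm_bounds (hε : 0 < ε) : ∃ C : ℝ, (∀ x, |wm ε x| ≤ C) ∧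
    (∀ k x, |pd k (wm ε) x| ≤ C) ∧
    (∀ i x, |x i * wm ε x| ≤ C) ∧ ∀ i k x, |pd k (fun x : E3 => x i * wm ε x) x| ≤ C := by
  set c := (√ε)⁻¹ with hc
  have hc0 : 0 < c := inv_pos.2 (Real.sqrt_pos.2 hε)
  have h1 := norm_mul_wq_le hε
  have hq := fun x => (wq_pos hε x).le
  have hm : ∀ x, |wm ε x| ≤ c ^ 2 := fun x => by
    rw [abs_of_nonneg (wm_nonneg hε x)]
    calc wm ε x = (‖x‖ * wq ε x) ^ 2 * wq ε x := by unfold wm; ring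
      _ ≤ c ^ 2 * 1 := by
        have := hq x
        have := h1 x
        have := wq_le_one hε x
        gcongr
      _ = _ := mul_one _
  have hd : ∀ k x, |pd k (wm ε) x| * ‖x‖ ≤ 2 * c ^ 2 := fun k x =>
    calc _ ≤ 2 * (‖x‖ * wq ε x ^ 3) * ‖x‖ := by gcongr; exact abs_pd_wm_le hε k x
      _ = 2 * |wm ε x| := by rw [abs_of_nonneg (wm_nonneg hε x), wm]; ring
      _ ≤ _ := by gcongr; exact hm x
  refine ⟨3 * c ^ 2 + 2 * c + c ^ 3, fun x => ?_, fun k x => ?_, fun i x => ?_, fun i k x => ?_⟩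
  · have := hm x
    have : 0 ≤ 2 * c ^ 2 + 2 * c + c ^ 3 := by positivity
    linarith
  · have h2 := abs_pd_wm_le hε k x
    have h3 : ‖x‖ * wq ε x ^ 3 ≤ c := by
      calc ‖x‖ * wq ε x ^ 3 = (‖x‖ * wq ε x) * wq ε x ^ 2 := by ring
        _ ≤ c * 1 := by
          have := hq x
          have := h1 x
          have := pow_le_one₀ (hq x) (wq_le_one hε x) (n := 2)
          gcongr
        _ = _ := mul_one _
    have : 0 ≤ 3 * c ^ 2 + c ^ 3 := by positivity
    linarith
  · have h2 : |x i * wm ε x| ≤ c ^ 3 := by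
      rw [abs_mul, abs_of_nonneg (wm_nonneg hε x)]
      calc |x i| * wm ε x ≤ ‖x‖ * wm ε x := by
            have := wm_nonneg hε x
            gcongr
            exact abs_apply_le x i
        _ = (‖x‖ * wq ε x) ^ 3 := by unfold wm; ring
        _ ≤ c ^ 3 := by
          have := mul_nonneg (norm_nonneg x) (hq x)
          have := h1 x
          gcongr
    have : 0 ≤ 3 * c ^ 2 + 2 * c := by positivity
    linarith
  · rw [pd_mul k ((contDiff_coord i).differentiable (by simp) x)
      ((contDiff_wm hε).differentiable (by simp) x), pd_coord]
    refine (abs_add_le _ _).trans ?_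
    rw [abs_mul, abs_mul]
    have h2 : |if i = k then (1 : ℝ) else 0| ≤ 1 := by split_ifs <;> simp
    have h3 : |if i = k then (1 : ℝ) else 0| * |wm ε x| ≤ 1 * c ^ 2 := by
      gcongr; exact hm x
    have h4 : |x i| * |pd k (wm ε) x| ≤ 2 * c ^ 2 := by
      refine le_trans ?_ (hd k x)
      rw [mul_comm]
      gcongr
      exact abs_apply_le x i
    have : 0 ≤ 2 * c + c ^ 3 := by positivity
    linarith

theorem pd_coord_mul_wm (hε : 0 < ε) (i k : Fin 3) (x : E3) :
    pd k (fun x : E3 => x i * wm ε x) x = (if i = k then wm ε x else 0) + x i * pd k (wm ε) x := by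
  rw [pd_mul k ((contDiff_coord i).differentiable (by simp) x)
      ((contDiff_wm hε).differentiable (by simp) x), pd_coord]
  split_ifs <;> ring

/-- This identity dictates the exponent -3/2 in m. The drift and the zeroth order term, tested with
m v, give (3m + x·∇m)/4 - m/2, which here equals (3/4)q²m ≥ 0. A weight decaying faster than 1/|x|
would make it negative at infinity, while x m has to stay bounded. -/
theorem sum_coord_mul_pd_wm (hε : 0 < ε) (x : E3) :
    ∑ i, x i * pd i (wm ε) x = wm ε x * (3 * wq ε x ^ 2 - 1) := by
  have h : ‖x‖ ^ 2 = ∑ i, x i ^ 2 := by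
    rw [EuclideanSpace.norm_sq_eq]; simp
  simp only [pd_wm hε, wm, h, Finset.sum_mul]
  exact Finset.sum_congr rfl fun i _ => by ring

end Weights

theorem HasWeakPD.mul_smooth {k : Fin 3} {f f' m : E3 → ℝ} (hf : HasWeakPD k f f')
    (hm : ContDiff ℝ ∞ m) {C : ℝ} (h0 : ∀ x, |m x| ≤ C) (h1 : ∀ x, |pd k m x| ≤ C) :
    HasWeakPD k (fun x => m x * f x) (fun x => pd k m x * f x + m x * f' x) := by
  have hb : ∀ {p q : E3 → ℝ}, Continuous p → (∀ x, |p x| ≤ C) → MemLp q 2 volume →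
      MemLp (fun x => p x * q x) 2 volume := fun {p q} hp hpC hq =>
    MemLp.of_le_mul (c := C) hq (hp.aestronglyMeasurable.mul hq.1) (ae_of_all _ fun x => by
      rw [norm_mul]
      exact mul_le_mul_of_nonneg_right (hpC x) (norm_nonneg _))
  have hpd : Continuous (pd k m) := (hm.continuous_fderiv (by simp)).clm_apply continuous_const
  exact (HasLocWeakPD.of_smooth hm k).mul hf (hb hm.continuous h0 hf.left)
    ((hb hpd h1 hf.left).add (hb hm.continuous h0 hf.right))

/-- Divergence-free fields are orthogonal to gradients of `H¹` functions. -/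
theorem V.hasInt_gradient (s : V) {u : E3 → ℝ} {du : Fin 3 → E3 → ℝ}
    (hu : ∀ a, HasWeakPD a u (du a)) : HasInt (fun x => ∑ a, s.comp a x * du a x) 0 := by
  have h1 := HasInt.sum fun a => HasInt.of_memLp (s.memLp_two a) (hu a).right
  refine h1.congr ae_eq_rfl (Complex.ofReal_injective ?_)
  push_cast
  simp only [integral_mul_eq_hat (s.memLp_two _) (hu _).right]
  have hi : ∀ a, Integrable (fun ξ => conj (hat (s.comp a) ξ) * hat (du a) ξ) volume := fun a =>
    integrable_conj_mul (Lp.memLp _) (Lp.memLp _)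
  rw [← integral_finsetSum _ fun a _ => hi a, ← integral_zero E3 ℂ (μ := volume)]
  refine integral_congr_ae ?_
  filter_upwards [hat_solenoidal s.2.1, ae_all_iff.2 fun a => (hu a).hat_eq] with ξ h2 h3
  have h4 := congrArg conj h2
  simp only [map_sum, map_mul, Complex.conj_ofReal, map_zero] at h4
  have h5 : ∑ a, (ξ a : ℂ) * conj (hat (s.comp a) ξ) = 0 := h4
  calc _ = (2 * Real.pi * Complex.I * hat u ξ) * ∑ a, (ξ a : ℂ) * conj (hat (s.comp a) ξ) := by
        rw [Finset.mul_sum]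
        exact Finset.sum_congr rfl fun a _ => by rw [h3 a]; ring
    _ = 0 := by rw [h5, mul_zero]

theorem HasWeakPD.hasInt_mul {k : Fin 3} {f f' g g' : E3 → ℝ} (hf : HasWeakPD k f f')
    (hg : HasWeakPD k g g') : HasInt (fun x => f' x * g x + f x * g' x) 0 :=
  ((HasInt.of_memLp hf.right hg.left).add (HasInt.of_memLp hf.left hg.right)).congr ae_eq_rfl
    (by rw [hf.integral_mul hg]; ring)

/-- Fatou's lemma for the weights as `ε → 0`. -/
theorem integrable_norm_sq_mul {w : ℕ → E3 → ℝ} {G : E3 → ℝ} {M : ℝ}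
    (hw : ∀ x, Tendsto (fun n => w n x) atTop (𝓝 (‖x‖ ^ 2))) (hw0 : ∀ n x, 0 ≤ w n x)
    (hG : AEStronglyMeasurable G volume) (hG0 : ∀ x, 0 ≤ G x)
    (hi : ∀ n, Integrable (fun x => w n x * G x) volume) (hM : ∀ n, ∫ x, w n x * G x ≤ M) :
    Integrable (fun x => ‖x‖ ^ 2 * G x) volume := by
  have hm : AEStronglyMeasurable (fun x => ‖x‖ ^ 2 * G x) volume :=
    (continuous_norm.pow 2).aestronglyMeasurable.mul hG
  refine ⟨hm, ?_⟩
  rw [hasFiniteIntegral_iff_ofReal (ae_of_all _ fun x => mul_nonneg (by positivity) (hG0 x))]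
  have h1 : ∀ x, ENNReal.ofReal (‖x‖ ^ 2 * G x)
      = liminf (fun n => ENNReal.ofReal (w n x * G x)) atTop := fun x =>
    (((ENNReal.continuous_ofReal.tendsto _).comp ((hw x).mul_const (G x))).liminf_eq).symm
  simp only [h1]
  refine (lintegral_liminf_le' fun n =>
      (hi n).aestronglyMeasurable.aemeasurable.ennreal_ofReal).trans_lt
    (lt_of_le_of_lt ?_ (ENNReal.ofReal_lt_top (r := M)))
  refine liminf_le_of_le (by isBoundedDefault) fun b hb => ?_
  obtain ⟨n, hn⟩ := hb.exists
  refine hn.trans ?_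
  rw [← ofReal_integral_eq_lintegral_ofReal (hi n)
    (ae_of_all _ fun x => mul_nonneg (hw0 n x) (hG0 x))]
  exact ENNReal.ofReal_le_ofReal (hM n)

theorem tendsto_wq (x : E3) : Tendsto (fun n : ℕ => wq (1 / ((n : ℝ) + 1)) x) atTop (𝓝 1) := by
  have h1 : Continuous fun ε : ℝ => √(1 + ε * ‖x‖ ^ 2) := by fun_prop
  have h2 : Tendsto (fun n : ℕ => √(1 + (1 / ((n : ℝ) + 1)) * ‖x‖ ^ 2)) atTop (𝓝 1) := by
    have := (h1.tendsto 0).comp (tendsto_one_div_add_atTop_nhds_zero_nat (𝕜 := ℝ))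
    simpa [Function.comp_def] using this
  simpa [wq] using h2.inv₀ one_ne_zero

theorem tendsto_wm (x : E3) :
    Tendsto (fun n : ℕ => wm (1 / ((n : ℝ) + 1)) x) atTop (𝓝 (‖x‖ ^ 2)) := by
  simpa [wm] using ((tendsto_wq x).pow 3).const_mul (‖x‖ ^ 2)

/-! ### Weighted energy estimates -/

/-- The components of a solution `v` of the profile equations with background field `α`, in the
form used for weighted energy estimates: `g k a = ∂ₖ vₐ`, `h i k a = ∂ₖ ∂ᵢ vₐ`, `dα k a = ∂ₖ αₐ`. -/
structure DecaySystem (v : Fin 3 → E3 → ℝ) (g : Fin 3 → Fin 3 → E3 → ℝ)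
    (h : Fin 3 → Fin 3 → Fin 3 → E3 → ℝ) (α : Fin 3 → E3 → ℝ) (dα : Fin 3 → Fin 3 → E3 → ℝ)
    (P : E3 → ℝ) (C : ℝ) : Prop where
  v_pd : ∀ k a, HasWeakPD k (v a) (g k a)
  g_pd : ∀ i k a, HasWeakPD k (g i a) (h i k a)
  sq_pd : ∀ k a, HasWeakPD k (fun x => v a x * v a x) (fun x => g k a x * v a x + v a x * g k a x)
  div_v : ∀ (u : E3 → ℝ) (du : Fin 3 → E3 → ℝ), (∀ a, HasWeakPD a u (du a)) →
      HasInt (fun x => ∑ a, v a x * du a x) 0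
  div_lap : ∀ (u : E3 → ℝ) (du : Fin 3 → E3 → ℝ), (∀ a, HasWeakPD a u (du a)) →
    HasInt (fun x => ∑ a, (∑ i, h i i a x) * du a x) 0
  P_pd : ∀ a, HasWeakPD a P (fun x => ∑ k, (α k x + v k x) * (dα k a x + g k a x)
    - ∑ i, h i i a x - 1 / 2 * ∑ i, x i * g i a x - 1 / 2 * v a x)
  cont_α : ∀ k, Continuous (α k)
  cont_dα : ∀ k a, Continuous (dα k a)
  α_le : ∀ k x, (1 + ‖x‖) * |α k x| ≤ C
  dα_le : ∀ k a x, (1 + ‖x‖) ^ 2 * |dα k a x| ≤ C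

section Young

theorem abs_mul_le_add_sq (a b : ℝ) {c d : ℝ} (hc : 0 < c) (hcd : 4 * c * d = 1) :
    |a * b| ≤ c * a ^ 2 + d * b ^ 2 := by
  have h := mul_nonneg (by nlinarith : 0 ≤ d) (sq_nonneg (2 * c * |a| - |b|))
  rw [abs_mul, ← sq_abs a, ← sq_abs b]
  nlinarith

/-- Pointwise lower bound for the terms in the first energy identity. -/
theorem energy_term_le {r q m g dm vk va α dα C : ℝ} (hr : 0 ≤ r) (hq0 : 0 < q) (hq1 : q ≤ 1)
    (hm : m = r ^ 2 * q ^ 3) (hdm : |dm| ≤ 2 * (r * q ^ 3)) (hα : (1 + r) * |α| ≤ C)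
    (hdα : (1 + r) ^ 2 * |dα| ≤ C) :
    1 / 2 * (m * g ^ 2) - 4 * va ^ 2 - 1 / 24 * (q ^ 2 * m * vk ^ 2) - 6 * (va * va) ^ 2
      - 1 / 24 * (q ^ 2 * m * va ^ 2) - 6 * C ^ 4 * ((1 + r) ^ 4)⁻¹ - C * (va ^ 2 + vk ^ 2)
      - C ^ 2 * va ^ 2
    ≤ m * g ^ 2 + g * dm * va - 1 / 2 * (vk * dm * va ^ 2)
      + m * va * (α * dα + vk * dα + α * g) := by
  have hC : 0 ≤ C := le_trans (by positivity) hα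
  -- X is the size of ∇m, and X² ≤ q²m ≤ m, m = X r. So every error term is a product of X times an
  -- unknown and a factor in L², and Young's inequality absorbs the first square in the left-hand
  -- side.
  obtain ⟨X, hX⟩ : ∃ X, X = r * q ^ 3 := ⟨_, rfl⟩
  rw [← hX] at hdm
  have hX0 : 0 ≤ X := by rw [hX]; positivity
  have hXm : X ^ 2 ≤ q ^ 2 * m := by
    rw [hX, hm]
    calc (r * q ^ 3) ^ 2 = r ^ 2 * q ^ 5 * q := by ring
      _ ≤ r ^ 2 * q ^ 5 * 1 := by gcongr
      _ = _ := by ring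
  have hqm : q ^ 2 * m ≤ m := by
    have hm0 : 0 ≤ m := by rw [hm]; positivity
    have : q ^ 2 ≤ 1 := pow_le_one₀ hq0.le hq1
    nlinarith
  have hmX : m = X * r := by rw [hm, hX]; ring
  have hrα : r * |α| ≤ C := le_trans (by gcongr; linarith) hα
  have hrdα : r ^ 2 * |dα| ≤ C := le_trans (by gcongr; linarith) hdα
  have hmr : m ≤ r ^ 2 := by
    rw [hm]; exact mul_le_of_le_one_right (by positivity) (pow_le_one₀ hq0.le hq1)
  have t1 : |g * dm * va| ≤ 1 / 4 * (m * g ^ 2) + 4 * va ^ 2 := by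
    have h1 := abs_mul_le_add_sq (X * g) (2 * va) (c := 1 / 4) (d := 1) (by norm_num) (by norm_num)
    have h2 : |g * dm * va| ≤ |(X * g) * (2 * va)| := by
      rw [abs_mul, abs_mul, abs_mul, abs_mul, abs_mul, abs_of_nonneg hX0, abs_two]
      calc |g| * |dm| * |va| ≤ |g| * (2 * X) * |va| := by gcongr
        _ = _ := by ring
    have h3 : (X * g) ^ 2 ≤ m * g ^ 2 := by
      rw [mul_pow]; gcongr; exact hXm.trans hqm
    linarith
  have t2 : |1 / 2 * (vk * dm * va ^ 2)| ≤ 1 / 24 * (q ^ 2 * m * vk ^ 2) + 6 * (va * va) ^ 2 := by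
    have h1 := abs_mul_le_add_sq (X * vk) (va * va) (c := 1 / 24) (d := 6)
        (by norm_num) (by norm_num)
    have h2 : |1 / 2 * (vk * dm * va ^ 2)| ≤ |(X * vk) * (va * va)| := by
      rw [pow_two, abs_mul, abs_mul (vk * dm), abs_mul vk, abs_mul (X * vk), abs_mul X,
        abs_of_nonneg hX0, abs_mul va, abs_of_pos (by norm_num : (0 : ℝ) < 1 / 2)]
      calc 1 / 2 * (|vk| * |dm| * (|va| * |va|)) ≤ 1 / 2 * (|vk| * (2 * X) * (|va| * |va|)) :=
          by gcongr
        _ = _ := by ring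
    have h3 : (X * vk) ^ 2 ≤ q ^ 2 * m * vk ^ 2 := by
      rw [mul_pow]; gcongr
    linarith
  have t3 : |m * va * (α * dα)| ≤ 1 / 24 * (q ^ 2 * m * va ^ 2) + 6 * C ^ 4 * ((1 + r) ^ 4)⁻¹ := by
    have h1 := abs_mul_le_add_sq (X * va) (C * (C * ((1 + r) ^ 2)⁻¹)) (c := 1 / 24) (d := 6)
        (by norm_num) (by norm_num)
    have h2 : |m * va * (α * dα)| ≤ |(X * va) * (C * (C * ((1 + r) ^ 2)⁻¹))| := by
      have hd : |dα| ≤ C * ((1 + r) ^ 2)⁻¹ := by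
        rw [← div_eq_mul_inv, le_div_iff₀ (by positivity), mul_comm]; exact hdα
      rw [abs_mul, abs_mul m, abs_mul α, abs_mul (X * va), abs_mul X, hmX, abs_mul X,
        abs_of_nonneg hX0, abs_of_nonneg hr,
            abs_of_nonneg (by positivity : 0 ≤ C * (C * ((1 + r) ^ 2)⁻¹))]
      calc X * r * |va| * (|α| * |dα|) = X * |va| * ((r * |α|) * |dα|) := by ring
        _ ≤ _ := by gcongr
    have h3 : (X * va) ^ 2 ≤ q ^ 2 * m * va ^ 2 := by
      rw [mul_pow]; gcongr
    have h4 : (C * (C * ((1 + r) ^ 2)⁻¹)) ^ 2 = C ^ 4 * ((1 + r) ^ 4)⁻¹ := by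
      rw [← inv_pow, ← inv_pow]; ring
    rw [h4] at h1
    linarith
  have hm0 : 0 ≤ m := by rw [hm]; positivity
  have t4 : |m * va * (vk * dα)| ≤ C * (va ^ 2 + vk ^ 2) := by
    rw [abs_mul, abs_mul m, abs_mul vk, abs_of_nonneg hm0]
    calc m * |va| * (|vk| * |dα|) ≤ r ^ 2 * |va| * (|vk| * |dα|) := by gcongr
      _ = (r ^ 2 * |dα|) * (|va| * |vk|) := by ring
      _ ≤ C * (va ^ 2 + vk ^ 2) := by
        gcongr
        nlinarith [sq_nonneg (|va| - |vk|), sq_abs va, sq_abs vk]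
  have t5 : |m * va * (α * g)| ≤ 1 / 4 * (m * g ^ 2) + C ^ 2 * va ^ 2 := by
    have h1 := abs_mul_le_add_sq (X * g) (C * va) (c := 1 / 4) (d := 1) (by norm_num) (by norm_num)
    have h2 : |m * va * (α * g)| ≤ |(X * g) * (C * va)| := by
      rw [abs_mul, abs_mul m, abs_mul α, abs_mul (X * g), abs_mul X, abs_mul C, hmX, abs_mul X,
        abs_of_nonneg hX0, abs_of_nonneg hr, abs_of_nonneg hC]
      calc X * r * |va| * (|α| * |g|) = X * |g| * ((r * |α|) * |va|) := by ring
        _ ≤ _ := by gcongr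
    have h3 : (X * g) ^ 2 ≤ m * g ^ 2 := by
      rw [mul_pow]; gcongr; exact hXm.trans hqm
    linarith
  have s1 := neg_le_of_abs_le t1
  have s2 := le_of_abs_le t2
  have s3 := neg_le_of_abs_le t3
  have s4 := neg_le_of_abs_le t4
  have s5 := neg_le_of_abs_le t5
  have e : m * va * (α * dα + vk * dα + α * g)
    = m * va * (α * dα) + m * va * (vk * dα) + m * va * (α * g) := by ring
  rw [e]
  linarith

end Young

section System
variable {v : Fin 3 → E3 → ℝ} {g : Fin 3 → Fin 3 → E3 → ℝ} {h : Fin 3 → Fin 3 → Fin 3 → E3 → ℝ}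
  {α : Fin 3 → E3 → ℝ} {dα : Fin 3 → Fin 3 → E3 → ℝ} {P : E3 → ℝ} {C : ℝ}

/-- The equation tested with m v. It enters through ∇P: v is divergence-free, so ∑ vₐ ∂ₐ(mP)
integrates to zero, and ∂ₐP is replaced by the equation. The remaining identities integrate the
Laplacian and the drift by parts. -/
theorem DecaySystem.energy_identity (S : DecaySystem v g h α dα P C) {ε : ℝ} (hε : 0 < ε) :
    HasInt (fun x => ∑ a, ∑ k, (wm ε x * g k a x ^ 2 + g k a x * pd k (wm ε) x * v a x
        - 1 / 2 * (v k x * pd k (wm ε) x * v a x ^ 2)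
        + wm ε x * v a x * (α k x * dα k a x + v k x * dα k a x + α k x * g k a x))
      + ∑ a, (3 / 4 * (wq ε x ^ 2 * wm ε x * v a x ^ 2) + P x * (pd a (wm ε) x * v a x))) 0 := by
  obtain ⟨c, b0, b1, b2, b3⟩ := exists_wm_bounds hε
  have hm := contDiff_wm hε
  have z1 : ∀ a i, HasInt _ 0 := fun a i =>
    ((S.v_pd i a).mul_smooth hm b0 (b1 i)).hasInt_mul (S.g_pd i i a)
  have z2 : ∀ a i, HasInt _ 0 := fun a i => ((S.v_pd i a).mul_smooth
    ((contDiff_coord i).mul hm) (b2 i) (b3 i i)).hasInt_mul (S.v_pd i a)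
  have z3 := S.div_v _ _ fun a => (S.P_pd a).mul_smooth hm b0 (b1 a)
  -- Since v is divergence-free, v·∇v against m v leaves only -1/2 of v·∇m |v|², with no derivative
  -- on v.
  have z4 := fun a => S.div_v _ _ fun k => (S.sq_pd k a).mul_smooth hm b0 (b1 k)
  have z := (((HasInt.sum fun a => HasInt.sum fun i => z1 a i).add
    ((HasInt.sum fun a => HasInt.sum fun i => z2 a i).const_mul (1 / 4))).add z3).sub
    ((HasInt.sum fun a => z4 a).const_mul (1 / 2))
  refine z.congr (ae_of_all _ fun x => ?_) (by simp)
  have hs := sum_coord_mul_pd_wm hε x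
  simp only [pd_coord_mul_wm hε, if_true]
  simp only [Fin.sum_univ_three] at hs ⊢
  linear_combination (1 / 4 * (v 0 x ^ 2 + v 1 x ^ 2 + v 2 x ^ 2)) * hs

theorem integrable_pow_inv_four : Integrable (fun x : E3 => ((1 + ‖x‖) ^ 4)⁻¹) volume :=
  integrable_pow_neg_four.congr (ae_of_all _ fun x => by
    have h0 : 0 < 1 + ‖x‖ := by linarith [norm_nonneg x]
    simp only []
    rw [Real.rpow_neg h0.le, show ((4 : ℝ) = (4 : ℕ)) by norm_num, Real.rpow_natCast])

theorem integrable_sq_of_memLp {f : E3 → ℝ} (hf : MemLp f 2 volume) :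
    Integrable (fun x => f x ^ 2) volume := by
  simpa only [pow_two] using integrable_mul_of_memLp hf hf

/-- The first weighted estimate: `|x| v` and `|x| ∇ v` are in `L²`. -/
theorem DecaySystem.integrable_norm_sq (S : DecaySystem v g h α dα P C) :
    (∀ a, Integrable (fun x => ‖x‖ ^ 2 * v a x ^ 2) volume) ∧
      ∀ k a, Integrable (fun x => ‖x‖ ^ 2 * g k a x ^ 2) volume := by
  let H : E3 → ℝ := fun x => ∑ a, ∑ k, (4 * v a x ^ 2 + 6 * (v a x * v a x) ^ 2
    + 6 * C ^ 4 * ((1 + ‖x‖) ^ 4)⁻¹ + C * (v a x ^ 2 + v k x ^ 2) + C ^ 2 * v a x ^ 2)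
    + ∑ _a : Fin 3, 8 * P x ^ 2
  have iv : ∀ a, Integrable (fun x => v a x ^ 2) volume := fun a =>
    integrable_sq_of_memLp (S.v_pd 0 a).left
  have hH : Integrable H volume := by
    refine Integrable.add (integrable_finsetSum _ fun a _ => integrable_finsetSum _ fun k _ => ?_)
      (integrable_finsetSum _ fun a _ => (integrable_sq_of_memLp (S.P_pd 0).left).const_mul 8)
    exact (((((iv a).const_mul 4).add ((integrable_sq_of_memLp (S.sq_pd 0 a).left).const_mul 6)).add
      (integrable_pow_inv_four.const_mul _)).add (((iv a).add (iv k)).const_mul C)).add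
        ((iv a).const_mul _)
  -- Bookkeeping of the absorbed parts: summed over a and k, the two terms with 1/24 cost 3/24 +
  -- 3/24 = 1/4 of q²m|v|², and the pressure costs 1/8. Of the available 3/4 there remains 3/8, and
  -- of m|∇v|² there remains 1/2. The function H that collects the errors does not depend on ε.
  have key : ∀ (ε : ℝ), 0 < ε → ∀ x, ∑ a, ∑ k, 1 / 2 * (wm ε x * g k a x ^ 2)
      + ∑ a, 3 / 8 * (wq ε x ^ 2 * wm ε x * v a x ^ 2) - H x
      ≤ ∑ a, ∑ k, (wm ε x * g k a x ^ 2 + g k a x * pd k (wm ε) x * v a x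
        - 1 / 2 * (v k x * pd k (wm ε) x * v a x ^ 2)
        + wm ε x * v a x * (α k x * dα k a x + v k x * dα k a x + α k x * g k a x))
      + ∑ a, (3 / 4 * (wq ε x ^ 2 * wm ε x * v a x ^ 2) + P x * (pd a (wm ε) x * v a x)) := by
    intro ε hε x
    have hq0 := wq_pos hε x
    have hq1 := wq_le_one hε x
    have h1 := fun a k => energy_term_le (g := g k a x) (vk := v k x) (va := v a x)
      (norm_nonneg x) hq0 hq1 (rfl : wm ε x = _) (abs_pd_wm_le hε k x) (S.α_le k x) (S.dα_le k a x)
    have h2 : ∀ a, -(1 / 8 * (wq ε x ^ 2 * wm ε x * v a x ^ 2) + 8 * P x ^ 2)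
        ≤ P x * (pd a (wm ε) x * v a x) := fun a => by
      refine neg_le_of_abs_le ?_
      have e1 := abs_mul_le_add_sq ((‖x‖ * wq ε x ^ 3) * v a x) (2 * P x) (c := 1 / 8) (d := 2)
          (by norm_num) (by norm_num)
      have hX0 : 0 ≤ ‖x‖ * wq ε x ^ 3 := by positivity
      have e2 : |P x * (pd a (wm ε) x * v a x)| ≤ |((‖x‖ * wq ε x ^ 3) * v a x) * (2 * P x)| := by
        rw [abs_mul, abs_mul (pd a (wm ε) x), abs_mul ((‖x‖ * wq ε x ^ 3) * v a x),
          abs_mul (‖x‖ * wq ε x ^ 3), abs_of_nonneg hX0, abs_mul 2, abs_two]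
        calc _ ≤ |P x| * (2 * (‖x‖ * wq ε x ^ 3) * |v a x|) := by
              gcongr; exact abs_pd_wm_le hε a x
          _ = _ := by ring
      have e3 : ((‖x‖ * wq ε x ^ 3) * v a x) ^ 2 ≤ wq ε x ^ 2 * wm ε x * v a x ^ 2 := by
        rw [mul_pow]
        gcongr
        calc (‖x‖ * wq ε x ^ 3) ^ 2 = ‖x‖ ^ 2 * wq ε x ^ 5 * wq ε x := by ring
          _ ≤ ‖x‖ ^ 2 * wq ε x ^ 5 * 1 := by gcongr
          _ = _ := by unfold wm; ring
      linarith
    have h3 := Finset.sum_le_sum fun a (_ : a ∈ Finset.univ) =>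
      Finset.sum_le_sum fun k (_ : k ∈ Finset.univ) => h1 a k
    have h4 := Finset.sum_le_sum fun a (_ : a ∈ Finset.univ) => h2 a
    simp only [H, Fin.sum_univ_three] at h3 h4 ⊢
    linarith
  have main : ∀ (ε : ℝ), 0 < ε →
      (∀ a, Integrable (fun x => wq ε x ^ 2 * wm ε x * v a x ^ 2) volume ∧
      ∫ x, wq ε x ^ 2 * wm ε x * v a x ^ 2 ≤ 8 / 3 * ∫ x, H x) ∧
      ∀ k a, Integrable (fun x => wm ε x * g k a x ^ 2) volume ∧
      ∫ x, wm ε x * g k a x ^ 2 ≤ 2 * ∫ x, H x := by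
    intro ε hε
    obtain ⟨c, b0, b1, b2, b3⟩ := exists_wm_bounds hε
    have hq0 := fun x => (wq_pos hε x).le
    have hm0 := fun x => wm_nonneg hε x
    have ig : ∀ k a, Integrable (fun x => wm ε x * g k a x ^ 2) volume := fun k a =>
      (integrable_sq_of_memLp (S.v_pd k a).right).bdd_mul (c := c)
        (contDiff_wm hε).continuous.aestronglyMeasurable (ae_of_all _ fun x => b0 x)
    have iv' : ∀ a, Integrable (fun x => wq ε x ^ 2 * wm ε x * v a x ^ 2) volume := fun a =>
      (iv a).bdd_mul (c := c)
        (((contDiff_wq hε).continuous.pow 2).mul (contDiff_wm hε).continuous).aestronglyMeasurable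
        (ae_of_all _ fun x => by
          rw [norm_mul, norm_pow, Real.norm_of_nonneg (hq0 x)]
          exact (mul_le_of_le_one_left (norm_nonneg _)
            (pow_le_one₀ (hq0 x) (wq_le_one hε x))).trans (b0 x))
    have e := S.energy_identity hε
    have i1 : Integrable (fun x => ∑ a, ∑ k, 1 / 2 * (wm ε x * g k a x ^ 2)
      + ∑ a, 3 / 8 * (wq ε x ^ 2 * wm ε x * v a x ^ 2)) volume :=
      (integrable_finsetSum _ fun a _ => integrable_finsetSum _ fun k _ => (ig k a).const_mul _).add
        (integrable_finsetSum _ fun a _ => (iv' a).const_mul _)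
    have h1 := integral_mono (i1.sub hH) e.int (key ε hε)
    rw [e.eq, integral_sub' i1 hH] at h1
    have h2 : ∫ x, (∑ a, ∑ k, 1 / 2 * (wm ε x * g k a x ^ 2)
      + ∑ a, 3 / 8 * (wq ε x ^ 2 * wm ε x * v a x ^ 2)) ≤ ∫ x, H x := by linarith
    have pg : ∀ k a x, 0 ≤ wm ε x * g k a x ^ 2 := fun k a x => mul_nonneg (hm0 x) (sq_nonneg _)
    have pv : ∀ a x, 0 ≤ wq ε x ^ 2 * wm ε x * v a x ^ 2 := fun a x =>
      mul_nonneg (mul_nonneg (sq_nonneg _) (hm0 x)) (sq_nonneg _)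
    refine ⟨fun a => ⟨iv' a, ?_⟩, fun k a => ⟨ig k a, ?_⟩⟩
    · have h3 := integral_mono ((iv' a).const_mul (3 / 8)) i1 fun x => by
        refine le_add_of_nonneg_of_le (Finset.sum_nonneg fun a _ => Finset.sum_nonneg fun k _ => ?_)
          (Finset.single_le_sum (f := fun a => 3 / 8 * (wq ε x ^ 2 * wm ε x * v a x ^ 2))
            (fun a _ => ?_) (Finset.mem_univ a))
        · have := pg k a x; positivity
        · have := pv a x; positivity
      rw [integral_const_mul] at h3
      linarith
    · have h3 := integral_mono ((ig k a).const_mul (1 / 2)) i1 fun x => by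
        refine le_add_of_le_of_nonneg (le_trans (Finset.single_le_sum
          (f := fun k => 1 / 2 * (wm ε x * g k a x ^ 2)) (fun k _ => ?_) (Finset.mem_univ k))
          (Finset.single_le_sum (f := fun a => ∑ k, 1 / 2 * (wm ε x * g k a x ^ 2))
            (fun a _ => Finset.sum_nonneg fun k _ => ?_) (Finset.mem_univ a)))
          (Finset.sum_nonneg fun a _ => ?_)
        · have := pg k a x; positivity
        · have := pg k a x; positivity
        · have := pv a x; positivity
      rw [integral_const_mul] at h3
      linarith
  have hn : ∀ n : ℕ, 0 < 1 / ((n : ℝ) + 1) := fun n => by positivity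
  refine ⟨fun a => ?_, fun k a => ?_⟩
  · refine integrable_norm_sq_mul
        (w := fun n x => wq (1 / ((n : ℝ) + 1)) x ^ 2 * wm (1 / ((n : ℝ) + 1)) x)
      (G := fun x => v a x ^ 2) (fun x => ?_) (fun n x => ?_)
      ((S.v_pd 0 a).left.1.pow 2) (fun x => sq_nonneg _) (fun n => ((main _ (hn n)).1 a).1)
      (fun n => ((main _ (hn n)).1 a).2)
    · simpa using ((tendsto_wq x).pow 2).mul (tendsto_wm x)
    · exact mul_nonneg (sq_nonneg _) (wm_nonneg (hn n) x)
  · exact integrable_norm_sq_mul (w := fun n x => wm (1 / ((n : ℝ) + 1)) x)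
      (G := fun x => g k a x ^ 2) tendsto_wm (fun n x => wm_nonneg (hn n) x)
      ((S.v_pd k a).right.1.pow 2) (fun x => sq_nonneg _) (fun n => ((main _ (hn n)).2 k a).1)
      (fun n => ((main _ (hn n)).2 k a).2)

/-- On the Fourier side both mixed derivatives are multiplication by the same symbol. -/
theorem HasWeakPD.symm_second {i k : Fin 3} {f f₁ f₂ f₁₂ f₂₁ : E3 → ℝ} (h1 : HasWeakPD i f f₁)
    (h2 : HasWeakPD k f f₂) (h12 : HasWeakPD k f₁ f₁₂) (h21 : HasWeakPD i f₂ f₂₁) :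
    f₁₂ =ᵐ[volume] f₂₁ := by
  have h : hat f₁₂ = hat f₂₁ := by
    refine Lp.ext ?_
    filter_upwards [h1.hat_eq, h2.hat_eq, h12.hat_eq, h21.hat_eq] with ξ e1 e2 e3 e4
    rw [e3, e4, e1, e2]
    ring
  have e := fourierInv_hat h12.right
  rw [h] at e
  filter_upwards [e, fourierInv_hat h21.right] with x e1 e2
  exact Complex.ofReal_injective (e1.symm.trans e2)

/-- The equation tested with m Δv, again through the vanishing of the integral of ∑ Δvₐ ∂ₐ(mP). The
dangerous term m (x·∇v) Δv is removed by a Pohozaev-type identity. -/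
theorem DecaySystem.second_identity (S : DecaySystem v g h α dα P C) {ε : ℝ} (hε : 0 < ε) :
    HasInt (fun x => ∑ a, ((∑ i, h i i a x) * (pd a (wm ε) x * P x)
        + wm ε x * (∑ i, h i i a x) * (∑ k, (α k x + v k x) * (dα k a x + g k a x))
        - wm ε x * (∑ i, h i i a x) ^ 2 - 1 / 2 * (wm ε x * (∑ i, h i i a x) * v a x))
      + ∑ a, ∑ i, ∑ k, (1 / 2 * (pd k (fun y : E3 => y i * wm ε y) x * g i a x * g k a x)
        - 1 / 4 * (pd i (fun y : E3 => y i * wm ε y) x * g k a x ^ 2))) 0 := by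
  obtain ⟨c, b0, b1, b2, b3⟩ := exists_wm_bounds hε
  have hm := contDiff_wm hε
  have z5 := S.div_lap _ _ fun a => (S.P_pd a).mul_smooth hm b0 (b1 a)
  have hsym : ∀ᵐ x : E3, ∀ i k a, h i k a x = h k i a x :=
    ae_all_iff.2 fun i => ae_all_iff.2 fun k => ae_all_iff.2 fun a =>
      (S.v_pd i a).symm_second (S.v_pd k a) (S.g_pd i k a) (S.g_pd k i a)
  -- Integrating m xᵢ∂ᵢvₐ ∂ₖₖvₐ by parts gives m xᵢ ∂ᵢ(∂ₖvₐ)²/2 by symmetry of second derivatives,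
  -- and a second integration by parts moves ∂ᵢ to the weight. What is left has only products of two
  -- first derivatives of v, with coefficients O(|x|²), bounded by the first estimate.
  have z6 : ∀ a i k, HasInt (fun x => pd k (fun y : E3 => y i * wm ε y) x * g i a x * g k a x
        + wm ε x * (x i * g i a x) * h k k a x
        - 1 / 2 * (pd i (fun y : E3 => y i * wm ε y) x * g k a x ^ 2)) 0 := fun a i k => by
    have z1 := ((S.g_pd i k a).mul_smooth
      ((contDiff_coord i).mul hm) (b2 i) (b3 i k)).hasInt_mul (S.g_pd k k a)
    have z2 := ((S.g_pd k i a).mul_smooth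
      ((contDiff_coord i).mul hm) (b2 i) (b3 i i)).hasInt_mul (S.g_pd k i a)
    refine (z1.sub (z2.const_mul (1 / 2))).congr ?_ (by simp)
    filter_upwards [hsym] with x hx
    rw [hx i k a]
    ring
  refine (z5.add ((HasInt.sum fun a => HasInt.sum fun i => HasInt.sum fun k => z6 a i k).const_mul
    (1 / 2))).congr (ae_of_all _ fun x => ?_) (by simp)
  simp only []
  rw [Finset.mul_sum, ← Finset.sum_add_distrib, ← Finset.sum_add_distrib]
  refine Finset.sum_congr rfl fun a _ => ?_
  simp only [Fin.sum_univ_three]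
  ring

end System

/-! ### Decay of solutions -/

/-- A function in `L²` with Laplacian in `L²` is bounded and vanishes at infinity. -/
theorem bounded_and_vanishing_of_laplacian {f : E3 → ℝ} {df : Fin 3 → E3 → ℝ} {q : E3 → ℝ}
    (h1 : ∀ k, HasWeakPD k f (df k)) (h2 : IsWeakDiv df q) (hq : MemLp q 2 volume) :
    (∃ C : ℝ, ∀ᵐ x : E3, |f x| ≤ C) ∧
    ∀ ε : ℝ, 0 < ε → ∃ R : ℝ, ∀ᵐ x : E3, R ≤ ‖x‖ → |f x| ≤ ε := by
  refine bounded_and_vanishing_of_hat (h1 0).left ?_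
  refine ((Lp.memLp (hat q)).const_mul (-(4 * (Real.pi : ℂ) ^ 2)⁻¹)).ae_eq ?_
  filter_upwards [h2.hat_eq (fun k => (h1 k).right) hq, ae_all_iff.2 fun k => (h1 k).hat_eq]
    with ξ e1 e2
  have hpi : (Real.pi : ℂ) ≠ 0 := Complex.ofReal_ne_zero.2 Real.pi_ne_zero
  rw [e1, norm_sq_eq_sum_complex]
  simp only [e2, Fin.sum_univ_three]
  field_simp
  linear_combination (-4 * hat f ξ * ((ξ 0 : ℂ) ^ 2 + (ξ 1 : ℂ) ^ 2 + (ξ 2 : ℂ) ^ 2)) * Complex.I_sq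

theorem isWeakDiv_of_hasWeakPD {g h : Fin 3 → E3 → ℝ} (hg : ∀ k, HasWeakPD k (g k) (h k)) :
    IsWeakDiv g (fun x => ∑ k, h k x) := by
  intro η hη
  simp only [Finset.mul_sum]
  rw [integral_finsetSum _ fun k _ => integrable_mul_of_memLp (hη.memLp 2) (hg k).right,
    ← Finset.sum_neg_distrib]
  exact Finset.sum_congr rfl fun k _ => (hg k).weak η hη

theorem memLp_norm_mul {f : E3 → ℝ} (hf : AEStronglyMeasurable f volume)
    (h : Integrable (fun x => ‖x‖ ^ 2 * f x ^ 2) volume) :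
    MemLp (fun x => ‖x‖ * f x) 2 volume := by
  have hm : AEStronglyMeasurable (fun x => ‖x‖ * f x) volume :=
    continuous_norm.aestronglyMeasurable.mul hf
  exact (memLp_two_iff_integrable_sq hm).2 (by simpa only [mul_pow] using h)

theorem memLp_coord_mul {f : E3 → ℝ} (hf : AEStronglyMeasurable f volume)
    (h : MemLp (fun x => ‖x‖ * f x) 2 volume) (j : Fin 3) :
    MemLp (fun x => x j * f x) 2 volume := by
  refine h.of_le ((contDiff_coord j).continuous.aestronglyMeasurable.mul hf)
      (ae_of_all _ fun x => ?_)
  rw [norm_mul, norm_mul, norm_norm]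
  gcongr
  exact abs_apply_le x j

/-- The formula Δ(xⱼf) = xⱼΔf + 2∂ⱼf in weak form, which makes xⱼv a function with Laplacian in L².
-/
theorem IsWeakDiv.coord_mul {f : E3 → ℝ} {df ddf : Fin 3 → E3 → ℝ}
    (h1 : ∀ k, HasWeakPD k f (df k)) (h2 : ∀ k, HasWeakPD k (df k) (ddf k)) (j : Fin 3)
    (m1 : ∀ k, MemLp (fun x => x j * df k x) 2 volume)
    (m2 : MemLp (fun x => x j * ∑ k, ddf k x) 2 volume) :
    IsWeakDiv (fun k x => (if j = k then f x else 0) + x j * df k x)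
      (fun x => x j * (∑ k, ddf k x) + 2 * df j x) := by
  intro η hη
  have i0 : ∀ k, MemLp (fun x => if j = k then f x else 0) 2 volume := fun k => by
    split_ifs
    · exact (h1 0).left
    · exact MemLp.zero'
  have m3 : MemLp (fun x => x j * (∑ k, ddf k x) + 2 * df j x) 2 volume :=
    m2.add ((h1 j).right.const_mul 2)
  have t1 := HasInt.sum fun k => HasInt.of_memLp ((hη.pd k).memLp 2) ((i0 k).add (m1 k))
  have t2 := HasInt.of_memLp (hη.memLp 2) m3
  have t3 := HasInt.sum fun k => ((isTest_coord_mul hη j).hasWeakPD k).hasInt_mul (h2 k)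
  have t4 := (hη.hasWeakPD j).hasInt_mul (h1 j)
  have t5 := (t1.add t2).eq
  have t6 := ((t3.add t4).congr (g := fun x => ∑ k, SelfSimilarNS.pd k η x *
    ((if j = k then f x else 0) + x j * df k x) + η x * (x j * (∑ k, ddf k x) + 2 * df j x))
    (ae_of_all _ fun x => by
      simp only [pd_coord_mul hη]
      fin_cases j <;> simp [Fin.sum_univ_three] <;> ring) rfl).eq
  have t7 := t5.symm.trans t6
  simp only [Finset.sum_const_zero, add_zero] at t7
  exact eq_neg_of_add_eq_zero_left t7

/-- Pointwise lower bound for the terms in the second energy identity. -/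
theorem second_term_le {r q m L f v dm P : ℝ} (hr : 0 ≤ r) (hq0 : 0 < q) (hq1 : q ≤ 1)
    (hm : m = r ^ 2 * q ^ 3) (hdm : |dm| ≤ 2 * (r * q ^ 3)) :
    L * (dm * P) + m * L * f - m * L ^ 2 - 1 / 2 * (m * L * v)
      ≤ 8 * P ^ 2 + 2 * (r ^ 2 * f ^ 2) + r ^ 2 * v ^ 2 - 1 / 2 * (m * L ^ 2) := by
  have hm0 : 0 ≤ m := by rw [hm]; positivity
  have hmr : m ≤ r ^ 2 := by
    rw [hm]; exact mul_le_of_le_one_right (by positivity) (pow_le_one₀ hq0.le hq1)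
  have hX0 : 0 ≤ r * q ^ 3 := by positivity
  have hX : (r * q ^ 3) ^ 2 ≤ m := by
    rw [hm]
    calc (r * q ^ 3) ^ 2 = r ^ 2 * q ^ 3 * q ^ 3 := by ring
      _ ≤ r ^ 2 * q ^ 3 * 1 := by
        have := pow_le_one₀ hq0.le hq1 (n := 3)
        gcongr
      _ = _ := mul_one _
  have t1 : L * (dm * P) ≤ 1 / 8 * (m * L ^ 2) + 8 * P ^ 2 := by
    have h1 := abs_mul_le_add_sq ((r * q ^ 3) * L) (2 * P) (c := 1 / 8) (d := 2) (by norm_num)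
      (by norm_num)
    have h2 : |L * (dm * P)| ≤ |((r * q ^ 3) * L) * (2 * P)| := by
      rw [abs_mul, abs_mul dm, abs_mul ((r * q ^ 3) * L), abs_mul (r * q ^ 3), abs_mul 2, abs_two,
        abs_of_nonneg hX0]
      calc |L| * (|dm| * |P|) ≤ |L| * (2 * (r * q ^ 3) * |P|) := by gcongr
        _ = _ := by ring
    have h3 : ((r * q ^ 3) * L) ^ 2 ≤ m * L ^ 2 := by rw [mul_pow]; gcongr
    have := le_abs_self (L * (dm * P))
    nlinarith
  have t2 : m * L * f ≤ 1 / 8 * (m * L ^ 2) + 2 * (r ^ 2 * f ^ 2) := by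
    have h1 : m * f ^ 2 ≤ r ^ 2 * f ^ 2 := by gcongr
    nlinarith [mul_nonneg hm0 (sq_nonneg (L - 4 * f))]
  have t3 : -(1 / 2 * (m * L * v)) ≤ 1 / 8 * (m * L ^ 2) + r ^ 2 * v ^ 2 := by
    have h1 : m * v ^ 2 ≤ r ^ 2 * v ^ 2 := by gcongr
    nlinarith [mul_nonneg hm0 (sq_nonneg (L + 2 * v))]
  have : 0 ≤ m * L ^ 2 := by positivity
  linarith

section System
variable {v : Fin 3 → E3 → ℝ} {g : Fin 3 → Fin 3 → E3 → ℝ} {h : Fin 3 → Fin 3 → Fin 3 → E3 → ℝ}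
  {α : Fin 3 → E3 → ℝ} {dα : Fin 3 → Fin 3 → E3 → ℝ} {P : E3 → ℝ} {C : ℝ}

theorem DecaySystem.memLp_lap (S : DecaySystem v g h α dα P C) (a : Fin 3) :
    MemLp (fun x => ∑ i, h i i a x) 2 volume :=
  memLp_finsetSum _ fun i _ => (S.g_pd i i a).right

/-- Expand the product of α + v and ∇α + ∇v. The weight |x| is absorbed by α or ∇α where one occurs;
in v·∇v it goes to ∇v by the first estimate, and v is bounded since its Laplacian is in L². -/
theorem DecaySystem.integrable_advection (S : DecaySystem v g h α dα P C) (a : Fin 3) :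
    Integrable (fun x => ‖x‖ ^ 2 * (∑ k, (α k x + v k x) * (dα k a x + g k a x)) ^ 2) volume := by
  obtain ⟨-, hg⟩ := S.integrable_norm_sq
  have hC : 0 ≤ C := le_trans (by positivity) (S.α_le 0 0)
  have hterm : ∀ k, MemLp (fun x => ‖x‖ * ((α k x + v k x) * (dα k a x + g k a x))) 2 volume := by
    intro k
    obtain ⟨⟨M, hM⟩, -⟩ := bounded_and_vanishing_of_laplacian (fun i => S.v_pd i k)
      (isWeakDiv_of_hasWeakPD fun i => S.g_pd i i k) (S.memLp_lap k)
    have m1 : MemLp (fun x : E3 => ((1 + ‖x‖) ^ 2)⁻¹) 2 volume := by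
      refine memLp_of_sq_decay (C := 1) (by fun_prop) fun x => ?_
      rw [Real.norm_of_nonneg (by positivity), mul_inv_cancel₀ (by positivity)]
    have m2 := memLp_norm_mul (S.v_pd k a).right.1 (hg k a)
    have hb : MemLp (fun x => C ^ 2 * ((1 + ‖x‖) ^ 2)⁻¹ + C * |g k a x| + C * |v k x|
        + M * |‖x‖ * g k a x|) 2 volume :=
      (((m1.const_mul _).add ((S.v_pd k a).right.norm.const_mul C)).add
        ((S.v_pd 0 k).left.norm.const_mul C)).add (m2.norm.const_mul M)
    refine hb.of_le (continuous_norm.aestronglyMeasurable.mul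
      (((S.cont_α k).aestronglyMeasurable.add (S.v_pd 0 k).left.1).mul
      ((S.cont_dα k a).aestronglyMeasurable.add (S.v_pd k a).right.1))) ?_
    filter_upwards [hM] with x hx
    refine le_trans ?_ (le_abs_self _)
    have h0 := norm_nonneg x
    have e1 : ‖x‖ * |α k x| ≤ C := le_trans (by gcongr; linarith) (S.α_le k x)
    have e2 : |dα k a x| ≤ C * ((1 + ‖x‖) ^ 2)⁻¹ := by
      rw [← div_eq_mul_inv, le_div_iff₀ (by positivity), mul_comm]; exact S.dα_le k a x
    have e3 : ‖x‖ * |dα k a x| ≤ C := by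
      refine le_trans ?_ (S.dα_le k a x)
      gcongr
      nlinarith
    rw [Real.norm_eq_abs, abs_mul, abs_mul, abs_norm, abs_mul, abs_norm]
    calc ‖x‖ * (|α k x + v k x| * |dα k a x + g k a x|)
        ≤ ‖x‖ * ((|α k x| + |v k x|) * (|dα k a x| + |g k a x|)) := by
          gcongr <;> exact abs_add_le _ _
      _ = (‖x‖ * |α k x|) * |dα k a x| + (‖x‖ * |α k x|) * |g k a x|
          + (‖x‖ * |dα k a x|) * |v k x| + |v k x| * (‖x‖ * |g k a x|) := by ring
      _ ≤ C * (C * ((1 + ‖x‖) ^ 2)⁻¹) + C * |g k a x| + C * |v k x| + M * (‖x‖ * |g k a x|) := by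
          gcongr
      _ = _ := by ring
  have hs : MemLp (fun x => ∑ k, ‖x‖ * ((α k x + v k x) * (dα k a x + g k a x))) 2 volume :=
    memLp_finsetSum _ fun k _ => hterm k
  refine (integrable_sq_of_memLp hs).congr (ae_of_all _ fun x => ?_)
  simp only [← Finset.mul_sum, mul_pow]

/-- The second weighted estimate: `|x| Δ v` is in `L²`. -/
theorem DecaySystem.integrable_lap (S : DecaySystem v g h α dα P C) (a : Fin 3) :
    Integrable (fun x => ‖x‖ ^ 2 * (∑ i, h i i a x) ^ 2) volume := by
  obtain ⟨hv, hg⟩ := S.integrable_norm_sq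
  let H : E3 → ℝ := fun x => ∑ a, (8 * P x ^ 2
    + 2 * (‖x‖ ^ 2 * (∑ k, (α k x + v k x) * (dα k a x + g k a x)) ^ 2) + ‖x‖ ^ 2 * v a x ^ 2)
    + ∑ a, ∑ i, ∑ k, (3 * (‖x‖ ^ 2 * g i a x ^ 2) + 3 * (‖x‖ ^ 2 * g k a x ^ 2))
  have hH : Integrable H volume := by
    refine Integrable.add (integrable_finsetSum _ fun a _ => ?_) (integrable_finsetSum _ fun a _ =>
      integrable_finsetSum _ fun i _ => integrable_finsetSum _ fun k _ =>
        ((hg i a).const_mul _).add ((hg k a).const_mul _))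
    exact (((integrable_sq_of_memLp (S.P_pd 0).left).const_mul 8).add
      ((S.integrable_advection a).const_mul 2)).add (hv a)
  have main : ∀ ε : ℝ, 0 < ε → Integrable (fun x => wm ε x * (∑ i, h i i a x) ^ 2) volume ∧
      ∫ x, wm ε x * (∑ i, h i i a x) ^ 2 ≤ 2 * ∫ x, H x := by
    intro ε hε
    obtain ⟨c, b0, b1, b2, b3⟩ := exists_wm_bounds hε
    have hm0 := fun x => wm_nonneg hε x
    have iL : ∀ a, Integrable (fun x => wm ε x * (∑ i, h i i a x) ^ 2) volume := fun a =>
      (integrable_sq_of_memLp (S.memLp_lap a)).bdd_mul (c := c)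
        (contDiff_wm hε).continuous.aestronglyMeasurable (ae_of_all _ fun x => b0 x)
    refine ⟨iL a, ?_⟩
    have e := S.second_identity hε
    -- Young's inequality costs three times 1/8 of m|Δv|²; half of it is kept. All other terms have
    -- been bounded by an integrable H independent of ε.
    have hle := integral_mono e.int
      (hH.sub (integrable_finsetSum Finset.univ fun a _ => (iL a).const_mul (1 / 2))) fun x => by
      have hq0 := wq_pos hε x
      have hq1 := wq_le_one hε x
      have hw : ∀ i k, |pd k (fun y : E3 => y i * wm ε y) x| ≤ 3 * ‖x‖ ^ 2 := fun i k => by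
        rw [pd_coord_mul_wm hε]
        refine (abs_add_le _ _).trans ?_
        have h1 : |if i = k then wm ε x else 0| ≤ ‖x‖ ^ 2 := by
          split_ifs
          · rw [abs_of_nonneg (hm0 x)]; exact wm_le hε x
          · rw [abs_zero]; positivity
        have h2 : |x i * pd k (wm ε) x| ≤ 2 * ‖x‖ ^ 2 := by
          rw [abs_mul]
          calc |x i| * |pd k (wm ε) x| ≤ ‖x‖ * (2 * (‖x‖ * wq ε x ^ 3)) := by
                gcongr
                · exact abs_apply_le x i
                · exact abs_pd_wm_le hε k x
            _ = 2 * ‖x‖ ^ 2 * wq ε x ^ 3 := by ring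
            _ ≤ 2 * ‖x‖ ^ 2 * 1 := by
                have := pow_le_one₀ hq0.le hq1 (n := 3)
                gcongr
            _ = _ := mul_one _
        linarith
      have h1 := Finset.sum_le_sum fun a (_ : a ∈ Finset.univ) => second_term_le
        (L := ∑ i, h i i a x) (f := ∑ k, (α k x + v k x) * (dα k a x + g k a x)) (v := v a x)
        (P := P x)
        (norm_nonneg x) hq0 hq1 (rfl : wm ε x = _) (abs_pd_wm_le hε a x)
      have h2 : ∀ a i k, 1 / 2 * (pd k (fun y : E3 => y i * wm ε y) x * g i a x * g k a x)
          - 1 / 4 * (pd i (fun y : E3 => y i * wm ε y) x * g k a x ^ 2)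
          ≤ 3 * (‖x‖ ^ 2 * g i a x ^ 2) + 3 * (‖x‖ ^ 2 * g k a x ^ 2) := fun a i k => by
        have u1 : |pd k (fun y : E3 => y i * wm ε y) x * g i a x * g k a x|
            ≤ 3 * ‖x‖ ^ 2 * (g i a x ^ 2 + g k a x ^ 2) := by
          rw [mul_assoc, abs_mul]
          gcongr
          · exact hw i k
          · rw [abs_mul]
            nlinarith [sq_nonneg (|g i a x| - |g k a x|), sq_abs (g i a x), sq_abs (g k a x)]
        have u2 : |pd i (fun y : E3 => y i * wm ε y) x * g k a x ^ 2| ≤ 3 * ‖x‖ ^ 2 * g k a x ^ 2 := by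
          rw [abs_mul, abs_of_nonneg (sq_nonneg (g k a x))]
          gcongr
          exact hw i i
        have u3 := le_of_abs_le u1
        have u4 := neg_le_of_abs_le u2
        have u5 : 0 ≤ ‖x‖ ^ 2 * g i a x ^ 2 := by positivity
        have u6 : 0 ≤ ‖x‖ ^ 2 * g k a x ^ 2 := by positivity
        nlinarith
      have h3 := Finset.sum_le_sum fun a (_ : a ∈ Finset.univ) => Finset.sum_le_sum
        fun i (_ : i ∈ Finset.univ) => Finset.sum_le_sum fun k (_ : k ∈ Finset.univ) => h2 a i k
      simp only [Fin.sum_univ_three, Pi.sub_apply, H] at h1 h3 ⊢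
      linarith
    rw [e.eq, integral_sub' hH
        (integrable_finsetSum Finset.univ fun a _ => (iL a).const_mul (1 / 2)),
      integral_finsetSum _ fun a _ => (iL a).const_mul (1 / 2)] at hle
    have h4 := Finset.single_le_sum (f := fun a => ∫ x, 1 / 2 * (wm ε x * (∑ i, h i i a x) ^ 2))
      (fun a _ => integral_nonneg fun x => by have := hm0 x; positivity) (Finset.mem_univ a)
    simp only [integral_const_mul] at h4 hle
    linarith
  have hn : ∀ n : ℕ, 0 < 1 / ((n : ℝ) + 1) := fun n => by positivity
  exact integrable_norm_sq_mul (w := fun n x => wm (1 / ((n : ℝ) + 1)) x)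
    (G := fun x => (∑ i, h i i a x) ^ 2) tendsto_wm (fun n x => wm_nonneg (hn n) x)
    ((S.memLp_lap a).1.pow 2) (fun x => sq_nonneg _) (fun n => (main _ (hn n)).1)
    (fun n => (main _ (hn n)).2)

/-- Solutions decay faster than `1 / |x|`. -/
theorem DecaySystem.vanishing (S : DecaySystem v g h α dα P C) (j a : Fin 3) (ε : ℝ) (hε : 0 < ε) :
    ∃ R : ℝ, ∀ᵐ x : E3, R ≤ ‖x‖ → |x j * v a x| ≤ ε := by
  obtain ⟨hv, hg⟩ := S.integrable_norm_sq
  have m0 := memLp_coord_mul (S.v_pd 0 a).left.1 (memLp_norm_mul (S.v_pd 0 a).left.1 (hv a)) j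
  have m1 := fun k => memLp_coord_mul (S.v_pd k a).right.1
    (memLp_norm_mul (S.v_pd k a).right.1 (hg k a)) j
  have m2 := memLp_coord_mul (S.memLp_lap a).1
    (memLp_norm_mul (S.memLp_lap a).1 (S.integrable_lap a)) j
  have i0 : ∀ k, MemLp (fun x => if j = k then v a x else 0) 2 volume := fun k => by
    split_ifs
    · exact (S.v_pd 0 a).left
    · exact MemLp.zero'
  have hpd : ∀ k, HasWeakPD k (fun x => x j * v a x)
      (fun x => (if j = k then v a x else 0) + x j * g k a x) := fun k => by
    have e : (fun x : E3 => pd k (fun x : E3 => x j) x * v a x + x j * g k a x)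
        = fun x => (if j = k then v a x else 0) + x j * g k a x := by
      ext x
      rw [pd_coord]
      split_ifs <;> ring
    rw [← e]
    refine (HasLocWeakPD.of_smooth (contDiff_coord j) k).mul (S.v_pd k a) m0 ?_
    rw [e]
    exact (i0 k).add (m1 k)
  -- The weighted estimates have put xⱼvₐ in H², and such functions vanish at infinity; that is the
  -- required decay multiplied by xⱼ.
  exact (bounded_and_vanishing_of_laplacian hpd
    (IsWeakDiv.coord_mul (fun k => S.v_pd k a) (fun k => S.g_pd k k a) j m1 m2)
    (m2.add ((S.v_pd j a).right.const_mul 2))).2 ε hε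

end System

/-! ### Solutions of `F(v, σ) = 0` are profile solutions -/

/-- The background is α = σA₀, with the decay of the heat extension. The linear terms involve v
alone because F contains A₀ only in the advection. -/
theorem IsScaleInvariantDatum.exists_decaySystem {a₀ : E3 → E3} (ha : IsScaleInvariantDatum a₀)
    {σ : ℝ} {v : D} (h : F a₀ v σ = 0) : ∃ (P : E3 → ℝ) (C : ℝ),
      DecaySystem v.toV.comp (fun k => (v.partial k).comp) (fun i k => (v.partial₂ i k).comp)
        (fun k x => σ * heatExt a₀ x k) (fun k a x => σ * (pd k (heatExt a₀) x) a) P C := by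
  obtain ⟨P, hP⟩ := ha.exists_pressure_profile h
  obtain ⟨C, hC0, hC⟩ := ha.exists_bound_heatExt
  refine ⟨P, |σ| * C, ?_⟩
  refine ⟨fun k a => v.hasWeakPD k a, fun i k a => v.hasWeakPD₂ i k a, fun k a => ?_,
    fun u du hu => v.toV.hasInt_gradient hu, fun u du hu => ?_, fun a => ?_, fun k => ?_,
    fun k a => ?_, fun k x => ?_, fun k a x => ?_⟩
  · have h1 := (IsMult.comp_V v.toV a).memLp (v.partial k) a
    refine (v.hasWeakPD k a).loc.mul (v.hasWeakPD k a) ((IsMult.comp_V v.toV a).memLp v.toV a) ?_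
    exact ((IsMult.comp_V (v.partial k) a).memLp v.toV a).add h1
  · refine (v.lap.hasInt_gradient hu).congr ?_ rfl
    filter_upwards [ae_all_iff.2 fun a => v.lap_comp a] with x hx
    simp only [hx]
  · refine (hP a).congr ae_eq_rfl ?_
    filter_upwards [v.lap_comp a] with x hx
    rw [hx, adv_apply]
    rfl
  · exact continuous_const.mul ((EuclideanSpace.proj k : E3 →L[ℝ] ℝ).continuous.comp
      ha.differentiable_heatExt.continuous)
  · exact continuous_const.mul ((EuclideanSpace.proj a : E3 →L[ℝ] ℝ).continuous.comp
      (ha.differentiable_pd_heatExt k).continuous)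
  · rw [abs_mul, mul_left_comm]
    gcongr
    refine le_trans ?_ (hC x).1
    gcongr
    exact abs_apply_le _ k
  · rw [abs_mul, mul_left_comm]
    gcongr
    refine le_trans ?_ ((hC x).2.1 k)
    gcongr
    exact abs_apply_le _ a

theorem IsScaleInvariantDatum.vanishing {a₀ : E3 → E3} (ha : IsScaleInvariantDatum a₀)
    {σ : ℝ} {v : D} (h : F a₀ v σ = 0) {ε : ℝ} (hε : 0 < ε) :
    ∃ R : ℝ, ∀ᵐ x : E3, R ≤ ‖x‖ → ‖x‖ * ‖v.toV.toL2 x‖ ≤ ε := by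
  obtain ⟨P, C, S⟩ := ha.exists_decaySystem h
  -- The product |x||v| is bounded by the sum of the nine products |xⱼ||vₐ|.
  choose R hR using fun j a => S.vanishing j a (ε / 9) (by positivity)
  refine ⟨∑ j, ∑ a, |R j a|, ?_⟩
  filter_upwards [ae_all_iff.2 fun j => ae_all_iff.2 fun a => hR j a] with x hx hxR
  have h1 : ∀ j a, |x j| * |v.toV.toL2 x a| ≤ ε / 9 := fun j a => by
    rw [← abs_mul]
    refine hx j a (le_trans ?_ hxR)
    calc R j a ≤ |R j a| := le_abs_self _
      _ ≤ ∑ a, |R j a| := Finset.single_le_sum (f := fun a => |R j a|) (fun _ _ => abs_nonneg _)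
          (Finset.mem_univ a)
      _ ≤ _ := Finset.single_le_sum (f := fun j => ∑ a, |R j a|)
          (fun _ _ => Finset.sum_nonneg fun _ _ => abs_nonneg _) (Finset.mem_univ j)
  calc ‖x‖ * ‖v.toV.toL2 x‖ ≤ (∑ j, |x j|) * ∑ a, |v.toV.toL2 x a| := by
        gcongr <;> exact norm_le_sum_abs _
    _ = ∑ j, ∑ a, |x j| * |v.toV.toL2 x a| := Finset.sum_mul_sum _ _ _ _
    _ ≤ ∑ j : Fin 3, ∑ a : Fin 3, ε / 9 :=
        Finset.sum_le_sum fun j _ => Finset.sum_le_sum fun a _ => h1 j a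
    _ = ε := by simp; ring

theorem IsScaleInvariantDatum.asymptotics_profile {a₀ : E3 → E3} (ha : IsScaleInvariantDatum a₀)
    {σ : ℝ} {v : D} (h : F a₀ v σ = 0) {ε : ℝ} (hε : 0 < ε) :
    ∃ R : ℝ, ∀ᵐ x : E3, R ≤ ‖x‖ → ‖(profile a₀ σ v).val x - σ • a₀ x‖ ≤ ε / ‖x‖ := by
  obtain ⟨R, hR⟩ := ha.vanishing h (half_pos hε)
  obtain ⟨C, hC0, hC⟩ := ha.exists_norm_heatExt_sub_le
  refine ⟨max R (max 1 (2 * |σ| * C / ε)), ?_⟩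
  filter_upwards [hR] with x hx hxR
  have h1 : 1 ≤ ‖x‖ := le_trans (le_trans (le_max_left _ _) (le_max_right _ _)) hxR
  have h2 : 2 * |σ| * C / ε ≤ ‖x‖ := le_trans (le_trans (le_max_right _ _) (le_max_right _ _)) hxR
  have h3 := hx (le_trans (le_max_left _ _) hxR)
  have h0 : 0 < ‖x‖ := by linarith
  have h4 : ‖heatExt a₀ x - a₀ x‖ * ‖x‖ ^ 2 ≤ C := by
    have := hC x h1
    rwa [le_div_iff₀ (by positivity)] at this
  rw [div_le_iff₀ hε] at h2
  rw [le_div_iff₀ h0]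
  have h5 : (profile a₀ σ v).val x - σ • a₀ x = σ • (heatExt a₀ x - a₀ x) + v.toV.toL2 x := by
    change σ • heatExt a₀ x + v.toV.toL2 x - σ • a₀ x = _
    rw [smul_sub]
    abel
  rw [h5]
  have h6 : |σ| * ‖heatExt a₀ x - a₀ x‖ * ‖x‖ ≤ ε / 2 := by
    have : |σ| * ‖heatExt a₀ x - a₀ x‖ * ‖x‖ * ‖x‖ ≤ ε / 2 * ‖x‖ := by
      nlinarith [abs_nonneg σ]
    exact le_of_mul_le_mul_right this h0
  calc _ ≤ (|σ| * ‖heatExt a₀ x - a₀ x‖ + ‖v.toV.toL2 x‖) * ‖x‖ := by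
        gcongr
        refine (norm_add_le _ _).trans ?_
        rw [norm_smul, Real.norm_eq_abs]
    _ ≤ ε := by linarith

theorem IsTest.apply {ξ : E3 → E3} (hξ : IsTest ξ) (a : Fin 3) : IsTest fun x => ξ x a :=
  ⟨(EuclideanSpace.proj a : E3 →L[ℝ] ℝ).contDiff.comp hξ.smooth,
    hξ.compact.comp_left (g := (EuclideanSpace.proj a : E3 →L[ℝ] ℝ)) (map_zero _)⟩

theorem IsTest.pd_field {ξ : E3 → E3} (h : IsTest ξ) (i : Fin 3) :
    IsTest (SelfSimilarNS.pd i ξ) where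
  smooth := (h.smooth.fderiv_right (m := ∞) (by simp)).clm_apply contDiff_const
  compact := h.compact.fderiv_apply (𝕜 := ℝ) (e i)

theorem IsTest.pd_apply {ξ : E3 → E3} (h : IsTest ξ) (i a : Fin 3) :
    (SelfSimilarNS.pd i fun x => ξ x a) = fun x => SelfSimilarNS.pd i ξ x a :=
  funext fun x => SelfSimilarNS.pd_apply (h.smooth.differentiable (by simp) x) i a

theorem fderiv_apply_eq_sum_pd (ξ : E3 → E3) (x y : E3) (a : Fin 3) :
    (fderiv ℝ ξ x y) a = ∑ k, y k * (pd k ξ x) a := by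
  conv_lhs => rw [← sum_smul_e y]
  simp [pd]

/-- The distributional form of the profile equation, one component at a time. -/
theorem IsScaleInvariantDatum.profile_equation {a₀ : E3 → E3} (ha : IsScaleInvariantDatum a₀)
    {σ : ℝ} {v : D} {P : E3 → ℝ} {a : Fin 3} (hP : HasWeakPD a P
      (fun x => adv (profile a₀ σ v) (profile a₀ σ v) x a - v.lap.comp a x
        - 1 / 2 * ∑ i, x i * (v.partial i).comp a x - 1 / 2 * v.toV.comp a x))
    {η : E3 → ℝ} (hη : IsTest η) :
    ∃ c₁ c₂ c₃ : ℝ, HasInt (fun x => (profile a₀ σ v).val x a *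
        (∑ i, pd i (pd i η) x - 1 / 2 * ∑ i, x i * pd i η x - η x)) c₁ ∧
      HasInt (fun x => ∑ k, pd k η x * ((profile a₀ σ v).val x k * (profile a₀ σ v).val x a)) c₂ ∧
      HasInt (fun x => P x * pd a η x) c₃ ∧ c₁ + c₂ - c₃ = 0 := by
  obtain ⟨N, hN⟩ := ha.exists_multField_profile σ v
  have i1 : Integrable (fun x => (profile a₀ σ v).val x a *
      (∑ i, pd i (pd i η) x - 1 / 2 * ∑ i, x i * pd i η x - η x)) volume := by
    have hζ : ∀ i, Integrable (fun x => (profile a₀ σ v).val x a * pd i (pd i η) x) volume :=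
        fun i =>
      ((hN.val_loc a 0).integrable ((hη.pd i).pd i)).congr (ae_of_all _ fun x => mul_comm _ _)
    have hζ' : ∀ i, Integrable (fun x => (profile a₀ σ v).val x a * (x i * pd i η x)) volume :=
        fun i =>
      ((hN.val_loc a 0).integrable (isTest_coord_mul (hη.pd i) i)).congr
        (ae_of_all _ fun x => mul_comm _ _)
    have hζ'' : Integrable (fun x => (profile a₀ σ v).val x a * η x) volume :=
      ((hN.val_loc a 0).integrable hη).congr (ae_of_all _ fun x => mul_comm _ _)
    refine (((integrable_finsetSum Finset.univ fun i _ => hζ i).sub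
        ((integrable_finsetSum Finset.univ
      fun i _ => hζ' i).const_mul (1 / 2))).sub hζ'').congr (ae_of_all _ fun x => ?_)
    simp only [Pi.sub_apply, Fin.sum_univ_three]
    ring
  have z1 : HasInt _ _ := ⟨i1, hN.integral_adjoint hη a⟩
  have z2 := HasInt.sum fun k => HasInt.of_memLp ((hη.pd k).memLp 2) (ha.memLp_profile_mul σ v a k)
  have e2 := ha.isWeakDiv_profile σ v a η hη
  have z3 := HasInt.of_memLp hP.left ((hη.pd a).memLp 2)
  have m4 := (memLp_apply (ha.memLp_adv_profile σ v) a)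
  have z4 := HasInt.of_memLp (hη.memLp 2) hP.right
  have z5 := HasInt.of_memLp (hη.memLp 2) m4
  refine ⟨_, _, _, z1, z2, z3, ?_⟩
  · have e3 := hP.weak η hη
    have e3' : ∫ x, P x * pd a η x = ∫ x, pd a η x * P x := by simp only [mul_comm]
    rw [e2, e3', e3]
    -- The linear terms of U and those of v differ by σ times the linear terms of A₀, which vanish
    -- by the self-similar heat equation.
    have key : (∫ x, η x * (∑ i, (σ • pd i (pd i (heatExt a₀)) x + (v.partial₂ i i).toL2 x) a
        + 1 / 2 * ∑ i, x i * (profile a₀ σ v).grad i x a + 1 / 2 * (profile a₀ σ v).val x a))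
        = (∫ x, η x * adv (profile a₀ σ v) (profile a₀ σ v) x a)
          - ∫ x, η x * (adv (profile a₀ σ v) (profile a₀ σ v) x a - v.lap.comp a x
            - 1 / 2 * ∑ i, x i * (v.partial i).comp a x - 1 / 2 * v.toV.comp a x) := by
      rw [← integral_sub z5.int z4.int]
      refine integral_congr_ae ?_
      filter_upwards [v.lap_comp a] with x hx
      have hh := congrArg (fun y : E3 => y a) (ha.heat_equation x)
      simp only [PiLp.add_apply, PiLp.smul_apply, smul_eq_mul, Fin.sum_univ_three,
        PiLp.zero_apply] at hh
      change _ = _ at hx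
      rw [hx]
      simp only [profile, D.field, V.comp, PiLp.add_apply, PiLp.smul_apply, smul_eq_mul,
        Fin.sum_univ_three]
      linear_combination (σ * η x) * hh
    rw [key]
    ring

/-- Solutions of `F(v, σ) = 0` are profile solutions. -/
theorem IsScaleInvariantDatum.isProfileSolution {a₀ : E3 → E3} (ha : IsScaleInvariantDatum a₀)
    {σ : ℝ} {v : D} (h : F a₀ v σ = 0) :
    IsProfileSolution (fun x => σ • a₀ x) (profile a₀ σ v).val := by
  have hcont : Continuous fun x => σ • heatExt a₀ x :=
    (continuous_const_smul σ).comp ha.differentiable_heatExt.continuous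
  obtain ⟨N, hN⟩ := ha.exists_multField_profile σ v
  have hmem : ∀ a, LocallyIntegrable (fun x => (profile a₀ σ v).val x a * (profile a₀ σ v).val x a)
    := fun a => (ha.memLp_profile_mul σ v a a).locallyIntegrable (by norm_num)
  refine ⟨?_, ?_, ?_, ?_, fun ε hε => ha.asymptotics_profile h hε⟩
  · exact hcont.locallyIntegrable.add ((Lp.memLp v.toV.toL2).locallyIntegrable (by norm_num))
  · have e1 : (fun x => ‖(profile a₀ σ v).val x‖ ^ 2)
        = fun x => ((profile a₀ σ v).val x 0 * (profile a₀ σ v).val x 0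
          + (profile a₀ σ v).val x 1 * (profile a₀ σ v).val x 1)
          + (profile a₀ σ v).val x 2 * (profile a₀ σ v).val x 2 := by
      ext x
      rw [← real_inner_self_eq_norm_sq, inner_eq_sum, Fin.sum_univ_three]
    rw [e1]
    exact ((hmem 0).add (hmem 1)).add (hmem 2)
  · intro η hη
    have z : ∀ a, HasInt (fun x => pd a η x * (profile a₀ σ v).val x a) _ := fun a =>
      .of_integrable ((hN.val_loc a a).integrable (hη.pd a))
    refine ((HasInt.sum z).congr (ae_of_all _ fun x => ?_) ?_).eq
    · simp only [inner_eq_sum, gradient_apply, mul_comm]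
    · have z' : ∀ a, HasInt (fun x => η x * (profile a₀ σ v).grad a x a) _ := fun a =>
        .of_integrable ((hN.val_loc a a).integrable' hη)
      rw [Finset.sum_congr rfl fun a _ => (hN.val_loc a a).integral_pd_mul hη,
        Finset.sum_neg_distrib, ← (HasInt.sum z').eq, neg_eq_zero,
            ← integral_zero E3 ℝ (μ := volume)]
      refine integral_congr_ae ?_
      filter_upwards [ha.div_profile σ v] with x hx
      rw [← Finset.mul_sum, hx, mul_zero]
  · obtain ⟨P, hP⟩ := ha.exists_pressure_profile h
    have hPl := (hP 0).left
    -- P was chosen with ∇P equal to advection plus linear part, where the linear part carries the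
    -- opposite sign to the profile equation; the physical pressure is therefore -P.
    refine ⟨fun x => -P x, (hPl.locallyIntegrable (by norm_num)).neg, fun ξ hξ => ?_⟩
    choose c₁ c₂ c₃ z1 z2 z3 hz using fun a => ha.profile_equation (hP a) (hξ.apply a)
    have e1 : ∀ i a, (pd i fun x => ξ x a) = fun x => pd i ξ x a := fun i a => hξ.pd_apply i a
    have e2 : ∀ i a, (pd i fun x => pd i ξ x a) = fun x => pd i (pd i ξ) x a := fun i a =>
      (hξ.pd_field i).pd_apply i a
    have y1 := (HasInt.sum z1).congr (g := fun x => ⟪(profile a₀ σ v).val x,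
      (∑ i, pd i (pd i ξ) x) - (1 / 2 : ℝ) • fderiv ℝ ξ x x - ξ x⟫) (ae_of_all _ fun x => by
        simp only [inner_eq_sum, PiLp.sub_apply, PiLp.smul_apply, fderiv_apply_eq_sum_pd, e1, e2,
          smul_eq_mul, WithLp.ofLp_sum, Finset.sum_apply]) rfl
    have y2 := (HasInt.sum z2).congr (g := fun x => ⟪(profile a₀ σ v).val x,
      fderiv ℝ ξ x ((profile a₀ σ v).val x)⟫) (ae_of_all _ fun x => by
        simp only [inner_eq_sum, fderiv_apply_eq_sum_pd, e1, Finset.mul_sum]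
        exact Finset.sum_congr rfl fun a _ => Finset.sum_congr rfl fun k _ => by ring) rfl
    have y3 := ((HasInt.sum z3).const_mul (-1)).congr (g := fun x => -P x * ∑ i, (pd i ξ x) i)
      (ae_of_all _ fun x => by
        simp only [e1, Finset.mul_sum]
        exact Finset.sum_congr rfl fun a _ => by ring) rfl
    rw [y1.eq, y2.eq, y3.eq, neg_one_mul, ← sub_eq_add_neg, ← Finset.sum_add_distrib,
      ← Finset.sum_sub_distrib]
    exact Finset.sum_eq_zero fun a _ => hz a

/-! ### Frequency truncation -/

/-- The part of `f` with frequencies in the ball of radius `N`. -/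
def lowPass (N : ℝ) (f : E3 → ℝ) (x : E3) : ℂ :=
  ∫ ξ in Metric.ball (0 : E3) N, Real.fourierChar ⟪ξ, x⟫ • hat f ξ

instance isFiniteMeasure_restrict_ball (N : ℝ) :
    IsFiniteMeasure ((volume : Measure E3).restrict (Metric.ball 0 N)) :=
  ⟨by rw [Measure.restrict_apply_univ]; exact measure_ball_lt_top⟩

theorem integrableOn_ball (N : ℝ) (w : Lp ℂ 2 (volume : Measure E3)) :
    IntegrableOn w (Metric.ball 0 N) volume :=
  ((Lp.memLp w).restrict _).integrable (by norm_num)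

theorem exists_integral_ball_le (N : ℝ) : ∃ C : ℝ, 0 ≤ C ∧ ∀ w : Lp ℂ 2 (volume : Measure E3),
    ∫ ξ in Metric.ball (0 : E3) N, ‖w ξ‖ ≤ C * ‖w‖ := by
  refine ⟨((volume : Measure E3).restrict (Metric.ball 0 N) univ ^
    (1 / (1 : ℝ≥0∞).toReal - 1 / (2 : ℝ≥0∞).toReal)).toReal, ENNReal.toReal_nonneg, fun w => ?_⟩
  have h := eLpNorm_le_eLpNorm_mul_rpow_measure_univ (p := 1) (q := 2) (by norm_num)
    (Lp.aestronglyMeasurable w).restrict (μ := (volume : Measure E3).restrict (Metric.ball 0 N))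
  have h2 : eLpNorm w 2 ((volume : Measure E3).restrict (Metric.ball 0 N)) ≤ eLpNorm w 2 volume :=
    eLpNorm_restrict_le _ _ _ _
  have htop : (volume : Measure E3).restrict (Metric.ball 0 N) univ ^
      (1 / (1 : ℝ≥0∞).toReal - 1 / (2 : ℝ≥0∞).toReal) ≠ ⊤ :=
    ENNReal.rpow_ne_top_of_nonneg (by norm_num) (measure_ne_top _ _)
  rw [integral_norm_eq_lintegral_enorm (Lp.aestronglyMeasurable w).restrict,
    ← eLpNorm_one_eq_lintegral_enorm, Lp.norm_def, ← ENNReal.toReal_mul]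
  refine ENNReal.toReal_mono (ENNReal.mul_ne_top htop (Lp.memLp w).2.ne) ?_
  rw [mul_comm]
  exact h.trans (by gcongr)

theorem norm_fourierChar_sub_le (a b : ℝ) :
    ‖(Real.fourierChar a : ℂ) - Real.fourierChar b‖ ≤ 2 * Real.pi * |a - b| := by
  have h : (Real.fourierChar a : ℂ) - Real.fourierChar b
      = Real.fourierChar b * (Complex.exp (Complex.I * (2 * Real.pi * (a - b) : ℝ)) - 1) := by
    rw [Real.fourierChar_apply, Real.fourierChar_apply, mul_sub, mul_one, ← Complex.exp_add]
    congr 2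
    push_cast
    ring
  rw [h, norm_mul, Circle.norm_coe, one_mul]
  refine Real.norm_exp_I_mul_ofReal_sub_one_le.trans (le_of_eq ?_)
  rw [Real.norm_eq_abs, abs_mul, abs_of_pos Real.two_pi_pos]

theorem integrableOn_lowPass (N : ℝ) (w : Lp ℂ 2 (volume : Measure E3)) (x : E3) :
    IntegrableOn (fun ξ => Real.fourierChar ⟪ξ, x⟫ • w ξ) (Metric.ball 0 N) volume := by
  refine (integrableOn_ball N w).norm.mono' ?_ (ae_of_all _ fun ξ => ?_)
  · have hc : Continuous fun ξ : E3 => (Real.fourierChar ⟪ξ, x⟫ : ℂ) :=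
      continuous_subtype_val.comp (Real.continuous_fourierChar.comp (by fun_prop))
    exact (hc.aestronglyMeasurable.smul (Lp.aestronglyMeasurable w)).restrict
  · rw [Circle.norm_smul]

/-- On a bounded set of frequencies the L² norm controls the L¹ norm of the transform, and
characters with |ξ| < N are 2πN-Lipschitz. So the truncations of an L² bounded family are
equibounded and equicontinuous. -/
theorem exists_norm_lowPass_le (N : ℝ) (hN : 0 ≤ N) : ∃ C : ℝ, 0 ≤ C ∧ ∀ f : E3 → ℝ,
    (∀ x, ‖lowPass N f x‖ ≤ C * ‖hat f‖) ∧
    ∀ x y, ‖lowPass N f x - lowPass N f y‖ ≤ C * ‖x - y‖ * ‖hat f‖ := by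
  obtain ⟨C, hC0, hC⟩ := exists_integral_ball_le N
  refine ⟨C + 2 * Real.pi * N * C, by positivity, fun f => ⟨fun x => ?_, fun x y => ?_⟩⟩
  · have h1 : ‖lowPass N f x‖ ≤ C * ‖hat f‖ := by
      refine (norm_integral_le_integral_norm _).trans (le_trans (le_of_eq ?_) (hC (hat f)))
      simp only [Circle.norm_smul]
    refine h1.trans ?_
    gcongr
    exact le_add_of_nonneg_right (by positivity)
  · have h1 : ‖lowPass N f x - lowPass N f y‖
        ≤ ∫ ξ in Metric.ball (0 : E3) N, 2 * Real.pi * N * ‖x - y‖ * ‖hat f ξ‖ := by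
      rw [lowPass, lowPass,
          ← integral_sub (integrableOn_lowPass N _ x) (integrableOn_lowPass N _ y)]
      refine norm_integral_le_of_norm_le ((integrableOn_ball N (hat f)).norm.const_mul _) ?_
      refine (ae_restrict_iff' measurableSet_ball).2 (ae_of_all _ fun ξ hξ => ?_)
      rw [mem_ball_zero_iff] at hξ
      rw [Circle.smul_def, Circle.smul_def, ← sub_smul, norm_smul]
      gcongr
      refine (norm_fourierChar_sub_le _ _).trans ?_
      rw [← inner_sub_right, mul_assoc (2 * Real.pi)]
      gcongr
      exact (abs_real_inner_le_norm _ _).trans (by gcongr)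
    rw [integral_const_mul] at h1
    refine h1.trans ?_
    calc 2 * Real.pi * N * ‖x - y‖ * ∫ ξ in Metric.ball (0 : E3) N, ‖hat f ξ‖
        ≤ 2 * Real.pi * N * ‖x - y‖ * (C * ‖hat f‖) := by gcongr; exact hC _
      _ = (2 * Real.pi * N * C) * ‖x - y‖ * ‖hat f‖ := by ring
      _ ≤ _ := by gcongr; exact le_add_of_nonneg_left hC0

theorem lowPass_add (N : ℝ) {f g : E3 → ℝ}
    (hf : MemLp f 2 volume) (hg : MemLp g 2 volume) (x : E3) :
    lowPass N (fun y => f y + g y) x = lowPass N f x + lowPass N g x := by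
  rw [lowPass, lowPass, lowPass, hat_add hf hg,
    ← integral_add (integrableOn_lowPass N _ x) (integrableOn_lowPass N _ x)]
  refine integral_congr_ae (ae_restrict_of_ae ?_)
  filter_upwards [Lp.coeFn_add (hat f) (hat g)] with ξ h
  rw [h, Pi.add_apply, smul_add]

theorem lowPass_const_mul (N : ℝ) {f : E3 → ℝ} (hf : MemLp f 2 volume) (c : ℝ) (x : E3) :
    lowPass N (fun y => c * f y) x = c • lowPass N f x := by
  rw [lowPass, lowPass, hat_const_mul c hf, ← integral_smul]
  refine integral_congr_ae (ae_restrict_of_ae ?_)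
  filter_upwards [Lp.coeFn_smul (c : ℂ) (hat f)] with ξ h
  rw [h, Pi.smul_apply, Complex.coe_smul, smul_comm]

theorem lowPass_congr (N : ℝ) {f g : E3 → ℝ} (h : f =ᵐ[volume] g) (x : E3) :
    lowPass N f x = lowPass N g x := by
  rw [lowPass, lowPass, hat_congr h]

theorem norm_fourierInv_eq (w : Lp ℂ 2 (volume : Measure E3)) :
    ‖(𝓕⁻ w : Lp ℂ 2 (volume : Measure E3))‖ = ‖w‖ := by
  rw [← Lp.norm_fourier_eq, FourierTransform.fourier_fourierInv_eq]

/-- Frequency truncation approximates functions in `H¹`. -/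
theorem eLpNorm_sub_lowPass_le {f : E3 → ℝ} {g : Fin 3 → E3 → ℝ} (h : ∀ k, HasWeakPD k f (g k))
    {N : ℝ} (hN : 0 < N) : eLpNorm (fun x => (f x : ℂ) - lowPass N f x) 2 volume
      ≤ ENNReal.ofReal (1 / N * ∑ k, ‖hat (g k)‖) := by
  have hm : MemLp ((Metric.ball (0 : E3) N).indicator (hat f)) 2 volume :=
    (Lp.memLp (hat f)).indicator measurableSet_ball
  set w := hm.toLp _ with hw
  have hwae : w =ᵐ[volume] (Metric.ball (0 : E3) N).indicator (hat f) := hm.coeFn_toLp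
  have hint : Integrable w volume :=
    ((integrableOn_ball N (hat f)).integrable_indicator measurableSet_ball).congr hwae.symm
  have e1 : (fun x => (f x : ℂ) - lowPass N f x) =ᵐ[volume]
      (𝓕⁻ (hat f - w) : Lp ℂ 2 (volume : Measure E3)) := by
    have e0 : (𝓕⁻ (hat f - w) : Lp ℂ 2 (volume : Measure E3)) = 𝓕⁻ (hat f) - 𝓕⁻ w := by
      rw [sub_eq_add_neg, FourierTransform.fourierInv_add, ← neg_one_smul ℂ w,
        FourierTransform.fourierInv_smul, neg_one_smul, ← sub_eq_add_neg]
    rw [e0]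
    filter_upwards [fourierInv_hat (h 0).left, fourierInv_toLp_ae_eq w hint,
      Lp.coeFn_sub (𝓕⁻ (hat f) : Lp ℂ 2 (volume : Measure E3)) (𝓕⁻ w)] with x h1 h2 h3
    rw [h3, Pi.sub_apply, h1, h2, Real.fourierInv_eq, lowPass,
        ← integral_indicator measurableSet_ball]
    congr 1
    refine integral_congr_ae ?_
    filter_upwards [hwae] with ξ hξ
    rw [hξ]
    by_cases hb : ξ ∈ Metric.ball (0 : E3) N
    · rw [indicator_of_mem hb, indicator_of_mem hb]
    · rw [indicator_of_notMem hb, indicator_of_notMem hb, smul_zero]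
  have e2 : eLpNorm (fun x => (f x : ℂ) - lowPass N f x) 2 volume =
      eLpNorm (hat f - w : Lp ℂ 2 (volume : Measure E3)) 2 volume := by
    rw [eLpNorm_congr_ae e1, ← Lp.enorm_def, ← Lp.enorm_def, ← ofReal_norm, ← ofReal_norm,
      norm_fourierInv_eq]
  rw [e2]
  -- Outside the ball N ≤ |ξ| ≤ ∑|ξₖ|, so a factor N is paid for by one derivative.
  have e3 : ∀ᵐ ξ : E3, ‖(hat f - w : Lp ℂ 2 (volume : Measure E3)) ξ‖
      ≤ ∑ k, ‖((1 / N : ℝ) : ℂ) * hat (g k) ξ‖ := by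
    filter_upwards [Lp.coeFn_sub (hat f) w, hwae,
        ae_all_iff.2 fun k => (h k).hat_eq] with ξ h1 h2 h3
    rw [h1, Pi.sub_apply, h2]
    by_cases hb : ξ ∈ Metric.ball (0 : E3) N
    · rw [indicator_of_mem hb, sub_self, norm_zero]
      positivity
    · rw [indicator_of_notMem hb, sub_zero]
      rw [mem_ball_zero_iff, not_lt] at hb
      have h4 : ∀ k, ‖((1 / N : ℝ) : ℂ) * hat (g k) ξ‖ =
          1 / N * (2 * Real.pi * |ξ k| * ‖hat f ξ‖) := by
        intro k
        rw [h3 k]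
        simp [abs_of_pos hN, abs_of_pos Real.pi_pos]
      simp only [h4]
      rw [← Finset.mul_sum, ← Finset.sum_mul, ← Finset.mul_sum]
      have h5 : N ≤ ∑ k, |ξ k| := hb.trans (norm_le_sum_abs ξ)
      have h6 : 1 ≤ 2 * Real.pi := by linarith [Real.pi_gt_three]
      rw [div_mul_eq_mul_div, one_mul, le_div_iff₀ hN, mul_comm]
      gcongr
      nlinarith
  refine (eLpNorm_mono_ae_real e3).trans ?_
  have hmk : ∀ k, AEStronglyMeasurable (fun ξ => ‖((1 / N : ℝ) : ℂ) * hat (g k) ξ‖) volume :=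
      fun k =>
    ((Lp.aestronglyMeasurable (hat (g k))).const_mul _).norm
  have h7 := eLpNorm_sum_le (s := Finset.univ) (fun k _ => hmk k) (p := 2) (by norm_num)
  have h8 : (fun ξ => ∑ k, ‖((1 / N : ℝ) : ℂ) * hat (g k) ξ‖)
      = ∑ k, fun ξ => ‖((1 / N : ℝ) : ℂ) * hat (g k) ξ‖ := by ext ξ; simp
  rw [h8]
  refine h7.trans (le_of_eq ?_)
  rw [Finset.mul_sum, ENNReal.ofReal_sum_of_nonneg fun k _ => by positivity]
  refine Finset.sum_congr rfl fun k _ => ?_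
  rw [eLpNorm_norm]
  have h9 : (fun ξ => ((1 / N : ℝ) : ℂ) * hat (g k) ξ) = ((1 / N : ℝ) : ℂ) • ⇑(hat (g k)) := rfl
  rw [h9, eLpNorm_const_smul, ← Lp.enorm_def, ← ofReal_norm, ← ofReal_norm,
    ENNReal.ofReal_mul (by positivity), Complex.norm_real, Real.norm_of_nonneg (by positivity)]

/-! ### Compactness -/

/-- The inclusion `𝒟 → 𝒱`. -/
def D.toVL : D →L[ℝ] V :=
  LinearMap.mkContinuous ⟨⟨D.toV, fun _ _ => rfl⟩, fun _ _ => rfl⟩ 1 fun v => by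
    rw [one_mul]; exact v.norm_toV_le

/-- The partial derivative `∂ᵢ : 𝒟 → 𝒱`. -/
def D.partialL (i : Fin 3) : D →L[ℝ] V :=
  LinearMap.mkContinuous ⟨⟨fun v => v.partial i, fun _ _ => rfl⟩, fun _ _ => rfl⟩ 1 fun v => by
    rw [one_mul]; exact v.norm_partial_le i

/-- A family of functions is `L²`-small up to finitely many continuous functionals. -/
structure AlmostFinite (f : D → E3 → ℝ) : Prop where
  meas : ∀ φ, AEStronglyMeasurable (f φ) volume
  le : ∀ ε : ℝ, 0 < ε → ∃ (s : Finset (D →L[ℝ] ℂ)) (C : ℝ), 0 ≤ C ∧ ∀ φ,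
    eLpNorm (f φ) 2 volume ≤ ENNReal.ofReal (ε * ‖φ‖ + C * ∑ l ∈ s, ‖l φ‖)

theorem AlmostFinite.add {f g : D → E3 → ℝ} (hf : AlmostFinite f) (hg : AlmostFinite g) :
    AlmostFinite fun φ x => f φ x + g φ x := by
  classical
  refine ⟨fun φ => (hf.meas φ).add (hg.meas φ), fun ε hε => ?_⟩
  obtain ⟨s, C, hC, h1⟩ := hf.le (ε / 2) (half_pos hε)
  obtain ⟨s', C', hC', h2⟩ := hg.le (ε / 2) (half_pos hε)
  refine ⟨s ∪ s', C + C', add_nonneg hC hC', fun φ => ?_⟩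
  refine (eLpNorm_add_le (hf.meas φ) (hg.meas φ) (by norm_num)).trans ?_
  refine (add_le_add (h1 φ) (h2 φ)).trans ?_
  rw [← ENNReal.ofReal_add (by positivity) (by positivity)]
  refine ENNReal.ofReal_le_ofReal ?_
  have e1 : ∑ l ∈ s, ‖l φ‖ ≤ ∑ l ∈ s ∪ s', ‖l φ‖ :=
    Finset.sum_le_sum_of_subset_of_nonneg Finset.subset_union_left fun _ _ _ => norm_nonneg _
  have e2 : ∑ l ∈ s', ‖l φ‖ ≤ ∑ l ∈ s ∪ s', ‖l φ‖ :=
    Finset.sum_le_sum_of_subset_of_nonneg Finset.subset_union_right fun _ _ _ => norm_nonneg _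
  nlinarith [mul_le_mul_of_nonneg_left e1 hC, mul_le_mul_of_nonneg_left e2 hC']

theorem AlmostFinite.zero : AlmostFinite fun _ _ => 0 :=
  ⟨fun _ => aestronglyMeasurable_const, fun ε hε => ⟨∅, 0, le_rfl, fun φ => by simp⟩⟩

theorem AlmostFinite.sum {ι : Type*} (s : Finset ι) {f : ι → D → E3 → ℝ}
    (h : ∀ i, AlmostFinite (f i)) : AlmostFinite fun φ x => ∑ i ∈ s, f i φ x := by
  classical
  induction s using Finset.induction_on with
  | empty => simpa using AlmostFinite.zero
  | insert i s hi ih =>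
    simp only [Finset.sum_insert hi]
    exact (h i).add ih

/-- A bounded linear map from `𝒟` to `𝒱` with values in `H¹`. -/
def IsRegularMap (w : D →L[ℝ] V) : Prop := ∃ (G : D → Fin 3 → L2) (M : ℝ), 0 ≤ M ∧ ∀ φ,
  ‖w φ‖ ≤ M * ‖φ‖ ∧ ∀ k, IsWeakPartial k (w φ).toL2 (G φ k) ∧ ‖G φ k‖ ≤ M * ‖φ‖

theorem D.isRegularMap_toVL : IsRegularMap D.toVL :=
  ⟨fun φ k => (φ.partial k).toL2, 1, zero_le_one, fun φ => by
    simp only [one_mul]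
    exact ⟨φ.norm_toV_le, fun k => ⟨φ.2.1 k, (V.norm_toL2_le _).trans (φ.norm_partial_le k)⟩⟩⟩

theorem D.isRegularMap_partialL (i : Fin 3) : IsRegularMap (D.partialL i) :=
  ⟨fun φ k => (φ.partial₂ i k).toL2, 1, zero_le_one, fun φ => by
    simp only [one_mul]
    exact ⟨φ.norm_partial_le i, fun k => ⟨φ.2.2.1 i k,
      (V.norm_toL2_le _).trans (φ.norm_partial₂_le i k)⟩⟩⟩

theorem norm_hat_apply_le (u : L2) (a : Fin 3) : ‖hat fun x => u x a‖ ≤ ‖u‖ := by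
  rw [norm_hat (memLp_apply (Lp.memLp u) a), Lp.norm_def]
  exact ENNReal.toReal_mono (Lp.memLp u).2.ne (eLpNorm_apply_le _ _ _)

/-- The frequency truncation at a point, as a functional. -/
theorem exists_lowPassL (w : D →L[ℝ] V) (a : Fin 3) {N : ℝ} (hN : 0 ≤ N) (p : E3) :
    ∃ l : D →L[ℝ] ℂ, ∀ φ, l φ = lowPass N ((w φ).comp a) p := by
  obtain ⟨C, hC0, hC⟩ := exists_norm_lowPass_le N hN
  refine ⟨LinearMap.mkContinuous ⟨⟨fun φ => lowPass N ((w φ).comp a) p, fun φ ψ => ?_⟩,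
    fun c φ => ?_⟩ (C * ‖w‖) fun φ => ?_, fun φ => rfl⟩
  · rw [← lowPass_add N ((w φ).memLp_two a) ((w ψ).memLp_two a)]
    refine lowPass_congr N ?_ p
    rw [map_add]
    filter_upwards [Lp.coeFn_add (w φ).toL2 (w ψ).toL2] with x hx
    rw [V.comp, V.toL2_add, hx, Pi.add_apply, PiLp.add_apply]
    rfl
  · simp only [RingHom.id_apply]
    rw [← lowPass_const_mul N ((w φ).memLp_two a)]
    refine lowPass_congr N ?_ p
    rw [map_smul]
    filter_upwards [Lp.coeFn_smul c (w φ).toL2] with x hx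
    simp [V.comp, V.toL2_smul, hx]
  · refine ((hC _).1 p).trans ?_
    rw [mul_assoc]
    gcongr
    exact (norm_hat_apply_le _ a).trans ((V.norm_toL2_le _).trans (w.le_opNorm φ))

/-- Rellich's theorem. -/
theorem IsRegularMap.almostFinite_indicator {w : D →L[ℝ] V} (hw : IsRegularMap w) (a : Fin 3)
    (R : ℝ) : AlmostFinite fun φ => (Metric.ball (0 : E3) R).indicator ((w φ).comp a) := by
  classical
  refine ⟨fun φ => ((w φ).memLp_two a).1.indicator measurableSet_ball, fun ε hε => ?_⟩
  obtain ⟨G, M, hM0, hG⟩ := hw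
  -- With three derivatives bounded by M‖φ‖ each, the discarded frequencies contribute at most
  -- 3M‖φ‖/N ≤ (ε/2)‖φ‖.
  set N : ℝ := 6 * M / ε + 1 with hN
  have hN0 : 0 < N := by positivity
  obtain ⟨C, hC0, hC⟩ := exists_norm_lowPass_le N hN0.le
  set A : ℝ := (volume (Metric.ball (0 : E3) R) ^ (1 / (2 : ℝ≥0∞).toReal)).toReal with hA
  have hA0 : 0 ≤ A := ENNReal.toReal_nonneg
  -- Mesh of the net in the ball. The truncation varies by at most CρM‖φ‖ between a point and its
  -- nearest node, and the factor A, the root of the volume, turns this into an L² error below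
  -- (ε/2)‖φ‖. The values at the nodes are the finitely many functionals.
  set ρ : ℝ := ε / (2 * (A * C * M + 1)) with hρ
  have hρ0 : 0 < ρ := by positivity
  obtain ⟨t, -, ht, hcov⟩ := finite_cover_balls_of_compact (isCompact_closedBall (0 : E3) R) hρ0
  choose l hl using exists_lowPassL w a hN0.le
  refine ⟨ht.toFinset.image l, A, hA0, fun φ => ?_⟩
  have hsum : ∀ p ∈ t, ‖l p φ‖ ≤ ∑ l ∈ ht.toFinset.image l, ‖l φ‖ := fun p hp =>
    Finset.single_le_sum (f := fun l : D →L[ℝ] ℂ => ‖l φ‖) (fun _ _ => norm_nonneg _)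
      (Finset.mem_image_of_mem l (ht.mem_toFinset.2 hp))
  set S := ∑ l ∈ ht.toFinset.image l, ‖l φ‖ with hS
  have hS0 : 0 ≤ S := Finset.sum_nonneg fun _ _ => norm_nonneg _
  set u := (w φ).comp a with hu
  have hpd : ∀ k, HasWeakPD k u (fun x => G φ k x a) := fun k =>
    isWeakPartial_iff.1 ((hG φ).2 k).1 a
  have hatu : ‖hat u‖ ≤ M * ‖φ‖ :=
    (norm_hat_apply_le _ a).trans ((V.norm_toL2_le _).trans (hG φ).1)
  have b1 : eLpNorm (fun x => (u x : ℂ) - lowPass N u x) 2 volume ≤ ENNReal.ofReal (ε / 2 * ‖φ‖) := by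
    refine (eLpNorm_sub_lowPass_le hpd hN0).trans (ENNReal.ofReal_le_ofReal ?_)
    have h1 : ∑ k, ‖hat (fun x => G φ k x a)‖ ≤ ∑ k : Fin 3, M * ‖φ‖ := Finset.sum_le_sum fun k _ =>
      (norm_hat_apply_le _ a).trans ((hG φ).2 k).2
    rw [Finset.sum_const, Finset.card_univ, Fintype.card_fin, nsmul_eq_mul] at h1
    have h2 : 6 * M ≤ ε * N := by
      rw [hN, mul_add, mul_div_cancel₀ _ hε.ne']
      linarith
    rw [div_mul_eq_mul_div, one_mul, div_le_iff₀ hN0]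
    push_cast at h1
    nlinarith [norm_nonneg φ]
  set K : ℝ := C * ρ * (M * ‖φ‖) + S with hK
  have hK0 : 0 ≤ K := by positivity
  have b2 : ∀ x ∈ Metric.ball (0 : E3) R, ‖lowPass N u x‖ ≤ K := fun x hx => by
    obtain ⟨p, hp, hxp⟩ := mem_iUnion₂.1 (hcov (Metric.ball_subset_closedBall hx))
    rw [mem_ball_iff_norm] at hxp
    have h1 := norm_le_norm_sub_add (lowPass N u x) (lowPass N u p)
    have h2 : ‖lowPass N u p‖ ≤ S := by
      rw [← hl p φ]; exact hsum p hp
    have h3 : ‖lowPass N u x - lowPass N u p‖ ≤ C * ρ * (M * ‖φ‖) :=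
      ((hC u).2 x p).trans (by gcongr)
    linarith
  have b3 : ∀ x, ‖(Metric.ball (0 : E3) R).indicator u x‖
      ≤ ‖(u x : ℂ) - lowPass N u x‖ + (Metric.ball (0 : E3) R).indicator (fun _ => K) x :=
          fun x => by
    by_cases hx : x ∈ Metric.ball (0 : E3) R
    · rw [indicator_of_mem hx, indicator_of_mem hx]
      have h1 := norm_le_norm_sub_add (u x : ℂ) (lowPass N u x)
      rw [Complex.norm_real] at h1
      linarith [b2 x hx]
    · rw [indicator_of_notMem hx, indicator_of_notMem hx, norm_zero, add_zero]
      positivity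
  have b4 : eLpNorm ((Metric.ball (0 : E3) R).indicator (fun _ => K)) 2 volume
      ≤ ENNReal.ofReal (A * K) := by
    have htop : volume (Metric.ball (0 : E3) R) ^ (1 / (2 : ℝ≥0∞).toReal) ≠ ⊤ :=
      ENNReal.rpow_ne_top_of_nonneg (by norm_num) measure_ball_lt_top.ne
    refine (eLpNorm_indicator_const_le _ _).trans (le_of_eq ?_)
    rw [ENNReal.ofReal_mul hA0, hA, ENNReal.ofReal_toReal htop, mul_comm, Real.enorm_of_nonneg hK0]
  have hmeas : AEStronglyMeasurable (fun x => (u x : ℂ) - lowPass N u x) volume := by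
    have hc : Continuous (lowPass N u) := by
      refine LipschitzWith.continuous (K := ⟨C * ‖hat u‖, by positivity⟩) ?_
      refine LipschitzWith.of_dist_le_mul fun x y => ?_
      rw [dist_eq_norm, dist_eq_norm]
      refine ((hC u).2 x y).trans (le_of_eq ?_)
      change _ = C * ‖hat u‖ * ‖x - y‖
      ring
    exact (Complex.continuous_ofReal.comp_aestronglyMeasurable ((w φ).memLp_two a).1).sub
      hc.aestronglyMeasurable
  refine (eLpNorm_mono_real b3).trans ((eLpNorm_add_le hmeas.norm
    (aestronglyMeasurable_const.indicator measurableSet_ball) (by norm_num)).trans ?_)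
  rw [eLpNorm_norm]
  refine (add_le_add b1 b4).trans ?_
  rw [← ENNReal.ofReal_add (by positivity) (by positivity)]
  refine ENNReal.ofReal_le_ofReal ?_
  have h5 : A * C * M * ρ ≤ ε / 2 := by
    rw [hρ, mul_div_assoc', div_le_iff₀ (by positivity)]
    nlinarith [mul_nonneg (mul_nonneg hA0 hC0) hM0]
  have h6 := mul_le_mul_of_nonneg_right h5 (norm_nonneg φ)
  calc ε / 2 * ‖φ‖ + A * K = ε / 2 * ‖φ‖ + A * C * M * ρ * ‖φ‖ + A * S := by rw [hK]; ring
    _ ≤ _ := by linarith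

/-- Multipliers that are limits, in the norm of multipliers `𝒱 → L²`, of bounded functions with
bounded support. -/
def IsVanishingMult (c : E3 → ℝ) : Prop := ∀ ε : ℝ, 0 < ε → ∃ (b : E3 → ℝ) (M R : ℝ), 0 ≤ M ∧
  AEStronglyMeasurable b volume ∧ (∀ x, |b x| ≤ M) ∧ (∀ x, R ≤ ‖x‖ → b x = 0) ∧
  IsMult (fun x => c x - b x) ε

theorem IsVanishingMult.add {c c' : E3 → ℝ} (h : IsVanishingMult c) (h' : IsVanishingMult c') :
    IsVanishingMult fun x => c x + c' x := by
  intro ε hε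
  obtain ⟨b, M, R, h0, h1, h2, h3, h4⟩ := h (ε / 2) (half_pos hε)
  obtain ⟨b', M', R', h0', h1', h2', h3', h4'⟩ := h' (ε / 2) (half_pos hε)
  refine ⟨fun x => b x + b' x, M + M', max R R', add_nonneg h0 h0', h1.add h1',
    fun x => (abs_add_le _ _).trans (add_le_add (h2 x) (h2' x)), fun x hx => ?_, ?_⟩
  · simp only [h3 x (le_trans (le_max_left _ _) hx), h3' x (le_trans (le_max_right _ _) hx),
        add_zero]
  · have h5 := h4.add h4' (half_pos hε).le (half_pos hε).le
    rw [add_halves] at h5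
    have e : (fun x => c x + c' x - (b x + b' x)) = fun x => c x - b x + (c' x - b' x) := by
      ext x; ring
    rwa [e]

/-- Compactly supported continuous functions are dense in L⁴, and the L⁴ norm bounds the multiplier
norm. -/
theorem IsVanishingMult.of_memLp_four {c : E3 → ℝ} (h : MemLp c 4 volume) : IsVanishingMult c := by
  intro ε hε
  obtain ⟨b, h1, h2, h3, h4⟩ := h.exists_hasCompactSupport_eLpNorm_sub_le (by norm_num)
    (ε := ENNReal.ofReal ε) (ENNReal.ofReal_pos.2 hε).ne'
  obtain ⟨M, hM⟩ := h1.exists_bound_of_continuous h3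
  obtain ⟨R, hR⟩ := h1.isCompact.isBounded.subset_ball 0
  refine ⟨b, M, R, (norm_nonneg _).trans (hM 0), h3.aestronglyMeasurable, hM, fun x hx => ?_, ?_⟩
  · refine image_eq_zero_of_notMem_tsupport fun hxt => ?_
    have := mem_ball_zero_iff.1 (hR hxt)
    linarith
  · refine (IsMult.of_memLp_four (h.sub h4)).mono ?_
    exact ENNReal.toReal_le_of_le_ofReal hε.le h2

theorem IsVanishingMult.of_decay {c : E3 → ℝ} (hc : AEStronglyMeasurable c volume) {C : ℝ}
    (h : ∀ x, (1 + ‖x‖) * |c x| ≤ C) : IsVanishingMult c := by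
  intro ε hε
  have hC : 0 ≤ C := le_trans (by positivity) (h 0)
  have hmul : ∀ x, |c x| ≤ C := fun x => by nlinarith [h x, norm_nonneg x, abs_nonneg (c x)]
  refine ⟨(Metric.ball (0 : E3) (C / ε)).indicator c, C, C / ε, hC, hc.indicator measurableSet_ball,
    fun x => ?_, fun x hx => ?_, ?_⟩
  · by_cases hx : x ∈ Metric.ball (0 : E3) (C / ε)
    · rw [indicator_of_mem hx]; exact hmul x
    · rw [indicator_of_notMem hx, abs_zero]; exact hC
  · exact indicator_of_notMem (by rw [mem_ball_zero_iff, not_lt]; exact hx) _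
  · refine IsMult.of_bounded hε.le (hc.sub (hc.indicator measurableSet_ball))
        (ae_of_all _ fun x => ?_)
    by_cases hx : x ∈ Metric.ball (0 : E3) (C / ε)
    · rw [indicator_of_mem hx, sub_self, abs_zero]; exact hε.le
    · rw [indicator_of_notMem hx, sub_zero]
      rw [mem_ball_zero_iff, not_lt, div_le_iff₀ hε] at hx
      have h1 := h x
      have h2 : 0 < 1 + ‖x‖ := by positivity
      by_contra! hcon
      nlinarith [norm_nonneg x]

theorem IsVanishingMult.const_mul {c : E3 → ℝ} (r : ℝ) (h : IsVanishingMult c) :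
    IsVanishingMult fun x => r * c x := by
  intro ε hε
  obtain ⟨b, M, R, h0, h1, h2, h3, h4⟩ := h (ε / (|r| + 1)) (by positivity)
  refine ⟨fun x => r * b x, |r| * M, R, by positivity, h1.const_mul r, fun x => ?_, fun x hx => ?_,
      ?_⟩
  · rw [abs_mul]; gcongr; exact h2 x
  · simp only [h3 x hx, mul_zero]
  · have h5 := (h4.const_mul r).mono (N' := ε) (by
      rw [mul_div_assoc', div_le_iff₀ (by positivity)]
      nlinarith [abs_nonneg r])
    have e : (fun x => r * c x - r * b x) = fun x => r * (c x - b x) := by ext x; ring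
    rwa [e]

/-- Split c into a bounded part with bounded support, to which Rellich's theorem applies, and a
remainder with small multiplier norm. -/
theorem IsRegularMap.almostFinite_mul {w : D →L[ℝ] V} (hw : IsRegularMap w) (a : Fin 3)
    {c : E3 → ℝ} (hc : IsVanishingMult c) : AlmostFinite fun φ x => c x * (w φ).comp a x := by
  have hcm : AEStronglyMeasurable c volume := by
    obtain ⟨b, M, R, -, h1, -, -, h4⟩ := hc 1 one_pos
    refine (h4.meas.add h1).congr (ae_of_all _ fun x => ?_)
    simp
  refine ⟨fun φ => hcm.mul ((w φ).memLp_two a).1, fun ε hε => ?_⟩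
  obtain ⟨b, M, R, h0, h1, h2, h3, h4⟩ := hc (ε / (2 * (‖w‖ + 1))) (by positivity)
  obtain ⟨s, C, hC0, hs⟩ := (hw.almostFinite_indicator a R).le (ε / (2 * (M + 1))) (by positivity)
  refine ⟨s, M * C, by positivity, fun φ => ?_⟩
  set S := ∑ l ∈ s, ‖l φ‖ with hS
  have hS0 : 0 ≤ S := Finset.sum_nonneg fun _ _ => norm_nonneg _
  have e1 : (fun x => c x * (w φ).comp a x)
      = fun x => (c x - b x) * (w φ).comp a x + b x * (w φ).comp a x := by ext x; ring
  have b1 := h4.le (w φ) a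
  have b2 : eLpNorm (fun x => b x * (w φ).comp a x) 2 volume
      ≤ ENNReal.ofReal (M * (ε / (2 * (M + 1)) * ‖φ‖ + C * S)) := by
    rw [ENNReal.ofReal_mul h0]
    refine (eLpNorm_le_mul_eLpNorm_of_ae_le_mul (c := M)
      (g := (Metric.ball (0 : E3) R).indicator ((w φ).comp a)) (ae_of_all _ fun x => ?_) 2).trans
      (by gcongr; exact hs φ)
    by_cases hx : x ∈ Metric.ball (0 : E3) R
    · rw [indicator_of_mem hx, norm_mul]
      gcongr
      exact h2 x
    · rw [indicator_of_notMem hx, norm_zero, mul_zero, h3 x, zero_mul, norm_zero]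
      rwa [mem_ball_zero_iff, not_lt] at hx
  rw [e1]
  refine (eLpNorm_add_le (h4.memLp _ a).1 (h1.mul ((w φ).memLp_two a).1) (by norm_num)).trans ?_
  refine (add_le_add b1 b2).trans ?_
  rw [← ENNReal.ofReal_add (by positivity) (by positivity)]
  refine ENNReal.ofReal_le_ofReal ?_
  have h5 : ε / (2 * (‖w‖ + 1)) * ‖w φ‖ ≤ ε / 2 * ‖φ‖ := by
    have h6 := w.le_opNorm φ
    rw [div_mul_eq_mul_div, div_le_iff₀ (by positivity)]
    nlinarith [norm_nonneg φ, norm_nonneg w, mul_nonneg hε.le (norm_nonneg φ),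
      mul_le_mul_of_nonneg_left h6 hε.le]
  have h7 : M * (ε / (2 * (M + 1)) * ‖φ‖) ≤ ε / 2 * ‖φ‖ := by
    rw [← mul_assoc]
    gcongr
    rw [mul_div_assoc', div_le_div_iff₀ (by positivity) (by positivity)]
    nlinarith
  calc _ = ε / (2 * (‖w‖ + 1)) * ‖w φ‖ + M * (ε / (2 * (M + 1)) * ‖φ‖) + M * C * S := by ring
    _ ≤ _ := by linarith

/-- The finitely many functionals map the unit ball to a bounded, hence totally bounded, set in a
finite-dimensional space. Preimages of a δ-net there give a finite ε-net for the image under K. The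
hypothesis is for norms up to 2 because it is applied to differences of two elements of the unit
ball. -/
theorem isCompactOperator_of_small {X Y : Type*} [NormedAddCommGroup X] [NormedSpace ℝ X]
    [NormedAddCommGroup Y] [NormedSpace ℝ Y] [CompleteSpace Y] (K : X →L[ℝ] Y)
    (h : ∀ ε : ℝ, 0 < ε → ∃ (δ : ℝ) (s : Finset (X →L[ℝ] ℂ)), 0 < δ ∧
      ∀ φ, ‖φ‖ ≤ 2 → (∀ l ∈ s, ‖l φ‖ ≤ δ) → ‖K φ‖ ≤ ε) : IsCompactOperator K := by
  refine (isCompactOperator_iff_isCompact_closure_image_closedBall (K : X →ₗ[ℝ] Y) one_pos).2 ?_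
  refine TotallyBounded.isCompact_of_isClosed ?_ isClosed_closure
  refine TotallyBounded.closure (Metric.totallyBounded_iff.2 fun ε hε => ?_)
  obtain ⟨δ, s, hδ, hs⟩ := h (ε / 2) (half_pos hε)
  let Λ : X →L[ℝ] (s → ℂ) := ContinuousLinearMap.pi fun l => l.1
  have hb : Bornology.IsBounded (Λ '' Metric.closedBall 0 1) :=
    Λ.lipschitz.isBounded_image Metric.isBounded_closedBall
  have htb : TotallyBounded (Λ '' Metric.closedBall 0 1) :=
    (hb.isCompact_closure.totallyBounded).subset subset_closure
  obtain ⟨t, ht, htf, hcov⟩ := Metric.finite_approx_of_totallyBounded htb δ hδ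
  have ht' : ∀ y ∈ t, ∃ φ ∈ Metric.closedBall (0 : X) 1, Λ φ = y := fun y hy => ht hy
  choose! ψ hψ using ht'
  refine ⟨(fun y => K (ψ y)) '' t, htf.image _, ?_⟩
  rintro _ ⟨φ, hφ, rfl⟩
  obtain ⟨y, hy, hφy⟩ := mem_iUnion₂.1 (hcov (mem_image_of_mem Λ hφ))
  refine mem_iUnion₂.2 ⟨K (ψ y), mem_image_of_mem _ hy, ?_⟩
  rw [mem_ball_iff_norm]
  obtain ⟨h1, h2⟩ := hψ y hy
  rw [mem_closedBall_zero_iff] at hφ h1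
  have h3 := hs (φ - ψ y) ((norm_sub_le _ _).trans (by linarith)) fun l hl => by
    rw [mem_ball_iff_norm, ← h2, ← map_sub] at hφy
    exact (norm_le_pi_norm (Λ (φ - ψ y)) ⟨l, hl⟩).trans hφy.le
  rw [map_sub] at h3
  exact lt_of_le_of_lt h3 (half_lt_self hε)

/-- Smallness in L² is enough: the interpolation inequality bounds the norm of 𝒱 by a positive power
of the L² norm times a power of the H¹ norm, and the H¹ norm is bounded on bounded sets. -/
theorem isCompactOperator_of_almostFinite {T : D →L[ℝ] V} {f : D → E3 → E3} {C : ℝ}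
    (hf : ∀ φ, MemLp (f φ) 2 volume) (hT : ∀ φ, (T φ).toL2 = leray (f φ))
    (hG : ∀ φ, ∃ G : Fin 3 → L2, (∀ k, IsWeakPartial k (T φ).toL2 (G k)) ∧ ∀ k, ‖G k‖ ≤ C * ‖φ‖)
    (ha : ∀ a, AlmostFinite fun φ x => f φ x a) : IsCompactOperator T := by
  classical
  obtain ⟨K, hK0, hK⟩ := exists_norm_V_le
  refine isCompactOperator_of_small T fun ε hε => ?_
  have hcont : Tendsto (fun τ : ℝ => τ + K * τ ^ (1 / 4 : ℝ) * (τ + 6 * |C|) ^ (3 / 4 : ℝ))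
      (𝓝 0) (𝓝 0) := by
    have hc : Continuous fun τ : ℝ => τ + K * τ ^ (1 / 4 : ℝ) * (τ + 6 * |C|) ^ (3 / 4 : ℝ) := by
      have h1 : Continuous fun τ : ℝ => τ ^ (1 / 4 : ℝ) := Real.continuous_rpow_const (by norm_num)
      have h2 : Continuous fun τ : ℝ => (τ + 6 * |C|) ^ (3 / 4 : ℝ) :=
        (Real.continuous_rpow_const (by norm_num)).comp (continuous_id.add continuous_const)
      exact continuous_id.add ((continuous_const.mul h1).mul h2)
    have h3 := hc.tendsto 0
    rwa [Real.zero_rpow (by norm_num), mul_zero, zero_mul, add_zero] at h3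
  obtain ⟨τ, hτ0, hτ⟩ : ∃ τ : ℝ, 0 < τ ∧
      τ + K * τ ^ (1 / 4 : ℝ) * (τ + 6 * |C|) ^ (3 / 4 : ℝ) < ε := by
    have h1 := (hcont.eventually_lt_const hε).filter_mono (nhdsWithin_le_nhds (s := Ioi 0))
    obtain ⟨τ, h2, h3⟩ := (h1.and self_mem_nhdsWithin).exists
    exact ⟨τ, h3, h2⟩
  -- With ‖φ‖ ≤ 2 and three components the first terms add up to τ/2; the choice of δ leaves the
  -- other τ/2 for the functionals.
  choose s c hc hs using fun a => (ha a).le (τ / 12) (by positivity)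
  let S := Finset.univ.biUnion s
  let M := ∑ a, c a * (s a).card
  have hM : 0 ≤ M := Finset.sum_nonneg fun a _ => mul_nonneg (hc a) (Nat.cast_nonneg _)
  refine ⟨τ / (2 * (M + 1)), S, by positivity, fun φ hφ hl => ?_⟩
  have h1 : ‖(T φ).toL2‖ ≤ τ := by
    rw [hT]
    refine (norm_leray_le _ (hf φ)).trans (ENNReal.toReal_le_of_le_ofReal hτ0.le ?_)
    refine (eLpNorm_le_sum_apply (hf φ).1 (by norm_num)).trans ?_
    refine (Finset.sum_le_sum fun a _ => hs a φ).trans ?_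
    rw [← ENNReal.ofReal_sum_of_nonneg fun a _ => add_nonneg (by positivity)
      (mul_nonneg (hc a) (Finset.sum_nonneg fun _ _ => norm_nonneg _))]
    refine ENNReal.ofReal_le_ofReal ?_
    have h2 : ∀ a, τ / 12 * ‖φ‖ + c a * ∑ l ∈ s a, ‖l φ‖
        ≤ τ / 6 + c a * (s a).card * (τ / (2 * (M + 1))) := fun a => by
      have h3 : ∑ l ∈ s a, ‖l φ‖ ≤ ∑ l ∈ s a, τ / (2 * (M + 1)) := Finset.sum_le_sum fun l hla =>
        hl l (Finset.mem_biUnion.2 ⟨a, Finset.mem_univ a, hla⟩)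
      rw [Finset.sum_const, nsmul_eq_mul] at h3
      have h4 := mul_le_mul_of_nonneg_left h3 (hc a)
      nlinarith
    refine (Finset.sum_le_sum fun a _ => h2 a).trans ?_
    rw [Finset.sum_add_distrib, ← Finset.sum_mul]
    have h5 : M * (τ / (2 * (M + 1))) ≤ τ / 2 := by
      rw [mul_div_assoc', div_le_div_iff₀ (by positivity) (by positivity)]
      nlinarith
    simp only [Finset.sum_const, Finset.card_univ, Fintype.card_fin, nsmul_eq_mul]
    push_cast
    linarith
  obtain ⟨G, hG1, hG2⟩ := hG φ
  have h6 : ∑ k, ‖G k‖ ≤ 6 * |C| := by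
    have h7 : ∀ k, ‖G k‖ ≤ 2 * |C| := fun k => (hG2 k).trans (by
      nlinarith [le_abs_self C, abs_nonneg C, norm_nonneg φ])
    refine (Finset.sum_le_sum fun k _ => h7 k).trans (le_of_eq ?_)
    simp only [Finset.sum_const, Finset.card_univ, Fintype.card_fin, nsmul_eq_mul]
    push_cast
    ring
  refine (hK (T φ) G hG1).trans (le_trans ?_ hτ.le)
  gcongr

/-- Each entry of U and ∇U is the sum of a decaying function and one in L⁴, so it vanishes at
infinity as a multiplier; φ and ∇φ are bounded in H¹ by the norm of 𝒟. Rellich's theorem then gives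
compactness in L², and the H¹ bound of the image lifts it to 𝒱. -/
theorem IsScaleInvariantDatum.exists_compact_advSym {a₀ : E3 → E3} (ha : IsScaleInvariantDatum a₀)
    (σ : ℝ) (v : D) : ∃ T : D →L[ℝ] V,
      (∀ φ, (T φ).toL2 = leray (advSym (profile a₀ σ v) φ.field)) ∧ IsCompactOperator T := by
  obtain ⟨N, hN⟩ := ha.exists_multField_profile σ v
  obtain ⟨T, hT, C, hC⟩ := hN.exists_advSymL
  obtain ⟨C₀, hC0, hb⟩ := ha.exists_bound_heatExt
  have hval : ∀ i, IsVanishingMult fun x => (profile a₀ σ v).val x i := fun i => by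
    have h1 : IsVanishingMult fun x => heatExt a₀ x i := by
      refine .of_decay (C := C₀) ((EuclideanSpace.proj i : E3 →L[ℝ] ℝ).continuous.comp
        ha.differentiable_heatExt.continuous).aestronglyMeasurable fun x => le_trans ?_ (hb x).1
      gcongr
      exact abs_apply_le _ i
    exact (h1.const_mul σ).add (.of_memLp_four (v.toV.memLp_four i))
  have hgrad : ∀ k i, IsVanishingMult fun x => (profile a₀ σ v).grad k x i := fun k i => by
    have h1 : IsVanishingMult fun x => (pd k (heatExt a₀) x) i := by
      refine .of_decay (C := C₀) ((EuclideanSpace.proj i : E3 →L[ℝ] ℝ).continuous.comp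
        (ha.differentiable_pd_heatExt k).continuous).aestronglyMeasurable
        fun x => le_trans ?_ ((hb x).2.1 k)
      have h0 := norm_nonneg x
      have h2 := abs_apply_le (pd k (heatExt a₀) x) i
      have h3 : 1 + ‖x‖ ≤ (1 + ‖x‖) ^ 2 := by nlinarith
      gcongr
    exact (h1.const_mul σ).add (.of_memLp_four ((v.partial k).memLp_four i))
  refine ⟨T, hT, isCompactOperator_of_almostFinite (fun φ => hN.memLp_advSym φ) hT hC fun a => ?_⟩
  have h1 := AlmostFinite.sum Finset.univ fun i =>
    (D.isRegularMap_partialL i).almostFinite_mul a (hval i)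
  have h2 := AlmostFinite.sum Finset.univ fun i =>
    D.isRegularMap_toVL.almostFinite_mul i (hgrad i a)
  have e : (fun (φ : D) (x : E3) => (advSym (profile a₀ σ v) φ.field x) a) = fun φ x =>
      (∑ i, (profile a₀ σ v).val x i * (D.partialL i φ).comp a x)
        + ∑ i, (profile a₀ σ v).grad i x a * (D.toVL φ).comp i x := by
    ext φ x
    rw [advSym, PiLp.add_apply, adv_apply, adv_apply]
    congr 1
    exact Finset.sum_congr rfl fun i _ => mul_comm _ _
  rw [e]
  exact h1.add h2

/-! ### Compact perturbations of bijective operators -/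

section Fredholm
variable {X Y : Type*} [NormedAddCommGroup X] [NormedSpace ℝ X] [CompleteSpace X]
  [NormedAddCommGroup Y] [NormedSpace ℝ Y] [CompleteSpace Y]

/-- An injective compact perturbation of a bijective operator is bijective. -/
theorem bijective_add_of_isCompactOperator {L K : X →L[ℝ] Y} (hL : Function.Bijective L)
    (hK : IsCompactOperator K) (hi : ∀ x, L x + K x = 0 → x = 0) : Function.Bijective (L + K) := by
  let e : X ≃L[ℝ] Y := ContinuousLinearEquiv.ofBijective L
    (LinearMap.ker_eq_bot.2 hL.1) (LinearMap.range_eq_top.2 hL.2)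
  have he : ∀ x, e x = L x := fun x => rfl
  -- With e = L one has L + K = (1 - S)e and S is compact. By the Fredholm alternative either 1 - S
  -- is invertible or 1 is an eigenvalue of S, and an eigenvector would give a kernel element of L +
  -- K.
  let S : Y →L[ℝ] Y := -(K.comp (e.symm : Y →L[ℝ] X))
  have hS : IsCompactOperator S := (hK.comp_clm (e.symm : Y →L[ℝ] X)).neg
  have hSa : ∀ y, S y = -K (e.symm y) := fun y => rfl
  rcases hS.hasEigenvalue_or_mem_resolventSet one_ne_zero with h | h
  · obtain ⟨y, hy⟩ := h.exists_hasEigenvector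
    refine absurd ?_ hy.2
    have h1 : S y = y := by simpa using hy.apply_eq_smul
    have h2 := hi (e.symm y) (by rw [← he, e.apply_symm_apply, ← sub_neg_eq_add, ← hSa, h1,
        sub_self])
    rw [← e.apply_symm_apply y, h2, map_zero]
  · obtain ⟨u, hu⟩ : IsUnit (1 - S) := by
      have := spectrum.mem_resolventSet_iff.1 h
      rwa [map_one] at this
    let f := ContinuousLinearEquiv.unitsEquiv ℝ Y u
    have hf : ∀ y, f y = y - S y := fun y => by
      have : f y = (u : Y →L[ℝ] Y) y := rfl
      rw [this, hu]
      rfl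
    have h3 : ⇑(L + K) = f ∘ e := by
      ext x
      rw [Function.comp_apply, hf, hSa, e.symm_apply_apply, sub_neg_eq_add, he]
      rfl
    rw [h3]
    exact f.bijective.comp e.bijective

/-- A uniformly coercive operator is bijective if all its positive shifts are. -/
theorem bijective_of_coercive {L j : X →L[ℝ] Y} {C : ℝ}
    (hb : ∀ t : ℝ, 0 < t → Function.Bijective (L + t • j))
    (hC : ∀ t : ℝ, 0 < t → ∀ x, ‖j x‖ ≤ C * ‖L x + t • j x‖) : Function.Bijective L := by
  obtain ⟨t, ht, htC⟩ : ∃ t : ℝ, 0 < t ∧ t * |C| < 1 :=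
    ⟨1 / (|C| + 1), by positivity, by rw [div_mul_eq_mul_div, div_lt_one (by positivity)]; linarith⟩
  have hL := hb t ht
  let e : X ≃L[ℝ] Y := ContinuousLinearEquiv.ofBijective (L + t • j)
    (LinearMap.ker_eq_bot.2 hL.1) (LinearMap.range_eq_top.2 hL.2)
  have he : ∀ x, e x = L x + t • j x := fun x => rfl
  -- L = (1 - S)(L + tj), and the coercive bound gives ‖S‖ ≤ t|C| < 1, so the Neumann series inverts
  -- 1 - S.
  let S : Y →L[ℝ] Y := t • j.comp (e.symm : Y →L[ℝ] X)
  have hSa : ∀ y, S y = t • j (e.symm y) := fun y => rfl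
  have hS : ‖S‖ < 1 := by
    refine lt_of_le_of_lt (S.opNorm_le_bound (by positivity) fun y => ?_) htC
    rw [hSa, norm_smul, Real.norm_of_nonneg ht.le, mul_assoc]
    gcongr
    have h1 := hC t ht (e.symm y)
    rw [← he, e.apply_symm_apply] at h1
    exact h1.trans (by gcongr; exact le_abs_self C)
  obtain ⟨u, hu⟩ : IsUnit (1 - S) := isUnit_one_sub_of_norm_lt_one hS
  let f := ContinuousLinearEquiv.unitsEquiv ℝ Y u
  have hf : ∀ y, f y = y - S y := fun y => by
    have : f y = (u : Y →L[ℝ] Y) y := rfl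
    rw [this, hu]
    rfl
  have h3 : ⇑L = f ∘ e := by
    ext x
    rw [Function.comp_apply, hf, hSa, e.symm_apply_apply, he, add_sub_cancel_right]
  rw [h3]
  exact f.bijective.comp e.bijective

/-- The splitting of `Y` for an operator with one-dimensional kernel that is a compact perturbation
of a uniformly coercive operator. -/
theorem bijective_add_smulRight {L K j : X →L[ℝ] Y} {C : ℝ} (hK : IsCompactOperator K)
    (hj : Function.Injective j)
    (hb : ∀ t : ℝ, 0 < t → Function.Bijective (L + K + t • j))
    (hC : ∀ t : ℝ, 0 ≤ t → ∀ x, ‖j x‖ ≤ C * ‖L x + t • j x‖) {φ : X} {z : Y} {l : X →L[ℝ] ℝ}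
    (hker : ∀ x, L x + K x = 0 → ∃ c : ℝ, x = c • φ) (hz : ∀ x, L x + K x ≠ z) (hl : l φ = 1) :
    Function.Bijective (L + K + l.smulRight z) := by
  have hinj : ∀ t : ℝ, 0 ≤ t → ∀ x, L x + t • j x = 0 → x = 0 := fun t ht x hx => by
    have h1 := hC t ht x
    rw [hx, norm_zero, mul_zero, norm_le_zero_iff] at h1
    exact hj (h1.trans (map_zero j).symm)
  -- Surjectivity of L is extracted from the bijectivity of L + K + tj: removing the compact K
  -- leaves the injective L + tj, and then t is removed by the uniform bound.
  have h1 : Function.Bijective L := by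
    refine bijective_of_coercive (j := j) (C := C) (fun t ht => ?_) fun t ht => hC t ht.le
    have h2 := bijective_add_of_isCompactOperator (hb t ht) (K := -K) hK.neg fun x hx => by
      refine hinj t ht.le x ?_
      have : L x + K x + t • j x + -K x = 0 := hx
      rw [← this]
      abel
    have h3 : L + K + t • j + -K = L + t • j := by abel
    rwa [h3] at h2
  have hr : IsCompactOperator (l.smulRight z) :=
    (isCompactOperator_of_locallyCompactSpace_dom l).clm_comp
      ((ContinuousLinearMap.id ℝ ℝ).smulRight z)
  have h4 := bijective_add_of_isCompactOperator h1
      (K := K + l.smulRight z) (hK.add hr) fun x hx => by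
    have hx' : L x + K x = -(l x • z) := by
      have : L x + (K x + l x • z) = 0 := hx
      rw [← add_assoc] at this
      exact eq_neg_of_add_eq_zero_left this
    -- Otherwise z would be in the range of L + K. Hence x is in the kernel, so x = cφ, and l φ = 1
    -- forces c = 0.
    have hlx : l x = 0 := by
      by_contra hne
      refine hz (-(l x)⁻¹ • x) ?_
      rw [map_smul, map_smul, ← smul_add, hx', smul_neg, neg_smul, neg_neg, smul_smul,
        inv_mul_cancel₀ hne, one_smul]
    rw [hlx, zero_smul, neg_zero] at hx'
    obtain ⟨c, rfl⟩ := hker x hx'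
    rw [map_smul, hl, smul_eq_mul, mul_one] at hlx
    rw [hlx, zero_smul]
  rwa [← add_assoc] at h4

end Fredholm

/-! ### Coercivity of the linear part -/

theorem pd_coord_mul_wq {ε : ℝ} (hε : 0 < ε) (i : Fin 3) (x : E3) :
    pd i (fun y : E3 => y i * wq ε y ^ 3) x =
        wq ε x ^ 3 - 3 * (ε * (x i * x i) * wq ε x ^ 2) * wq ε x ^ 3 := by
  have hq := ((contDiff_wq hε).differentiable (by simp)) x
  have h0 : pd i (fun y => wq ε y ^ 3) x = 3 * wq ε x ^ 2 * pd i (wq ε) x := by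
    rw [pd, (hq.hasFDerivAt.pow 3).fderiv]
    simp [pd]
  rw [pd_mul i ((contDiff_coord i).differentiable (by simp) x)
    (show DifferentiableAt ℝ (fun y => wq ε y ^ 3) x from hq.pow 3), h0, pd_coord, if_pos rfl,
        pd_wq hε]
  ring

theorem wq_coord_le {ε : ℝ} (hε : 0 < ε) (x : E3) : ε * ‖x‖ ^ 2 * wq ε x ^ 2 ≤ 1 := by
  have h := wq_sq hε x
  nlinarith [sq_nonneg (wq ε x)]

/-- `∫ f (x · ∇ f) = -3/2 ∫ f²`. -/
theorem HasWeakPD.hasInt_radial {f r : E3 → ℝ} {g : Fin 3 → E3 → ℝ} (h : ∀ k, HasWeakPD k f (g k))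
    (hr : MemLp r 2 volume) (hrg : r =ᵐ[volume] fun x => ∑ k, x k * g k x) :
    HasInt (fun x => 3 / 2 * (f x * f x) + f x * r x) 0 := by
  have hff := HasInt.of_memLp (h 0).left (h 0).left
  have hfr := HasInt.of_memLp (h 0).left hr
  have hF := (hff.const_mul (3 / 2)).add hfr
  -- S is the divergence of x q³, a bounded field with bounded derivatives that replaces x; xf
  -- itself need not be in L². As ε → 0 the divergence tends to 3, and dominated convergence gives
  -- the identity.
  let S : ℝ → E3 → ℝ := fun ε x => ∑ i, pd i (fun y : E3 => y i * wq ε y ^ 3) x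
  have hS : ∀ {ε : ℝ}, 0 < ε → ∀ x, S ε x =
      3 * wq ε x ^ 3 - 3 * (ε * ‖x‖ ^ 2 * wq ε x ^ 2) * wq ε x ^ 3 :=
    fun {ε} hε x => by
      simp only [S, pd_coord_mul_wq hε, Fin.sum_univ_three, EuclideanSpace.norm_sq_eq,
          Real.norm_eq_abs,
        sq_abs]
      ring
  have main : ∀ {ε : ℝ}, 0 < ε →
      HasInt (fun x => S ε x * (f x * f x) + 2 * wq ε x ^ 3 * (f x * r x)) 0 := by
    intro ε hε
    have hm : ∀ i : Fin 3, ContDiff ℝ ∞ fun y : E3 => y i * wq ε y ^ 3 := fun i =>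
      (contDiff_coord i).mul ((contDiff_wq hε).pow 3)
    have b0 : ∀ (i : Fin 3) (x : E3), |x i * wq ε x ^ 3| ≤ (√ε)⁻¹ + 4 := fun i x => by
      have hq0 := wq_pos hε x
      have hq1 := wq_le_one hε x
      have h1 := norm_mul_wq_le hε x
      rw [abs_mul, abs_of_nonneg (by positivity : 0 ≤ wq ε x ^ 3)]
      calc |x i| * wq ε x ^ 3 ≤ ‖x‖ * wq ε x ^ 1 := by
            gcongr ?_ * ?_
            · exact abs_apply_le x i
            · exact pow_le_pow_of_le_one hq0.le hq1 (by norm_num)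
        _ ≤ _ := by rw [pow_one]; linarith
    have b1 : ∀ (i : Fin 3) (x : E3), |pd i (fun y : E3 => y i * wq ε y ^ 3) x| ≤ (√ε)⁻¹ + 4 :=
        fun i x => by
      have hq0 := wq_pos hε x
      have hq1 := wq_le_one hε x
      rw [pd_coord_mul_wq hε]
      have h1 := pow_le_one₀ hq0.le hq1 (n := 3)
      have h2 : ε * (x i * x i) * wq ε x ^ 2 ≤ 1 := by
        refine le_trans ?_ (wq_coord_le hε x)
        gcongr
        rw [← abs_mul_abs_self, pow_two]
        gcongr <;> exact abs_apply_le x i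
      have h3 : 0 ≤ ε * (x i * x i) * wq ε x ^ 2 :=
        mul_nonneg (mul_nonneg hε.le (mul_self_nonneg _)) (sq_nonneg _)
      have h4 : 0 < (√ε)⁻¹ := by positivity
      have h5 : 0 < wq ε x ^ 3 := by positivity
      rw [abs_le]
      constructor <;> nlinarith [mul_nonneg h3 h5.le, mul_le_mul_of_nonneg_right h2 h5.le]
    have z := HasInt.sum fun i => ((h i).mul_smooth (hm i) (b0 i) (b1 i)).hasInt_mul (h i)
    refine z.congr ?_ (by simp)
    filter_upwards [hrg] with x hx
    rw [hx]
    simp only [S, Fin.sum_univ_three]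
    ring
  have hlim : Tendsto (fun n : ℕ => ∫ x, (S (1 / ((n : ℝ) + 1)) x * (f x * f x)
      + 2 * wq (1 / ((n : ℝ) + 1)) x ^ 3 * (f x * r x))) atTop
      (𝓝 (∫ x, 2 * (3 / 2 * (f x * f x) + f x * r x))) := by
    have hn : ∀ n : ℕ, 0 < 1 / ((n : ℝ) + 1) := fun n => by positivity
    refine tendsto_integral_of_dominated_convergence
      (fun x => 6 * |f x * f x| + 2 * |f x * r x|) (fun n => (main (hn n)).int.1)
      ((hff.int.norm.const_mul 6).add (hfr.int.norm.const_mul 2)) (fun n => ae_of_all _ fun x => ?_)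
      (ae_of_all _ fun x => ?_)
    · have hq0 := wq_pos (hn n) x
      have hq3 := pow_le_one₀ hq0.le (wq_le_one (hn n) x) (n := 3)
      have hq4 : 0 < wq (1 / ((n : ℝ) + 1)) x ^ 3 := by positivity
      have h1 := wq_coord_le (hn n) x
      have h2 : 0 ≤ 1 / ((n : ℝ) + 1) * ‖x‖ ^ 2 * wq (1 / ((n : ℝ) + 1)) x ^ 2 := by positivity
      refine (norm_add_le _ _).trans ?_
      rw [Real.norm_eq_abs, Real.norm_eq_abs, abs_mul, abs_mul (2 * _)]
      gcongr
      · rw [hS (hn n), abs_le]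
        constructor <;> nlinarith [mul_nonneg h2 hq4.le, mul_le_mul_of_nonneg_right h1 hq4.le]
      · rw [abs_of_nonneg (by positivity)]
        linarith
    · have hq := tendsto_wq x
      have hε : Tendsto (fun n : ℕ => 1 / ((n : ℝ) + 1)) atTop (𝓝 0) :=
        tendsto_one_div_add_atTop_nhds_zero_nat
      have h1 := ((hq.pow 3).const_mul 3).sub
        ((((hε.mul_const (‖x‖ ^ 2)).mul (hq.pow 2)).const_mul 3).mul (hq.pow 3))
      have h2 := (h1.mul_const (f x * f x)).add (((hq.pow 3).const_mul 2).mul_const (f x * r x))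
      have e : (3 * 1 ^ 3 - 3 * (0 * ‖x‖ ^ 2 * 1 ^ 2) * 1 ^ 3) * (f x * f x) + 2 * 1 ^ 3 *
          (f x * r x)
          = 2 * (3 / 2 * (f x * f x) + f x * r x) := by ring
      rw [e] at h2
      simpa only [hS (hn _)] using h2
  have hz : ∀ n : ℕ, ∫ x, (S (1 / ((n : ℝ) + 1)) x * (f x * f x)
      + 2 * wq (1 / ((n : ℝ) + 1)) x ^ 3 * (f x * r x)) = 0 := fun n => (main (by positivity)).eq
  simp only [hz] at hlim
  have h0 := tendsto_nhds_unique hlim tendsto_const_nhds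
  rw [integral_const_mul] at h0
  exact ⟨hF.int, by linarith⟩

theorem V.hasInt_inner (u w : V) :
    HasInt (fun x => ∑ a, u.comp a x * w.comp a x) ⟪u.toL2, w.toL2⟫ := by
  refine ⟨integrable_finsetSum _ fun a _ => integrable_mul_of_memLp (u.memLp_two a) (w.memLp_two a),
      ?_⟩
  rw [MeasureTheory.L2.inner_def]
  simp only [inner_eq_sum]
  rfl

/-- The energy identity for the linear part. -/
theorem D.inner_linPart (v : D) : ⟪linPart v, v.toV.toL2⟫
    = ∑ k, ‖(v.partial k).toL2‖ ^ 2 + 1 / 4 * ‖v.toV.toL2‖ ^ 2 := by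
  have h1 : ∀ a, HasInt (fun x => (∑ i, (v.partial₂ i i).comp a x) * v.toV.comp a x
      + ∑ i, (v.partial i).comp a x * (v.partial i).comp a x) 0 := fun a => by
    have z := HasInt.sum fun i => (v.hasWeakPD₂ i i a).hasInt_mul (v.hasWeakPD i a)
    refine z.congr (ae_of_all _ fun x => ?_) (by simp)
    simp only [Fin.sum_univ_three]
    ring
  have h2 : ∀ a, HasInt (fun x => 3 / 2 * (v.toV.comp a x * v.toV.comp a x)
      + v.toV.comp a x * v.radial.comp a x) 0 := fun a =>
    HasWeakPD.hasInt_radial (fun k => v.hasWeakPD k a) (v.radial.memLp_two a) (v.radial_ae a)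
  have h3 := HasInt.sum fun k => V.hasInt_inner (v.partial k) (v.partial k)
  have h4 := V.hasInt_inner v.toV v.toV
  -- The drift contributes 3/4 of ‖v‖² and the zeroth order term -1/2, which leaves the coefficient
  -- 1/4.
  have h5 := ((h3.add (h4.const_mul (1 / 4))).sub (HasInt.sum h1)).sub
      ((HasInt.sum h2).const_mul (1 / 2))
  simp only [real_inner_self_eq_norm_sq, Finset.sum_const_zero, mul_zero, sub_zero] at h5
  rw [← h5.eq, MeasureTheory.L2.inner_def]
  refine integral_congr_ae ?_
  filter_upwards [ae_all_iff.2 fun a => v.linPart_apply a, ae_all_iff.2 fun a => v.lap_comp a,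
    ae_all_iff.2 fun a => v.radial_ae a] with x e1 e2 e3
  simp only [inner_eq_sum, e1, e2, e3]
  have e4 : ∀ a, v.toV.toL2 x a = v.toV.comp a x := fun a => rfl
  simp only [e4, Fin.sum_univ_three]
  ring

/-- The energy identity with t ≥ 0 bounds ‖v‖ in L² by 4‖w‖ and each first derivative by 2‖w‖, and
H¹ controls 𝒱; 10 = 4 + 3 · 2. The constant does not depend on t, which permits t → 0. -/
theorem exists_coercive : ∃ C : ℝ, ∀ t : ℝ, 0 ≤ t → ∀ (v : D) (w : V),
    w.toL2 = linPart v + t • v.toV.toL2 → ‖v.toV‖ ≤ C * ‖w‖ := by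
  obtain ⟨K, hK0, hK⟩ := exists_norm_V_le_H1
  refine ⟨K * 10, fun t ht v w hw => ?_⟩
  have h1 : ⟪w.toL2, v.toV.toL2⟫ = ∑ k, ‖(v.partial k).toL2‖ ^ 2 + 1 / 4 * ‖v.toV.toL2‖ ^ 2
      + t * ‖v.toV.toL2‖ ^ 2 := by
    rw [hw, inner_add_left, v.inner_linPart, real_inner_smul_left, real_inner_self_eq_norm_sq]
  have h2 : ⟪w.toL2, v.toV.toL2⟫ ≤ ‖w‖ * ‖v.toV.toL2‖ :=
    (real_inner_le_norm _ _).trans (by gcongr; exact w.norm_toL2_le)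
  have hs : 0 ≤ ∑ k, ‖(v.partial k).toL2‖ ^ 2 := Finset.sum_nonneg fun _ _ => sq_nonneg _
  have ht2 : 0 ≤ t * ‖v.toV.toL2‖ ^ 2 := by positivity
  have h3 : ‖v.toV.toL2‖ ≤ 4 * ‖w‖ := by
    rcases (norm_nonneg v.toV.toL2).eq_or_lt with h0 | h0
    · rw [← h0]; positivity
    · have : ‖v.toV.toL2‖ * ‖v.toV.toL2‖ ≤ 4 * ‖w‖ * ‖v.toV.toL2‖ := by nlinarith
      exact le_of_mul_le_mul_right this h0
  have h4 : ∀ k, ‖(v.partial k).toL2‖ ≤ 2 * ‖w‖ := fun k => by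
    have h5 := Finset.single_le_sum
        (f := fun k => ‖(v.partial k).toL2‖ ^ 2) (fun _ _ => sq_nonneg _)
      (Finset.mem_univ k)
    refine abs_le_of_sq_le_sq' ?_ (by positivity) |>.2
    nlinarith [norm_nonneg w, norm_nonneg v.toV.toL2, sq_nonneg ‖v.toV.toL2‖]
  refine (hK v.toV (fun k => (v.partial k).toL2) v.2.1).trans ?_
  rw [mul_assoc]
  gcongr
  have h6 := Finset.sum_le_sum fun k (_ : k ∈ Finset.univ) => h4 k
  simp only [Finset.sum_const, Finset.card_univ, Fintype.card_fin, nsmul_eq_mul] at h6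
  push_cast at h6
  linarith

/-! ### The implicit function theorem for curves of solutions -/

section Implicit
variable {Z Y : Type*} [NormedAddCommGroup Z] [NormedSpace ℝ Z] [CompleteSpace Z]
  [NormedAddCommGroup Y] [NormedSpace ℝ Y] [CompleteSpace Y]

/-- The inverse function theorem for (s, z) ↦ (s, H(s, z)), whose derivative is triangular with
diagonal blocks 1 and M; the curve is the preimage of the points (s, 0). -/
theorem exists_solution_curve {H : ℝ × Z → Y} {O : Set (ℝ × Z)} (hO : IsOpen O)
    (hH : ContDiffOn ℝ ∞ H O) {s₀ : ℝ} {z₀ : Z} (h0 : (s₀, z₀) ∈ O) (hz : H (s₀, z₀) = 0)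
    {M : Z →L[ℝ] Y} (hM : Function.Bijective M) (hMd : ∀ ζ, fderiv ℝ H (s₀, z₀) (0, ζ) = M ζ) :
    ∃ ε r : ℝ, 0 < ε ∧ 0 < r ∧ ∃ ζ : ℝ → Z, ContDiffOn ℝ ∞ ζ (Ioo (s₀ - ε) (s₀ + ε)) ∧ ζ s₀ = z₀ ∧
      (∀ s ∈ Ioo (s₀ - ε) (s₀ + ε), (s, ζ s) ∈ O ∧ ζ s ∈ Metric.ball z₀ r ∧ H (s, ζ s) = 0) ∧
      ∀ s ∈ Ioo (s₀ - ε) (s₀ + ε), ∀ z ∈ Metric.ball z₀ r, H (s, z) = 0 → z = ζ s := by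
  let Φ : ℝ × Z → ℝ × Y := fun p => (p.1, H p)
  have hHat : ∀ p ∈ O, ContDiffAt ℝ ∞ H p := fun p hp => hH.contDiffAt (hO.mem_nhds hp)
  have hΦ : ∀ p ∈ O, ContDiffAt ℝ ∞ Φ p := fun p hp => contDiffAt_fst.prodMk (hHat p hp)
  have hd : ∀ p ∈ O, HasFDerivAt Φ ((ContinuousLinearMap.fst ℝ ℝ Z).prod (fderiv ℝ H p)) p :=
    fun p hp => hasFDerivAt_fst.prodMk ((hHat p hp).differentiableAt (by simp)).hasFDerivAt
  set A : ℝ × Z →L[ℝ] ℝ × Y := (ContinuousLinearMap.fst ℝ ℝ Z).prod (fderiv ℝ H (s₀, z₀)) with hA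
  have hAa : ∀ τ ζ, A (τ, ζ) = (τ, fderiv ℝ H (s₀, z₀) (τ, 0) + M ζ) := fun τ ζ => by
    rw [← hMd, ← map_add]
    simp [hA]
  have hinj : Function.Injective A := by
    rw [injective_iff_map_eq_zero]
    rintro ⟨τ, ζ⟩ h
    rw [hAa, Prod.mk_eq_zero] at h
    obtain ⟨rfl, h⟩ := h
    have h1 : ((0 : ℝ), (0 : Z)) = 0 := rfl
    rw [h1, map_zero, zero_add] at h
    rw [hM.1 (h.trans (map_zero M).symm)]
    rfl
  have hsurj : Function.Surjective A := by
    rintro ⟨τ, y⟩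
    obtain ⟨ζ, hζ⟩ := hM.2 (y - fderiv ℝ H (s₀, z₀) (τ, 0))
    exact ⟨(τ, ζ), by rw [hAa, hζ, add_sub_cancel]⟩
  let E : (ℝ × Z) ≃L[ℝ] (ℝ × Y) := ContinuousLinearEquiv.ofBijective A
    (LinearMap.ker_eq_bot.2 hinj) (LinearMap.range_eq_top.2 hsurj)
  have hE : (E : ℝ × Z →L[ℝ] ℝ × Y) = A :=
    ContinuousLinearMap.ext fun p => rfl
  have hdE : HasFDerivAt Φ (E : ℝ × Z →L[ℝ] ℝ × Y) (s₀, z₀) := by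
    rw [hE]; exact hd _ h0
  let P := (hΦ _ h0).toOpenPartialHomeomorph Φ hdE (by simp)
  have hPc : ∀ p, P p = Φ p := fun p => rfl
  have hps : (s₀, z₀) ∈ P.source := (hΦ _ h0).mem_toOpenPartialHomeomorph_source hdE (by simp)
  have hP0 : P (s₀, z₀) = (s₀, 0) := by rw [hPc]; simp only [Φ, hz]
  have ht0 : (s₀, (0 : Y)) ∈ P.target := hP0 ▸ P.map_source hps
  have hsymm0 : P.symm (s₀, 0) = (s₀, z₀) := by rw [← hP0, P.left_inv hps]
  have hcd : ContinuousAt (fderiv ℝ Φ) (s₀, z₀) :=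
    ((hΦ _ h0).fderiv_right (m := ∞) (by simp)).continuousAt
  -- Smoothness of the local inverse at a point requires an invertible derivative there. Invertible
  -- operators form an open set, so this holds on a whole ball and the curve is smooth on an
  -- interval, not only at s₀.
  have hW : ∀ᶠ p in 𝓝 (s₀, z₀), p ∈ O ∧ p ∈ P.source ∧
      fderiv ℝ Φ p ∈ range ((↑) : ((ℝ × Z) ≃L[ℝ] (ℝ × Y)) → (ℝ × Z →L[ℝ] ℝ × Y)) := by
    refine Filter.Eventually.and (hO.mem_nhds h0)
      (Filter.Eventually.and (P.open_source.mem_nhds hps) (hcd ?_))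
    rw [(hd _ h0).fderiv, ← hA, ← hE]
    exact ContinuousLinearEquiv.isOpen.mem_nhds ⟨E, rfl⟩
  obtain ⟨r, hr0, hr⟩ := Metric.eventually_nhds_iff_ball.1 hW
  let ζ : ℝ → Z := fun s => (P.symm (s, 0)).2
  have hin : Continuous fun s : ℝ => (s, (0 : Y)) := by fun_prop
  have hc : ContinuousAt (fun s : ℝ => P.symm (s, 0)) s₀ :=
    ContinuousAt.comp (f := fun s : ℝ => (s, (0 : Y))) (P.continuousAt_symm ht0) hin.continuousAt
  have hev : ∀ᶠ s in 𝓝 s₀, (s, (0 : Y)) ∈ P.target ∧ P.symm (s, 0) ∈ Metric.ball (s₀, z₀) r := by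
    refine Filter.Eventually.and (hin.continuousAt (P.open_target.mem_nhds ht0)) (hc ?_)
    change Metric.ball (s₀, z₀) r ∈ 𝓝 (P.symm (s₀, 0))
    rw [hsymm0]
    exact Metric.ball_mem_nhds _ hr0
  obtain ⟨ε, hε0, hε⟩ := Metric.eventually_nhds_iff_ball.1 hev
  have hI : ∀ s ∈ Ioo (s₀ - min ε r) (s₀ + min ε r), s ∈ Metric.ball s₀ ε ∧ s ∈ Metric.ball s₀ r :=
    fun s hs => by
      rw [← Real.ball_eq_Ioo] at hs
      exact ⟨Metric.ball_subset_ball (min_le_left _ _) hs,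
          Metric.ball_subset_ball (min_le_right _ _) hs⟩
  have hsol : ∀ s ∈ Ioo (s₀ - min ε r) (s₀ + min ε r), P.symm (s, 0) = (s, ζ s) ∧ H (s, ζ s) = 0 := by
    intro s hs
    have h1 := P.right_inv (hε s (hI s hs).1).1
    rw [hPc] at h1
    have h2 : (P.symm (s, 0)).1 = s := congrArg Prod.fst h1
    have h3 : P.symm (s, 0) = (s, ζ s) := Prod.ext h2 rfl
    refine ⟨h3, ?_⟩
    rw [← h3]
    exact congrArg Prod.snd h1
  have hball : ∀ s ∈ Ioo (s₀ - min ε r) (s₀ + min ε r), (s, ζ s) ∈ Metric.ball (s₀, z₀) r :=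
    fun s hs => (hsol s hs).1 ▸ (hε s (hI s hs).1).2
  refine ⟨min ε r, r, lt_min hε0 hr0, hr0, ζ, fun s hs => ?_, ?_, fun s hs => ?_,
      fun s hs z hz' hHz => ?_⟩
  · obtain ⟨hpO, hpS, e, he⟩ := hr _ (hε s (hI s hs).1).2
    have h1 : HasFDerivAt P (e : ℝ × Z →L[ℝ] ℝ × Y) (P.symm (s, 0)) := by
      rw [he]
      exact ((hΦ _ hpO).differentiableAt (by simp)).hasFDerivAt
    have h2 : ContDiffAt ℝ ∞ P.symm (s, 0) :=
      P.contDiffAt_symm (hε s (hI s hs).1).1 h1 (hΦ _ hpO)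
    have h3 : ContDiffAt ℝ ∞ (fun s : ℝ => (s, (0 : Y))) s := contDiffAt_id.prodMk contDiffAt_const
    exact (contDiffAt_snd.comp s (ContDiffAt.comp (g := P.symm) s h2 h3)).contDiffWithinAt
  · change (P.symm (s₀, 0)).2 = z₀
    rw [hsymm0]
  · have h1 := hball s hs
    refine ⟨(hr _ h1).1, ?_, (hsol s hs).2⟩
    rw [← ball_prod_same] at h1
    exact h1.2
  · have h1 : (s, z) ∈ Metric.ball (s₀, z₀) r := by
      rw [← ball_prod_same]
      exact ⟨(hI s hs).2, hz'⟩
    have h2 : P (s, z) = P (s, ζ s) := by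
      rw [hPc, hPc]
      exact Prod.ext rfl (hHz.trans (hsol s hs).2.symm)
    exact congrArg Prod.snd (P.injOn (hr _ h1).2.1 (hr _ (hball s hs)).2.1 h2)

end Implicit

/-- Continuous curves of solutions coincide with a locally unique curve. -/
theorem eqOn_of_locally_unique {Z : Type*} [NormedAddCommGroup Z] {u ζ : ℝ → Z}
    {I : Set ℝ} (hI : IsPreconnected I) (hIo : IsOpen I)
    {S : ℝ → Z → Prop} {s₀ : ℝ} (hs₀ : s₀ ∈ I) {z₀ : Z} {r : ℝ} (hζ : ContinuousOn ζ I)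
    (hζr : ∀ s ∈ I, ζ s ∈ Metric.ball z₀ r) (hu : ContinuousOn u I) (hus : ∀ s ∈ I, S s (u s))
    (h : ∀ s ∈ I, ∀ z ∈ Metric.ball z₀ r, S s z → z = ζ s) (h0 : u s₀ = ζ s₀) : EqOn u ζ I := by
  have hd : ContinuousOn (fun s => u s - ζ s) I := hu.sub hζ
  have h1 : IsOpen (I ∩ u ⁻¹' Metric.ball z₀ r) := hu.isOpen_inter_preimage hIo Metric.isOpen_ball
  have h2 : IsOpen (I ∩ (fun s => u s - ζ s) ⁻¹' {0}ᶜ) :=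
    hd.isOpen_inter_preimage hIo isClosed_singleton.isOpen_compl
  -- A connectedness argument: the interval is covered by the open set where u is in the ball and
  -- the open set where u ≠ ζ. Local uniqueness makes them disjoint, and s₀ lies in the first.
  have h3 : I ⊆ (I ∩ u ⁻¹' Metric.ball z₀ r) ∪ (I ∩ (fun s => u s - ζ s) ⁻¹' {0}ᶜ) := fun s hs => by
    by_cases hb : u s - ζ s = 0
    · refine Or.inl ⟨hs, ?_⟩
      rw [mem_preimage, sub_eq_zero.1 hb]
      exact hζr s hs
    · exact Or.inr ⟨hs, hb⟩
  have h4 : Disjoint (I ∩ u ⁻¹' Metric.ball z₀ r) (I ∩ (fun s => u s - ζ s) ⁻¹' {0}ᶜ) := by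
    rw [Set.disjoint_left]
    rintro s ⟨hs, hb⟩ ⟨-, hne⟩
    exact hne (sub_eq_zero.2 (h s hs _ hb (hus s hs)))
  have h5 := hI.subset_left_of_subset_union h1 h2 h4 h3
    ⟨s₀, hs₀, hs₀, by rw [mem_preimage, h0]; exact hζr s₀ hs₀⟩
  exact fun s hs => h s hs _ (h5 hs).2 (hus s hs)

/-! ### Bifurcation from a simple eigenvalue for quadratic equations -/

section Bifurcation
variable {X Y : Type*} [NormedAddCommGroup X] [NormedSpace ℝ X] [NormedAddCommGroup Y]
  [NormedSpace ℝ Y]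

theorem exists_norm_le_of_bijective [CompleteSpace X] [CompleteSpace Y] {M : X →L[ℝ] Y}
    (hM : Function.Bijective M) : ∃ C : ℝ, 0 ≤ C ∧ ∀ x, ‖x‖ ≤ C * ‖M x‖ := by
  let e : X ≃L[ℝ] Y := ContinuousLinearEquiv.ofBijective M
    (LinearMap.ker_eq_bot.2 hM.1) (LinearMap.range_eq_top.2 hM.2)
  refine ⟨‖(e.symm : Y →L[ℝ] X)‖, norm_nonneg _, fun x => ?_⟩
  have h := (e.symm : Y →L[ℝ] X).le_opNorm (e x)
  have h1 : (e.symm : Y →L[ℝ] X) (e x) = x := e.symm_apply_apply x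
  rwa [h1] at h

/-- Small solutions of `N(σ) w + B(w, w) = 0` are nearly multiples of the kernel vector. -/
theorem eventually_decomposition [CompleteSpace X] [CompleteSpace Y] {N : ℝ → X →L[ℝ] Y}
    (B : X →L[ℝ] X →L[ℝ] Y) {σ₀ : ℝ} (hN : ContinuousAt N σ₀) {φ : X} {z : Y} (hφ : N σ₀ φ = 0)
    {l : X →L[ℝ] ℝ} (hl : l φ = 1) (hM : Function.Bijective (N σ₀ + l.smulRight z)) {ε₂ r : ℝ}
    (hε₂ : 0 < ε₂) (hr : 0 < r) :
    ∀ᶠ q : X × ℝ in 𝓝 (0, σ₀), N q.2 q.1 + B q.1 q.1 = 0 → q.1 = 0 ∨ ∃ (s : ℝ) (χ : X), s ≠ 0 ∧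
      l χ = 0 ∧ s ∈ Ioo (-ε₂) ε₂ ∧ q.1 = s • (φ + χ) ∧
      (q.2 - σ₀) • φ + χ ∈ Metric.ball (0 : X) r := by
  obtain ⟨C, hC0, hC⟩ := exists_norm_le_of_bijective hM
  -- η ≤ 1/2 lets the remainder κ be absorbed in ‖w‖; the second bound keeps χ within r/2, so that
  -- together with (σ - σ₀)φ it stays in the ball of radius r.
  obtain ⟨η, hη0, hη1, hη2⟩ : ∃ η : ℝ, 0 < η ∧ η ≤ 1 / 2 ∧ 2 * η * ‖φ‖ < r / 2 := by
    refine ⟨min (1 / 2) (r / (8 * (‖φ‖ + 1))), by positivity, min_le_left _ _, ?_⟩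
    have h1 : min (1 / 2) (r / (8 * (‖φ‖ + 1))) ≤ r / (8 * (‖φ‖ + 1)) := min_le_right _ _
    rw [le_div_iff₀ (by positivity)] at h1
    have h2 : 0 < min (1 / 2) (r / (8 * (‖φ‖ + 1))) := by positivity
    nlinarith [norm_nonneg φ]
  have hNc : Tendsto (fun q : X × ℝ => N q.2) (𝓝 (0, σ₀)) (𝓝 (N σ₀)) :=
    hN.tendsto.comp (continuous_snd.tendsto (0, σ₀))
  have c1 : Tendsto (fun q : X × ℝ => C * (‖N q.2 - N σ₀‖ + ‖B‖ * ‖q.1‖)) (𝓝 (0, σ₀)) (𝓝 0) := by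
    have h1 : Tendsto (fun q : X × ℝ => ‖q.1‖) (𝓝 (0, σ₀)) (𝓝 ‖(0 : X)‖) :=
      continuous_fst.norm.tendsto (0, σ₀)
    have h2 := (((hNc.sub_const (N σ₀)).norm).add (h1.const_mul ‖B‖)).const_mul C
    simpa using h2
  have c2 : Tendsto (fun q : X × ℝ => |q.2 - σ₀| * ‖φ‖) (𝓝 (0, σ₀)) (𝓝 0) := by
    have h1 : Continuous fun q : X × ℝ => |q.2 - σ₀| * ‖φ‖ := by fun_prop
    simpa using h1.tendsto (0, σ₀)
  have c3 : Tendsto (fun q : X × ℝ => |l q.1|) (𝓝 (0, σ₀)) (𝓝 0) := by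
    have h1 : Continuous fun q : X × ℝ => |l q.1| := by fun_prop
    simpa using h1.tendsto (0, σ₀)
  filter_upwards [c1.eventually_lt_const hη0, c2.eventually_lt_const (half_pos hr),
    c3.eventually_lt_const hε₂] with ⟨w, σ⟩ b1 b2 b3 hw
  simp only at b1 b2 b3 hw
  by_cases hw0 : w = 0
  · exact Or.inl hw0
  right
  obtain ⟨s, hs⟩ : ∃ s, s = l w := ⟨_, rfl⟩
  obtain ⟨κ, hκ⟩ : ∃ κ, κ = w - l w • φ := ⟨_, rfl⟩
  have hwd : w = s • φ + κ := by rw [hκ, hs]; abel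
  have hlκ : l κ = 0 := by
    rw [hκ, map_sub, map_smul, hl, smul_eq_mul, mul_one, sub_self]
  have hκn : ‖κ‖ ≤ η * ‖w‖ := by
    -- Since l κ = 0 and φ is in the kernel, the bijective operator acts on κ as N(σ₀) acts on w.
    -- The equation makes this a small multiple of ‖w‖, so κ is small compared with w.
    have h1 : (N σ₀ + l.smulRight z) κ = -((N σ - N σ₀) w) - B w w := by
      have h2 : N σ₀ κ = N σ₀ w := by rw [hwd, map_add, map_smul, hφ, smul_zero, zero_add]
      have h3 : B w w = -N σ w := eq_neg_of_add_eq_zero_right hw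
      simp [hlκ, h2, h3]
    refine (hC κ).trans ?_
    rw [h1]
    calc C * ‖-((N σ - N σ₀) w) - B w w‖ ≤ C * (‖N σ - N σ₀‖ * ‖w‖ + ‖B‖ * ‖w‖ * ‖w‖) := by
          gcongr
          refine (norm_sub_le _ _).trans ?_
          rw [norm_neg]
          exact add_le_add ((N σ - N σ₀).le_opNorm w) (B.le_opNorm₂ w w)
      _ = C * (‖N σ - N σ₀‖ + ‖B‖ * ‖w‖) * ‖w‖ := by ring
      _ ≤ η * ‖w‖ := by gcongr
  have hwn : ‖w‖ ≤ 2 * (|s| * ‖φ‖) := by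
    have h1 : ‖w‖ ≤ |s| * ‖φ‖ + ‖κ‖ := by
      conv_lhs => rw [hwd]
      refine (norm_add_le _ _).trans ?_
      rw [norm_smul, Real.norm_eq_abs]
    have h2 : η * ‖w‖ ≤ 1 / 2 * ‖w‖ := by gcongr
    linarith
  have hs0 : s ≠ 0 := by
    rintro rfl
    rw [abs_zero, zero_mul, mul_zero, norm_le_zero_iff] at hwn
    exact hw0 hwn
  have hsI : s ∈ Ioo (-ε₂) ε₂ := abs_lt.1 (hs ▸ b3)
  have hlχ : l (s⁻¹ • κ) = 0 := by simp [hlκ]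
  have hχn : ‖s⁻¹ • κ‖ ≤ 2 * η * ‖φ‖ := by
    rw [norm_smul, norm_inv, Real.norm_eq_abs, inv_mul_le_iff₀ (abs_pos.2 hs0)]
    calc ‖κ‖ ≤ η * ‖w‖ := hκn
      _ ≤ η * (2 * (|s| * ‖φ‖)) := by gcongr
      _ = _ := by ring
  refine ⟨s, s⁻¹ • κ, hs0, hlχ, hsI, ?_, ?_⟩
  · rw [smul_add, smul_inv_smul₀ hs0, ← hwd]
  · rw [mem_ball_zero_iff]
    refine lt_of_le_of_lt (norm_add_le _ _) ?_
    rw [norm_smul, Real.norm_eq_abs]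
    linarith

/-- The equation `N(σ) w + B(w, w) = 0`, divided by `s`, for `w = s (φ + χ)`. The unknown is
`y = (σ - σ₀) φ + χ`, where `l φ = 1` and `l χ = 0`. -/
def bifurcationMap (N : ℝ → X →L[ℝ] Y) (B : X →L[ℝ] X →L[ℝ] Y) (l : X →L[ℝ] ℝ) (φ : X) (σ₀ : ℝ)
    (q : ℝ × X) : Y :=
  N (σ₀ + l q.2) (φ + (q.2 - l q.2 • φ)) + q.1 • B (φ + (q.2 - l q.2 • φ)) (φ + (q.2 - l q.2 • φ))

section Map
variable {N : ℝ → X →L[ℝ] Y} (B : X →L[ℝ] X →L[ℝ] Y) {σ₀ : ℝ} {φ : X} {l : X →L[ℝ] ℝ} {I : Set ℝ}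

theorem contDiff_add_projection (l : X →L[ℝ] ℝ) (φ : X) :
    ContDiff ℝ ∞ fun y : X => φ + (y - l y • φ) :=
  contDiff_const.add (contDiff_id.sub (l.contDiff.smul contDiff_const))

theorem contDiffOn_bifurcationMap (hN : ContDiffOn ℝ ∞ N I) :
    ContDiffOn ℝ ∞ (bifurcationMap N B l φ σ₀) ((fun q => σ₀ + l q.2) ⁻¹' I) := by
  have hlc : ContDiff ℝ ∞ fun q : ℝ × X => σ₀ + l q.2 :=
      contDiff_const.add (l.contDiff.comp contDiff_snd)
  have hpc : ContDiff ℝ ∞ fun q : ℝ × X => φ + (q.2 - l q.2 • φ) :=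
    (contDiff_add_projection l φ).comp contDiff_snd
  refine ContDiffOn.add ((hN.comp hlc.contDiffOn fun q hq => hq).clm_apply hpc.contDiffOn) ?_
  exact (contDiff_fst.smul ((B.contDiff.comp hpc).clm_apply hpc)).contDiffOn

/-- At s = 0 the quadratic term is absent. Varying y changes σ by l η and φ + χ by η - (l η)φ; the
latter part is harmless because φ is in the kernel, so the transversality vector appears exactly as
the rank-one term. -/
theorem fderiv_bifurcationMap (hN : DifferentiableAt ℝ N σ₀)
    (hd : DifferentiableAt ℝ (bifurcationMap N B l φ σ₀) (0, 0)) (hφ : N σ₀ φ = 0) (η : X) :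
    fderiv ℝ (bifurcationMap N B l φ σ₀) (0, 0) (0, η)
      = (N σ₀ + l.smulRight (deriv N σ₀ φ)) η := by
  have hline : HasDerivAt (fun t : ℝ => ((0 : ℝ), t • η)) (0, η) 0 := by
    have h1 := (hasDerivAt_const (0 : ℝ) (0 : ℝ)).prodMk ((hasDerivAt_id (0 : ℝ)).smul_const η)
    simpa using h1
  have hHd' : HasFDerivAt (bifurcationMap N B l φ σ₀) (fderiv ℝ (bifurcationMap N B l φ σ₀) (0, 0))
      ((0 : ℝ), (0 : ℝ) • η) := by
    rw [zero_smul]; exact hd.hasFDerivAt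
  have h1 : HasDerivAt (fun t : ℝ => bifurcationMap N B l φ σ₀ (0, t • η))
      (fderiv ℝ (bifurcationMap N B l φ σ₀) (0, 0) (0, η)) 0 :=
    HasFDerivAt.comp_hasDerivAt (f := fun t : ℝ => ((0 : ℝ), t • η)) (0 : ℝ) hHd' hline
  have hσ : HasDerivAt (fun t : ℝ => σ₀ + t * l η) (l η) 0 := by
    simpa using ((hasDerivAt_id (0 : ℝ)).mul_const (l η)).const_add σ₀
  have hNd : HasDerivAt N (deriv N σ₀) (σ₀ + 0 * l η) := by
    rw [zero_mul, add_zero]; exact hN.hasDerivAt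
  have hy : HasDerivAt (fun t : ℝ => φ + t • (η - l η • φ)) (η - l η • φ) 0 := by
    simpa using ((hasDerivAt_id (0 : ℝ)).smul_const (η - l η • φ)).const_add φ
  have h2 : HasDerivAt (fun t : ℝ => N (σ₀ + t * l η)) (l η • deriv N σ₀) 0 :=
    HasDerivAt.scomp (h := fun t : ℝ => σ₀ + t * l η) (0 : ℝ) hNd hσ
  have h3 := h2.clm_apply hy
  have e : (fun t : ℝ => bifurcationMap N B l φ σ₀ ((0 : ℝ), t • η))
      = fun t => N (σ₀ + t * l η) (φ + t • (η - l η • φ)) := by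
    ext t
    simp only [bifurcationMap, zero_smul, add_zero, map_smul, smul_eq_mul, smul_sub, mul_smul]
  rw [e] at h1
  rw [h1.unique h3]
  simp [hφ, add_comm]

end Map

/-- The nontrivial solutions of `N(σ) w + B(w, w) = 0` bifurcating from the trivial ones. -/
theorem exists_bifurcating_curve [CompleteSpace X] [CompleteSpace Y] {N : ℝ → X →L[ℝ] Y}
    (B : X →L[ℝ] X →L[ℝ] Y) {σ₀ ε : ℝ} (hε : 0 < ε)
    (hN : ContDiffOn ℝ ∞ N (Ioo (σ₀ - ε) (σ₀ + ε))) {φ : X} (hφ : N σ₀ φ = 0) {l : X →L[ℝ] ℝ}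
    (hl : l φ = 1) (hM : Function.Bijective (N σ₀ + l.smulRight (deriv N σ₀ φ))) :
    ∃ ε₂ : ℝ, 0 < ε₂ ∧ ∃ (p : ℝ → X) (σ₂ : ℝ → ℝ), ContDiffOn ℝ ∞ p (Ioo (-ε₂) ε₂) ∧
      ContDiffOn ℝ ∞ σ₂ (Ioo (-ε₂) ε₂) ∧ p 0 = φ ∧ σ₂ 0 = σ₀ ∧
      (∀ s ∈ Ioo (-ε₂) ε₂, σ₂ s ∈ Ioo (σ₀ - ε) (σ₀ + ε) ∧ p s ≠ 0 ∧
        N (σ₂ s) (p s) + s • B (p s) (p s) = 0) ∧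
      ∀ᶠ q : X × ℝ in 𝓝 (0, σ₀), N q.2 q.1 + B q.1 q.1 = 0 →
        q.1 = 0 ∨ ∃ s ∈ Ioo (-ε₂) ε₂, q.1 = s • p s ∧ q.2 = σ₂ s := by
  have hσ₀ : σ₀ ∈ Ioo (σ₀ - ε) (σ₀ + ε) := ⟨by linarith, by linarith⟩
  have hNat : ContDiffAt ℝ ∞ N σ₀ := hN.contDiffAt (Ioo_mem_nhds hσ₀.1 hσ₀.2)
  have hlc : Continuous fun q : ℝ × X => σ₀ + l q.2 := by fun_prop
  have hO : IsOpen ((fun q : ℝ × X => σ₀ + l q.2) ⁻¹' Ioo (σ₀ - ε) (σ₀ + ε)) :=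
      isOpen_Ioo.preimage hlc
  have h0 : ((0 : ℝ), (0 : X)) ∈ (fun q : ℝ × X => σ₀ + l q.2) ⁻¹' Ioo (σ₀ - ε) (σ₀ + ε) := by
    change σ₀ + l 0 ∈ Ioo (σ₀ - ε) (σ₀ + ε)
    rwa [map_zero, add_zero]
  have hH := contDiffOn_bifurcationMap B (l := l) (φ := φ) (σ₀ := σ₀) hN
  have hH0 : bifurcationMap N B l φ σ₀ (0, 0) = 0 := by simp [bifurcationMap, hφ]
  obtain ⟨ε₂, r, hε₂, hr, y, hy, hy0, hsol, huniq⟩ := exists_solution_curve hO hH h0 hH0 hM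
    (fderiv_bifurcationMap B (hNat.differentiableAt (by simp))
      ((hH.contDiffAt (hO.mem_nhds h0)).differentiableAt (by simp)) hφ)
  simp only [zero_sub, zero_add] at hy hsol huniq
  refine ⟨ε₂, hε₂, fun s => φ + (y s - l (y s) • φ), fun s => σ₀ + l (y s),
    (contDiff_add_projection l φ).comp_contDiffOn hy,
    contDiffOn_const.add (l.contDiff.comp_contDiffOn hy), by simp [hy0], by simp [hy0],
    fun s hs => ⟨(hsol s hs).1, fun h => ?_, (hsol s hs).2.2⟩, ?_⟩
  · have := congrArg l h
    simp [hl] at this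
  filter_upwards [eventually_decomposition B hNat.continuousAt hφ hl hM hε₂ hr] with ⟨w, σ⟩ hq hw
  refine (hq hw).imp id ?_
  rintro ⟨s, χ, hs0, hlχ, hsI, hwχ, hyb⟩
  simp only at hw hwχ hyb
  have hly : l ((σ - σ₀) • φ + χ) = σ - σ₀ := by
    rw [map_add, map_smul, hl, hlχ, smul_eq_mul, mul_one, add_zero]
  have hπy : (σ - σ₀) • φ + χ - (σ - σ₀) • φ = χ := add_sub_cancel_left _ _
  have hHy : bifurcationMap N B l φ σ₀ (s, (σ - σ₀) • φ + χ) = 0 := by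
    -- Conversely, for w = s(φ + χ) the equation is s times the divided equation. As s ≠ 0, the pair
    -- lies on the curve by the uniqueness in the implicit function theorem.
    have h1 : s • bifurcationMap N B l φ σ₀ (s, (σ - σ₀) • φ + χ) = 0 := by
      simp only [bifurcationMap, hly, hπy, add_sub_cancel]
      rw [← hw, hwχ]
      rw [map_smul, map_smul, map_smul, _root_.smul_apply, smul_add]
    exact (smul_eq_zero.1 h1).resolve_left hs0
  have hys := huniq s hsI _ hyb hHy
  refine ⟨s, hsI, ?_, ?_⟩
  · simp only [← hys, hly, hπy, hwχ]
  · simp only [← hys, hly, add_sub_cancel]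

theorem hasDerivAt_of_contDiffOn {E : Type*} [NormedAddCommGroup E] [NormedSpace ℝ E] {f : ℝ → E}
    {I : Set ℝ} (hI : IsOpen I) (hf : ContDiffOn ℝ ∞ f I) {s : ℝ} (hs : s ∈ I) :
    HasDerivAt f (deriv f s) s :=
  ((hf.contDiffAt (hI.mem_nhds hs)).differentiableAt (by simp)).hasDerivAt

/-- The first two derivatives of `N(σ₂(s)) p(s) + s B(p(s), p(s)) = 0` at `s = 0`. -/
theorem bifurcation_derivatives {N : ℝ → X →L[ℝ] Y} (B : X →L[ℝ] X →L[ℝ] Y) {J I : Set ℝ}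
    (hJ : IsOpen J) (hI : IsOpen I) (h0 : (0 : ℝ) ∈ J) (hN : ContDiffOn ℝ ∞ N I) {p : ℝ → X}
    {σ₂ : ℝ → ℝ} (hp : ContDiffOn ℝ ∞ p J) (hσ : ContDiffOn ℝ ∞ σ₂ J)
    (h : ∀ s ∈ J, σ₂ s ∈ I ∧ N (σ₂ s) (p s) + s • B (p s) (p s) = 0) :
    deriv σ₂ 0 • deriv N (σ₂ 0) (p 0) + N (σ₂ 0) (deriv p 0) + B (p 0) (p 0) = 0 ∧
    (deriv σ₂ 0 = 0 → deriv (deriv σ₂) 0 • deriv N (σ₂ 0) (p 0) + N (σ₂ 0) (deriv (deriv p) 0)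
      + (2 : ℝ) • (B (deriv p 0) (p 0) + B (p 0) (deriv p 0)) = 0) := by
  have hp' : ContDiffOn ℝ ∞ (deriv p) J := hp.deriv_of_isOpen hJ (by simp)
  have hσ' : ContDiffOn ℝ ∞ (deriv σ₂) J := hσ.deriv_of_isOpen hJ (by simp)
  have hN' : ContDiffOn ℝ ∞ (deriv N) I := hN.deriv_of_isOpen hI (by simp)
  have dB : ∀ {u w : ℝ → X} {u' w' : X} {s : ℝ}, HasDerivAt u u' s → HasDerivAt w w' s →
      HasDerivAt (fun t => B (u t) (w t)) (B u' (w s) + B (u s) w') s := fun {u w u' w' s} hu hw =>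
    (B.hasFDerivAt.comp_hasDerivAt s hu).clm_apply hw
  have d1 : ∀ s ∈ J, HasDerivAt (fun t => N (σ₂ t) (p t) + t • B (p t) (p t))
      ((deriv σ₂ s • deriv N (σ₂ s)) (p s) + N (σ₂ s) (deriv p s)
        + (s • (B (deriv p s) (p s) + B (p s) (deriv p s)) + (1 : ℝ) • B (p s) (p s))) s :=
            fun s hs => by
    have hps := hasDerivAt_of_contDiffOn hJ hp hs
    have hNs := (hasDerivAt_of_contDiffOn hI hN (h s hs).1).scomp s
        (hasDerivAt_of_contDiffOn hJ hσ hs)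
    exact (hNs.clm_apply hps).add ((hasDerivAt_id s).smul (dB hps hps))
  have e1 : ∀ s ∈ J, (deriv σ₂ s • deriv N (σ₂ s)) (p s) + N (σ₂ s) (deriv p s)
        + (s • (B (deriv p s) (p s) + B (p s) (deriv p s)) + (1 : ℝ) • B (p s) (p s)) = 0 :=
            fun s hs => by
    refine (d1 s hs).unique ?_
    refine (hasDerivAt_const s (0 : Y)).congr_of_eventuallyEq ?_
    filter_upwards [hJ.mem_nhds hs] with t ht
    exact (h t ht).2
  refine ⟨by simpa using e1 0 h0, fun hz => ?_⟩
  have hp0 := hasDerivAt_of_contDiffOn hJ hp h0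
  have hp1 := hasDerivAt_of_contDiffOn hJ hp' h0
  have hσ0 := hasDerivAt_of_contDiffOn hJ hσ h0
  have hσ1 := hasDerivAt_of_contDiffOn hJ hσ' h0
  have hN0 := (hasDerivAt_of_contDiffOn hI hN (h 0 h0).1).scomp (0 : ℝ) hσ0
  have hN1 := (hasDerivAt_of_contDiffOn hI hN' (h 0 h0).1).scomp (0 : ℝ) hσ0
  have d2 := (((hσ1.smul hN1).clm_apply hp0).add (hN0.clm_apply hp1)).add
    (((hasDerivAt_id (0 : ℝ)).smul ((dB hp1 hp0).add (dB hp0 hp1))).add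
      ((dB hp0 hp0).const_smul (1 : ℝ)))
  have d3 := d2.unique ((hasDerivAt_const (0 : ℝ) (0 : Y)).congr_of_eventuallyEq (by
    filter_upwards [hJ.mem_nhds h0] with t ht
    exact e1 t ht))
  simp only [hz, zero_smul, Function.comp_apply, id, zero_add, one_smul, add_zero,
    _root_.zero_apply, _root_.smul_apply, Pi.add_apply, Pi.smul_apply'] at d3
  rw [two_smul, ← d3]

/-- Let z = N'(σ₀)φ. The first derivative at s = 0 reads σ₂'z + N p' + B(φ, φ) = 0. If σ₂' = 0, then
B(φ, φ) is in the range. If B(φ, φ) = -Nχ, then σ₂'z is in the range, so σ₂' = 0 and p' = χ + cφ. In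
that case the second derivative decides whether σ₂'' vanishes. -/
theorem bifurcation_type {N : ℝ → X →L[ℝ] Y} (B : X →L[ℝ] X →L[ℝ] Y) {J I : Set ℝ}
    (hJ : IsOpen J) (hI : IsOpen I) (h0 : (0 : ℝ) ∈ J) (hN : ContDiffOn ℝ ∞ N I) {p : ℝ → X}
    {σ₂ : ℝ → ℝ} (hp : ContDiffOn ℝ ∞ p J) (hσ : ContDiffOn ℝ ∞ σ₂ J)
    (h : ∀ s ∈ J, σ₂ s ∈ I ∧ N (σ₂ s) (p s) + s • B (p s) (p s) = 0) {σ₀ : ℝ} {φ : X}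
    (hσ0 : σ₂ 0 = σ₀) (hp0 : p 0 = φ) (hker : ∀ x, N σ₀ x = 0 → ∃ c : ℝ, x = c • φ)
    (hz : ∀ x, N σ₀ x ≠ deriv N σ₀ φ) :
    ((∀ x, N σ₀ x ≠ B φ φ) → IsTranscritical σ₂) ∧
    ((∃ x, N σ₀ x = B φ φ) → (∃ χ, N σ₀ χ + B φ φ = 0 ∧ ∀ x, N σ₀ x ≠ B φ χ + B χ φ) →
      IsPitchfork σ₂) := by
  obtain ⟨h1, h2⟩ := bifurcation_derivatives B hJ hI h0 hN hp hσ h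
  rw [hσ0, hp0] at h1 h2
  refine ⟨fun hB hd => ?_, fun _ => ?_⟩
  · rw [hd, zero_smul, zero_add] at h1
    exact hB (-deriv p 0) (by rw [map_neg]; exact neg_eq_of_add_eq_zero_right h1)
  rintro ⟨χ, hχ, hχB⟩
  have hBφ : B φ φ = -N σ₀ χ := eq_neg_of_add_eq_zero_right hχ
  have hd : deriv σ₂ 0 = 0 := by
    by_contra hne
    refine hz (-(deriv σ₂ 0)⁻¹ • (deriv p 0 - χ)) ?_
    have h3 : N σ₀ (deriv p 0 - χ) = -(deriv σ₂ 0 • deriv N σ₀ φ) := by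
      rw [map_sub, ← sub_eq_zero, ← h1, hBφ]
      abel
    rw [map_smul, h3, neg_smul, smul_neg, neg_neg, inv_smul_smul₀ hne]
  refine ⟨hd, fun hdd => ?_⟩
  rw [iteratedDeriv_succ, iteratedDeriv_one] at hdd
  have h3 := h2 hd
  rw [hdd, zero_smul, zero_add] at h3
  rw [hd, zero_smul, zero_add, hBφ, ← sub_eq_add_neg, ← map_sub] at h1
  obtain ⟨c, hc⟩ := hker _ h1
  have hpχ : deriv p 0 = χ + c • φ := by rw [← hc]; abel
  -- If σ₂'' = 0, the second derivative gives N p'' = -2(B(χ, φ) + B(φ, χ) + 2cB(φ, φ)). With B(φ,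
  -- φ) = -Nχ this solves for the symmetric term, and the witness is the resulting preimage.
  refine hχB (-(1 / 2 : ℝ) • deriv (deriv p) 0 + (2 * c) • χ) ?_
  rw [hpχ] at h3
  simp only [map_add, map_smul, _root_.add_apply, _root_.smul_apply, hBφ] at h3 ⊢
  have h4 : N σ₀ (deriv (deriv p) 0) = -((2 : ℝ) • (B χ φ + c • -N σ₀ χ + (B φ χ + c • -N σ₀ χ))) :=
    eq_neg_of_add_eq_zero_left h3
  rw [h4]
  module

end Bifurcation

/-! ### The linearization as a Fredholm operator -/

theorem IsWeakPartial.eq_zero {i : Fin 3} {f g : L2} (h : IsWeakPartial i f g) (hf : f = 0) :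
    g = 0 := by
  refine (Lp.eq_zero_iff_ae_eq_zero).2
    (ae_eq_zero_of_integral_contDiff_smul_eq_zero ?_ fun η h1 h2 => ?_)
  · exact (Lp.memLp g).locallyIntegrable (by norm_num)
  · have h3 := h η ⟨h1, h2⟩
    rw [hf, IsTest.integral_smul_zero] at h3
    exact neg_eq_zero.1 h3.symm

/-- Weak derivatives are unique, so the stored derivatives and the radial derivative vanish with v.
-/
theorem D.toVL_injective : Function.Injective D.toVL := by
  rw [injective_iff_map_eq_zero]
  intro v hv
  have h0 : v.1.1 = 0 := hv
  have h1 : ∀ i, (v.1.2.1 i).toL2 = 0 := fun i => (v.2.1 i).eq_zero (by rw [h0]; rfl)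
  have h2 : ∀ i j, (v.1.2.2.1 i j).toL2 = 0 := fun i j => (v.2.2.1 i j).eq_zero (h1 i)
  have h3 : v.1.2.2.2.toL2 = 0 := by
    refine (Lp.eq_zero_iff_ae_eq_zero).2 ?_
    filter_upwards [v.2.2.2, Lp.coeFn_zero E3 2 (volume : Measure E3)] with x hx hx0
    simp only [hx, h1, hx0, Pi.zero_apply, smul_zero, Finset.sum_const_zero]
  exact Subtype.ext (Prod.ext h0 (Prod.ext (funext fun i => V.toL2_injective (h1 i))
    (Prod.ext (funext fun i => funext fun j => V.toL2_injective (h2 i j)) (V.toL2_injective h3))))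

/-- At a real point the equations for real and imaginary parts decouple, so the real operator is
recovered by taking the imaginary datum to be zero. -/
theorem bijective_of_inResolventSet {U : GradField} {A : D →L[ℝ] V} (hA : ∀ φ, (A φ).toL2 = lin U φ)
    {t : ℝ} (h : InResolventSet U ((-t : ℝ) : ℂ)) : Function.Bijective (A + t • D.toVL) := by
  have h1 := h.1
  simp only [Complex.ofReal_re, Complex.ofReal_im, zero_smul, add_zero, sub_zero, neg_smul,
    sub_neg_eq_add, ← hA] at h1
  have h2 : ∀ φ : D, ((A + t • D.toVL) φ).toL2 = (A φ).toL2 + t • φ.toV.toL2 := fun φ => rfl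
  simp only [← h2] at h1
  have h3 : ∀ φ (w : V), ((A + t • D.toVL) φ).toL2 = w.toL2 ↔ (A + t • D.toVL) φ = w := fun φ w =>
    ⟨fun h => V.toL2_injective h, fun h => by rw [h]⟩
  simp only [h3] at h1
  refine ⟨fun x y hxy => ?_, fun w => ?_⟩
  · obtain ⟨p, -, hp⟩ := h1 ((A + t • D.toVL) x) 0
    have e1 := hp (x, 0) ⟨rfl, map_zero _⟩
    have e2 := hp (y, 0) ⟨hxy.symm, map_zero _⟩
    exact congrArg Prod.fst (e1.trans e2.symm)
  · obtain ⟨p, hp, -⟩ := h1 w 0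
    exact ⟨p.1, hp.1⟩

/-- The abstract splitting with L the linear part, K the compact advection part and j the inclusion
of 𝒟 in 𝒱. Of the spectrum only the absence of negative real points is used. -/
theorem IsScaleInvariantDatum.bijective_add_smulRight {a₀ : E3 → E3} (ha : IsScaleInvariantDatum a₀)
    {σ : ℝ} {v : D} {A : D →L[ℝ] V} (hA : ∀ φ, (A φ).toL2 = lin (profile a₀ σ v) φ)
    (hs : ∀ t : ℝ, 0 < t → InResolventSet (profile a₀ σ v) ((-t : ℝ) : ℂ)) {φ : D} {z : V}
    {l : D →L[ℝ] ℝ} (hker : ∀ x, A x = 0 → ∃ c : ℝ, x = c • φ) (hz : ∀ x, A x ≠ z) (hl : l φ = 1) :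
    Function.Bijective (A + l.smulRight z) := by
  obtain ⟨L, T, B, a, hL, -⟩ := ha.exists_maps
  obtain ⟨K, hK, hKc⟩ := ha.exists_compact_advSym σ v
  obtain ⟨C, hC⟩ := exists_coercive
  have hAK : A = L + K := by
    ext1 x
    refine V.toL2_injective ?_
    rw [hA, lin, ← hL, ← hK]
    rfl
  rw [hAK] at hA hker hz ⊢
  refine SelfSimilarNS.bijective_add_smulRight (j := D.toVL) (C := C) hKc D.toVL_injective
    (fun t ht => bijective_of_inResolventSet hA (hs t ht)) (fun t ht x => hC t ht x _ ?_) hker hz hl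
  rw [← hL]
  rfl

/-! ### Quadratic equations with a parameter -/

section Quadratic

variable {X Y : Type*} [NormedAddCommGroup X] [NormedSpace ℝ X] [NormedAddCommGroup Y]
  [NormedSpace ℝ Y]

/-- The quadratic map `v ↦ L v + σ² a + σ T v + B(v, v)` with parameter `σ`. -/
def quadMap (L T : X →L[ℝ] Y) (B : X →L[ℝ] X →L[ℝ] Y) (a : Y) (v : X) (σ : ℝ) : Y :=
  L v + σ ^ 2 • a + σ • T v + B v v

/-- The derivative of the quadratic map with respect to `v`. -/
def quadLin (L T : X →L[ℝ] Y) (B : X →L[ℝ] X →L[ℝ] Y) (v : X) (σ : ℝ) : X →L[ℝ] Y :=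
  L + σ • T + B v + B.flip v

variable {L T : X →L[ℝ] Y} {B : X →L[ℝ] X →L[ℝ] Y} {a : Y}

theorem quadLin_apply (v : X) (σ : ℝ) (w : X) :
    quadLin L T B v σ w = L w + σ • T w + B v w + B w v := rfl

/-- The Taylor expansion in v stops at second order. This exactness reduces solutions near a known
branch to N(σ)w + B(w, w) = 0 without remainder. -/
theorem quadMap_add (v w : X) (σ : ℝ) :
    quadMap L T B a (v + w) σ = quadMap L T B a v σ + (quadLin L T B v σ w + B w w) := by
  simp only [quadMap, quadLin_apply, map_add, _root_.add_apply, smul_add]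
  abel

theorem contDiff_quadMap : ContDiff ℝ ∞ fun q : ℝ × X => quadMap L T B a q.2 q.1 := by
  unfold quadMap
  fun_prop

theorem fderiv_quadMap (σ : ℝ) (v w : X) :
    fderiv ℝ (fun q : ℝ × X => quadMap L T B a q.2 q.1) (σ, v) (0, w) = quadLin L T B v σ w := by
  have hline : HasDerivAt (fun t : ℝ => (σ, v + t • w)) (0, w) 0 := by
    have h1 := (hasDerivAt_const (0 : ℝ) σ).prodMk
      (((hasDerivAt_id (0 : ℝ)).smul_const w).const_add v)
    simpa using h1
  have hd : HasFDerivAt (fun q : ℝ × X => quadMap L T B a q.2 q.1)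
      (fderiv ℝ (fun q : ℝ × X => quadMap L T B a q.2 q.1) (σ, v)) (σ, v + (0 : ℝ) • w) := by
    rw [zero_smul, add_zero]
    exact (contDiff_quadMap.contDiffAt.differentiableAt (by simp)).hasFDerivAt
  have h1 : HasDerivAt (fun t : ℝ => quadMap L T B a (v + t • w) σ)
      (fderiv ℝ (fun q : ℝ × X => quadMap L T B a q.2 q.1) (σ, v) (0, w)) 0 :=
    HasFDerivAt.comp_hasDerivAt (f := fun t : ℝ => (σ, v + t • w)) (0 : ℝ) hd hline
  have e : (fun t : ℝ => quadMap L T B a (v + t • w) σ) = fun t : ℝ =>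
      quadMap L T B a v σ + (t • quadLin L T B v σ w + (t ^ 2) • B w w) := by
    ext t
    rw [quadMap_add]
    simp only [map_smul, _root_.smul_apply, smul_smul, pow_two]
  have h2 : HasDerivAt (fun t : ℝ => t ^ 2) 0 0 := by simpa using hasDerivAt_pow 2 (0 : ℝ)
  have h3 : HasDerivAt (fun t : ℝ =>
      quadMap L T B a v σ + (t • quadLin L T B v σ w + (t ^ 2) • B w w))
      ((1 : ℝ) • quadLin L T B v σ w + (0 : ℝ) • B w w) 0 :=
    (((hasDerivAt_id (0 : ℝ)).smul_const _).add (h2.smul_const _)).const_add _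
  rw [e] at h1
  rw [h1.unique h3, one_smul, zero_smul, add_zero]

theorem exists_quadMap_curve [CompleteSpace X] [CompleteSpace Y] {σ₀ : ℝ} {v₀ : X}
    (h0 : quadMap L T B a v₀ σ₀ = 0) (hM : Function.Bijective (quadLin L T B v₀ σ₀)) :
    ∃ ε : ℝ, 0 < ε ∧ ∃ v : ℝ → X, ContDiffOn ℝ ∞ v (Ioo (σ₀ - ε) (σ₀ + ε)) ∧ v σ₀ = v₀ ∧
      (∀ σ ∈ Ioo (σ₀ - ε) (σ₀ + ε), quadMap L T B a (v σ) σ = 0) ∧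
      (∀ u : ℝ → X, ContinuousOn u (Ioo (σ₀ - ε) (σ₀ + ε)) → u σ₀ = v₀ →
        (∀ σ ∈ Ioo (σ₀ - ε) (σ₀ + ε), quadMap L T B a (u σ) σ = 0) →
        EqOn u v (Ioo (σ₀ - ε) (σ₀ + ε))) ∧
      ∃ r : ℝ, 0 < r ∧ ∀ σ ∈ Ioo (σ₀ - ε) (σ₀ + ε), ∀ u ∈ Metric.ball v₀ r,
        quadMap L T B a u σ = 0 → u = v σ := by
  obtain ⟨ε, r, hε, hr, v, hv, hv0, hsol, huniq⟩ := exists_solution_curve isOpen_univ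
    (H := fun q : ℝ × X => quadMap L T B a q.2 q.1) contDiff_quadMap.contDiffOn
    (mem_univ (σ₀, v₀)) h0 hM (fun ζ => fderiv_quadMap σ₀ v₀ ζ)
  refine ⟨ε, hε, v, hv, hv0, fun σ hσ => (hsol σ hσ).2.2, fun u hu hu0 hus => ?_, r, hr,
    fun σ hσ u hu h => huniq σ hσ u hu h⟩
  exact eqOn_of_locally_unique (S := fun σ u => quadMap L T B a u σ = 0) isPreconnected_Ioo
    isOpen_Ioo ⟨by linarith, by linarith⟩ hv.continuousOn (fun s hs => (hsol s hs).2.1) hu hus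
    huniq (hu0.trans hv0.symm)

theorem contDiffOn_quadLin {v : ℝ → X} {I : Set ℝ} (hv : ContDiffOn ℝ ∞ v I) :
    ContDiffOn ℝ ∞ (fun σ => quadLin L T B (v σ) σ) I := by
  have h1 : ContDiffOn ℝ ∞ (fun σ => B (v σ)) I := B.contDiff.comp_contDiffOn hv
  have h2 : ContDiffOn ℝ ∞ (fun σ => B.flip (v σ)) I := B.flip.contDiff.comp_contDiffOn hv
  have h3 : ContDiffOn ℝ ∞ (fun σ : ℝ => L + σ • T) I :=
    contDiffOn_const.add (contDiffOn_id.smul contDiffOn_const)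
  exact (h3.add h1).add h2

theorem deriv_quadLin_apply {v : ℝ → X} {σ₀ : ℝ} {v' : X} (hv : HasDerivAt v v' σ₀) (φ : X) :
    deriv (fun σ => quadLin L T B (v σ) σ) σ₀ φ = T φ + B v' φ + B φ v' := by
  have h1 : HasDerivAt (fun σ => B (v σ)) (B v') σ₀ := B.hasFDerivAt.comp_hasDerivAt σ₀ hv
  have h2 : HasDerivAt (fun σ => B.flip (v σ)) (B.flip v') σ₀ :=
    B.flip.hasFDerivAt.comp_hasDerivAt σ₀ hv
  have h3 : HasDerivAt (fun σ : ℝ => L + σ • T) ((1 : ℝ) • T) σ₀ :=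
    ((hasDerivAt_id σ₀).smul_const T).const_add L
  have h4 : HasDerivAt (fun σ => quadLin L T B (v σ) σ) ((1 : ℝ) • T + B v' + B.flip v') σ₀ :=
    (h3.add h1).add h2
  rw [h4.deriv, one_smul]
  rfl

/-- Subtracting the known branch, v = v₁(σ) + w, turns it into the trivial solution w = 0; the
second branch is v₁(σ₂(s)) + s p(s), and p(0) = φ gives its tangent. -/
theorem exists_quadMap_bifurcation [CompleteSpace X] [CompleteSpace Y] {σ₀ ε : ℝ} (hε : 0 < ε)
    {v₁ : ℝ → X} (hv₁ : ContDiffOn ℝ ∞ v₁ (Ioo (σ₀ - ε) (σ₀ + ε)))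
    (hsol : ∀ σ ∈ Ioo (σ₀ - ε) (σ₀ + ε), quadMap L T B a (v₁ σ) σ = 0) {φ : X} {l : X →L[ℝ] ℝ}
    (hl : l φ = 1) (hker : ∀ x, quadLin L T B (v₁ σ₀) σ₀ x = 0 ↔ ∃ c : ℝ, x = c • φ) {z : Y}
    (hz : z = T φ + B (deriv v₁ σ₀) φ + B φ (deriv v₁ σ₀))
    (hzr : ∀ x, quadLin L T B (v₁ σ₀) σ₀ x ≠ z)
    (hM : Function.Bijective (quadLin L T B (v₁ σ₀) σ₀ + l.smulRight z)) :
    ∃ ε₂ : ℝ, 0 < ε₂ ∧ ∃ (v₂ : ℝ → X) (σ₂ : ℝ → ℝ),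
      ContDiffOn ℝ ∞ v₂ (Ioo (-ε₂) ε₂) ∧ ContDiffOn ℝ ∞ σ₂ (Ioo (-ε₂) ε₂) ∧
      v₂ 0 = v₁ σ₀ ∧ σ₂ 0 = σ₀ ∧
      (∀ s ∈ Ioo (-ε₂) ε₂, σ₂ s ∈ Ioo (σ₀ - ε) (σ₀ + ε) ∧ quadMap L T B a (v₂ s) (σ₂ s) = 0 ∧
        (s ≠ 0 → v₂ s ≠ v₁ (σ₂ s))) ∧
      HasDerivAt (fun s => v₂ s - v₁ (σ₂ s)) φ 0 ∧
      (∀ᶠ q : X × ℝ in 𝓝 (v₁ σ₀, σ₀), quadMap L T B a q.1 q.2 = 0 →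
        q.1 = v₁ q.2 ∨ ∃ s ∈ Ioo (-ε₂) ε₂, q = (v₂ s, σ₂ s)) ∧
      ((∀ x, quadLin L T B (v₁ σ₀) σ₀ x ≠ B φ φ) → IsTranscritical σ₂) ∧
      ((∃ x, quadLin L T B (v₁ σ₀) σ₀ x = B φ φ) →
        (∃ χ, quadLin L T B (v₁ σ₀) σ₀ χ + B φ φ = 0 ∧
          ∀ x, quadLin L T B (v₁ σ₀) σ₀ x ≠ B φ χ + B χ φ) → IsPitchfork σ₂) := by
  have hI0 : σ₀ ∈ Ioo (σ₀ - ε) (σ₀ + ε) := ⟨by linarith, by linarith⟩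
  have hN := contDiffOn_quadLin (L := L) (T := T) (B := B) hv₁
  have hNd : deriv (fun σ => quadLin L T B (v₁ σ) σ) σ₀ φ = z :=
    (deriv_quadLin_apply (hasDerivAt_of_contDiffOn isOpen_Ioo hv₁ hI0) φ).trans hz.symm
  have hφ : quadLin L T B (v₁ σ₀) σ₀ φ = 0 := (hker φ).2 ⟨1, (one_smul _ _).symm⟩
  obtain ⟨ε₂, hε₂, p, σ₂, hp, hσ₂, hp0, hσ0, hps, huniq⟩ := exists_bifurcating_curve B hε hN hφ hl
    (by rw [hNd]; exact hM)
  have hJ0 : (0 : ℝ) ∈ Ioo (-ε₂) ε₂ := ⟨by linarith, hε₂⟩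
  have hw : ContDiffOn ℝ ∞ (fun s => s • p s) (Ioo (-ε₂) ε₂) := contDiffOn_id.smul hp
  have hv₁σ : ContDiffOn ℝ ∞ (fun s => v₁ (σ₂ s)) (Ioo (-ε₂) ε₂) :=
    hv₁.comp hσ₂ fun s hs => (hps s hs).1
  have hkey : ∀ w : X, ∀ σ ∈ Ioo (σ₀ - ε) (σ₀ + ε),
      quadMap L T B a (v₁ σ + w) σ = quadLin L T B (v₁ σ) σ w + B w w := fun w σ hσ => by
    rw [quadMap_add, hsol σ hσ, zero_add]
  obtain ⟨ht1, ht2⟩ := bifurcation_type B isOpen_Ioo isOpen_Ioo hJ0 hN hp hσ₂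
    (fun s hs => ⟨(hps s hs).1, (hps s hs).2.2⟩) hσ0 hp0 (fun x hx => (hker x).1 hx)
    (by rw [hNd]; exact hzr)
  refine ⟨ε₂, hε₂, fun s => v₁ (σ₂ s) + s • p s, σ₂, hv₁σ.add hw, hσ₂, by simp [hσ0], hσ0,
    fun s hs => ⟨(hps s hs).1, ?_, fun hs0 h => ?_⟩, ?_, ?_, ht1, ht2⟩
  · have h1 := (hps s hs).2.2
    rw [hkey _ _ (hps s hs).1, map_smul, map_smul, map_smul, _root_.smul_apply, ← smul_add, h1,
      smul_zero]
  · exact (smul_ne_zero hs0 (hps s hs).2.1) (add_eq_left.1 h)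
  · have h1 : HasDerivAt (fun s => s • p s) ((0 : ℝ) • deriv p 0 + (1 : ℝ) • p 0) 0 :=
      (hasDerivAt_id (0 : ℝ)).smul (hasDerivAt_of_contDiffOn isOpen_Ioo hp hJ0)
    rw [zero_smul, zero_add, one_smul, hp0] at h1
    simpa only [add_sub_cancel_left] using h1
  · have hc : ContinuousAt (fun q : X × ℝ => (q.1 - v₁ q.2, q.2)) (v₁ σ₀, σ₀) := by
      have h1 : ContinuousAt v₁ σ₀ := (hv₁.contDiffAt (isOpen_Ioo.mem_nhds hI0)).continuousAt
      have h2 : ContinuousAt (fun q : X × ℝ => v₁ q.2) (v₁ σ₀, σ₀) :=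
        ContinuousAt.comp (g := v₁) (f := Prod.snd) h1 continuousAt_snd
      exact (continuousAt_fst.sub h2).prodMk continuousAt_snd
    have hc' : Tendsto (fun q : X × ℝ => (q.1 - v₁ q.2, q.2)) (𝓝 (v₁ σ₀, σ₀)) (𝓝 (0, σ₀)) := by
      have := hc.tendsto
      rwa [sub_self] at this
    have hI : ∀ᶠ q : X × ℝ in 𝓝 (v₁ σ₀, σ₀), q.2 ∈ Ioo (σ₀ - ε) (σ₀ + ε) :=
      continuousAt_snd.eventually (isOpen_Ioo.mem_nhds hI0)
    filter_upwards [hc'.eventually huniq, hI] with ⟨u, σ⟩ h1 h2 h3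
    simp only at h1 h2 h3 ⊢
    rw [← add_sub_cancel (v₁ σ) u, hkey _ _ h2] at h3
    refine (h1 h3).imp sub_eq_zero.1 ?_
    rintro ⟨s, hs, hs1, hs2⟩
    refine ⟨s, hs, ?_⟩
    rw [← hs1, ← hs2, add_sub_cancel]

end Quadratic

end SelfSimilarNS

end

/-! ### The theorem -/

theorem mainTheorem2 (a₀ : E3 → E3) (ha₀ : IsScaleInvariantDatum a₀)
    (σ₀ : ℝ) (v₀ : D) (hv₀ : F a₀ v₀ σ₀ = 0) :
    -- the maps `F : 𝒟 × ℝ → 𝒱` and `ℒ(σ A₀ + v) : 𝒟 → 𝒱` are well defined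
    ((∀ (v : D) (σ : ℝ),
        MemLp (adv (profile a₀ σ v) (profile a₀ σ v)) 2 (volume : Measure E3) ∧
        ∃ w : V, w.toL2 = F a₀ v σ) ∧
      (∀ (v : D) (σ : ℝ) (φ : D),
        MemLp (advSym (profile a₀ σ v) φ.field) 2 (volume : Measure E3) ∧
        ∃ w : V, w.toL2 = lin (profile a₀ σ v) φ)) ∧
    IsProfileSolution (fun x => σ₀ • a₀ x) (profile a₀ σ₀ v₀).val ∧
    -- continuation
    ((0 : ℂ) ∉ linSpectrum (profile a₀ σ₀ v₀) →
      ∃ ε : ℝ, 0 < ε ∧ ∃ v : ℝ → D,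
        ContDiffOn ℝ ∞ v (Ioo (σ₀ - ε) (σ₀ + ε)) ∧ v σ₀ = v₀ ∧
        (∀ σ ∈ Ioo (σ₀ - ε) (σ₀ + ε), F a₀ (v σ) σ = 0 ∧
          IsProfileSolution (fun x => σ • a₀ x) (profile a₀ σ (v σ)).val) ∧
        (∀ u : ℝ → D, ContinuousOn u (Ioo (σ₀ - ε) (σ₀ + ε)) → u σ₀ = v₀ →
          (∀ σ ∈ Ioo (σ₀ - ε) (σ₀ + ε), F a₀ (u σ) σ = 0) →
          EqOn u v (Ioo (σ₀ - ε) (σ₀ + ε))) ∧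
        ∃ r : ℝ, 0 < r ∧ ∀ σ ∈ Ioo (σ₀ - ε) (σ₀ + ε), ∀ u ∈ Metric.ball v₀ r,
          F a₀ u σ = 0 → u = v σ) ∧
    -- bifurcation
    (∀ (ε : ℝ) (v₁ : ℝ → D) (δ : ℝ) (φ : D), 0 < ε → 0 < δ →
      ContDiffOn ℝ ∞ v₁ (Ioo (σ₀ - ε) (σ₀ + ε)) → v₁ σ₀ = v₀ →
      (∀ σ ∈ Ioo (σ₀ - ε) (σ₀ + ε), F a₀ (v₁ σ) σ = 0) →
      {0} ⊆ linSpectrum (profile a₀ σ₀ v₀) →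
      linSpectrum (profile a₀ σ₀ v₀) ⊆ {lam : ℂ | δ < lam.re} ∪ {0} →
      φ ≠ 0 → (∀ χ : D, lin (profile a₀ σ₀ v₀) χ = 0 ↔ ∃ c : ℝ, χ = c • φ) →
      leray (advSym (profile a₀ 1 (deriv v₁ σ₀)) φ.field) ∉ linRange (profile a₀ σ₀ v₀) →
      ∃ ε₂ : ℝ, 0 < ε₂ ∧ ∃ (v₂ : ℝ → D) (σ₂ : ℝ → ℝ),
        ContDiffOn ℝ ∞ v₂ (Ioo (-ε₂) ε₂) ∧ ContDiffOn ℝ ∞ σ₂ (Ioo (-ε₂) ε₂) ∧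
        v₂ 0 = v₀ ∧ σ₂ 0 = σ₀ ∧
        (∀ s ∈ Ioo (-ε₂) ε₂, σ₂ s ∈ Ioo (σ₀ - ε) (σ₀ + ε) ∧ F a₀ (v₂ s) (σ₂ s) = 0 ∧
          (s ≠ 0 → v₂ s ≠ v₁ (σ₂ s))) ∧
        HasDerivAt (fun s => v₂ s - v₁ (σ₂ s)) φ 0 ∧
        (∀ᶠ q : D × ℝ in 𝓝 (v₀, σ₀), F a₀ q.1 q.2 = 0 →
          q.1 = v₁ q.2 ∨ ∃ s ∈ Ioo (-ε₂) ε₂, q = (v₂ s, σ₂ s)) ∧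
        (leray (adv φ.field φ.field) ∉ linRange (profile a₀ σ₀ v₀) → IsTranscritical σ₂) ∧
        (leray (adv φ.field φ.field) ∈ linRange (profile a₀ σ₀ v₀) →
          PitchforkNondegenerate (profile a₀ σ₀ v₀) φ → IsPitchfork σ₂)) := by
  have hinj : ∀ {w : V} {f : L2}, w.toL2 = f → (f = 0 ↔ w = 0) := fun {w f} h =>
    ⟨fun h0 => V.toL2_injective (h.trans h0), fun h0 => by rw [← h, h0]; rfl⟩
  obtain ⟨L, T, B, a, hL, hB, hF, hlin⟩ := ha₀.exists_maps
  have hG : ∀ (v : D) (σ : ℝ), F a₀ v σ = 0 ↔ quadMap L T B a v σ = 0 := fun v σ => hinj (hF v σ)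
  have hA : ∀ (v : D) (σ : ℝ) (φ : D), (quadLin L T B v σ φ).toL2 = lin (profile a₀ σ v) φ := hlin
  have hres : ∀ t : ℝ, ((-t : ℝ) : ℂ) ∉ linSpectrum (profile a₀ σ₀ v₀) →
      InResolventSet (profile a₀ σ₀ v₀) ((-t : ℝ) : ℂ) := fun t h => not_not.1 h
  refine ⟨⟨fun v σ => ⟨ha₀.memLp_adv_profile σ v, _, hF v σ⟩, fun v σ φ => ⟨?_, _, hlin v σ φ⟩⟩,
    ha₀.isProfileSolution hv₀, fun h0 => ?_, ?_⟩
  · obtain ⟨N, hN⟩ := ha₀.exists_multField_profile σ v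
    exact hN.memLp_advSym φ
  · have hM : Function.Bijective (quadLin L T B v₀ σ₀) := by
      have h1 := bijective_of_inResolventSet (hA v₀ σ₀) (hres 0 (by simpa using h0))
      rwa [zero_smul, add_zero] at h1
    obtain ⟨ε, hε, v, hv, hv0, hsol, hu, r, hr, hloc⟩ :=
      exists_quadMap_curve ((hG v₀ σ₀).1 hv₀) hM
    have hsol' : ∀ σ ∈ Ioo (σ₀ - ε) (σ₀ + ε), F a₀ (v σ) σ = 0 := fun σ hσ =>
      (hG _ _).2 (hsol σ hσ)
    exact ⟨ε, hε, v, hv, hv0, fun σ hσ => ⟨hsol' σ hσ, ha₀.isProfileSolution (hsol' σ hσ)⟩,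
      fun u huc hu0 hus => hu u huc hu0 fun σ hσ => (hG _ _).1 (hus σ hσ), r, hr,
      fun σ hσ u hub h => hloc σ hσ u hub ((hG _ _).1 h)⟩
  · intro ε v₁ δ φ hε hδ hv₁ hv₁0 hsol _ hspec hφ0 hker hz
    subst hv₁0
    have hrange : ∀ {w : V} {f : L2}, w.toL2 = f →
        (f ∈ linRange (profile a₀ σ₀ (v₁ σ₀)) ↔ ∃ x, quadLin L T B (v₁ σ₀) σ₀ x = w) :=
      fun {w f} h => exists_congr fun x => by
        rw [← hA, ← h]
        exact V.toL2_injective.eq_iff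
    have hrange' : ∀ {w : V} {f : L2}, w.toL2 = f →
        (f ∉ linRange (profile a₀ σ₀ (v₁ σ₀)) ↔ ∀ x, quadLin L T B (v₁ σ₀) σ₀ x ≠ w) :=
      fun {w f} h => (hrange h).not.trans not_exists
    have hker' : ∀ x, quadLin L T B (v₁ σ₀) σ₀ x = 0 ↔ ∃ c : ℝ, x = c • φ := fun x =>
      (hinj (hA _ _ x)).symm.trans (hker x)
    -- The σ-derivative of the linearization along v₁ is the advection part of the linearization at
    -- A₀ + v₁'(σ₀): it is obtained from that linearization by cancelling L.
    have hz1 : (T φ + B (deriv v₁ σ₀) φ + B φ (deriv v₁ σ₀)).toL2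
        = leray (advSym (profile a₀ 1 (deriv v₁ σ₀)) φ.field) := by
      have h1 := hlin (deriv v₁ σ₀) 1 φ
      rw [lin, ← hL, one_smul, add_assoc, add_assoc, V.toL2_add, add_right_inj] at h1
      rw [add_assoc]
      exact h1
    have hzr := (hrange' hz1).1 hz
    obtain ⟨l, hl⟩ := SeparatingDual.exists_eq_one (R := ℝ) hφ0
    -- For t > 0 the point -t is neither 0 nor in the half-plane Re λ > δ, so it belongs to the
    -- resolvent set.
    have hM := ha₀.bijective_add_smulRight (hA (v₁ σ₀) σ₀) (fun t ht => hres t fun hmem => by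
      rcases hspec hmem with h | h
      · have h' : δ < (((-t : ℝ) : ℂ)).re := h
        rw [Complex.ofReal_re] at h'
        linarith
      · have h' : ((-t : ℝ) : ℂ) = 0 := h
        rw [Complex.ofReal_eq_zero] at h'
        linarith) (fun x hx => (hker' x).1 hx) hzr hl
    obtain ⟨ε₂, hε₂, v₂, σ₂, hv₂, hσ₂, hv₂0, hσ₂0, hs, hd, hloc, ht, hp⟩ :=
      exists_quadMap_bifurcation hε hv₁ (fun σ hσ => (hG _ _).1 (hsol σ hσ)) hl hker' rfl hzr hM
    refine ⟨ε₂, hε₂, v₂, σ₂, hv₂, hσ₂, hv₂0, hσ₂0,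
      fun s hsI => ⟨(hs s hsI).1, (hG _ _).2 (hs s hsI).2.1, (hs s hsI).2.2⟩, hd, ?_,
      fun h => ht ((hrange' (hB φ φ)).1 h), fun h hnd => hp ((hrange (hB φ φ)).1 h) ?_⟩
    · filter_upwards [hloc] with q hq h
      exact hq ((hG _ _).1 h)
    · obtain ⟨χ, hχ, hχr⟩ := hnd
      have h1 : (quadLin L T B (v₁ σ₀) σ₀ χ + B φ φ).toL2
          = lin (profile a₀ σ₀ (v₁ σ₀)) χ + leray (adv φ.field φ.field) := by
        rw [← hA, ← hB]
        rfl
      have h2 : (B φ χ + B χ φ).toL2 = leray (advSym φ.field χ.field) := by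
        have h3 := leray_add (φ.multField.memLp_left χ) (φ.multField.memLp_right χ)
        rw [V.toL2_add, hB, hB]
        exact h3.symm
      exact ⟨χ, (hinj h1).1 hχ, (hrange' h2).1 hχr⟩
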